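/- Conventions. A quadratic space is a finite-dimensional positive definite rational vector space $V$ with symmetric bilinear form $B$ and $Q(x)=B(x,x)$; a lattice on $V$ is a finitely generated $\mathbb Z$-submodule spanning $V$. A ternary lattice (rank $3$) $L$ is primitive if its scale, the group generated by $B(L,L)$, is $\mathbb Z$; $dL$ is the determinant of a Gram matrix of $L$; $L_q=\mathbb Z_q\otimes L$; $O(L)=\{\sigma\in O(V):\sigma(L)=L\}$ and $O^+(L)$ is its subgroup of isometries of determinant $1$; the genus $\mathrm{gen}(L)$ is the set of lattices $M$ on $V$ with $M_q\cong L_q$ for every prime $q$; the class of $M$ is $\{\sigma(M):\sigma\in O(V)\}$. For an odd prime $p$ put $\Lambda_p(L)=\{x\in L: Q(x+y)\equiv Q(y) \bmod p \text{ for all } y\in L\}$. Let $L$ be a primitive ternary lattice, $p$ an odd prime with $\operatorname{ord}_p(dL)\ge 2$, and $N=\Lambda_p(L)$. Let $\Gamma=\Gamma_p^L(N)$ be the set of $M\in\mathrm{gen}(L)$ with $\Lambda_p(M)=N$, let $\Gamma_\sigma=\{M\in\Gamma:\sigma(M)=M\}$, and let $h_n=h_n(N)$ be the number of classes of lattices in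 $\Gamma$ whose isometry group has order $n$. Let $S(N)$ be the set of symmetries (reflections) $\tau_x: y\mapsto y-\frac{2B(x,y)}{Q(x)}x$ in $O(N)$. For a symmetry $\sigma=\tau_x$ of a lattice $M$, with $x$ primitive in $M$, write $Q_M(\sigma)=Q(x)$, and call $\sigma$ special to $M$ if $p\nmid Q_M(\sigma)$ when the unimodular Jordan component of $M_p$ has rank $1$, and $p\mid Q_M(\sigma)$ otherwise. Put $$w=|\Gamma|,\qquad f=\sum_{\sigma\in S(N)}|\Gamma_\sigma|,\qquad s=\#\{\sigma\in S(N): \sigma \text{ is special to some } M\in\Gamma_\sigma\},$$ and let $[w]_n$ be the remainder of $w$ modulo $n$. **Theorem.** Assume $p\ne 3$ if $|O(N)|=24$. Then $|O(N)|\in\{2,4,8,12,16,24,48\}$, and for every positive divisor $d$ of $|O^+(N)|$ the number $h_{2d}$ is as follows; in fact $h_n=0$ for every $n\notin\{2,4,8,12,16,24\}$, and * if $|O(N)|=2$: $h_2=w$ and $h_4=h_8=h_{12}=h_{16}=h_{24}=0$; * if $|O(N)|=4$: $h_2=\frac{w-f}{2}$, $h_4=f$, $h_8=h_{12}=h_{16}=h_{24}=0$;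 * if $|O(N)|=8$: $h_2=\frac{w-f+2s}{4}$, $h_4=\frac{f-3s}{2}$, $h_8=s$, $h_{12}=h_{16}=h_{24}=0$; * if $|O(N)|=12$: $h_2=\frac{w-f+2[w]_3}{6}$, $h_4=\frac{f-3[w]_3}{3}$, $h_{12}=[w]_3$, $h_8=h_{16}=h_{24}=0$; * if $|O(N)|=16$: $h_2=\frac{w-f+2s+2[w]_2}{8}$, $h_4=\frac{f-3s-2[w]_2}{4}$, $h_8=\frac{s-[w]_2}{2}$, $h_{16}=[w]_2$, $h_{12}=h_{24}=0$; * if $|O(N)|=24$: $h_2=\frac{w-f+2s+4[w]_3}{12}$, $h_4=\frac{f-3s-4[w]_3}{6}$, $h_8=\frac{s-[w]_3}{3}$, $h_{24}=[w]_3$, $h_{12}=h_{16}=0$; * if $|O(N)|=48$: $h_{24}=h_{48}=0$; a unimodular Jordan component of $L_p$ exists, and if $d_0$ is the discriminant of any such component, then $$h_{12}=(1-\delta_{3p})\,\frac{1+\left(\frac{3d_0}{p}\right)}{2},\qquad h_{16}=\frac{1+\left(\frac{d_0}{p}\right)}{2};$$ moreover $h_8=\frac{s-3h_{16}}{6}$,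 $h_4=\frac{f-18h_8-12h_{12}-15h_{16}}{12}$, and $h_2=\frac{w-f+12h_8+8h_{12}+12h_{16}}{24}$. In particular the numbers $h_n$ are determined by $p$, the isometry class of $L_p$ and the label of $N$, that is, the order $|O(N)|$ together with the multiset of the numbers $Q_N(\sigma)$, $\sigma\in S(N)$: if $L'$ is another primitive ternary lattice (possibly on another quadratic space) with $L'_p\cong L_p$, and $N'=\Lambda_p(L')$ has the same label as $N$, then $h_n(N')=h_n(N)$ for all $n$. -/

import Mathlib

open scoped TensorProduct Pointwise

universe u v

namespace TernaryLattice

noncomputable section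

/-! Throughout, a quadratic space over `ℚ` is a rational vector space `V` with a symmetric bilinear
form `B`; its quadratic map is `Q(x) = B(x, x)`.  A lattice on `V` is a finitely generated
`ℤ`-submodule of `V` that spans `V` over `ℚ`. -/

/-- The scale of `L`: the `ℤ`-submodule of `ℚ` generated by all values `B(x, y)` with `x, y ∈ L`. -/
def scale {V : Type u} [AddCommGroup V] [Module ℚ V] (B : LinearMap.BilinForm ℚ V)
    (L : Submodule ℤ V) : Submodule ℤ ℚ :=
  Submodule.span ℤ {c : ℚ | ∃ x ∈ L, ∃ y ∈ L, c = B x y}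

/-- `L` is a primitive lattice (scale equal to `ℤ`) on the positive definite
ternary quadratic space `(V, B)`. -/
structure IsPrimitiveTernary {V : Type u} [AddCommGroup V] [Module ℚ V]
    (B : LinearMap.BilinForm ℚ V) (L : Submodule ℤ V) : Prop where
  finrank_eq : Module.finrank ℚ V = 3
  symm : ∀ x y, B x y = B y x
  pos : ∀ x, x ≠ 0 → 0 < B x x
  lattice : L.IsLattice ℚ
  primitive : scale B L = 1

/-- `d` is the discriminant of the ternary lattice `L`: the determinant of a Gram matrix of `L`. -/
def IsDisc {V : Type u} [AddCommGroup V] [Module ℚ V] (B : LinearMap.BilinForm ℚ V)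
    (L : Submodule ℤ V) (d : ℚ) : Prop :=
  ∃ b : Module.Basis (Fin 3) ℤ L, d = (Matrix.of fun i j => B (b i : V) (b j : V)).det

/-- `Λ_m(L) = {x ∈ L : Q(x + y) ≡ Q(y) mod m for all y ∈ L}`. -/
def watson {V : Type u} [AddCommGroup V] [Module ℚ V] (B : LinearMap.BilinForm ℚ V) (m : ℕ)
    (L : Submodule ℤ V) : Submodule ℤ V :=
  AddSubgroup.toIntSubmodule
    { carrier := {x | x ∈ L ∧ ∀ y ∈ L, ∃ k : ℤ, B (x + y) (x + y) - B y y = (m : ℚ) * k}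
      zero_mem' := ⟨L.zero_mem, fun y _ => ⟨0, by simp⟩⟩
      add_mem' := by
        rintro a b ⟨ha, ha'⟩ ⟨hb, hb'⟩
        refine ⟨L.add_mem ha hb, fun y hy => ?_⟩
        obtain ⟨k, hk⟩ := ha' (b + y) (L.add_mem hb hy)
        obtain ⟨l, hl⟩ := hb' y hy
        refine ⟨k + l, ?_⟩
        rw [add_assoc]
        push_cast
        linarith
      neg_mem' := by
        rintro a ⟨ha, ha'⟩
        refine ⟨L.neg_mem ha, fun y hy => ?_⟩
        obtain ⟨k, hk⟩ := ha' (-a + y) (L.add_mem (L.neg_mem ha) hy)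
        refine ⟨-k, ?_⟩
        rw [add_neg_cancel_left] at hk
        push_cast
        linarith }

/-- The orthogonal group `O(V)`. -/
def orthogonalGroup {V : Type u} [AddCommGroup V] [Module ℚ V] (B : LinearMap.BilinForm ℚ V) :
    Subgroup (V ≃ₗ[ℚ] V) where
  carrier := {σ | ∀ x y, B (σ x) (σ y) = B x y}
  one_mem' := fun _ _ => rfl
  mul_mem' := by
    intro a b ha hb x y
    rw [LinearEquiv.mul_apply, LinearEquiv.mul_apply, ha, hb]
  inv_mem' := by
    intro a ha x y
    have h := ha (a⁻¹ x) (a⁻¹ y)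
    rw [← LinearEquiv.mul_apply, ← LinearEquiv.mul_apply, mul_inv_cancel] at h
    exact h.symm

/-- The isometry group `O(M) = {σ ∈ O(V) : σ(M) = M}`;
here `σ • M` is the image of `M` under `σ`. -/
def isometryGroup {V : Type u} [AddCommGroup V] [Module ℚ V] (B : LinearMap.BilinForm ℚ V)
    (M : Submodule ℤ V) : Subgroup (V ≃ₗ[ℚ] V) :=
  orthogonalGroup B ⊓ MulAction.stabilizer (V ≃ₗ[ℚ] V) M

/-- The (isometry) class of `M`: all lattices `σ(M)` with `σ ∈ O(V)`. -/
def isometryClass {V : Type u} [AddCommGroup V] [Module ℚ V] (B : LinearMap.BilinForm ℚ V)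
    (M : Submodule ℤ V) : Set (Submodule ℤ V) :=
  {M' | ∃ σ ∈ orthogonalGroup B, M' = σ • M}

/-- The completion `L_q`: the `ℤ_q`-submodule of `V_q = ℚ_q ⊗ V` generated by `L`. -/
def localize {V : Type u} [AddCommGroup V] [Module ℚ V] (q : ℕ) [Fact q.Prime]
    (L : Submodule ℤ V) : Submodule ℤ_[q] (ℚ_[q] ⊗[ℚ] V) :=
  Submodule.span ℤ_[q] ((fun x : V => (1 : ℚ_[q]) ⊗ₜ[ℚ] x) '' (L : Set V))

/-- The extension of `B` to `V_q`. -/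
def localForm {V : Type u} [AddCommGroup V] [Module ℚ V] (q : ℕ) [Fact q.Prime]
    (B : LinearMap.BilinForm ℚ V) : LinearMap.BilinForm ℚ_[q] (ℚ_[q] ⊗[ℚ] V) :=
  LinearMap.BilinForm.baseChange ℚ_[q] B

/-- `L_q ≅ L'_q`: some isometry `V_q ≃ V'_q` carries `L_q` onto `L'_q`. -/
def LocallyIsometric {V : Type u} [AddCommGroup V] [Module ℚ V] {V' : Type v} [AddCommGroup V']
    [Module ℚ V'] (q : ℕ) [Fact q.Prime]
    (B : LinearMap.BilinForm ℚ V) (L : Submodule ℤ V)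
    (B' : LinearMap.BilinForm ℚ V') (L' : Submodule ℤ V') : Prop :=
  ∃ σ : (ℚ_[q] ⊗[ℚ] V) ≃ₗ[ℚ_[q]] (ℚ_[q] ⊗[ℚ] V'),
    (∀ x y, localForm q B' (σ x) (σ y) = localForm q B x y) ∧
    (localize q L).map (σ.toLinearMap.restrictScalars ℤ_[q]) = localize q L'

/-- The genus of `L`: the lattices `M` on `V` with `M_q ≅ L_q` for every prime `q`. -/
def genus {V : Type u} [AddCommGroup V] [Module ℚ V] (B : LinearMap.BilinForm ℚ V)
    (L : Submodule ℤ V) : Set (Submodule ℤ V) :=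
  {M | M.IsLattice ℚ ∧ ∀ (q : ℕ) [Fact q.Prime], LocallyIsometric q B L B M}

/-- `Γ_p^L(N) = {M ∈ gen(L) : Λ_p(M) = N}`. -/
def Gam {V : Type u} [AddCommGroup V] [Module ℚ V] (B : LinearMap.BilinForm ℚ V) (p : ℕ)
    (L N : Submodule ℤ V) : Set (Submodule ℤ V) :=
  {M | M ∈ genus B L ∧ watson B p M = N}

/-- `Γ_p^L(N)_σ`: the fixed points of `σ` in `Γ_p^L(N)`. -/
def GamFix {V : Type u} [AddCommGroup V] [Module ℚ V] (B : LinearMap.BilinForm ℚ V) (p : ℕ)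
    (L N : Submodule ℤ V) (σ : V ≃ₗ[ℚ] V) : Set (Submodule ℤ V) :=
  {M | M ∈ Gam B p L N ∧ σ • M = M}

/-- `h_n(N)`: the number of classes of lattices in `Γ_p^L(N)` with isometry group of order `n`. -/
def classCount {V : Type u} [AddCommGroup V] [Module ℚ V] (B : LinearMap.BilinForm ℚ V) (p : ℕ)
    (L N : Submodule ℤ V) (n : ℕ) : ℕ :=
  {C : Set (Submodule ℤ V) |
    ∃ M ∈ Gam B p L N, Nat.card (isometryGroup B M) = n ∧ C = isometryClass B M}.ncard

/-- `σ` is the symmetry `τ_x : y ↦ y - (2 B(x, y) / Q(x)) x`. -/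
def IsSymmetryAlong {V : Type u} [AddCommGroup V] [Module ℚ V] (B : LinearMap.BilinForm ℚ V)
    (x : V) (σ : V ≃ₗ[ℚ] V) : Prop :=
  x ≠ 0 ∧ ∀ y, σ y = y - (2 * B x y / B x x) • x

/-- `S(K)`: the symmetries in `O(K)`. -/
def symmetries {V : Type u} [AddCommGroup V] [Module ℚ V] (B : LinearMap.BilinForm ℚ V)
    (K : Submodule ℤ V) : Set (V ≃ₗ[ℚ] V) :=
  {σ | σ ∈ isometryGroup B K ∧ ∃ x, IsSymmetryAlong B x σ}

/-- `x` is a primitive vector of `M`. -/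
def IsPrimitiveVector {V : Type u} [AddCommGroup V] (M : Submodule ℤ V) (x : V) : Prop :=
  x ∈ M ∧ ∀ (n : ℤ) (y : V), y ∈ M → x = n • y → IsUnit n

/-- `Q_M(σ) = c`: `σ = τ_x` with `x` a primitive vector of `M` and `Q(x) = c`.
(The vector `x` is unique up to sign.) -/
def SymNormEq {V : Type u} [AddCommGroup V] [Module ℚ V] (B : LinearMap.BilinForm ℚ V)
    (M : Submodule ℤ V) (σ : V ≃ₗ[ℚ] V) (c : ℚ) : Prop :=
  ∃ x, IsPrimitiveVector M x ∧ IsSymmetryAlong B x σ ∧ B x x = c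

/-- The label of `K`: the order of `O(K)`, with the multiset of the numbers `Q_K(σ)`, `σ ∈ S(K)`,
recorded by the multiplicity of each value. -/
def label {V : Type u} [AddCommGroup V] [Module ℚ V] (B : LinearMap.BilinForm ℚ V)
    (K : Submodule ℤ V) : ℕ × (ℚ → ℕ) :=
  (Nat.card (isometryGroup B K), fun c => {σ | σ ∈ symmetries B K ∧ SymNormEq B K σ c}.ncard)

/-- `b` is a basis, with Gram determinant the unit `d`, of the unimodular component of a Jordan
splitting of `M_p`: `M_p = J ⊥ J'` with `J` spanned by `b` and `B(J', J') ⊆ p ℤ_p`.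
(As `d` is a unit, `b` is automatically linearly independent and `J ∩ J' = 0`.) -/
structure IsUnimodularComponent {V : Type u} [AddCommGroup V] [Module ℚ V] (p : ℕ) [Fact p.Prime]
    (B : LinearMap.BilinForm ℚ V) (M : Submodule ℤ V) {r : ℕ} (b : Fin r → ℚ_[p] ⊗[ℚ] V)
    (d : ℤ_[p]ˣ) : Prop where
  gram : ∃ G : Matrix (Fin r) (Fin r) ℤ_[p],
    (∀ i j, localForm p B (b i) (b j) = (G i j : ℚ_[p])) ∧ G.det = (d : ℤ_[p])
  splits : ∃ J' : Submodule ℤ_[p] (ℚ_[p] ⊗[ℚ] V),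
    Submodule.span ℤ_[p] (Set.range b) ⊔ J' = localize p M ∧
    (∀ i, ∀ y ∈ J', localForm p B (b i) y = 0) ∧
    ∀ x ∈ J', ∀ y ∈ J', ∃ c : ℤ_[p], localForm p B x y = (p : ℚ_[p]) * (c : ℚ_[p])

/-- The unimodular component of `M_p` has rank `r`. -/
def UnimodularRankEq {V : Type u} [AddCommGroup V] [Module ℚ V] (p : ℕ) [Fact p.Prime]
    (B : LinearMap.BilinForm ℚ V) (M : Submodule ℤ V) (r : ℕ) : Prop :=
  ∃ (b : Fin r → ℚ_[p] ⊗[ℚ] V) (d : ℤ_[p]ˣ), IsUnimodularComponent p B M b d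

/-- `d₀` is the discriminant of a unimodular Jordan component of `M_p`. -/
def IsUnimodularDisc {V : Type u} [AddCommGroup V] [Module ℚ V] (p : ℕ) [Fact p.Prime]
    (B : LinearMap.BilinForm ℚ V) (M : Submodule ℤ V) (d₀ : ℤ_[p]ˣ) : Prop :=
  ∃ (r : ℕ) (b : Fin r → ℚ_[p] ⊗[ℚ] V), IsUnimodularComponent p B M b d₀

/-- The symmetry `σ` is special to `M` (at `p`): `Q_M(σ) ≢ 0 mod p` if the unimodular component of
`M_p` has rank `1`, and `Q_M(σ) ≡ 0 mod p` otherwise. -/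
def IsSpecial {V : Type u} [AddCommGroup V] [Module ℚ V] (p : ℕ) [Fact p.Prime]
    (B : LinearMap.BilinForm ℚ V) (M : Submodule ℤ V) (σ : V ≃ₗ[ℚ] V) : Prop :=
  ∃ c : ℚ, SymNormEq B M σ c ∧
    ((UnimodularRankEq p B M 1 ∧ ¬ ∃ k : ℤ, c = (p : ℚ) * k) ∨
      (¬ UnimodularRankEq p B M 1 ∧ ∃ k : ℤ, c = (p : ℚ) * k))

/-- `w = |Γ_p^L(N)|`. -/
def wCount {V : Type u} [AddCommGroup V] [Module ℚ V] (B : LinearMap.BilinForm ℚ V) (p : ℕ)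
    (L N : Submodule ℤ V) : ℕ :=
  (Gam B p L N).ncard

/-- `f = ∑_{σ ∈ S(N)} |Γ_p^L(N)_σ|`. -/
def fCount {V : Type u} [AddCommGroup V] [Module ℚ V] (B : LinearMap.BilinForm ℚ V) (p : ℕ)
    (L N : Submodule ℤ V) : ℕ :=
  ∑ᶠ σ ∈ symmetries B N, (GamFix B p L N σ).ncard

/-- `s`: the number of symmetries `σ` of `N` that are special to some `M ∈ Γ_p^L(N)_σ`. -/
def sCount {V : Type u} [AddCommGroup V] [Module ℚ V] (B : LinearMap.BilinForm ℚ V) (p : ℕ)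
    [Fact p.Prime] (L N : Submodule ℤ V) : ℕ :=
  {σ | σ ∈ symmetries B N ∧ ∃ M ∈ GamFix B p L N σ, IsSpecial p B M σ}.ncard

/-- The Legendre symbol `(a / p)` of a `p`-adic integer `a` (for odd `p`). -/
def legendre (p : ℕ) [Fact p.Prime] (a : ℤ_[p]) : ℤ :=
  quadraticChar (ZMod p) (PadicInt.toZMod a)

end

end TernaryLattice

namespace TernaryLattice

noncomputable section

variable {V : Type u} [AddCommGroup V] [Module ℚ V] {B : LinearMap.BilinForm ℚ V}
  {M N : Submodule ℤ V}

section

/-- `B` is a positive definite ternary form. -/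
structure IsTernaryForm (B : LinearMap.BilinForm ℚ V) : Prop where
  finrank_eq : Module.finrank ℚ V = 3
  symm : ∀ x y, B x y = B y x
  pos : ∀ x, x ≠ 0 → 0 < B x x

theorem IsTernaryForm.ne_zero (hB : IsTernaryForm B) {x : V} (hx : x ≠ 0) : B x x ≠ 0 :=
  (hB.pos x hx).ne'

theorem IsTernaryForm.eq_zero (hB : IsTernaryForm B) {x : V} (hx : B x x = 0) : x = 0 := by
  by_contra h
  exact hB.ne_zero h hx

/-- The reflection along `x` (the identity when `B x x = 0`). -/
def tau (B : LinearMap.BilinForm ℚ V) (x : V) : V ≃ₗ[ℚ] V :=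
  LinearEquiv.ofInvolutive (LinearMap.id - ((2 / B x x) • B x).smulRight x) (by
    intro y
    simp only [LinearMap.sub_apply, LinearMap.id_apply, LinearMap.smulRight_apply,
      LinearMap.smul_apply, map_sub, map_smul, smul_eq_mul]
    by_cases h : B x x = 0
    · simp [h]
    · rw [div_mul_cancel₀ _ h]
      module)

theorem tau_apply (x y : V) : tau B x y = y - (2 * B x y / B x x) • x := by
  have : tau B x y = y - (2 / B x x * B x y) • x := rfl
  rw [this, div_mul_eq_mul_div]

@[simp] theorem tau_tau (x y : V) : tau B x (tau B x y) = y := by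
  exact (tau B x).left_inv y

@[simp] theorem tau_inv (x : V) : (tau B x)⁻¹ = tau B x := rfl

theorem tau_self (hB : IsTernaryForm B) (x : V) : tau B x x = -x := by
  by_cases hx : x = 0
  · simp [hx]
  rw [tau_apply, mul_div_assoc, div_self (hB.ne_zero hx), mul_one, two_smul]
  abel

theorem tau_of_orth {x y : V} (h : B x y = 0) : tau B x y = y := by
  rw [tau_apply, h]; simp

theorem tau_smul {x : V} {c : ℚ} (hc : c ≠ 0) : tau B (c • x) = tau B x := by
  ext y
  simp only [tau_apply, map_smul, LinearMap.smul_apply, smul_eq_mul, smul_smul]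
  congr 2
  by_cases h : B x x = 0
  · simp [h]
  · field_simp

theorem tau_mem (hB : IsTernaryForm B) (x : V) : tau B x ∈ orthogonalGroup B := by
  intro y z
  by_cases hx : x = 0
  · simp [hx, tau_apply]
  have h := hB.ne_zero hx
  simp only [tau_apply, map_sub, map_smul, LinearMap.sub_apply, LinearMap.smul_apply, smul_eq_mul,
    hB.symm y x]
  field_simp
  ring

theorem isSymmetryAlong_tau {x : V} (hx : x ≠ 0) : IsSymmetryAlong B x (tau B x) :=
  ⟨hx, fun y => tau_apply x y⟩

theorem IsSymmetryAlong.eq_tau {x : V} {σ : V ≃ₗ[ℚ] V} (h : IsSymmetryAlong B x σ) :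
    σ = tau B x := by
  ext y
  rw [h.2, tau_apply]

theorem conj_tau {g : V ≃ₗ[ℚ] V} (hg : g ∈ orthogonalGroup B) (x : V) :
    g * tau B x * g⁻¹ = tau B (g x) := by
  ext y
  have h1 : g (g⁻¹ y) = y := by rw [← LinearEquiv.mul_apply, mul_inv_cancel]; rfl
  simp only [LinearEquiv.mul_apply, tau_apply, map_sub, map_smul, h1]
  rw [hg x x]
  congr 3
  rw [← hg x, h1]

/-- Equal reflections have proportional vectors. -/
theorem tau_eq_tau (hB : IsTernaryForm B) {x y : V} (hy : y ≠ 0)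
    (h : tau B x = tau B y) : ∃ c : ℚ, c ≠ 0 ∧ y = c • x := by
  have h1 := tau_self hB y
  rw [← h, tau_apply] at h1
  refine ⟨(2 * B x y / B x x) / 2, ?_, ?_⟩
  · intro h0
    have h2 : 2 * B x y / B x x = 0 := by linarith
    rw [h2, zero_smul, sub_zero] at h1
    have : (2 : ℚ) • y = 0 := by rw [two_smul]; nth_rewrite 1 [h1]; simp
    exact hy ((smul_eq_zero.1 this).resolve_left (by norm_num))
  · have h2 : (2 * B x y / B x x) • x = (2 : ℚ) • y := by
      rw [sub_eq_iff_eq_add] at h1; rw [two_smul]; nth_rewrite 2 [h1]; abel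
    rw [div_eq_inv_mul, mul_smul, h2, smul_smul]; norm_num

/-! ### Orthogonal frames -/

/-- An orthogonal frame of nonzero vectors. -/
structure IsFrame (B : LinearMap.BilinForm ℚ V) (x y z : V) : Prop where
  ne1 : x ≠ 0
  ne2 : y ≠ 0
  ne3 : z ≠ 0
  h12 : B x y = 0
  h13 : B x z = 0
  h23 : B y z = 0

theorem IsFrame.rotate (hB : IsTernaryForm B) {x y z : V} (h : IsFrame B x y z) :
    IsFrame B y z x :=
  ⟨h.ne2, h.ne3, h.ne1, h.h23, by rw [hB.symm, h.h12], by rw [hB.symm, h.h13]⟩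

theorem exists_orth (hB : IsTernaryForm B) (x y : V) : ∃ z, z ≠ 0 ∧ B x z = 0 ∧ B y z = 0 := by
  have : Module.Finite ℚ V := Module.finite_of_finrank_pos (by rw [hB.finrank_eq]; norm_num)
  have h := LinearMap.ker_ne_bot_of_finrank_lt (f := (B x).prod (B y))
    (by simp [hB.finrank_eq])
  obtain ⟨z, hz, hz0⟩ := (Submodule.ne_bot_iff _).1 h
  refine ⟨z, hz0, ?_⟩
  simpa using hz

theorem exists_frame (hB : IsTernaryForm B) {x : V} (hx : x ≠ 0) : ∃ y z, IsFrame B x y z := by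
  obtain ⟨y, hy, h1, -⟩ := exists_orth hB x x
  obtain ⟨z, hz, h2, h3⟩ := exists_orth hB x y
  exact ⟨y, z, hx, hy, hz, h1, h2, h3⟩

theorem exists_frame_of_orth (hB : IsTernaryForm B) {x y : V} (hx : x ≠ 0) (hy : y ≠ 0)
    (h1 : B x y = 0) : ∃ z, IsFrame B x y z := by
  obtain ⟨z, hz, h2, h3⟩ := exists_orth hB x y
  exact ⟨z, hx, hy, hz, h1, h2, h3⟩

theorem IsFrame.linearIndependent (hB : IsTernaryForm B) {x y z : V} (h : IsFrame B x y z) :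
    LinearIndependent ℚ ![x, y, z] := by
  rw [Fintype.linearIndependent_iff]
  intro c hc
  simp only [Fin.sum_univ_three, Matrix.cons_val_zero, Matrix.cons_val_one, Matrix.cons_val] at hc
  have e1 : B x (c 0 • x + c 1 • y + c 2 • z) = 0 := by rw [hc, map_zero]
  have e2 : B y (c 0 • x + c 1 • y + c 2 • z) = 0 := by rw [hc, map_zero]
  have e3 : B z (c 0 • x + c 1 • y + c 2 • z) = 0 := by rw [hc, map_zero]
  simp only [map_add, map_smul, smul_eq_mul, h.h12, h.h13, h.h23, hB.symm y x, hB.symm z x,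
    hB.symm z y, mul_zero, add_zero, zero_add, mul_eq_zero, hB.ne_zero h.ne1, hB.ne_zero h.ne2,
    hB.ne_zero h.ne3, or_false] at e1 e2 e3
  intro i
  fin_cases i <;> assumption

theorem IsFrame.expand (hB : IsTernaryForm B) {x y z : V} (h : IsFrame B x y z) (v : V) :
    v = (B x v / B x x) • x + (B y v / B y y) • y + (B z v / B z z) • z := by
  have : Module.Finite ℚ V := Module.finite_of_finrank_pos (by rw [hB.finrank_eq]; norm_num)
  have hs : ⊤ ≤ Submodule.span ℚ (Set.range ![x, y, z]) := by
    rw [(h.linearIndependent hB).span_eq_top_of_card_eq_finrank (by simp [hB.finrank_eq])]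
  have hv : v ∈ Submodule.span ℚ (Set.range ![x, y, z]) := hs trivial
  rw [Submodule.mem_span_range_iff_exists_fun] at hv
  obtain ⟨c, hc⟩ := hv
  simp only [Fin.sum_univ_three, Matrix.cons_val_zero, Matrix.cons_val_one, Matrix.cons_val] at hc
  rw [← hc]
  simp only [map_add, map_smul, smul_eq_mul, h.h12, h.h13, h.h23, hB.symm y x, hB.symm z x,
    hB.symm z y, mul_zero, add_zero, zero_add]
  rw [mul_div_assoc, mul_div_assoc, mul_div_assoc, div_self (hB.ne_zero h.ne1),
    div_self (hB.ne_zero h.ne2), div_self (hB.ne_zero h.ne3), mul_one, mul_one, mul_one]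

theorem IsFrame.ext (hB : IsTernaryForm B) {x y z : V} (h : IsFrame B x y z)
    {f g : V ≃ₗ[ℚ] V} (h1 : f x = g x) (h2 : f y = g y) (h3 : f z = g z) : f = g := by
  ext v
  rw [h.expand hB v]
  simp only [map_add, map_smul, h1, h2, h3]

theorem IsFrame.eq_smul (hB : IsTernaryForm B) {x y z : V} (h : IsFrame B x y z) {v : V}
    (h1 : B x v = 0) (h2 : B y v = 0) : v = (B z v / B z z) • z := by
  nth_rewrite 1 [h.expand hB v]; rw [h1, h2]; simp

theorem IsFrame.tau_mul (hB : IsTernaryForm B) {x y z : V} (h : IsFrame B x y z) :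
    tau B x * tau B y = LinearEquiv.neg ℚ * tau B z := by
  have h21 : B y x = 0 := by rw [hB.symm, h.h12]
  have h31 : B z x = 0 := by rw [hB.symm, h.h13]
  have h32 : B z y = 0 := by rw [hB.symm, h.h23]
  refine h.ext hB ?_ ?_ ?_
  · simp [LinearEquiv.mul_apply, tau_of_orth h21, tau_of_orth h31, tau_self hB]
  · simp [LinearEquiv.mul_apply, tau_self hB, tau_of_orth h32, tau_of_orth h.h12]
  · simp [LinearEquiv.mul_apply, tau_self hB, tau_of_orth h.h13, tau_of_orth h.h23]

theorem neg_mem_orth : LinearEquiv.neg ℚ ∈ orthogonalGroup B := by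
  intro x y; simp

theorem cauchy_schwarz (hB : IsTernaryForm B) (x y : V) :
    B x y ^ 2 ≤ B x x * B y y := by
  by_cases hx : x = 0
  · simp [hx]
  have h : 0 ≤ B (B x x • y - B x y • x) (B x x • y - B x y • x) := by
    by_cases h0 : B x x • y - B x y • x = 0
    · rw [h0]; simp
    · exact (hB.pos _ h0).le
  simp only [map_sub, map_smul, LinearMap.sub_apply, LinearMap.smul_apply, smul_eq_mul,
    hB.symm y x] at h
  have hp := hB.pos x hx
  nlinarith

theorem parallel_of_cauchy_schwarz (hB : IsTernaryForm B) {x y : V} (hx : x ≠ 0)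
    (h : B x y ^ 2 = B x x * B y y) : y = (B x y / B x x) • x := by
  have hq := hB.ne_zero hx
  rw [← sub_eq_zero]
  apply hB.eq_zero
  simp only [map_sub, map_smul, LinearMap.sub_apply, LinearMap.smul_apply, smul_eq_mul,
    hB.symm y x]
  field_simp
  nlinarith

/-! ### Proper rotations -/

/-- `g` is a rotation about `e` of trace `t` on the plane `e^⊥`, other than `1` and the half-turn. -/
structure IsRot (B : LinearMap.BilinForm ℚ V) (e : V) (t : ℚ) (g : V ≃ₗ[ℚ] V) : Prop where
  ne : e ≠ 0
  orth : g ∈ orthogonalGroup B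
  fix : g e = e
  quad : ∀ v, B e v = 0 → g (g v) = t • g v - v
  lt : t < 2
  gt : -2 < t

theorem IsRot.smul {e : V} {t : ℚ} {g : V ≃ₗ[ℚ] V} (h : IsRot B e t g) {c : ℚ} (hc : c ≠ 0) :
    IsRot B (c • e) t g :=
  ⟨smul_ne_zero hc h.ne, h.orth, by rw [map_smul, h.fix],
    fun v hv => h.quad v (by simpa [hc] using hv), h.lt, h.gt⟩

theorem IsRot.orth_apply {e : V} {t : ℚ} {g : V ≃ₗ[ℚ] V} (h : IsRot B e t g) {v : V}
    (hv : B e v = 0) : B e (g v) = 0 := by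
  rw [← h.fix, h.orth, hv]

theorem IsRot.form (hB : IsTernaryForm B) {e : V} {t : ℚ} {g : V ≃ₗ[ℚ] V} (h : IsRot B e t g)
    {v : V} (hv : B e v = 0) : B v (g v) = t / 2 * B v v := by
  have h1 : B (g v) (g (g v)) = B v (g v) := h.orth _ _
  rw [h.quad v hv] at h1
  simp only [map_sub, map_smul, smul_eq_mul, hB.symm (g v) v] at h1
  rw [h.orth] at h1
  linarith

/-- A vector of the plane `e^⊥` in terms of `x` and `g x`. -/
theorem IsRot.expand (hB : IsTernaryForm B) {e : V} {t : ℚ} {g : V ≃ₗ[ℚ] V} (h : IsRot B e t g)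
    {x v : V} (hx : x ≠ 0) (hex : B e x = 0) (hev : B e v = 0) :
    ∃ a b : ℚ, v = a • x + b • g x := by
  have hq := hB.ne_zero hx
  have hxx := h.form hB hex
  have hex' : B x e = 0 := by rw [hB.symm, hex]
  have hgx := h.orth_apply hex
  set y := g x - (t / 2) • x with hy
  have hxy : B x y = 0 := by
    simp only [hy, map_sub, map_smul, smul_eq_mul, hxx]; ring
  have hyne : y ≠ 0 := by
    intro h0
    have h1 : g x = (t / 2) • x := by rw [hy, sub_eq_zero] at h0; exact h0
    have h2 : B (g x) (g x) = B x x := h.orth _ _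
    rw [h1] at h2
    simp only [map_smul, LinearMap.smul_apply, smul_eq_mul] at h2
    have h3 : (t / 2) * (t / 2) = 1 := by
      have : ((t / 2) * (t / 2) - 1) * B x x = 0 := by linarith
      have := (mul_eq_zero.1 this).resolve_right hq
      linarith
    have := h.lt; have := h.gt
    nlinarith
  have hf : IsFrame B e x y := ⟨h.ne, hx, hyne, hex, by simp [hy, hex, hgx], hxy⟩
  have := (hf.rotate hB).eq_smul hB (v := v)
  have h2 := hf.expand hB v
  rw [hev, zero_div, zero_smul, zero_add] at h2
  refine ⟨B x v / B x x - B y v / B y y * (t / 2), B y v / B y y, ?_⟩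
  nth_rewrite 1 [h2]
  rw [hy]
  module

theorem IsTernaryForm.finite (hB : IsTernaryForm B) : Module.Finite ℚ V :=
  Module.finite_of_finrank_pos (by rw [hB.finrank_eq]; norm_num)

/-- An isometry of a ternary space has an eigenvector with eigenvalue `±1`. -/
theorem exists_eigen (hB : IsTernaryForm B) {g : V ≃ₗ[ℚ] V} (hg : g ∈ orthogonalGroup B) :
    ∃ e, e ≠ 0 ∧ (g e = e ∨ g e = -e) := by
  have := hB.finite
  let b := Module.finBasisOfFinrankEq ℚ V hB.finrank_eq
  set P := LinearMap.toMatrix b b g.toLinearMap with hP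
  set S := LinearMap.BilinForm.toMatrix b B with hS
  have h1 : P.transpose * S * P = S := by
    rw [hP, hS, ← LinearMap.BilinForm.toMatrix_comp b b B g.toLinearMap g.toLinearMap]
    congr 1
    ext x y; exact hg x y
  have hdS : S.det ≠ 0 := by
    refine (LinearMap.BilinForm.nondegenerate_iff_det_ne_zero b).1 ?_
    constructor
    · intro x hx; exact hB.eq_zero (hx x)
    · intro x hx; exact hB.eq_zero (hx x)
  have h2 : P.det * P.det = 1 := by
    have := congrArg Matrix.det h1
    rw [Matrix.det_mul, Matrix.det_mul, Matrix.det_transpose] at this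
    have h3 : (P.det * P.det - 1) * S.det = 0 := by linarith
    have := (mul_eq_zero.1 h3).resolve_right hdS
    linarith
  set s := P.det with hs
  have h3 : P.transpose * S * (P - s • 1) = (-s) • ((P.transpose - s • 1) * S) := by
    rw [mul_sub, h1, sub_mul, smul_sub, smul_mul_assoc, smul_smul, one_mul, neg_mul, h2,
      mul_smul_comm, mul_one]
    module
  have h4 : (P.transpose - s • (1 : Matrix (Fin 3) (Fin 3) ℚ)).det = (P - s • 1).det := by
    rw [← Matrix.det_transpose]; simp
  have h5 : (P - s • (1 : Matrix (Fin 3) (Fin 3) ℚ)).det = 0 := by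
    have := congrArg Matrix.det h3
    rw [Matrix.det_mul, Matrix.det_mul, Matrix.det_transpose, Matrix.det_smul, Matrix.det_mul, h4,
      Fintype.card_fin, ← hs] at this
    have h6 : (-s) ^ 3 = -s := by linear_combination (-s) * h2
    rw [h6] at this
    have h7 : (2 * s * S.det) * (P - s • (1 : Matrix (Fin 3) (Fin 3) ℚ)).det = 0 := by linarith
    refine (mul_eq_zero.1 h7).resolve_left ?_
    have : s ≠ 0 := by rintro h; rw [h] at h2; norm_num at h2
    simp [this, hdS]
  obtain ⟨v, hv, hv'⟩ := Matrix.exists_mulVec_eq_zero_iff.2 h5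
  refine ⟨b.equivFun.symm v, (LinearEquiv.map_ne_zero_iff _).2 hv, ?_⟩
  have h6 : g (b.equivFun.symm v) = s • b.equivFun.symm v := by
    apply b.equivFun.injective
    have h7 := LinearMap.toMatrix_mulVec_repr b b g.toLinearMap (b.equivFun.symm v)
    rw [← hP] at h7
    have h8 : (b.repr (b.equivFun.symm v) : Fin 3 → ℚ) = v := by
      rw [← Module.Basis.equivFun_apply, LinearEquiv.apply_symm_apply]
    rw [h8] at h7
    rw [map_smul, LinearEquiv.apply_symm_apply]
    rw [Matrix.sub_mulVec, h7, Matrix.smul_mulVec, Matrix.one_mulVec, sub_eq_zero] at hv'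
    exact hv'
  rcases mul_self_eq_one_iff.1 h2 with h | h
  · left; rw [h6, h, one_smul]
  · right; rw [h6, h, neg_one_smul]

theorem neg_mul_apply (g : V ≃ₗ[ℚ] V) (v : V) :
    (LinearEquiv.neg ℚ * g : V ≃ₗ[ℚ] V) v = -g v := by
  simp [LinearEquiv.mul_apply]

theorem neg_neg_mul (g : V ≃ₗ[ℚ] V) : LinearEquiv.neg ℚ * (LinearEquiv.neg ℚ * g) = g := by
  ext v; simp

/-- An isometry fixing `e` is `1`, a reflection, a half-turn, or a proper rotation about `e`. -/
theorem classify_fix (hB : IsTernaryForm B) {g : V ≃ₗ[ℚ] V} (hg : g ∈ orthogonalGroup B)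
    {e : V} (he : e ≠ 0) (hge : g e = e) :
    g = 1 ∨ (∃ x, x ≠ 0 ∧ (g = tau B x ∨ g = LinearEquiv.neg ℚ * tau B x)) ∨ ∃ t, IsRot B e t g := by
  obtain ⟨x, y, hf⟩ := exists_frame hB he
  have hq := hB.pos x hf.ne2
  have hr := hB.pos y hf.ne3
  have hgo : ∀ v, B e v = 0 → B e (g v) = 0 := fun v hv => by rw [← hge, hg, hv]
  have hx := hf.expand hB (g x)
  have hy := hf.expand hB (g y)
  rw [hgo x hf.h12, zero_div, zero_smul, zero_add] at hx
  rw [hgo y hf.h13, zero_div, zero_smul, zero_add] at hy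
  set α := B x (g x) / B x x
  set β := B y (g x) / B y y
  set γ := B x (g y) / B x x
  set δ := B y (g y) / B y y
  set q := B x x with hqd
  set r := B y y with hrd
  have hxy := hf.h23
  have hyx : B y x = 0 := by rw [hB.symm, hxy]
  have e1 : α ^ 2 * q + β ^ 2 * r = q := by
    have := hg x x
    rw [hx] at this
    simp only [map_add, map_smul, LinearMap.add_apply, LinearMap.smul_apply, smul_eq_mul, hxy, hyx]
      at this
    linarith
  have e2 : γ ^ 2 * q + δ ^ 2 * r = r := by
    have := hg y y
    rw [hy] at this
    simp only [map_add, map_smul, LinearMap.add_apply, LinearMap.smul_apply, smul_eq_mul, hxy, hyx]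
      at this
    linarith
  have e3 : α * γ * q + β * δ * r = 0 := by
    have := hg x y
    rw [hx, hy] at this
    simp only [map_add, map_smul, LinearMap.add_apply, LinearMap.smul_apply, smul_eq_mul, hxy, hyx]
      at this
    linarith
  have e4 : (α - δ) * (α + δ) = 0 := by
    have h1 : α ^ 2 * γ ^ 2 * q ^ 2 = β ^ 2 * δ ^ 2 * r ^ 2 := by
      have : α * γ * q = -(β * δ * r) := by linarith
      calc α ^ 2 * γ ^ 2 * q ^ 2 = (α * γ * q) ^ 2 := by ring
        _ = _ := by rw [this]; ring
    have h2 : β ^ 2 * r = q - α ^ 2 * q := by linarith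
    have h3 : γ ^ 2 * q = r - δ ^ 2 * r := by linarith
    have h4 : (α ^ 2 - δ ^ 2) * (q * r) = 0 := by
      have h5 : α ^ 2 * (γ ^ 2 * q) * q = (β ^ 2 * r) * δ ^ 2 * r := by linarith
      rw [h2, h3] at h5
      linarith
    have := (mul_eq_zero.1 h4).resolve_right (mul_pos hq hr).ne'
    linarith
  have e5 : (δ = α ∧ γ * q = -(β * r)) ∨ (δ = -α ∧ γ * q = β * r) := by
    rcases mul_eq_zero.1 e4 with h | h
    · have h' : δ = α := by linarith
      rw [h'] at e3 e2
      by_cases hα : α = 0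
      · rw [hα] at e1 e2
        have : (γ * q - β * r) * (γ * q + β * r) = 0 := by linear_combination q * e2 - r * e1
        rcases mul_eq_zero.1 this with h3 | h3
        · right; exact ⟨by rw [h', hα, neg_zero], by linarith⟩
        · left; exact ⟨h', by linarith⟩
      · left
        refine ⟨h', ?_⟩
        have : α * (γ * q + β * r) = 0 := by linarith
        have := (mul_eq_zero.1 this).resolve_left hα
        linarith
    · have h' : δ = -α := by linarith
      rw [h'] at e3 e2
      by_cases hα : α = 0
      · rw [hα] at e1 e2
        have : (γ * q - β * r) * (γ * q + β * r) = 0 := by linear_combination q * e2 - r * e1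
        rcases mul_eq_zero.1 this with h3 | h3
        · right; exact ⟨h', by linarith⟩
        · left; exact ⟨by rw [h', hα, neg_zero], by linarith⟩
      · right
        refine ⟨h', ?_⟩
        have : α * (γ * q - β * r) = 0 := by linarith
        have := (mul_eq_zero.1 this).resolve_left hα
        linarith
  clear_value α β γ δ
  rcases e5 with ⟨h1, h2⟩ | ⟨h1, h2⟩
  · by_cases hβ : β = 0
    · rw [hβ] at e1 h2 hx
      have hγ : γ = 0 := by simpa [hq.ne'] using h2
      rw [h1, hγ] at hy
      have : (α - 1) * (α + 1) = 0 := by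
        have : (α ^ 2 - 1) * q = 0 := by linarith
        have := (mul_eq_zero.1 this).resolve_right hq.ne'
        linarith
      rcases mul_eq_zero.1 this with h3 | h3
      · left
        have h4 : α = 1 := by linarith
        refine hf.ext hB hge ?_ ?_
        · rw [hx, h4]; simp
        · rw [hy, h4]; simp
      · right; left
        have h4 : α = -1 := by linarith
        refine ⟨e, he, Or.inr (hf.ext hB ?_ ?_ ?_)⟩
        · rw [neg_mul_apply, tau_self hB, hge, neg_neg]
        · rw [neg_mul_apply, tau_of_orth hf.h12, hx, h4]; simp
        · rw [neg_mul_apply, tau_of_orth hf.h13, hy, h4]; simp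
    · right; right
      have h3 : α ^ 2 < 1 := by
        have : 0 < β ^ 2 * r := by positivity
        by_contra h; push Not at h
        nlinarith
      have h4 : α ^ 2 + β * γ = 2 * α ^ 2 - 1 := by
        have : (α ^ 2 + β * γ - (2 * α ^ 2 - 1)) * q = 0 := by
          linear_combination β * h2 - e1
        have := (mul_eq_zero.1 this).resolve_right hq.ne'
        linarith
      refine ⟨2 * α, he, hg, hge, ?_, by nlinarith, by nlinarith⟩
      intro v hv
      have hv' := hf.expand hB v
      rw [hv, zero_div, zero_smul, zero_add] at hv'
      have h5 : g (g x) = (2 * α) • g x - x := by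
        conv_lhs => rw [hx, map_add, map_smul, map_smul, hx, hy, h1]
        rw [hx]
        have : α • (α • x + β • y) + β • (γ • x + α • y) =
            (α ^ 2 + β * γ) • x + (2 * α * β) • y := by module
        rw [this, h4]; module
      have h6 : g (g y) = (2 * α) • g y - y := by
        conv_lhs => rw [hy, map_add, map_smul, map_smul, hx, hy, h1]
        rw [hy, h1]
        have : γ • (α • x + β • y) + α • (γ • x + α • y) =
            (2 * α * γ) • x + (α ^ 2 + β * γ) • y := by module
        rw [this, h4]; module
      rw [hv']
      simp only [map_add, map_smul, h5, h6]
      module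
  · right; left
    have h4 : β * γ = 1 - α ^ 2 := by
      have : (β * γ - (1 - α ^ 2)) * q = 0 := by linear_combination β * h2 + e1
      have := (mul_eq_zero.1 this).resolve_right hq.ne'
      linarith
    by_cases hα : α = 1
    · have hβ : β = 0 := by
        rw [hα] at e1
        have : β ^ 2 * r = 0 := by linarith
        simpa [hr.ne'] using this
      have hγ : γ = 0 := by rw [hβ] at h2; simpa [hq.ne'] using h2
      refine ⟨y, hf.ne3, Or.inl (hf.ext hB ?_ ?_ ?_)⟩
      · rw [hge, tau_of_orth (by rw [hB.symm, hf.h13])]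
      · rw [hx, tau_of_orth hyx, hα, hβ]; simp
      · rw [hy, tau_self hB, h1, hγ, hα]; simp
    · have hα1 : 1 - α ≠ 0 := fun h => hα (by linarith)
      have hwx : B ((1 - α) • x - β • y) x = (1 - α) * q := by
        simp [hyx, ← hqd]
      have hwy : B ((1 - α) • x - β • y) y = -(β * r) := by
        simp [hxy, ← hrd]
      have hww : B ((1 - α) • x - β • y) ((1 - α) • x - β • y) = 2 * (1 - α) * q := by
        rw [map_sub, map_smul, map_smul, hwx, hwy, smul_eq_mul, smul_eq_mul]
        linear_combination e1
      refine ⟨(1 - α) • x - β • y, ?_, Or.inl (hf.ext hB ?_ ?_ ?_)⟩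
      · intro h; rw [h] at hww; simp [hα1, hq.ne'] at hww
      · rw [hge, tau_of_orth]
        rw [hB.symm]; simp [hf.h12, hf.h13]
      · rw [hx, tau_apply, hwx, hww]
        have : 2 * ((1 - α) * q) / (2 * (1 - α) * q) = 1 := by field_simp
        rw [this]; module
      · rw [hy, tau_apply, hwy, hww, h1]
        have hc : 2 * -(β * r) / (2 * (1 - α) * q) = -(γ / (1 - α)) := by
          rw [← h2]; field_simp
        have h6 : γ / (1 - α) * β = 1 + α := by
          field_simp; linear_combination h4
        have h7 : γ / (1 - α) * (1 - α) = γ := div_mul_cancel₀ _ hα1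
        have : y - -(γ / (1 - α)) • ((1 - α) • x - β • y) =
            (γ / (1 - α) * (1 - α)) • x + (1 - γ / (1 - α) * β) • y := by module
        rw [hc, this, h6, h7]; module

theorem classify (hB : IsTernaryForm B) {g : V ≃ₗ[ℚ] V} (hg : g ∈ orthogonalGroup B) :
    (g = 1 ∨ g = LinearEquiv.neg ℚ) ∨
    (∃ x, x ≠ 0 ∧ (g = tau B x ∨ g = LinearEquiv.neg ℚ * tau B x)) ∨
    ∃ e t, IsRot B e t g ∨ IsRot B e t (LinearEquiv.neg ℚ * g) := by
  obtain ⟨e, he, h | h⟩ := exists_eigen hB hg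
  · rcases classify_fix hB hg he h with h | h | ⟨t, h⟩
    · exact Or.inl (Or.inl h)
    · exact Or.inr (Or.inl h)
    · exact Or.inr (Or.inr ⟨e, t, Or.inl h⟩)
  · have h' : (LinearEquiv.neg ℚ * g : V ≃ₗ[ℚ] V) e = e := by rw [neg_mul_apply, h, neg_neg]
    rcases classify_fix hB (mul_mem neg_mem_orth hg) he h' with h | ⟨x, hx, h | h⟩ | ⟨t, h⟩
    · refine Or.inl (Or.inr ?_)
      rw [← neg_neg_mul g, h, mul_one]
    · exact Or.inr (Or.inl ⟨x, hx, Or.inr (by rw [← neg_neg_mul g, h])⟩)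
    · exact Or.inr (Or.inl ⟨x, hx, Or.inl (by rw [← neg_neg_mul g, h, neg_neg_mul])⟩)
    · exact Or.inr (Or.inr ⟨e, t, Or.inr h⟩)

end

section

/-! ### Lattices and their symmetries -/

theorem zsmul_ne_zero {n : ℤ} (hn : n ≠ 0) {x : V} (hx : x ≠ 0) : n • x ≠ 0 := by
  rw [← Int.cast_smul_eq_zsmul ℚ]
  exact smul_ne_zero (by exact_mod_cast hn) hx

theorem smul_mem_smul_iff {σ : V ≃ₗ[ℚ] V} {v : V} : σ v ∈ σ • M ↔ v ∈ M := by
  rw [Submodule.mem_smul_pointwise_iff_exists]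
  constructor
  · rintro ⟨w, hw, h⟩
    rw [← σ.injective h]; exact hw
  · intro h; exact ⟨v, h, rfl⟩

theorem mem_smul_iff {σ : V ≃ₗ[ℚ] V} {v : V} : v ∈ σ • M ↔ σ⁻¹ v ∈ M := by
  have h : σ (σ⁻¹ v) = v := by rw [← LinearEquiv.mul_apply, mul_inv_cancel]; rfl
  nth_rewrite 1 [← h]
  exact smul_mem_smul_iff

theorem map_mem {σ : V ≃ₗ[ℚ] V} (h : σ ∈ isometryGroup B M) {v : V} (hv : v ∈ M) : σ v ∈ M := by
  rw [← h.2]; exact smul_mem_smul_iff.2 hv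

theorem mem_isometryGroup_of {σ : V ≃ₗ[ℚ] V} (h : σ ∈ orthogonalGroup B)
    (h1 : ∀ v ∈ M, σ v ∈ M) (h2 : ∀ v ∈ M, σ⁻¹ v ∈ M) : σ ∈ isometryGroup B M := by
  refine ⟨h, ?_⟩
  change σ • M = M
  ext v
  rw [mem_smul_iff]
  refine ⟨fun hv => ?_, h2 v⟩
  have := h1 _ hv
  rwa [← LinearEquiv.mul_apply, mul_inv_cancel] at this

theorem neg_mem_isometryGroup : LinearEquiv.neg ℚ ∈ isometryGroup B M := by
  refine mem_isometryGroup_of neg_mem_orth (fun v hv => by simpa using hv) (fun v hv => ?_)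
  have : (LinearEquiv.neg ℚ : V ≃ₗ[ℚ] V)⁻¹ = LinearEquiv.neg ℚ := rfl
  rw [this]; simpa using hv

/-- A lattice on a positive definite ternary space on which the form is integral. -/
structure IsIntLattice (B : LinearMap.BilinForm ℚ V) (M : Submodule ℤ V) : Prop
    extends IsTernaryForm B where
  lattice : M.IsLattice ℚ
  integral : ∀ x ∈ M, ∀ y ∈ M, ∃ k : ℤ, B x y = k

/-- The reflection along `x ≠ 0` is a symmetry of `M`. -/
def IsSym (B : LinearMap.BilinForm ℚ V) (M : Submodule ℤ V) (x : V) : Prop :=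
  x ≠ 0 ∧ tau B x ∈ isometryGroup B M

theorem IsSym.smul {x : V} (h : IsSym B M x) {c : ℚ} (hc : c ≠ 0) : IsSym B M (c • x) :=
  ⟨smul_ne_zero hc h.1, by rw [tau_smul hc]; exact h.2⟩

theorem IsSym.map {x : V} (h : IsSym B M x) {g : V ≃ₗ[ℚ] V} (hg : g ∈ isometryGroup B M) :
    IsSym B M (g x) := by
  refine ⟨by simpa using h.1, ?_⟩
  rw [← conj_tau hg.1]
  exact mul_mem (mul_mem hg h.2) (inv_mem hg)

theorem IsSym.third (hB : IsTernaryForm B) {x y z : V} (hf : IsFrame B x y z) (hx : IsSym B M x)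
    (hy : IsSym B M y) : IsSym B M z := by
  refine ⟨hf.ne3, ?_⟩
  rw [← neg_neg_mul (tau B z), ← hf.tau_mul hB]
  exact mul_mem neg_mem_isometryGroup (mul_mem hx.2 hy.2)

theorem exists_int_smul_mem [M.IsLattice ℚ] (v : V) : ∃ n : ℤ, n ≠ 0 ∧ n • v ∈ M := by
  have hv : v ∈ Submodule.span ℚ (M : Set V) := by
    rw [Submodule.IsLattice.span_eq_top]; trivial
  induction hv using Submodule.span_induction with
  | mem x hx => exact ⟨1, one_ne_zero, by simpa using hx⟩
  | zero => exact ⟨1, one_ne_zero, by simp⟩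
  | add x y _ _ hx hy =>
    obtain ⟨n, hn, h1⟩ := hx
    obtain ⟨m, hm, h2⟩ := hy
    refine ⟨n * m, mul_ne_zero hn hm, ?_⟩
    rw [smul_add]
    refine M.add_mem ?_ ?_
    · rw [mul_comm, mul_smul]; exact M.smul_mem _ h1
    · rw [mul_smul]; exact M.smul_mem _ h2
  | smul a x _ hx =>
    obtain ⟨n, hn, h1⟩ := hx
    refine ⟨n * a.den, mul_ne_zero hn (by exact_mod_cast a.den_nz), ?_⟩
    have : (n * a.den : ℤ) • a • x = a.num • n • x := by
      rw [← Int.cast_smul_eq_zsmul ℚ, ← Int.cast_smul_eq_zsmul ℚ, ← Int.cast_smul_eq_zsmul ℚ,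
        smul_smul, smul_smul]
      congr 1
      have := Rat.mul_den_eq_num a
      push_cast
      linear_combination (n : ℚ) * this
    rw [this]
    exact M.smul_mem _ h1

theorem IsIntLattice.exists_min (hM : IsIntLattice B M) (P : V → Prop)
    (h : ∃ v ∈ M, v ≠ 0 ∧ P v) :
    ∃ x ∈ M, x ≠ 0 ∧ P x ∧ ∀ w ∈ M, w ≠ 0 → P w → B x x ≤ B w w := by
  classical
  have key : ∀ v ∈ M, ∃ n : ℕ, B v v = n := by
    intro v hv
    obtain ⟨k, hk⟩ := hM.integral v hv v hv
    have : 0 ≤ B v v := by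
      by_cases h0 : v = 0
      · simp [h0]
      · exact (hM.pos v h0).le
    rw [hk] at this
    lift k to ℕ using (by exact_mod_cast this)
    exact ⟨k, by simpa using hk⟩
  have hex : ∃ n : ℕ, ∃ v ∈ M, v ≠ 0 ∧ P v ∧ B v v = n := by
    obtain ⟨v, hv, h0, hP⟩ := h
    obtain ⟨n, hn⟩ := key v hv
    exact ⟨n, v, hv, h0, hP, hn⟩
  obtain ⟨x, hx, hx0, hPx, hn⟩ := Nat.find_spec hex
  refine ⟨x, hx, hx0, hPx, fun w hw hw0 hPw => ?_⟩
  obtain ⟨m, hm⟩ := key w hw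
  rw [hn, hm]
  exact_mod_cast Nat.find_min' hex ⟨w, hw, hw0, hPw, hm⟩

/-- Every line of `V` meets the lattice in `ℤ x` for a nonzero `x`. -/
theorem IsIntLattice.exists_generator (hM : IsIntLattice B M) {v : V} (hv : v ≠ 0) :
    ∃ x ∈ M, (∃ c : ℚ, c ≠ 0 ∧ x = c • v) ∧ ∀ w ∈ M, (∃ r : ℚ, w = r • v) → ∃ k : ℤ, w = k • x := by
  have := hM.lattice
  obtain ⟨n, hn, hnv⟩ := exists_int_smul_mem (M := M) v
  obtain ⟨x, hx, hx0, ⟨c, rfl⟩, hmin⟩ := hM.exists_min (fun w => ∃ r : ℚ, w = r • v)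
    ⟨n • v, hnv, zsmul_ne_zero hn hv, n, by rw [Int.cast_smul_eq_zsmul]⟩
  have hc : c ≠ 0 := by rintro rfl; simp at hx0
  refine ⟨c • v, hx, ⟨c, hc, rfl⟩, ?_⟩
  rintro w hw ⟨r, rfl⟩
  refine ⟨round (r / c), ?_⟩
  by_contra hne
  have h1 := hmin (r • v - round (r / c) • c • v) (M.sub_mem hw (M.smul_mem _ hx))
    (sub_ne_zero.2 hne) ⟨r - round (r / c) * c, by
      rw [← Int.cast_smul_eq_zsmul ℚ, smul_smul, sub_smul]⟩
  rw [← Int.cast_smul_eq_zsmul ℚ, smul_smul, ← sub_smul] at h1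
  simp only [map_smul, LinearMap.smul_apply, smul_eq_mul] at h1
  have h2 : c * (c * B v v) ≤ ((r / c - round (r / c)) ^ 2) * (c * (c * B v v)) := by
    refine h1.trans_eq ?_
    field_simp
  have h3 := abs_sub_round (r / c)
  have h4 : (r / c - round (r / c)) ^ 2 ≤ 1 / 4 := by
    rw [← sq_abs]; nlinarith [abs_nonneg (r / c - round (r / c))]
  have h5 : 0 < c * (c * B v v) := by
    have := hM.pos v hv
    have : 0 < c ^ 2 * B v v := by positivity
    nlinarith
  nlinarith

theorem isPrimitive_of_generator {x : V} (hx : x ∈ M) (hx0 : x ≠ 0)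
    (h : ∀ w ∈ M, (∃ r : ℚ, w = r • x) → ∃ k : ℤ, w = k • x) : IsPrimitiveVector M x := by
  refine ⟨hx, fun n y hy hxy => ?_⟩
  have hn : n ≠ 0 := by rintro rfl; simp at hxy; exact hx0 hxy
  obtain ⟨k, hk⟩ := h y hy ⟨(n : ℚ)⁻¹, by
    rw [hxy, ← Int.cast_smul_eq_zsmul ℚ, smul_smul, inv_mul_cancel₀ (by exact_mod_cast hn),
      one_smul]⟩
  have : (n * k - 1) • x = 0 := by
    rw [sub_smul, one_smul, mul_smul, ← hk, ← hxy, sub_self]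
  refine IsUnit.of_mul_eq_one k ?_
  by_contra h1
  exact zsmul_ne_zero (sub_ne_zero.2 h1) hx0 this

theorem IsIntLattice.exists_primitive (hM : IsIntLattice B M) {v : V} (hv : v ≠ 0) :
    ∃ c : ℚ, c ≠ 0 ∧ IsPrimitiveVector M (c • v) := by
  obtain ⟨x, hx, ⟨c, hc, rfl⟩, h⟩ := hM.exists_generator hv
  refine ⟨c, hc, isPrimitive_of_generator hx (smul_ne_zero hc hv) ?_⟩
  rintro w hw ⟨r, rfl⟩
  exact h _ hw ⟨r * c, by rw [mul_smul]⟩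

omit [Module ℚ V] in
theorem IsPrimitiveVector.ne_zero {x : V} (h : IsPrimitiveVector M x) : x ≠ 0 := by
  rintro rfl
  have := h.2 0 0 M.zero_mem (by simp)
  simp at this

theorem IsIntLattice.primitive_dvd (hM : IsIntLattice B M) {x : V} (h : IsPrimitiveVector M x)
    {w : V} (hw : w ∈ M) {r : ℚ} (hr : w = r • x) : ∃ k : ℤ, r = k := by
  obtain ⟨y, hy, ⟨c, hc, hyx⟩, hgen⟩ := hM.exists_generator h.ne_zero
  obtain ⟨n, hn⟩ := hgen x h.1 ⟨1, by simp⟩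
  obtain ⟨m, hm⟩ := hgen w hw ⟨r, hr⟩
  have hu := h.2 n y hy hn
  rcases Int.isUnit_iff.1 hu with h1 | h1
  · refine ⟨m, ?_⟩
    rw [h1, one_smul] at hn
    rw [hr, hn, ← Int.cast_smul_eq_zsmul ℚ] at hm
    exact smul_left_injective ℚ (hn ▸ h.ne_zero) hm
  · refine ⟨-m, ?_⟩
    rw [h1] at hn
    have hy' : y = -x := by rw [hn]; simp
    rw [hr, hy', ← Int.cast_smul_eq_zsmul ℚ, smul_neg, ← neg_smul] at hm
    have := smul_left_injective ℚ h.ne_zero hm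
    push_cast; exact this

theorem IsIntLattice.primitive_unique (hM : IsIntLattice B M) {x y : V}
    (hx : IsPrimitiveVector M x) (hy : IsPrimitiveVector M y) {r : ℚ} (hr : y = r • x) :
    y = x ∨ y = -x := by
  obtain ⟨k, rfl⟩ := hM.primitive_dvd hx hy.1 hr
  rw [Int.cast_smul_eq_zsmul] at hr
  rcases Int.isUnit_iff.1 (hy.2 k x hx.1 hr) with h | h
  · left; rw [hr, h, one_smul]
  · right; rw [hr, h]; simp

theorem IsIntLattice.root_integral (hM : IsIntLattice B M) {x : V} (hx : IsPrimitiveVector M x)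
    (hs : tau B x ∈ isometryGroup B M) {v : V} (hv : v ∈ M) :
    ∃ k : ℤ, 2 * B x v = k * B x x := by
  have h1 := map_mem hs hv
  rw [tau_apply] at h1
  have h2 : (2 * B x v / B x x) • x ∈ M := by
    have := M.sub_mem hv h1
    rwa [sub_sub_cancel] at this
  obtain ⟨k, hk⟩ := hM.primitive_dvd hx h2 rfl
  exact ⟨k, by rw [← hk, div_mul_cancel₀ _ (hM.ne_zero hx.ne_zero)]⟩

/-- The crystallographic restriction for two symmetries. -/
theorem IsIntLattice.cos_sq (hM : IsIntLattice B M) {x y : V} (hx : IsSym B M x)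
    (hy : IsSym B M y) : ∃ k : ℕ, k ≤ 4 ∧ 4 * B x y ^ 2 = k * (B x x * B y y) := by
  obtain ⟨c, hc, hcx⟩ := hM.exists_primitive hx.1
  obtain ⟨d, hd, hdy⟩ := hM.exists_primitive hy.1
  obtain ⟨m, hm⟩ := hM.root_integral hcx (hx.smul hc).2 hdy.1
  obtain ⟨n, hn⟩ := hM.root_integral hdy (hy.smul hd).2 hcx.1
  simp only [map_smul, LinearMap.smul_apply, smul_eq_mul, hM.symm y x] at hm hn
  have hqx := hM.pos x hx.1
  have hqy := hM.pos y hy.1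
  have h1 : 2 * (d * B x y) = m * (c * B x x) := by
    apply mul_left_cancel₀ hc; linear_combination hm
  have h2 : 2 * (c * B x y) = n * (d * B y y) := by
    apply mul_left_cancel₀ hd; linear_combination hn
  have h3 : 4 * B x y ^ 2 = (m * n : ℤ) * (B x x * B y y) := by
    apply mul_left_cancel₀ (mul_ne_zero hc hd)
    push_cast
    linear_combination (m * (c * B x x)) * h2 + 2 * (c * B x y) * h1
  have h4 := cauchy_schwarz hM.toIsTernaryForm x y
  have hpos : 0 < B x x * B y y := mul_pos hqx hqy
  have h5 : 0 ≤ m * n := by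
    by_contra h
    push Not at h
    have : ((m * n : ℤ) : ℚ) < 0 := by exact_mod_cast h
    nlinarith [sq_nonneg (B x y)]
  have h6 : m * n ≤ 4 := by
    by_contra h
    push Not at h
    have : (4 : ℚ) < ((m * n : ℤ) : ℚ) := by exact_mod_cast h
    nlinarith
  obtain ⟨k, hk⟩ := Int.eq_ofNat_of_zero_le h5
  exact ⟨k, by omega, by rw [h3, hk]; simp⟩

/-! ### Rotations of a lattice -/

theorem IsRot.ext (hB : IsTernaryForm B) {e : V} {t : ℚ} {g : V ≃ₗ[ℚ] V} (h : IsRot B e t g)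
    {x : V} (hx : x ≠ 0) (hex : B e x = 0) {f f' : V ≃ₗ[ℚ] V} (h1 : f e = f' e) (h2 : f x = f' x)
    (h3 : f (g x) = f' (g x)) : f = f' := by
  ext v
  have hv : B e (v - (B e v / B e e) • e) = 0 := by
    simp [div_mul_cancel₀ _ (hB.ne_zero h.ne)]
  obtain ⟨a, b, hab⟩ := h.expand hB hx hex hv
  rw [sub_eq_iff_eq_add] at hab
  rw [hab]
  simp only [map_add, map_smul, h1, h2, h3]

theorem IsRot.symm_add (hB : IsTernaryForm B) {e : V} {t : ℚ} {g : V ≃ₗ[ℚ] V} (h : IsRot B e t g)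
    (hg : g ∈ isometryGroup B M) {x : V} (hx : IsSym B M x) (hex : B e x = 0) :
    IsSym B M (x + g x) := by
  have hq := hB.pos x hx.1
  have hxx := h.form hB hex
  have ht : 0 < 2 + t := by linarith [h.gt]
  have hQ : B (x + g x) (x + g x) = (2 + t) * B x x := by
    simp only [map_add, LinearMap.add_apply, h.orth x x, hB.symm (g x) x, hxx]; ring
  have hne : x + g x ≠ 0 := by
    intro h0
    rw [h0] at hQ
    have : (2 + t) * B x x > 0 := mul_pos ht hq
    simp only [map_zero] at hQ; linarith
  refine ⟨hne, ?_⟩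
  have : g * tau B x = tau B (x + g x) := by
    refine h.ext hB hx.1 hex ?_ ?_ ?_
    · rw [LinearEquiv.mul_apply, tau_of_orth (by rw [hB.symm, hex]), h.fix, tau_of_orth]
      rw [hB.symm, map_add, hex, h.orth_apply hex, add_zero]
    · rw [LinearEquiv.mul_apply, tau_self hB, tau_apply, hQ]
      have : 2 * B (x + g x) x / ((2 + t) * B x x) = 1 := by
        simp only [map_add, LinearMap.add_apply, hB.symm (g x) x, hxx]
        field_simp
      rw [this]; simp
    · rw [LinearEquiv.mul_apply, tau_apply, tau_apply, hQ, hxx]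
      have h1 : 2 * B (x + g x) (g x) / ((2 + t) * B x x) = 1 := by
        simp only [map_add, LinearMap.add_apply, h.orth x x, hxx]
        field_simp
        ring
      have h2 : 2 * (t / 2 * B x x) / B x x = t := by field_simp
      rw [h1, h2, map_sub, map_smul, h.quad x hex]; module
  rw [← this]
  exact mul_mem hg hx.2

/-- Basic structure of a lattice with a proper rotation: the trace is `0` or `±1`, and the plane
lattice `M ∩ e^⊥` is `ℤ x + ℤ g x` with `x` the vector of a symmetry. -/
theorem IsIntLattice.rot_structure (hM : IsIntLattice B M) {e : V} {t : ℚ} {g : V ≃ₗ[ℚ] V}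
    (h : IsRot B e t g) (hg : g ∈ isometryGroup B M) :
    (t = 0 ∨ t = 1 ∨ t = -1) ∧ ∃ x, IsPrimitiveVector M x ∧ B e x = 0 ∧ IsSym B M x ∧
      ∀ w ∈ M, B e w = 0 → ∃ a b : ℤ, w = a • x + b • g x := by
  have hB := hM.toIsTernaryForm
  have := hM.lattice
  obtain ⟨v, hv0, hv, -⟩ := exists_orth hB e e
  obtain ⟨n, hn, hnv⟩ := exists_int_smul_mem (M := M) v
  obtain ⟨x, hx, hx0, hex, hmin⟩ := hM.exists_min (fun w => B e w = 0)
    ⟨n • v, hnv, zsmul_ne_zero hn hv0, by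
      rw [← Int.cast_smul_eq_zsmul ℚ, map_smul, hv, smul_zero]⟩
  have hq := hB.pos x hx0
  have hxx := h.form hB hex
  have hgx := map_mem hg hx
  have hprim : IsPrimitiveVector M x := by
    refine ⟨hx, fun n y hy hxy => ?_⟩
    have hn : n ≠ 0 := by rintro rfl; simp at hxy; exact hx0 hxy
    have hy0 : y ≠ 0 := by rintro rfl; simp at hxy; exact hx0 hxy
    rw [← Int.cast_smul_eq_zsmul ℚ] at hxy
    have hey : B e y = 0 := by
      rw [hxy, map_smul, smul_eq_mul] at hex
      exact (mul_eq_zero.1 hex).resolve_left (by exact_mod_cast hn)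
    have h1 := hmin y hy hy0 hey
    rw [hxy] at h1
    simp only [map_smul, LinearMap.smul_apply, smul_eq_mul] at h1
    have h2 := hB.pos y hy0
    have h3 : (n : ℚ) * n ≤ 1 := by
      by_contra hc; push Not at hc; nlinarith
    have h4 : n * n ≤ 1 := by exact_mod_cast h3
    rw [Int.isUnit_iff]
    have : n ≤ 1 := by nlinarith
    have : -1 ≤ n := by nlinarith
    omega
  have ht : ∃ k : ℤ, t = k := by
    have h1 : g x + g⁻¹ x ∈ M := M.add_mem hgx (map_mem (inv_mem hg) hx)
    have hgi : g (g⁻¹ x) = x := by rw [← LinearEquiv.mul_apply, mul_inv_cancel]; rfl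
    have h2 : B e (g⁻¹ x) = 0 := by rw [← h.orth, hgi, h.fix, hex]
    have h3 := h.quad _ h2
    rw [hgi] at h3
    refine hM.primitive_dvd hprim h1 (r := t) ?_
    rw [h3]; abel
  have hlat : ∀ w ∈ M, B e w = 0 → ∃ a b : ℤ, w = a • x + b • g x := by
    intro w hw hew
    obtain ⟨α, β, hab⟩ := h.expand hB hx0 hex hew
    refine ⟨round α, round β, ?_⟩
    by_contra hne
    set w' := w - (round α • x + round β • g x) with hw'
    have h1 : w' ∈ M := M.sub_mem hw (M.add_mem (M.smul_mem _ hx) (M.smul_mem _ hgx))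
    have h2 : w' = (α - round α) • x + (β - round β) • g x := by
      rw [hw', hab, ← Int.cast_smul_eq_zsmul ℚ, ← Int.cast_smul_eq_zsmul ℚ]; module
    have h3 : B e w' = 0 := by
      rw [h2, map_add, map_smul, map_smul, hex, h.orth_apply hex]; simp
    have h4 := hmin w' h1 (sub_ne_zero.2 hne) h3
    have h5 : B w' w' = ((α - round α) ^ 2 + t * (α - round α) * (β - round β) +
        (β - round β) ^ 2) * B x x := by
      rw [h2]
      simp only [map_add, map_smul, LinearMap.add_apply, LinearMap.smul_apply, smul_eq_mul,
        hB.symm (g x) x, hxx, h.orth x x]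
      ring
    have ha := abs_le.1 (abs_sub_round α)
    have hb := abs_le.1 (abs_sub_round β)
    set α' := α - round α
    set β' := β - round β
    have h6 : α' ^ 2 + t * α' * β' + β' ^ 2 < 1 := by
      obtain ⟨k, rfl⟩ := ht
      have k1 : k < 2 := by exact_mod_cast h.lt
      have k2 : -2 < k := by exact_mod_cast h.gt
      have : α' ^ 2 ≤ 1 / 4 := by nlinarith [ha.1, ha.2]
      have : β' ^ 2 ≤ 1 / 4 := by nlinarith [hb.1, hb.2]
      have : k = 0 ∨ k = 1 ∨ k = -1 := by omega
      rcases this with rfl | rfl | rfl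
      · push_cast; linarith
      · push_cast; nlinarith [sq_nonneg (α' - β')]
      · push_cast; nlinarith [sq_nonneg (α' + β')]
    rw [h5] at h4
    nlinarith
  refine ⟨?_, x, hprim, hex, ⟨hx0, ?_⟩, hlat⟩
  · obtain ⟨k, rfl⟩ := ht
    have k1 : k < 2 := by exact_mod_cast h.lt
    have k2 : -2 < k := by exact_mod_cast h.gt
    have : k = 0 ∨ k = 1 ∨ k = -1 := by omega
    rcases this with rfl | rfl | rfl <;> simp
  · have key : ∀ v ∈ M, tau B x v ∈ M := by
      intro v hv
      have hw : v - g v ∈ M := M.sub_mem hv (map_mem hg hv)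
      have hew : B e (v - g v) = 0 := by
        rw [map_sub, sub_eq_zero]; nth_rewrite 2 [← h.fix]; rw [h.orth]
      obtain ⟨a, b, hab⟩ := hlat _ hw hew
      rw [← Int.cast_smul_eq_zsmul ℚ, ← Int.cast_smul_eq_zsmul ℚ] at hab
      have e1 := congrArg (B (g x)) hab
      have e2 := congrArg (B (g (g x))) hab
      simp only [map_add, map_smul, map_sub, smul_eq_mul, hB.symm (g x) x, hxx, h.orth x,
        h.quad x hex, LinearMap.sub_apply, LinearMap.smul_apply] at e1 e2
      have e3 : t * B x v - B x (g v) = B (g x) v := by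
        rw [← h.orth (g x) v, h.quad x hex, map_sub, map_smul, LinearMap.sub_apply,
          LinearMap.smul_apply, h.orth, smul_eq_mul]
      have h5 : 2 * B x v / B x x = ((a - b : ℤ) : ℚ) := by
        rw [div_eq_iff hq.ne']
        have hlt : 2 - t ≠ 0 := by linarith [h.lt]
        apply mul_left_cancel₀ hlt
        push_cast
        linear_combination 2 * ((t - 1) * e1 - e2 - e3)
      rw [tau_apply, h5, Int.cast_smul_eq_zsmul]
      exact M.sub_mem hv (M.smul_mem _ hx)
    exact mem_isometryGroup_of (tau_mem hB x) key key

end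

section

/-! ### Cubic lattices and oblique symmetries -/

theorem eq_zero_of_sq_eq_two_mul {a b : ℚ} (h : a ^ 2 = 2 * b ^ 2) : b = 0 := by
  by_contra hb
  have h1 : IsSquare ((2 : ℕ) : ℚ) := ⟨a / b, by push_cast; field_simp; linarith⟩
  rw [Rat.isSquare_natCast_iff] at h1
  obtain ⟨r, hr⟩ := h1
  have : r ≤ 2 := by nlinarith
  interval_cases r <;> omega

theorem eq_zero_of_sq_eq_three_mul {a b : ℚ} (h : a ^ 2 = 3 * b ^ 2) : b = 0 := by
  by_contra hb
  have h1 : IsSquare ((3 : ℕ) : ℚ) := ⟨a / b, by push_cast; field_simp; linarith⟩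
  rw [Rat.isSquare_natCast_iff] at h1
  obtain ⟨r, hr⟩ := h1
  have : r ≤ 3 := by nlinarith
  interval_cases r <;> omega

/-- `f₁, f₂, f₃` is an orthogonal frame of equal lengths along the fourfold axes of the cubic
lattice `M`. -/
structure IsCubic (B : LinearMap.BilinForm ℚ V) (M : Submodule ℤ V) (f₁ f₂ f₃ : V) : Prop
    extends IsFrame B f₁ f₂ f₃ where
  q2 : B f₂ f₂ = B f₁ f₁
  q3 : B f₃ f₃ = B f₁ f₁
  s1 : IsSym B M f₁
  s2 : IsSym B M f₂
  s3 : IsSym B M f₃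
  s12 : IsSym B M (f₁ - f₂)
  s23 : IsSym B M (f₂ - f₃)

theorem IsRot.sym_axis (hB : IsTernaryForm B) {e : V} {g : V ≃ₗ[ℚ] V} (h : IsRot B e 0 g)
    (hg : g ∈ isometryGroup B M) : IsSym B M e := by
  refine ⟨h.ne, ?_⟩
  obtain ⟨x, y, hf⟩ := exists_frame hB h.ne
  have : tau B e = LinearEquiv.neg ℚ * (g * g) := by
    refine hf.ext hB ?_ ?_ ?_
    · rw [tau_self hB, neg_mul_apply, LinearEquiv.mul_apply, h.fix, h.fix]
    · rw [tau_of_orth hf.h12, neg_mul_apply, LinearEquiv.mul_apply, h.quad x hf.h12]; simp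
    · rw [tau_of_orth hf.h13, neg_mul_apply, LinearEquiv.mul_apply, h.quad y hf.h13]; simp
  rw [this]
  exact mul_mem neg_mem_isometryGroup (mul_mem hg hg)

theorem IsRot.square {e : V} {g : V ≃ₗ[ℚ] V} (h : IsRot B e 1 g) : IsRot B e (-1) (g * g) := by
  refine ⟨h.ne, mul_mem h.orth h.orth, by rw [LinearEquiv.mul_apply, h.fix, h.fix], ?_,
    by norm_num, by norm_num⟩
  intro v hv
  have h1 := h.quad v hv
  simp only [LinearEquiv.mul_apply, h1, map_sub, map_smul]
  module

theorem IsIntLattice.normal_rot (hM : IsIntLattice B M) {e : V} {t : ℚ} {g : V ≃ₗ[ℚ] V}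
    (h : IsRot B e t g) (hg : g ∈ isometryGroup B M) :
    ∃ t' g', (t' = 0 ∨ t' = -1) ∧ g' ∈ isometryGroup B M ∧ IsRot B e t' g' := by
  rcases (hM.rot_structure h hg).1 with rfl | rfl | rfl
  · exact ⟨0, g, Or.inl rfl, hg, h⟩
  · exact ⟨-1, g * g, Or.inr rfl, mul_mem hg hg, h.square⟩
  · exact ⟨-1, g, Or.inr rfl, hg, h⟩

theorem IsRot.cube (hB : IsTernaryForm B) {e : V} {g : V ≃ₗ[ℚ] V} (h : IsRot B e (-1) g) (v : V) :
    g (g (g v)) = v := by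
  have hv : B e (v - (B e v / B e e) • e) = 0 := by
    simp [div_mul_cancel₀ _ (hB.ne_zero h.ne)]
  set w := v - (B e v / B e e) • e with hw
  have h1 : g (g (g w)) = w := by
    rw [h.quad w hv, map_sub, map_smul, h.quad w hv]; module
  rw [sub_eq_iff_eq_add.1 hw.symm]
  simp only [map_add, map_smul, h.fix, h1]

theorem IsRot.conj {e : V} {t : ℚ} {g : V ≃ₗ[ℚ] V} (h : IsRot B e t g) {s : V ≃ₗ[ℚ] V}
    (hs : s ∈ orthogonalGroup B) : IsRot B (s e) t (s * g * s⁻¹) := by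
  have hinv : ∀ v, s⁻¹ (s v) = v := fun v => by
    rw [← LinearEquiv.mul_apply, inv_mul_cancel]; rfl
  have hinv' : ∀ v, s (s⁻¹ v) = v := fun v => by
    rw [← LinearEquiv.mul_apply, mul_inv_cancel]; rfl
  refine ⟨by simpa using h.ne, mul_mem (mul_mem hs h.orth) (inv_mem hs), ?_, ?_, h.lt, h.gt⟩
  · simp only [LinearEquiv.mul_apply, hinv, h.fix]
  · intro v hv
    have : B e (s⁻¹ v) = 0 := by rw [← hs, hinv', hv]
    simp only [LinearEquiv.mul_apply, hinv, h.quad _ this, map_sub, map_smul, hinv']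

theorem IsIntLattice.cubic_of_orth_orbit (hM : IsIntLattice B M) {e : V} {g : V ≃ₗ[ℚ] V}
    (h : IsRot B e (-1) g) (hg : g ∈ isometryGroup B M) {z : V} (hz : IsSym B M z)
    (hez : B e z ≠ 0) (hzg : B z (g z) = 0) : ∃ f₁ f₂ f₃, IsCubic B M f₁ f₂ f₃ := by
  have hB := hM.toIsTernaryForm
  have hcube := h.cube hB
  have ho := h.orth
  have hzgg : B z (g (g z)) = 0 := by
    rw [hB.symm, ← ho, hcube, hzg]
  have hf : IsFrame B z (g z) (g (g z)) :=
    ⟨hz.1, by simpa using hz.1, by simpa using hz.1, hzg, hzgg, by rw [ho, hzg]⟩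
  obtain ⟨x, -, hex, hx, -⟩ := (hM.rot_structure h hg).2
  have hZ := hM.pos z hz.1
  have hq := hM.pos x hx.1
  have hexp := hf.expand hB x
  rw [ho, ho, ho] at hexp
  obtain ⟨k₁, hk₁, e₁⟩ := hM.cos_sq hz hx
  obtain ⟨k₂, hk₂, e₂⟩ := hM.cos_sq (hz.map hg) hx
  obtain ⟨k₃, hk₃, e₃⟩ := hM.cos_sq ((hz.map hg).map hg) hx
  rw [ho] at e₂
  rw [ho, ho] at e₃
  set b₁ := B z x
  set b₂ := B (g z) x
  set b₃ := B (g (g z)) x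
  set Z := B z z
  have hsum : b₁ + b₂ + b₃ = 0 := by
    have h1 := congrArg (B e) hexp
    have h2 : B e (g z) = B e z := by nth_rewrite 1 [← h.fix]; rw [ho]
    have h3 : B e (g (g z)) = B e z := by nth_rewrite 1 [← h.fix]; rw [ho, h2]
    simp only [map_add, map_smul, hex, h2, h3, smul_eq_mul] at h1
    have h4 : (b₁ + b₂ + b₃) * B e z = 0 := by
      field_simp at h1
      linarith
    exact (mul_eq_zero.1 h4).resolve_right hez
  have hpar : b₁ ^ 2 + b₂ ^ 2 + b₃ ^ 2 = Z * B x x := by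
    have h1 := congrArg (B x) hexp
    simp only [map_add, map_smul, smul_eq_mul, hB.symm x z, hB.symm x (g z),
      hB.symm x (g (g z))] at h1
    rw [h1]
    change _ = Z * (b₁ / Z * b₁ + b₂ / Z * b₂ + b₃ / Z * b₃)
    field_simp
  have hks : k₁ + k₂ + k₃ = 4 := by
    have : ((k₁ + k₂ + k₃ : ℕ) : ℚ) * (Z * B x x) = 4 * (Z * B x x) := by
      push_cast; linarith
    have := mul_right_cancel₀ (mul_pos hZ hq).ne' this
    exact_mod_cast this
  have hzero : b₁ = 0 ∨ b₂ = 0 ∨ b₃ = 0 := by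
    by_contra hne
    push Not at hne
    obtain ⟨n1, n2, n3⟩ := hne
    have p1 : 0 < b₁ ^ 2 := by positivity
    have p2 : 0 < b₂ ^ 2 := by positivity
    have p3 : 0 < b₃ ^ 2 := by positivity
    have hk1 : k₁ ≠ 0 := by rintro rfl; simp at e₁; exact n1 e₁
    have hk2 : k₂ ≠ 0 := by rintro rfl; simp at e₂; exact n2 e₂
    have hk3 : k₃ ≠ 0 := by rintro rfl; simp at e₃; exact n3 e₃
    have hb3 : b₃ = -b₁ - b₂ := by linarith
    have aux : ∀ a b c : ℚ, a ≠ 0 → a + b + c = 0 → a ^ 2 = b ^ 2 → c ^ 2 = 2 * a ^ 2 → False := by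
      intro a b c ha h1 h2 h3
      have := eq_zero_of_sq_eq_two_mul h3
      exact ha this
    have : (k₁ = 1 ∧ k₂ = 1 ∧ k₃ = 2) ∨ (k₁ = 1 ∧ k₂ = 2 ∧ k₃ = 1) ∨
        (k₁ = 2 ∧ k₂ = 1 ∧ k₃ = 1) := by omega
    rcases this with ⟨rfl, rfl, rfl⟩ | ⟨rfl, rfl, rfl⟩ | ⟨rfl, rfl, rfl⟩
    · exact aux b₁ b₂ b₃ n1 hsum (by push_cast at *; linarith) (by push_cast at *; linarith)
    · exact aux b₁ b₃ b₂ n1 (by linarith) (by push_cast at *; linarith)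
        (by push_cast at *; linarith)
    · exact aux b₂ b₃ b₁ n2 (by linarith) (by push_cast at *; linarith)
        (by push_cast at *; linarith)
  have hZne := hZ.ne'
  have hsub : ∀ v : V, IsSym B M (v - g v) → IsSym B M (g v - g (g v)) := by
    intro v hv
    have := hv.map hg
    rwa [map_sub] at this
  have key : IsSym B M (z - g z) := by
    rcases hzero with h0 | h0 | h0
    · have hb : b₃ = -b₂ := by linarith
      have hxs : x = (b₂ / Z) • (g z - g (g z)) := by
        rw [hexp, h0, hb]; simp only [neg_div, zero_div]; module
      have hb2 : b₂ / Z ≠ 0 := by rintro h1; rw [h1, zero_smul] at hxs; exact hx.1 hxs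
      have h1 : IsSym B M (g z - g (g z)) := by
        have := hx.smul (inv_ne_zero hb2)
        rwa [hxs, smul_smul, inv_mul_cancel₀ hb2, one_smul] at this
      have := hsub _ (hsub _ h1)
      rwa [hcube] at this
    · have hb : b₃ = -b₁ := by linarith
      have hxs : x = (-(b₁ / Z)) • (g (g z) - g (g (g z))) := by
        rw [hcube, hexp, h0, hb]; simp only [neg_div, zero_div]; module
      have hb2 : -(b₁ / Z) ≠ 0 := by rintro h1; rw [h1, zero_smul] at hxs; exact hx.1 hxs
      have h1 : IsSym B M (g (g z) - g (g (g z))) := by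
        have := hx.smul (inv_ne_zero hb2)
        rwa [hxs, smul_smul, inv_mul_cancel₀ hb2, one_smul] at this
      have := hsub _ h1
      rwa [hcube] at this
    · have hb : b₂ = -b₁ := by linarith
      have hxs : x = (b₁ / Z) • (z - g z) := by
        rw [hexp, h0, hb]; simp only [neg_div, zero_div]; module
      have hb2 : b₁ / Z ≠ 0 := by rintro h1; rw [h1, zero_smul] at hxs; exact hx.1 hxs
      have := hx.smul (inv_ne_zero hb2)
      rwa [hxs, smul_smul, inv_mul_cancel₀ hb2, one_smul] at this
  exact ⟨z, g z, g (g z), hf, ho _ _, (ho _ _).trans (ho _ _), hz, hz.map hg,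
    (hz.map hg).map hg, key, hsub _ key⟩

theorem IsIntLattice.cos_of_eq_norm (hM : IsIntLattice B M) {x y : V} (hx : IsSym B M x)
    (hy : IsSym B M y) (hxy : B y y = B x x) : 2 * B x y = 0 ∨ 2 * B x y = B x x ∨
      2 * B x y = -B x x ∨ 2 * B x y = 2 * B x x ∨ 2 * B x y = -2 * B x x := by
  obtain ⟨k, hk, e1⟩ := hM.cos_sq hx hy
  have hq := hM.pos x hx.1
  rw [hxy] at e1
  have hsq : (2 * B x y / B x x) ^ 2 = k := by
    rw [div_pow, div_eq_iff (by positivity)]; linarith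
  have h1 : IsSquare ((k : ℕ) : ℚ) := ⟨2 * B x y / B x x, by rw [← hsq]; ring⟩
  rw [Rat.isSquare_natCast_iff] at h1
  obtain ⟨r, rfl⟩ := h1
  have hr : r ≤ 2 := by nlinarith
  push_cast at hsq
  have h2 : (2 * B x y / B x x - r) * (2 * B x y / B x x + r) = 0 := by linarith
  rcases mul_eq_zero.1 h2 with h3 | h3
  · have h4 : 2 * B x y = r * B x x := by
      rw [← div_eq_iff hq.ne']; linarith
    interval_cases r
    · left; simpa using h4
    · right; left; simpa using h4
    · right; right; right; left; simpa using h4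
  · have h4 : 2 * B x y = -r * B x x := by
      rw [← div_eq_iff hq.ne']; linarith
    interval_cases r
    · left; simpa using h4
    · right; right; left; simpa using h4
    · right; right; right; right; simpa using h4

/-- Decomposition of a symmetry vector along the axis of a rotation. -/
theorem IsRot.oblique (hB : IsTernaryForm B) {e : V} {t : ℚ} {g : V ≃ₗ[ℚ] V} (h : IsRot B e t g)
    {z : V} (hez : B e z ≠ 0) (hpar : ¬ ∃ c : ℚ, z = c • e) :
    ∃ (α : ℚ) (u : V), α ≠ 0 ∧ u ≠ 0 ∧ B e u = 0 ∧ z = α • e + u ∧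
      B z z = α ^ 2 * B e e + B u u ∧ B z (g z) = α ^ 2 * B e e + t / 2 * B u u := by
  have ho := h.orth
  have hE := hB.pos e h.ne
  set α := B e z / B e e with hα
  have hα0 : α ≠ 0 := div_ne_zero hez hE.ne'
  set u := z - α • e with hu
  have heu : B e u = 0 := by simp [hu, hα, div_mul_cancel₀ _ hE.ne']
  have hue : B u e = 0 := by rw [hB.symm, heu]
  have hu0 : u ≠ 0 := fun h0 => hpar ⟨α, by rwa [hu, sub_eq_zero] at h0⟩
  have hzu : z = α • e + u := by rw [hu]; abel
  have hgz : g z = α • e + g u := by rw [hzu, map_add, map_smul, h.fix]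
  have hegu := h.orth_apply heu
  have huu := h.form hB heu
  clear_value u α
  refine ⟨α, u, hα0, hu0, heu, hzu, ?_, ?_⟩
  · rw [hzu]
    simp only [map_add, map_smul, LinearMap.add_apply, LinearMap.smul_apply, smul_eq_mul, heu, hue]
    ring
  · rw [hgz, hzu]
    simp only [map_add, map_smul, LinearMap.add_apply, LinearMap.smul_apply, smul_eq_mul, hegu, hue,
      huu]
    ring

theorem IsIntLattice.cubic_of_oblique_four (hM : IsIntLattice B M) {e : V} {g : V ≃ₗ[ℚ] V}
    (h : IsRot B e 0 g) (hg : g ∈ isometryGroup B M) {z : V} (hz : IsSym B M z)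
    (hez : B e z ≠ 0) (hpar : ¬ ∃ c : ℚ, z = c • e) : ∃ f₁ f₂ f₃, IsCubic B M f₁ f₂ f₃ := by
  have hB := hM.toIsTernaryForm
  have ho := h.orth
  have hE := hM.pos e h.ne
  obtain ⟨α, u, hα0, hu0, heu, hzu, hZ, hd⟩ := h.oblique hB hez hpar
  have hue : B u e = 0 := by rw [hB.symm, heu]
  have hU := hM.pos u hu0
  have hA : 0 < α ^ 2 * B e e := by positivity
  have hUA : B u u = α ^ 2 * B e e := by
    rcases hM.cos_of_eq_norm hz (hz.map hg) (ho _ _) with h1 | h1 | h1 | h1 | h1 <;>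
      rw [hd] at h1 <;> linarith
  obtain ⟨x, -, hex, hx, -⟩ := (hM.rot_structure h hg).2
  obtain ⟨β, γ, huβ⟩ := h.expand hB hx.1 hex heu
  have hq := hM.pos x hx.1
  have hxx : B x (g x) = 0 := by rw [h.form hB hex]; ring
  have hgxx : B (g x) x = 0 := by rw [hB.symm, hxx]
  have hUq : B u u = (β ^ 2 + γ ^ 2) * B x x := by
    rw [huβ]
    simp only [map_add, map_smul, LinearMap.add_apply, LinearMap.smul_apply, smul_eq_mul, hgxx,
      hxx, ho x x]
    ring
  have hzx : B z x = β * B x x := by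
    rw [hzu, huβ]
    simp only [map_add, map_smul, LinearMap.add_apply, LinearMap.smul_apply, smul_eq_mul, hgxx,
      hex]
    ring
  have hbg : 0 < β ^ 2 + γ ^ 2 := by
    by_contra hc
    push Not at hc
    nlinarith
  have husym : IsSym B M u := by
    obtain ⟨k, hk, e2⟩ := hM.cos_sq hz hx
    have e3 : 2 * β ^ 2 = k * (β ^ 2 + γ ^ 2) := by
      rw [hzx, hZ, ← hUA, hUq] at e2
      apply mul_right_cancel₀ (mul_pos hq hq).ne'
      linarith
    have h0 : β = 0 → IsSym B M u := by
      intro h0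
      rw [huβ, h0, zero_smul, zero_add]
      exact (hx.map hg).smul (by rintro rfl; simp [h0] at hbg)
    clear hk
    have hk : k = 0 ∨ k = 1 ∨ k = 2 ∨ 3 ≤ k := by omega
    rcases hk with rfl | rfl | rfl | hk
    · exact h0 (by simpa using e3)
    · have : (β - γ) * (β + γ) = 0 := by push_cast at e3; linarith
      have hβ : β ≠ 0 := by rintro rfl; simp at this; simp [this] at hbg
      rcases mul_eq_zero.1 this with h1 | h1
      · have : u = β • (x + g x) := by rw [huβ, ← sub_eq_zero.1 h1]; module
        rw [this]
        exact (h.symm_add hB hg hx hex).smul hβ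
      · have : u = (-β) • g (x + g x) := by
          rw [huβ, map_add, h.quad x hex, eq_neg_of_add_eq_zero_right h1]; module
        rw [this]
        exact ((h.symm_add hB hg hx hex).map hg).smul (neg_ne_zero.2 hβ)
    · have hγ : γ ^ 2 = 0 := by push_cast at e3; linarith
      have hγ : γ = 0 := by simpa using hγ
      rw [huβ, hγ, zero_smul, add_zero]
      exact hx.smul (by rintro rfl; simp [hγ] at hbg)
    · have hk' : (3 : ℚ) ≤ k := by exact_mod_cast hk
      have hle : 3 * (β ^ 2 + γ ^ 2) ≤ k * (β ^ 2 + γ ^ 2) :=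
        mul_le_mul_of_nonneg_right hk' hbg.le
      have hβ : β ^ 2 = 0 := by linarith [sq_nonneg β, sq_nonneg γ]
      exact h0 (by simpa using hβ)
  have hugu : B u (g u) = 0 := by rw [h.form hB heu]; ring
  refine ⟨α • e, u, g u, ⟨smul_ne_zero hα0 h.ne, hu0, by simpa using hu0, by simp [heu],
    by simp [h.orth_apply heu], hugu⟩, ?_, ?_, (h.sym_axis hB hg).smul hα0, husym, husym.map hg,
    ?_, ?_⟩
  · rw [hUA]; simp; ring
  · rw [ho, hUA]; simp; ring
  · have := hz.map husym.2
    rwa [hzu, map_add, map_smul, tau_of_orth hue, tau_self hB, ← sub_eq_add_neg] at this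
  · have := ((h.symm_add hB hg husym heu).map hg).smul (c := -1) (by norm_num)
    rw [map_add, h.quad u heu] at this
    convert this using 1
    module

theorem IsIntLattice.cubic_of_oblique_three (hM : IsIntLattice B M) {e : V} {g : V ≃ₗ[ℚ] V}
    (h : IsRot B e (-1) g) (hg : g ∈ isometryGroup B M) {z : V} (hz : IsSym B M z)
    (hez : B e z ≠ 0) (hpar : ¬ ∃ c : ℚ, z = c • e) : ∃ f₁ f₂ f₃, IsCubic B M f₁ f₂ f₃ := by
  have hB := hM.toIsTernaryForm
  have ho : ∀ x y, B (g x) (g y) = B x y := h.orth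
  have hE := hM.pos e h.ne
  obtain ⟨α, u, hα0, hu0, heu, hzu, hZ, hd⟩ := h.oblique hB hez hpar
  have hU := hM.pos u hu0
  have hA : 0 < α ^ 2 * B e e := by positivity
  rcases hM.cos_of_eq_norm hz (hz.map hg) (ho _ _) with h1 | h1 | h1 | h1 | h1
  · exact hM.cubic_of_orth_orbit h hg hz hez (by linarith)
  · have hAU : α ^ 2 * B e e = 2 * B u u := by rw [hd, hZ] at h1; linarith
    have hZ' : B z z = 3 * B u u := by rw [hZ, hAU]; ring
    have hd' : B z (g z) = 3 / 2 * B u u := by rw [hd, hAU]; ring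
    have hd'' : B (g z) z = 3 / 2 * B u u := by rw [hB.symm, hd']
    have hzgg : B z (g (g z)) = 3 / 2 * B u u := by
      rw [hB.symm, ← ho, h.cube hB, hd']
    have hggz : B (g (g z)) z = 3 / 2 * B u u := by rw [hB.symm, hzgg]
    have hdiff : IsSym B M (z - g z) := by
      have := ((hz.map hg).map hz.2).smul (c := -1) (by norm_num)
      rw [tau_apply, hd', hZ'] at this
      have h2 : 2 * (3 / 2 * B u u) / (3 * B u u) = 1 := by field_simp
      rw [h2] at this
      convert this using 1
      module
    set f := z + g z - g (g z) with hf
    have hefz : B e f = B e z := by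
      have h2 : B e (g z) = B e z := by nth_rewrite 1 [← h.fix]; rw [ho]
      have h3 : B e (g (g z)) = B e z := by nth_rewrite 1 [← h.fix]; rw [ho, h2]
      rw [hf, map_sub, map_add, h2, h3]; ring
    have hf0 : f ≠ 0 := by intro h0; rw [h0] at hefz; simp at hefz; exact hez hefz.symm
    have hfr : IsFrame B (z - g z) (g (g z)) f := by
      refine ⟨hdiff.1, by simpa using hz.1, hf0, ?_, ?_, ?_⟩
      · simp only [map_sub, LinearMap.sub_apply, hzgg, ho, hd']; ring
      · simp only [hf, map_sub, map_add, LinearMap.sub_apply, hzgg, ho, hd', hd'', hZ']; ring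
      · simp only [hf, map_sub, map_add, hggz, hB.symm (g (g z)) (g z), ho, hd', hZ']
        ring
    have hfs : IsSym B M f := hdiff.third hB hfr ((hz.map hg).map hg)
    refine hM.cubic_of_orth_orbit h hg hfs (by rwa [hefz]) ?_
    have : g f = g z + g (g z) - z := by
      rw [hf, map_sub, map_add, h.cube hB]
    rw [this, hf]
    simp only [map_sub, map_add, LinearMap.sub_apply, LinearMap.add_apply, hzgg, hggz, ho, hd',
      hd'', hZ']
    ring
  · rw [hd, hZ] at h1; linarith
  · rw [hd, hZ] at h1; linarith
  · rw [hd, hZ] at h1; linarith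

/-- A proper rotation together with a symmetry vector that is neither parallel nor orthogonal to
its axis forces the lattice to be cubic. -/
theorem IsIntLattice.cubic_of_oblique (hM : IsIntLattice B M) {e : V} {t : ℚ} {g : V ≃ₗ[ℚ] V}
    (h : IsRot B e t g) (hg : g ∈ isometryGroup B M) {z : V} (hz : IsSym B M z)
    (hez : B e z ≠ 0) (hpar : ¬ ∃ c : ℚ, z = c • e) : ∃ f₁ f₂ f₃, IsCubic B M f₁ f₂ f₃ := by
  obtain ⟨t, g, rfl | rfl, hg, h⟩ := hM.normal_rot h hg
  · exact hM.cubic_of_oblique_four h hg hz hez hpar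
  · exact hM.cubic_of_oblique_three h hg hz hez hpar

theorem IsRot.not_parallel (hB : IsTernaryForm B) {e : V} {t : ℚ} {g : V ≃ₗ[ℚ] V}
    (h : IsRot B e t g) {x : V} (hx : x ≠ 0) (hex : B e x = 0) (c : ℚ) : g x ≠ c • x := by
  intro h1
  have h2 := h.form hB hex
  have h3 := h.orth x x
  have hq := hB.pos x hx
  rw [h1] at h2 h3
  simp only [map_smul, LinearMap.smul_apply, smul_eq_mul] at h2 h3
  have h4 : c = t / 2 := mul_right_cancel₀ hq.ne' h2
  have h5 : c * c = 1 := by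
    apply mul_right_cancel₀ hq.ne'; linarith
  have := h.lt; have := h.gt
  nlinarith

/-- Two different axes of proper rotations force the lattice to be cubic. -/
theorem IsIntLattice.cubic_of_two_axes (hM : IsIntLattice B M) {e e' : V} {t t' : ℚ}
    {g g' : V ≃ₗ[ℚ] V} (h : IsRot B e t g) (hg : g ∈ isometryGroup B M) (h' : IsRot B e' t' g')
    (hg' : g' ∈ isometryGroup B M) (hne : ¬ ∃ c : ℚ, e' = c • e) :
    ∃ f₁ f₂ f₃, IsCubic B M f₁ f₂ f₃ := by
  have hB := hM.toIsTernaryForm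
  by_contra hcub
  have key : ∀ z, IsSym B M z → B e z = 0 ∨ ∃ c : ℚ, z = c • e := by
    intro z hz
    by_contra hc
    push Not at hc
    exact hcub (hM.cubic_of_oblique h hg hz hc.1 (by push Not; exact hc.2))
  obtain ⟨x, -, hex, hx, -⟩ := (hM.rot_structure h' hg').2
  have hnp := h'.not_parallel hB hx.1 hex
  have hnz : ¬ (B e x = 0 ∧ B e (g' x) = 0) := by
    rintro ⟨h1, h2⟩
    apply hne
    have hv : B e' (e - (B e' e / B e' e') • e') = 0 := by
      simp [div_mul_cancel₀ _ (hB.ne_zero h'.ne)]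
    obtain ⟨a, b, hab⟩ := h'.expand hB hx.1 hex hv
    have h3 : B e (e - (B e' e / B e' e') • e') = 0 := by
      rw [hab, map_add, map_smul, map_smul, h1, h2]; simp
    have h4 : e - (B e' e / B e' e') • e' = 0 := by
      have h5 : ∀ w, B e w = 0 → B e' w = 0 → B (e - (B e' e / B e' e') • e') w = 0 := by
        intro w hw hw'; simp [hw, hw']
      exact hB.eq_zero (h5 _ h3 hv)
    rw [sub_eq_zero] at h4
    have hc : B e' e / B e' e' ≠ 0 := by rintro h5; rw [h5, zero_smul] at h4; exact h.ne h4
    refine ⟨(B e' e / B e' e')⁻¹, ?_⟩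
    rw [eq_comm, inv_smul_eq_iff₀ hc]
    exact h4
  have par : ∀ a b : ℚ, x = a • e → g' x = b • e → False := by
    intro a b h1 h2
    have ha : a ≠ 0 := by rintro rfl; rw [zero_smul] at h1; exact hx.1 h1
    apply hnp (b * a⁻¹)
    have h3 : a⁻¹ • x = e := by rw [h1, smul_smul, inv_mul_cancel₀ ha, one_smul]
    rw [h2, mul_smul, h3]
  rcases key x hx with h1 | ⟨a, h1⟩ <;> rcases key _ (hx.map hg') with h2 | ⟨b, h2⟩
  · exact hnz ⟨h1, h2⟩
  · rcases key _ (h'.symm_add hB hg' hx hex) with h3 | ⟨c, h3⟩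
    · exact hnz ⟨h1, by rwa [map_add, h1, zero_add] at h3⟩
    · exact par (c - b) b (by rw [sub_smul, ← h3, ← h2]; abel) h2
  · rcases key _ (h'.symm_add hB hg' hx hex) with h3 | ⟨c, h3⟩
    · exact hnz ⟨by rwa [map_add, h2, add_zero] at h3, h2⟩
    · exact par a (c - a) h1 (by rw [sub_smul, ← h3, ← h1]; abel)
  · exact par a b h1 h2

/-- Two symmetry vectors that are neither parallel nor orthogonal give a proper rotation. -/
theorem exists_rot_of_syms (hB : IsTernaryForm B) {x y : V} (hx : x ≠ 0) (hy : y ≠ 0)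
    (hxy : B x y ≠ 0) (hpar : ¬ ∃ c : ℚ, y = c • x) :
    ∃ e t, IsRot B e t (tau B x * tau B y) := by
  have hqx := hB.pos x hx
  have hqy := hB.pos y hy
  obtain ⟨e, he, hxe, hye⟩ := exists_orth hB x y
  set b := B x y with hb
  have hyx : B y x = b := hB.symm y x
  set t := 4 * b ^ 2 / (B x x * B y y) - 2 with ht
  have hg : tau B x * tau B y ∈ orthogonalGroup B := mul_mem (tau_mem hB x) (tau_mem hB y)
  have hfix : (tau B x * tau B y) e = e := by
    rw [LinearEquiv.mul_apply, tau_of_orth hye, tau_of_orth hxe]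
  have hspan : ∀ v, B e v = 0 → ∃ α β : ℚ, v = α • x + β • y := by
    intro v hv
    set y' := y - (b / B x x) • x with hy'
    have hf : IsFrame B x y' e := by
      refine ⟨hx, fun h0 => hpar ⟨_, sub_eq_zero.1 h0⟩, he, ?_, hxe, ?_⟩
      · simp [hy', ← hb, div_mul_cancel₀ _ hqx.ne']
      · simp [hy', hxe, hye]
    have h1 := hf.expand hB v
    rw [hv, zero_div, zero_smul, add_zero] at h1
    refine ⟨B x v / B x x - B y' v / B y' y' * (b / B x x), B y' v / B y' y', ?_⟩
    nth_rewrite 1 [h1]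
    rw [hy']; module
  have hsum : ∀ v, B e v = 0 → tau B x (tau B y v) + tau B y (tau B x v) = t • v := by
    have h1 : tau B x (tau B y x) + tau B y (tau B x x) = t • x := by
      rw [tau_self hB, map_neg, tau_apply y x, map_sub, map_smul, tau_self hB, tau_apply x y, hyx,
        ht]
      have : 4 * b ^ 2 / (B x x * B y y) = (2 * b / B y y) * (2 * b / B x x) := by
        field_simp; ring
      rw [this]; module
    have h2 : tau B x (tau B y y) + tau B y (tau B x y) = t • y := by
      rw [tau_self hB, map_neg, tau_apply x y, map_sub, map_smul, tau_self hB, tau_apply y x, hyx,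
        ht]
      have : 4 * b ^ 2 / (B x x * B y y) = (2 * b / B y y) * (2 * b / B x x) := by
        field_simp; ring
      rw [this]; module
    intro v hv
    obtain ⟨α, β, rfl⟩ := hspan v hv
    simp only [map_add, map_smul, smul_add]
    rw [smul_comm t, smul_comm t, ← h1, ← h2]
    module
  refine ⟨e, t, he, hg, hfix, ?_, ?_, ?_⟩
  · intro v hv
    have hgv : B e ((tau B x * tau B y) v) = 0 := by rw [← hfix, hg, hv]
    have := hsum _ hgv
    rw [LinearEquiv.mul_apply, tau_tau, tau_tau] at this
    rw [LinearEquiv.mul_apply, LinearEquiv.mul_apply, eq_sub_iff_add_eq]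
    exact this
  · rw [ht]
    have hcs := cauchy_schwarz hB x y
    have hne : b ^ 2 ≠ B x x * B y y := fun h0 => hpar ⟨_, parallel_of_cauchy_schwarz hB hx h0⟩
    have hlt : b ^ 2 < B x x * B y y := lt_of_le_of_ne hcs hne
    have : 4 * b ^ 2 / (B x x * B y y) < 4 := by
      rw [div_lt_iff₀ (by positivity)]; linarith
    linarith
  · have : 0 < 4 * b ^ 2 / (B x x * B y y) := by positivity
    rw [ht]; linarith

end

section

/-! ### Counting isometries and symmetries -/

/-- Integral combination of three vectors. -/
def comb (u : Fin 3 → V) (c : Fin 3 → ℤ) : V :=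
  (c 0 : ℚ) • u 0 + (c 1 : ℚ) • u 1 + (c 2 : ℚ) • u 2

theorem comb_injective {u : Fin 3 → V} (hu : LinearIndependent ℚ u) {c d : Fin 3 → ℚ}
    (h : c 0 • u 0 + c 1 • u 1 + c 2 • u 2 = d 0 • u 0 + d 1 • u 1 + d 2 • u 2) : c = d := by
  rw [Fintype.linearIndependent_iff] at hu
  have := hu (c - d) (by
    simp only [Fin.sum_univ_three, Pi.sub_apply, sub_smul]
    rw [← sub_eq_zero] at h
    rw [← h]; abel)
  ext i
  have := this i
  simpa [sub_eq_zero] using this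

theorem card_step (G : Subgroup (V ≃ₗ[ℚ] V)) (v : V) {u : Fin 3 → V}
    (hu : LinearIndependent ℚ u) (O : Finset (Fin 3 → ℤ))
    (h1 : ∀ g ∈ G, ∃ c ∈ O, g v = comb u c) (h2 : ∀ c ∈ O, ∃ g ∈ G, g v = comb u c) :
    Nat.card G = O.card * Nat.card ↥(G ⊓ MulAction.stabilizer (V ≃ₗ[ℚ] V) v) := by
  have e1 : Nat.card ↥(MulAction.stabilizer G v) * (MulAction.orbit G v).ncard = Nat.card G := by
    rw [← MulAction.index_stabilizer, Subgroup.card_mul_index]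
  have e2 : MulAction.orbit G v = (comb u) '' (O : Set (Fin 3 → ℤ)) := by
    ext w
    constructor
    · rintro ⟨g, rfl⟩
      obtain ⟨c, hc, h⟩ := h1 g g.2
      exact ⟨c, hc, h.symm⟩
    · rintro ⟨c, hc, rfl⟩
      obtain ⟨g, hg, h⟩ := h2 c hc
      exact ⟨⟨g, hg⟩, h⟩
  have e3 : (MulAction.orbit G v).ncard = O.card := by
    rw [e2, Set.ncard_image_of_injective, Set.ncard_coe_finset]
    intro c d h
    have := comb_injective hu (c := fun i => (c i : ℚ)) (d := fun i => (d i : ℚ)) h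
    ext i
    have := congrFun this i
    exact_mod_cast this
  have e4 : Nat.card ↥(MulAction.stabilizer G v) =
      Nat.card ↥(G ⊓ MulAction.stabilizer (V ≃ₗ[ℚ] V) v) := by
    refine Nat.card_congr ⟨fun g => ⟨g.1.1, g.1.2, g.2⟩, fun g => ⟨⟨g.1, g.2.1⟩, g.2.2⟩, ?_, ?_⟩
    · intro g; rfl
    · intro g; rfl
  rw [← e1, e3, e4, mul_comm]

theorem card_chain (G : Subgroup (V ≃ₗ[ℚ] V)) {u : Fin 3 → V} (hu : LinearIndependent ℚ u)
    (O₁ O₂ O₃ : Finset (Fin 3 → ℤ))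
    (h1 : ∀ g ∈ G, ∃ c ∈ O₁, g (u 0) = comb u c) (h1' : ∀ c ∈ O₁, ∃ g ∈ G, g (u 0) = comb u c)
    (h2 : ∀ g ∈ G, g (u 0) = u 0 → ∃ c ∈ O₂, g (u 1) = comb u c)
    (h2' : ∀ c ∈ O₂, ∃ g ∈ G, g (u 0) = u 0 ∧ g (u 1) = comb u c)
    (h3 : ∀ g ∈ G, g (u 0) = u 0 → g (u 1) = u 1 → ∃ c ∈ O₃, g (u 2) = comb u c)
    (h3' : ∀ c ∈ O₃, ∃ g ∈ G, g (u 0) = u 0 ∧ g (u 1) = u 1 ∧ g (u 2) = comb u c)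
    (h4 : ∀ g ∈ G, g (u 0) = u 0 → g (u 1) = u 1 → g (u 2) = u 2 → g = 1) :
    Nat.card G = O₁.card * (O₂.card * O₃.card) := by
  have e1 := card_step G (u 0) hu O₁ h1 h1'
  have e2 := card_step (G ⊓ MulAction.stabilizer (V ≃ₗ[ℚ] V) (u 0)) (u 1) hu O₂
    (fun g hg => h2 g hg.1 hg.2) (fun c hc => by
      obtain ⟨g, hg, e1, e2⟩ := h2' c hc
      exact ⟨g, ⟨hg, e1⟩, e2⟩)
  have e3 := card_step (G ⊓ MulAction.stabilizer (V ≃ₗ[ℚ] V) (u 0) ⊓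
    MulAction.stabilizer (V ≃ₗ[ℚ] V) (u 1)) (u 2) hu O₃
    (fun g hg => h3 g hg.1.1 hg.1.2 hg.2) (fun c hc => by
      obtain ⟨g, hg, e1, e2, e3⟩ := h3' c hc
      exact ⟨g, ⟨⟨hg, e1⟩, e2⟩, e3⟩)
  have : G ⊓ MulAction.stabilizer (V ≃ₗ[ℚ] V) (u 0) ⊓ MulAction.stabilizer (V ≃ₗ[ℚ] V) (u 1) ⊓
      MulAction.stabilizer (V ≃ₗ[ℚ] V) (u 2) = ⊥ := by
    rw [Subgroup.eq_bot_iff_forall]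
    exact fun g hg => h4 g hg.1.1.1 hg.1.1.2 hg.1.2 hg.2
  rw [e1, e2, e3, this, Subgroup.card_bot, mul_one]

theorem mem_symmetries_iff {σ : V ≃ₗ[ℚ] V} :
    σ ∈ symmetries B M ↔ ∃ x, IsSym B M x ∧ σ = tau B x := by
  constructor
  · rintro ⟨h1, x, hx⟩
    exact ⟨x, ⟨hx.1, by rw [← hx.eq_tau]; exact h1⟩, hx.eq_tau⟩
  · rintro ⟨x, hx, rfl⟩
    exact ⟨hx.2, x, isSymmetryAlong_tau hx.1⟩

theorem ncard_symmetries (hB : IsTernaryForm B) {u : Fin 3 → V} (hu : LinearIndependent ℚ u)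
    (R : Finset (Fin 3 → ℤ))
    (hR : ∀ c ∈ R, ∀ d ∈ R, c 0 * d 1 = c 1 * d 0 → c 0 * d 2 = c 2 * d 0 →
      c 1 * d 2 = c 2 * d 1 → c = d)
    (h1 : ∀ c ∈ R, IsSym B M (comb u c))
    (h2 : ∀ z, IsSym B M z → ∃ c ∈ R, ∃ r : ℚ, z = r • comb u c) :
    (symmetries B M).ncard = R.card := by
  have e : symmetries B M = (fun c => tau B (comb u c)) '' (R : Set (Fin 3 → ℤ)) := by
    ext σ
    rw [mem_symmetries_iff]
    constructor
    · rintro ⟨x, hx, rfl⟩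
      obtain ⟨c, hc, r, rfl⟩ := h2 x hx
      have hr : r ≠ 0 := by rintro rfl; exact hx.1 (zero_smul _ _)
      exact ⟨c, hc, (tau_smul hr).symm⟩
    · rintro ⟨c, hc, rfl⟩
      exact ⟨_, h1 c hc, rfl⟩
  rw [e, Set.InjOn.ncard_image, Set.ncard_coe_finset]
  intro c hc d hd hcd
  obtain ⟨r, -, hr⟩ := tau_eq_tau hB (h1 d hd).1 hcd
  have h3 := comb_injective hu (c := fun i => (d i : ℚ)) (d := fun i => r * (c i : ℚ)) (by
    have : comb u d = r • comb u c := hr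
    simp only [comb] at this
    rw [this]; module)
  have h4 : ∀ i, (d i : ℚ) = r * c i := fun i => congrFun h3 i
  refine hR c hc d hd ?_ ?_ ?_ <;>
  · have : ∀ i j, (c i : ℚ) * d j = c j * d i := fun i j => by rw [h4, h4]; ring
    exact_mod_cast this _ _

/-! ### Lattices of each crystal system -/

theorem neg_ne {x : V} (hx : x ≠ 0) : -x ≠ x := by
  intro h
  have h1 : (2 : ℚ) • x = 0 := by rw [two_smul]; nth_rewrite 1 [← h]; simp
  exact hx ((smul_eq_zero.1 h1).resolve_left (by norm_num))

theorem eq_or_neg_of_eq_smul (hB : IsTernaryForm B) {v w : V} {r : ℚ} (hw : w ≠ 0)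
    (h : v = r • w) (hq : B v v = B w w) : v = w ∨ v = -w := by
  have hp := hB.pos w hw
  rw [h] at hq
  simp only [map_smul, LinearMap.smul_apply, smul_eq_mul] at hq
  have : (r - 1) * (r + 1) = 0 := by
    apply mul_right_cancel₀ hp.ne'; linarith
  rcases mul_eq_zero.1 this with h1 | h1
  · left; rw [h, sub_eq_zero.1 h1, one_smul]
  · right; rw [h, eq_neg_of_add_eq_zero_left h1, neg_one_smul]

/-- No rotations of order greater than two. -/
def NoRot (B : LinearMap.BilinForm ℚ V) (M : Submodule ℤ V) : Prop :=
  ∀ e t g, g ∈ isometryGroup B M → ¬ IsRot B e t g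

theorem NoRot.cases (hB : IsTernaryForm B) (h : NoRot B M) {g : V ≃ₗ[ℚ] V}
    (hg : g ∈ isometryGroup B M) : (g = 1 ∨ g = LinearEquiv.neg ℚ) ∨
    ∃ x, IsSym B M x ∧ (g = tau B x ∨ g = LinearEquiv.neg ℚ * tau B x) := by
  have hng := mul_mem (neg_mem_isometryGroup (B := B) (M := M)) hg
  rcases classify hB hg.1 with h1 | ⟨x, hx, h1 | h1⟩ | ⟨e, t, h1 | h1⟩
  · exact Or.inl h1
  · exact Or.inr ⟨x, ⟨hx, h1 ▸ hg⟩, Or.inl h1⟩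
  · refine Or.inr ⟨x, ⟨hx, ?_⟩, Or.inr h1⟩
    rw [h1, neg_neg_mul] at hng; exact hng
  · exact absurd h1 (h e t g hg)
  · exact absurd h1 (h e t _ hng)

theorem NoRot.orth (hB : IsTernaryForm B) (h : NoRot B M) {x y : V} (hx : IsSym B M x)
    (hy : IsSym B M y) : B x y = 0 ∨ ∃ c : ℚ, y = c • x := by
  by_contra hc
  push Not at hc
  obtain ⟨e, t, hr⟩ := exists_rot_of_syms hB hx.1 hy.1 hc.1 (by push Not; exact hc.2)
  exact h e t _ (mul_mem hx.2 hy.2) hr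

theorem card_of_no_sym (hB : IsTernaryForm B) (h : NoRot B M) (hs : ∀ x, ¬ IsSym B M x) :
    Nat.card (isometryGroup B M) = 2 ∧ (symmetries B M).ncard = 0 := by
  constructor
  · have := Module.nontrivial_of_finrank_pos (R := ℚ) (M := V) (by rw [hB.finrank_eq]; norm_num)
    obtain ⟨v, hv⟩ := exists_ne (0 : V)
    have : (isometryGroup B M : Set (V ≃ₗ[ℚ] V)) = {1, LinearEquiv.neg ℚ} := by
      ext g
      constructor
      · intro hg
        rcases h.cases hB hg with h1 | ⟨x, hx, -⟩
        · exact h1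
        · exact absurd hx (hs x)
      · rintro (rfl | rfl)
        · exact one_mem (isometryGroup B M)
        · exact neg_mem_isometryGroup
    rw [← SetLike.coe_sort_coe, Nat.card_coe_set_eq, this, Set.ncard_pair]
    intro h1
    have : (1 : V ≃ₗ[ℚ] V) v = (LinearEquiv.neg ℚ : V ≃ₗ[ℚ] V) v := by rw [h1]
    simp only [LinearEquiv.coe_one, id_eq, LinearEquiv.neg_apply] at this
    exact neg_ne hv this.symm
  · have : symmetries B M = ∅ := by
      ext σ
      rw [mem_symmetries_iff]
      simp only [Set.mem_empty_iff_false, iff_false]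
      rintro ⟨x, hx, -⟩
      exact hs x hx
    rw [this, Set.ncard_empty]

theorem card_of_one_sym (hB : IsTernaryForm B) (h : NoRot B M) {x : V} (hx : IsSym B M x)
    (hs : ∀ y, IsSym B M y → ∃ c : ℚ, y = c • x) :
    Nat.card (isometryGroup B M) = 4 ∧ (symmetries B M).ncard = 1 := by
  obtain ⟨y, z, hf⟩ := exists_frame hB hx.1
  have hu := hf.linearIndependent hB
  have hyx : B y x = 0 := by rw [hB.symm, hf.h12]
  have hcases : ∀ g ∈ isometryGroup B M, g = 1 ∨ g = LinearEquiv.neg ℚ ∨ g = tau B x ∨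
      g = LinearEquiv.neg ℚ * tau B x := by
    intro g hg
    rcases h.cases hB hg with h1 | ⟨w, hw, h1⟩
    · tauto
    · obtain ⟨c, rfl⟩ := hs w hw
      have hc : c ≠ 0 := by rintro rfl; exact hw.1 (zero_smul _ _)
      rw [tau_smul hc] at h1
      tauto
  constructor
  · rw [card_chain (isometryGroup B M) hu {![1, 0, 0], ![-1, 0, 0]} {![0, 1, 0], ![0, -1, 0]}
      {![0, 0, 1]}]
    · decide
    · intro g hg
      rcases hcases g hg with rfl | rfl | rfl | rfl
      · exact ⟨![1, 0, 0], by simp, by simp [comb]⟩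
      · exact ⟨![-1, 0, 0], by simp, by simp [comb]⟩
      · exact ⟨![-1, 0, 0], by simp, by simp [comb, tau_self hB]⟩
      · exact ⟨![1, 0, 0], by simp, by simp [comb, tau_self hB]⟩
    · intro c hc
      simp only [Finset.mem_insert, Finset.mem_singleton] at hc
      rcases hc with rfl | rfl
      · exact ⟨1, one_mem _, by simp [comb]⟩
      · exact ⟨_, hx.2, by simp [comb, tau_self hB]⟩
    · intro g hg hgx
      rcases hcases g hg with rfl | rfl | rfl | rfl
      · exact ⟨![0, 1, 0], by simp, by simp [comb]⟩
      · exact ⟨![0, -1, 0], by simp, by simp [comb]⟩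
      · exact ⟨![0, 1, 0], by simp, by simp [comb, tau_of_orth hf.h12]⟩
      · exact ⟨![0, -1, 0], by simp, by simp [comb, tau_of_orth hf.h12]⟩
    · intro c hc
      simp only [Finset.mem_insert, Finset.mem_singleton] at hc
      rcases hc with rfl | rfl
      · exact ⟨1, one_mem _, by simp [comb]⟩
      · exact ⟨_, mul_mem neg_mem_isometryGroup hx.2, by
          simp [comb, tau_self hB, tau_of_orth hf.h12]⟩
    · intro g hg hgx hgy
      refine ⟨![0, 0, 1], by simp, ?_⟩
      have hx0 := hf.ne1
      have hy0 := hf.ne2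
      rcases hcases g hg with rfl | rfl | rfl | rfl
      · simp [comb]
      · simp [neg_ne hx0] at hgx
      · simp [tau_self hB, neg_ne hx0] at hgx
      · simp [tau_of_orth hf.h12, neg_ne hy0] at hgy
    · intro c hc
      simp only [Finset.mem_singleton] at hc
      subst hc
      exact ⟨1, one_mem _, by simp [comb]⟩
    · intro g hg h1 h2 h3
      exact hf.ext hB h1 h2 h3
  · rw [ncard_symmetries hB hu {![1, 0, 0]} (by decide)]
    · decide
    · intro c hc
      simp only [Finset.mem_singleton] at hc
      subst hc
      simpa [comb] using hx
    · intro w hw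
      obtain ⟨c, hc⟩ := hs w hw
      exact ⟨![1, 0, 0], by simp, c, by simpa [comb] using hc⟩

theorem card_of_ortho (hB : IsTernaryForm B) (h : NoRot B M) {x y z : V} (hf : IsFrame B x y z)
    (hx : IsSym B M x) (hy : IsSym B M y) :
    (∀ w, IsSym B M w → ∃ c : ℚ, w = c • x ∨ w = c • y ∨ w = c • z) ∧
    Nat.card (isometryGroup B M) = 8 ∧ (symmetries B M).ncard = 3 := by
  have hz := hx.third hB hf hy
  have hu := hf.linearIndependent hB
  have hyx : B y x = 0 := by rw [hB.symm, hf.h12]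
  have hzx : B z x = 0 := by rw [hB.symm, hf.h13]
  have hzy : B z y = 0 := by rw [hB.symm, hf.h23]
  have hs : ∀ w, IsSym B M w → ∃ c : ℚ, w = c • x ∨ w = c • y ∨ w = c • z := by
    intro w hw
    rcases h.orth hB hx hw with h1 | ⟨c, h1⟩
    · rcases h.orth hB hy hw with h2 | ⟨c, h2⟩
      · exact ⟨_, Or.inr (Or.inr (hf.eq_smul hB h1 h2))⟩
      · exact ⟨c, Or.inr (Or.inl h2)⟩
    · exact ⟨c, Or.inl h1⟩
  have hcases : ∀ g ∈ isometryGroup B M, (g = 1 ∨ g = LinearEquiv.neg ℚ) ∨ (g = tau B x ∨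
      g = LinearEquiv.neg ℚ * tau B x) ∨ (g = tau B y ∨ g = LinearEquiv.neg ℚ * tau B y) ∨
      (g = tau B z ∨ g = LinearEquiv.neg ℚ * tau B z) := by
    intro g hg
    rcases h.cases hB hg with h1 | ⟨w, hw, h1⟩
    · tauto
    · obtain ⟨c, hc⟩ := hs w hw
      have hc0 : c ≠ 0 := by rintro rfl; simp at hc; exact hw.1 hc
      rcases hc with rfl | rfl | rfl <;> rw [tau_smul hc0] at h1 <;> tauto
  refine ⟨hs, ?_, ?_⟩
  · have hsign : ∀ g ∈ isometryGroup B M, (g x = x ∨ g x = -x) ∧ (g y = y ∨ g y = -y) ∧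
        (g z = z ∨ g z = -z) := by
      intro g hg
      rcases hcases g hg with (rfl | rfl) | (rfl | rfl) | (rfl | rfl) | (rfl | rfl) <;>
        simp [tau_self hB, tau_of_orth, hf.h12, hf.h13, hf.h23, hyx, hzx, hzy]
    rw [card_chain (isometryGroup B M) hu {![1, 0, 0], ![-1, 0, 0]} {![0, 1, 0], ![0, -1, 0]}
      {![0, 0, 1], ![0, 0, -1]}]
    · decide
    · intro g hg
      rcases (hsign g hg).1 with h1 | h1
      · exact ⟨![1, 0, 0], by simp, by simp [comb, h1]⟩
      · exact ⟨![-1, 0, 0], by simp, by simp [comb, h1]⟩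
    · intro c hc
      simp only [Finset.mem_insert, Finset.mem_singleton] at hc
      rcases hc with rfl | rfl
      · exact ⟨1, one_mem _, by simp [comb]⟩
      · exact ⟨_, hx.2, by simp [comb, tau_self hB]⟩
    · intro g hg _
      rcases (hsign g hg).2.1 with h1 | h1
      · exact ⟨![0, 1, 0], by simp, by simp [comb, h1]⟩
      · exact ⟨![0, -1, 0], by simp, by simp [comb, h1]⟩
    · intro c hc
      simp only [Finset.mem_insert, Finset.mem_singleton] at hc
      rcases hc with rfl | rfl
      · exact ⟨1, one_mem _, by simp [comb]⟩
      · exact ⟨_, hy.2, by simp [comb, tau_self hB, tau_of_orth hyx]⟩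
    · intro g hg _ _
      rcases (hsign g hg).2.2 with h1 | h1
      · exact ⟨![0, 0, 1], by simp, by simp [comb, h1]⟩
      · exact ⟨![0, 0, -1], by simp, by simp [comb, h1]⟩
    · intro c hc
      simp only [Finset.mem_insert, Finset.mem_singleton] at hc
      rcases hc with rfl | rfl
      · exact ⟨1, one_mem _, by simp [comb]⟩
      · exact ⟨_, hz.2, by simp [comb, tau_self hB, tau_of_orth hzx, tau_of_orth hzy]⟩
    · intro g hg h1 h2 h3
      exact hf.ext hB h1 h2 h3
  · rw [ncard_symmetries hB hu {![1, 0, 0], ![0, 1, 0], ![0, 0, 1]} (by decide)]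
    · decide
    · intro c hc
      simp only [Finset.mem_insert, Finset.mem_singleton] at hc
      rcases hc with rfl | rfl | rfl
      · simpa [comb] using hx
      · simpa [comb] using hy
      · simpa [comb] using hz
    · intro w hw
      obtain ⟨c, hc | hc | hc⟩ := hs w hw
      · exact ⟨![1, 0, 0], by simp, c, by simpa [comb] using hc⟩
      · exact ⟨![0, 1, 0], by simp, c, by simpa [comb] using hc⟩
      · exact ⟨![0, 0, 1], by simp, c, by simpa [comb] using hc⟩

end

section

/-! ### Lattices with a single axis of rotations -/

/-- `M` has a proper rotation `g` of trace `t ∈ {0, -1}` about `e`, and it is not cubic. -/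
structure IsAxial (B : LinearMap.BilinForm ℚ V) (M : Submodule ℤ V) (e : V) (t : ℚ)
    (g : V ≃ₗ[ℚ] V) : Prop where
  rot : IsRot B e t g
  mem : g ∈ isometryGroup B M
  syms : ∀ z, IsSym B M z → B e z = 0 ∨ ∃ c : ℚ, z = c • e
  axes : ∀ e' t' g', g' ∈ isometryGroup B M → IsRot B e' t' g' → ∃ c : ℚ, e' = c • e

theorem IsAxial.map_axis (hB : IsTernaryForm B) {e : V} {t : ℚ} {g : V ≃ₗ[ℚ] V}
    (h : IsAxial B M e t g) {s : V ≃ₗ[ℚ] V} (hs : s ∈ isometryGroup B M) :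
    s e = e ∨ s e = -e := by
  obtain ⟨c, hc⟩ := h.axes _ _ _ (mul_mem (mul_mem hs h.mem) (inv_mem hs)) (h.rot.conj hs.1)
  exact eq_or_neg_of_eq_smul hB h.rot.ne hc (hs.1 _ _)

theorem IsRot.indep (hB : IsTernaryForm B) {e : V} {t : ℚ} {g : V ≃ₗ[ℚ] V} (h : IsRot B e t g)
    {x : V} (hx : x ≠ 0) (hex : B e x = 0) : LinearIndependent ℚ ![x, e, g x] := by
  rw [Fintype.linearIndependent_iff]
  intro c hc
  simp only [Fin.sum_univ_three, Matrix.cons_val_zero, Matrix.cons_val_one, Matrix.cons_val] at hc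
  have h1 := congrArg (B e) hc
  simp only [map_add, map_smul, hex, h.orth_apply hex, map_zero, smul_eq_mul, mul_zero, add_zero,
    zero_add, mul_eq_zero, hB.ne_zero h.ne, or_false] at h1
  have h2 : c 2 = 0 := by
    by_contra h2
    apply h.not_parallel hB hx hex (-(c 0 / c 2))
    rw [h1, zero_smul, add_zero] at hc
    apply smul_right_injective V h2
    change c 2 • g x = c 2 • (-(c 0 / c 2)) • x
    rw [eq_neg_of_add_eq_zero_right hc, smul_smul, mul_neg, mul_div_cancel₀ _ h2, neg_smul]
  have h0 : c 0 = 0 := by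
    rw [h1, h2] at hc
    simpa [hx] using hc
  intro i
  fin_cases i <;> assumption

theorem IsRot.fix_two (hB : IsTernaryForm B) {e : V} {t : ℚ} {g : V ≃ₗ[ℚ] V} (h : IsRot B e t g)
    {x : V} (hx : x ≠ 0) (hex : B e x = 0) {s : V ≃ₗ[ℚ] V} (hs : s ∈ orthogonalGroup B)
    (h1 : s x = x) (h2 : s e = e) : s (g x) = g x ∨ s (g x) = t • x - g x := by
  have hq := hB.pos x hx
  have he : B e (s (g x)) = 0 := by
    nth_rewrite 1 [← h2]; rw [hs, h.orth_apply hex]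
  obtain ⟨a, b, hab⟩ := h.expand hB hx hex he
  have hxx := h.form hB hex
  have e1 : B x (s (g x)) = t / 2 * B x x := by
    nth_rewrite 1 [← h1]; rw [hs, hxx]
  have e2 : B (s (g x)) (s (g x)) = B x x := by rw [hs, h.orth]
  rw [hab] at e1 e2
  simp only [map_add, map_smul, LinearMap.add_apply, LinearMap.smul_apply, smul_eq_mul,
    hB.symm (g x) x, hxx, h.orth x x] at e1 e2
  have e3 : a = t / 2 - b * t / 2 := by
    apply mul_right_cancel₀ hq.ne'; linarith
  have e4 : a ^ 2 + t * a * b + b ^ 2 = 1 := by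
    apply mul_right_cancel₀ hq.ne'; linarith
  have e5 : (b - 1) * (b + 1) * (1 - t ^ 2 / 4) = 0 := by rw [e3] at e4; linarith
  have ht : 1 - t ^ 2 / 4 ≠ 0 := by
    have := h.lt; have := h.gt
    nlinarith
  rcases mul_eq_zero.1 ((mul_eq_zero.1 e5).resolve_right ht) with h3 | h3
  · left
    have hb : b = 1 := by linarith
    rw [hab, e3, hb]; module
  · right
    have hb : b = -1 := by linarith
    rw [hab, e3, hb]; module

theorem tau_flip (hB : IsTernaryForm B) {e x : V} (hex : B e x = 0) :
    (LinearEquiv.neg ℚ * tau B x : V ≃ₗ[ℚ] V) x = x ∧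
      (LinearEquiv.neg ℚ * tau B x : V ≃ₗ[ℚ] V) e = -e := by
  rw [neg_mul_apply, neg_mul_apply, tau_self hB, tau_of_orth (by rw [hB.symm, hex]), neg_neg]
  exact ⟨rfl, rfl⟩

theorem IsAxial.tetragonal (hM : IsIntLattice B M) {e : V} {g : V ≃ₗ[ℚ] V}
    (h : IsAxial B M e 0 g) : Nat.card (isometryGroup B M) = 16 ∧ (symmetries B M).ncard = 5 := by
  have hB := hM.toIsTernaryForm
  obtain ⟨x, -, hex, hx, -⟩ := (hM.rot_structure h.rot h.mem).2
  have hu := h.rot.indep hB hx.1 hex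
  have hq := hM.pos x hx.1
  have hxx : B x (g x) = 0 := by rw [h.rot.form hB hex]; ring
  have hxx' : B (g x) x = 0 := by rw [hB.symm, hxx]
  have hexg := h.rot.orth_apply hex
  have hgx := hx.map h.mem
  have hp := h.rot.symm_add hB h.mem hx hex
  have hm : IsSym B M (x - g x) := by
    have := (hp.map h.mem).smul (c := -1) (by norm_num)
    rw [map_add, h.rot.quad x hex] at this
    convert this using 1; module
  have hse := h.rot.sym_axis hB h.mem
  have hplane : ∀ z, IsSym B M z → B e z = 0 → ∃ r : ℚ, (z = r • x ∨ z = r • g x) ∨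
      (z = r • (x + g x) ∨ z = r • (x - g x)) := by
    intro z hz hez
    obtain ⟨b, c, hbc⟩ := h.rot.expand hB hx.1 hex hez
    obtain ⟨k, hk, e1⟩ := hM.cos_sq hz hx
    have e2 : B z x = b * B x x := by
      rw [hbc]; simp [hxx']
    have e3 : B z z = (b ^ 2 + c ^ 2) * B x x := by
      rw [hbc]
      simp only [map_add, map_smul, LinearMap.add_apply, LinearMap.smul_apply, smul_eq_mul, hxx',
        hxx, h.rot.orth x x]
      ring
    rw [e2, e3] at e1
    have e4 : 4 * b ^ 2 = k * (b ^ 2 + c ^ 2) := by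
      apply mul_right_cancel₀ (mul_pos hq hq).ne'; linarith
    interval_cases k
    · have : b = 0 := by simpa using e4
      exact ⟨c, Or.inl (Or.inr (by rw [hbc, this]; module))⟩
    · have hb := eq_zero_of_sq_eq_three_mul (a := c) (b := b) (by push_cast at e4; linarith)
      exact ⟨c, Or.inl (Or.inr (by rw [hbc, hb]; module))⟩
    · have : (b - c) * (b + c) = 0 := by push_cast at e4; linarith
      rcases mul_eq_zero.1 this with h1 | h1
      · exact ⟨b, Or.inr (Or.inl (by rw [hbc, ← sub_eq_zero.1 h1]; module))⟩
      · exact ⟨b, Or.inr (Or.inr (by rw [hbc, eq_neg_of_add_eq_zero_right h1]; module))⟩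
    · have hb := eq_zero_of_sq_eq_three_mul (a := b) (b := c) (by push_cast at e4; linarith)
      exact ⟨b, Or.inl (Or.inl (by rw [hbc, hb]; module))⟩
    · have : c = 0 := by
        have : c ^ 2 = 0 := by push_cast at e4; linarith
        simpa using this
      exact ⟨b, Or.inl (Or.inl (by rw [hbc, this]; module))⟩
  constructor
  · rw [card_chain (isometryGroup B M) hu
      {![1, 0, 0], ![-1, 0, 0], ![0, 0, 1], ![0, 0, -1]} {![0, 1, 0], ![0, -1, 0]}
      {![0, 0, 1], ![0, 0, -1]}]
    · decide
    · intro s hs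
      have hes : B e (s x) = 0 := by
        rcases h.map_axis hB hs with h1 | h1
        · nth_rewrite 1 [← h1]; rw [hs.1, hex]
        · rw [← neg_neg e, ← h1, map_neg, LinearMap.neg_apply, hs.1, hex, neg_zero]
      have hqs : B (s x) (s x) = B x x := hs.1 x x
      have hlong : ∀ r : ℚ, r ^ 2 * (2 * B x x) ≠ B x x := by
        intro r hr
        have : (2 * r) ^ 2 = 2 * 1 ^ 2 := by
          apply mul_right_cancel₀ hq.ne'; linarith
        have := eq_zero_of_sq_eq_two_mul this
        norm_num at this
      obtain ⟨r, (h1 | h1) | (h1 | h1)⟩ := hplane _ (hx.map hs) hes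
      · rcases eq_or_neg_of_eq_smul hB hx.1 h1 hqs with h2 | h2
        · exact ⟨![1, 0, 0], by simp, by simp [comb, h2]⟩
        · exact ⟨![-1, 0, 0], by simp, by simp [comb, h2]⟩
      · rcases eq_or_neg_of_eq_smul hB hgx.1 h1 (by rw [hqs, h.rot.orth]) with h2 | h2
        · exact ⟨![0, 0, 1], by simp, by simp [comb, h2]⟩
        · exact ⟨![0, 0, -1], by simp, by simp [comb, h2]⟩
      · refine absurd ?_ (hlong r)
        rw [h1] at hqs
        simp only [map_add, map_smul, LinearMap.add_apply, LinearMap.smul_apply, smul_eq_mul, hxx,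
          hxx', h.rot.orth x x] at hqs
        linarith
      · refine absurd ?_ (hlong r)
        rw [h1] at hqs
        simp only [map_sub, map_smul, LinearMap.sub_apply, LinearMap.smul_apply, smul_eq_mul, hxx,
          hxx', h.rot.orth x x] at hqs
        linarith
    · intro c hc
      simp only [Finset.mem_insert, Finset.mem_singleton] at hc
      rcases hc with rfl | rfl | rfl | rfl
      · exact ⟨1, one_mem _, by simp [comb]⟩
      · exact ⟨_, hx.2, by simp [comb, tau_self hB]⟩
      · exact ⟨g, h.mem, by simp [comb]⟩
      · exact ⟨_, mul_mem neg_mem_isometryGroup h.mem, by simp [comb]⟩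
    · intro s hs _
      rcases h.map_axis hB hs with h1 | h1
      · exact ⟨![0, 1, 0], by simp, by simp [comb, h1]⟩
      · exact ⟨![0, -1, 0], by simp, by simp [comb, h1]⟩
    · intro c hc
      simp only [Finset.mem_insert, Finset.mem_singleton] at hc
      rcases hc with rfl | rfl
      · exact ⟨1, one_mem _, by simp [comb]⟩
      · exact ⟨_, mul_mem neg_mem_isometryGroup hx.2, (tau_flip hB hex).1,
          by rw [Matrix.cons_val_one, Matrix.cons_val_zero, (tau_flip hB hex).2]; simp [comb]⟩
    · intro s hs h1 h2
      rcases h.rot.fix_two hB hx.1 hex hs.1 h1 h2 with h3 | h3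
      · exact ⟨![0, 0, 1], by simp, by simp [comb, h3]⟩
      · exact ⟨![0, 0, -1], by simp, by simp [comb, h3]⟩
    · intro c hc
      simp only [Finset.mem_insert, Finset.mem_singleton] at hc
      rcases hc with rfl | rfl
      · exact ⟨1, one_mem _, by simp [comb]⟩
      · exact ⟨_, hgx.2, by simp [tau_of_orth hxx'], by
          simp [tau_of_orth (show B (g x) e = 0 by rw [hB.symm, hexg])], by
          simp [comb, tau_self hB]⟩
    · intro s hs h1 h2 h3
      exact h.rot.ext hB hx.1 hex h2 h1 h3
  · rw [ncard_symmetries hB hu {![1, 0, 0], ![0, 0, 1], ![1, 0, 1], ![1, 0, -1], ![0, 1, 0]}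
      (by decide)]
    · decide
    · intro c hc
      simp only [Finset.mem_insert, Finset.mem_singleton] at hc
      rcases hc with rfl | rfl | rfl | rfl | rfl
      · simpa [comb] using hx
      · simpa [comb] using hgx
      · simpa [comb] using hp
      · simpa [comb, ← sub_eq_add_neg] using hm
      · simpa [comb] using hse
    · intro z hz
      rcases h.syms z hz with h1 | ⟨r, h1⟩
      · obtain ⟨r, (h1 | h1) | (h1 | h1)⟩ := hplane z hz h1
        · exact ⟨![1, 0, 0], by simp, r, by simp [comb, h1]⟩
        · exact ⟨![0, 0, 1], by simp, r, by simp [comb, h1]⟩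
        · exact ⟨![1, 0, 1], by simp, r, by simp [comb, h1]⟩
        · exact ⟨![1, 0, -1], by simp, r, by simp [comb, h1, sub_eq_add_neg]⟩
      · exact ⟨![0, 1, 0], by simp, r, by simp [comb, h1]⟩

/-- The symmetry vectors in the plane orthogonal to a threefold axis. -/
theorem IsRot.plane_syms (hM : IsIntLattice B M) {e : V} {g : V ≃ₗ[ℚ] V} (h : IsRot B e (-1) g)
    {x : V} (hx : IsSym B M x) (hex : B e x = 0) {z : V} (hz : IsSym B M z) (hez : B e z = 0) :
    ∃ r : ℚ, (z = r • x ∨ z = r • g x ∨ z = r • (x + g x)) ∨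
      (z = r • (x - g x) ∨ z = r • g (x - g x) ∨ z = r • g (g (x - g x))) := by
  have hB := hM.toIsTernaryForm
  have hq := hM.pos x hx.1
  have hxx : B x (g x) = -1 / 2 * B x x := h.form hB hex
  have hxx' : B (g x) x = -1 / 2 * B x x := by rw [hB.symm, hxx]
  obtain ⟨b, c, hbc⟩ := h.expand hB hx.1 hex hez
  have hgg : g (g x) = (-1 : ℚ) • g x - x := h.quad x hex
  have l1 : g (x - g x) = x + (2 : ℚ) • g x := by rw [map_sub, hgg]; module
  have l2 : g (g (x - g x)) = (-2 : ℚ) • x - g x := by rw [l1, map_add, map_smul, hgg]; module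
  rw [l2, l1]
  obtain ⟨k, hk, e1⟩ := hM.cos_sq hz hx
  have e2 : B z x = (b - c / 2) * B x x := by
    rw [hbc]
    simp only [map_add, map_smul, LinearMap.add_apply, LinearMap.smul_apply, smul_eq_mul, hxx']
    ring
  have e3 : B z z = (b ^ 2 - b * c + c ^ 2) * B x x := by
    rw [hbc]
    simp only [map_add, map_smul, LinearMap.add_apply, LinearMap.smul_apply, smul_eq_mul, hxx',
      hxx, h.orth x x]
    ring
  rw [e2, e3] at e1
  have e4 : 4 * (2 * b - c) ^ 2 = k * ((2 * b - c) ^ 2 + 3 * c ^ 2) := by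
    apply mul_right_cancel₀ (mul_pos hq hq).ne'; linarith
  interval_cases k
  · have : 2 * b - c = 0 := by simpa using e4
    refine ⟨b, Or.inr (Or.inr (Or.inl ?_))⟩
    rw [hbc, show c = 2 * b by linarith]; module
  · have : (2 * b - c - c) * (2 * b - c + c) = 0 := by push_cast at e4; linarith
    rcases mul_eq_zero.1 this with h1 | h1
    · refine ⟨b, Or.inl (Or.inr (Or.inr ?_))⟩
      rw [hbc, show c = b by linarith]; module
    · refine ⟨c, Or.inl (Or.inr (Or.inl ?_))⟩
      rw [hbc, show b = 0 by linarith]; module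
  · have hc := eq_zero_of_sq_eq_three_mul (a := 2 * b - c) (b := c) (by push_cast at e4; linarith)
    refine ⟨b, Or.inl (Or.inl ?_)⟩
    rw [hbc, hc]; module
  · have : (2 * b - c - 3 * c) * (2 * b - c + 3 * c) = 0 := by push_cast at e4; linarith
    rcases mul_eq_zero.1 this with h1 | h1
    · refine ⟨-c, Or.inr (Or.inr (Or.inr ?_))⟩
      rw [hbc, show b = 2 * c by linarith]; module
    · refine ⟨b, Or.inr (Or.inl ?_)⟩
      rw [hbc, show c = -b by linarith]; module
  · have hc : c ^ 2 = 0 := by push_cast at e4; linarith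
    have hc : c = 0 := by simpa using hc
    refine ⟨b, Or.inl (Or.inl ?_)⟩
    rw [hbc, hc]; module

/-- If one of the long vectors is a symmetry vector, so is the threefold axis. -/
theorem IsRot.long_sym (hM : IsIntLattice B M) {e : V} {g : V ≃ₗ[ℚ] V} (h : IsRot B e (-1) g)
    (hg : g ∈ isometryGroup B M) {x : V} (hx : IsSym B M x) (hex : B e x = 0) :
    IsFrame B (x + g x) (x - g x) e ∧ (IsSym B M (x - g x) ↔ IsSym B M e) := by
  have hB := hM.toIsTernaryForm
  have hs := h.symm_add hB hg hx hex
  have hexg := h.orth_apply hex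
  have hne : x - g x ≠ 0 := by
    intro h0
    exact h.not_parallel hB hx.1 hex 1 (by rw [one_smul, ← sub_eq_zero.1 h0])
  have hf : IsFrame B (x + g x) (x - g x) e := by
    refine ⟨hs.1, hne, h.ne, ?_, ?_, ?_⟩
    · simp only [map_add, map_sub, LinearMap.add_apply, hB.symm (g x) x]
      rw [h.orth]; ring
    · rw [hB.symm, map_add, hex, hexg, add_zero]
    · rw [hB.symm, map_sub, hex, hexg, sub_zero]
  exact ⟨hf, fun h1 => hs.third hB hf h1, fun h1 => h1.third hB
    ((hf.rotate hB).rotate hB) hs⟩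

theorem IsAxial.orbit_three (hM : IsIntLattice B M) {e : V} {g : V ≃ₗ[ℚ] V}
    (h : IsAxial B M e (-1) g) {x : V} (hx : IsSym B M x) (hex : B e x = 0) {s : V ≃ₗ[ℚ] V}
    (hs : s ∈ isometryGroup B M) : (s x = x ∨ s x = -x) ∨ (s x = g x ∨ s x = -g x) ∨
      (s x = x + g x ∨ s x = -(x + g x)) := by
  have hB := hM.toIsTernaryForm
  have hq := hM.pos x hx.1
  have hes : B e (s x) = 0 := by
    rcases h.map_axis hB hs with h1 | h1
    · nth_rewrite 1 [← h1]; rw [hs.1, hex]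
    · rw [← neg_neg e, ← h1, map_neg, LinearMap.neg_apply, hs.1, hex, neg_zero]
  have hxx : B x (g x) = -1 / 2 * B x x := h.rot.form hB hex
  have hxx' : B (g x) x = -1 / 2 * B x x := by rw [hB.symm, hxx]
  have hqs : B (s x) (s x) = B x x := hs.1 x x
  have hQl : B (x - g x) (x - g x) = 3 * B x x := by
    simp only [map_sub, LinearMap.sub_apply, hxx, hxx', h.rot.orth x x]; ring
  have hlong : ∀ (r : ℚ) (v : V), B v v = 3 * B x x → s x ≠ r • v := by
    intro r v hv hr
    rw [hr] at hqs
    simp only [map_smul, LinearMap.smul_apply, smul_eq_mul, hv] at hqs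
    have : (3 * r) ^ 2 = 3 * 1 ^ 2 := by
      apply mul_right_cancel₀ hq.ne'; linarith
    have := eq_zero_of_sq_eq_three_mul this
    norm_num at this
  have ho : ∀ v, B (g v) (g v) = B v v := fun v => h.rot.orth v v
  obtain ⟨r, (h1 | h1 | h1) | (h1 | h1 | h1)⟩ := h.rot.plane_syms hM hx hex (hx.map hs) hes
  · exact Or.inl (eq_or_neg_of_eq_smul hB hx.1 h1 hqs)
  · exact Or.inr (Or.inl (eq_or_neg_of_eq_smul hB (by simpa using hx.1) h1 (by rw [hqs, ho])))
  · refine Or.inr (Or.inr (eq_or_neg_of_eq_smul hB (h.rot.symm_add hB h.mem hx hex).1 h1 ?_))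
    simp only [map_add, LinearMap.add_apply, hxx, hxx', hqs, h.rot.orth x x]; ring
  · exact absurd h1 (hlong r _ hQl)
  · exact absurd h1 (hlong r _ (by rw [ho, hQl]))
  · exact absurd h1 (hlong r _ (by rw [ho, ho, hQl]))

theorem IsAxial.card_three (hM : IsIntLattice B M) {e : V} {g : V ≃ₗ[ℚ] V}
    (h : IsAxial B M e (-1) g) {x : V} (hx : IsSym B M x) (hex : B e x = 0)
    (O : Finset (Fin 3 → ℤ))
    (h3 : ∀ s ∈ isometryGroup B M, s x = x → s e = e → ∃ c ∈ O, s (g x) = comb ![x, e, g x] c)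
    (h3' : ∀ c ∈ O, ∃ s ∈ isometryGroup B M, s x = x ∧ s e = e ∧
      s (g x) = comb ![x, e, g x] c) : Nat.card (isometryGroup B M) = 12 * O.card := by
  have hB := hM.toIsTernaryForm
  have hgg : g (g x) = (-1 : ℚ) • g x - x := h.rot.quad x hex
  rw [card_chain (isometryGroup B M) (h.rot.indep hB hx.1 hex)
      {![1, 0, 0], ![-1, 0, 0], ![0, 0, 1], ![0, 0, -1], ![1, 0, 1], ![-1, 0, -1]}
      {![0, 1, 0], ![0, -1, 0]} O ?_ ?_ ?_ ?_ h3 h3'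
      (fun s hs h1 h2 h3 => h.rot.ext hB hx.1 hex h2 h1 h3), ← mul_assoc]
  · congr 1
  · intro s hs
    rcases h.orbit_three hM hx hex hs with (h1 | h1) | (h1 | h1) | (h1 | h1)
    · exact ⟨![1, 0, 0], by simp, by simp [comb, h1]⟩
    · exact ⟨![-1, 0, 0], by simp, by simp [comb, h1]⟩
    · exact ⟨![0, 0, 1], by simp, by simp [comb, h1]⟩
    · exact ⟨![0, 0, -1], by simp, by simp [comb, h1]⟩
    · exact ⟨![1, 0, 1], by simp, by simp [comb, h1]⟩
    · exact ⟨![-1, 0, -1], by simp, by simp [comb, h1]; abel⟩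
  · intro c hc
    have hn := neg_mem_isometryGroup (B := B) (M := M)
    simp only [Finset.mem_insert, Finset.mem_singleton] at hc
    rcases hc with rfl | rfl | rfl | rfl | rfl | rfl
    · exact ⟨1, one_mem _, by simp [comb]⟩
    · exact ⟨_, hn, by simp [comb]⟩
    · exact ⟨g, h.mem, by simp [comb]⟩
    · exact ⟨_, mul_mem hn h.mem, by simp [comb]⟩
    · exact ⟨_, mul_mem hn (mul_mem h.mem h.mem), by
        simp [comb, hgg]⟩
    · exact ⟨_, mul_mem h.mem h.mem, by simp [comb, hgg]; abel⟩
  · intro s hs _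
    rcases h.map_axis hB hs with h1 | h1
    · exact ⟨![0, 1, 0], by simp, by simp [comb, h1]⟩
    · exact ⟨![0, -1, 0], by simp, by simp [comb, h1]⟩
  · intro c hc
    simp only [Finset.mem_insert, Finset.mem_singleton] at hc
    rcases hc with rfl | rfl
    · exact ⟨1, one_mem _, by simp [comb]⟩
    · exact ⟨_, mul_mem neg_mem_isometryGroup hx.2, (tau_flip hB hex).1,
        by rw [Matrix.cons_val_one, Matrix.cons_val_zero, (tau_flip hB hex).2]; simp [comb]⟩

theorem IsAxial.trigonal (hM : IsIntLattice B M) {e : V} {g : V ≃ₗ[ℚ] V}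
    (h : IsAxial B M e (-1) g) (he : ¬ IsSym B M e) :
    (Nat.card (isometryGroup B M) = 12 ∧ (symmetries B M).ncard = 3) ∧
    ∀ y z, IsSym B M y → IsSym B M z → B y z ≠ 0 := by
  have hB := hM.toIsTernaryForm
  obtain ⟨x, -, hex, hx, -⟩ := (hM.rot_structure h.rot h.mem).2
  have hu := h.rot.indep hB hx.1 hex
  have hgx := hx.map h.mem
  have hp := h.rot.symm_add hB h.mem hx hex
  obtain ⟨hf, hlong⟩ := h.rot.long_sym hM h.mem hx hex
  have hnl : ¬ IsSym B M (x - g x) := fun h1 => he (hlong.1 h1)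
  have hcube := h.rot.cube hB
  have hplane : ∀ z, IsSym B M z → ∃ r : ℚ, r ≠ 0 ∧ (z = r • x ∨ z = r • g x ∨ z = r • (x + g x)) := by
    intro z hz
    have hez : B e z = 0 := by
      rcases h.syms z hz with h1 | ⟨c, rfl⟩
      · exact h1
      · exfalso
        have hc : c ≠ 0 := by rintro rfl; exact hz.1 (zero_smul _ _)
        have := hz.smul (inv_ne_zero hc)
        rw [smul_smul, inv_mul_cancel₀ hc, one_smul] at this
        exact he this
    obtain ⟨r, h1⟩ := h.rot.plane_syms hM hx hex hz hez
    have hr : r ≠ 0 := by rintro rfl; simp at h1; exact hz.1 h1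
    have hun : ∀ v : V, IsSym B M (r • v) → IsSym B M v := by
      intro v hv
      have := hv.smul (inv_ne_zero hr)
      rwa [smul_smul, inv_mul_cancel₀ hr, one_smul] at this
    rcases h1 with h1 | (h1 | h1 | h1)
    · exact ⟨r, hr, h1⟩
    · exact absurd (hun _ (h1 ▸ hz)) hnl
    · have h2 := ((hun _ (h1 ▸ hz)).map h.mem).map h.mem
      rw [hcube] at h2
      exact absurd h2 hnl
    · have h2 := (hun _ (h1 ▸ hz)).map h.mem
      rw [hcube] at h2
      exact absurd h2 hnl
  refine ⟨⟨?_, ?_⟩, ?_⟩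
  · rw [h.card_three hM hx hex {![0, 0, 1]}]
    · rfl
    · intro s hs h1 h2
      rcases h.rot.fix_two hB hx.1 hex hs.1 h1 h2 with h3 | h3
      · exact ⟨![0, 0, 1], by simp, by simp [comb, h3]⟩
      · exfalso
        apply hnl
        have hl := ((hf.rotate hB).rotate hB)
        have hsl : s = tau B (g (x - g x)) := by
          have hgl : g (x - g x) = x + (2 : ℚ) • g x := by
            rw [map_sub, h.rot.quad x hex]; module
          have hxl : B (g (x - g x)) x = 0 := by
            rw [hgl]
            simp only [map_add, map_smul, LinearMap.add_apply, LinearMap.smul_apply, smul_eq_mul,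
              hB.symm (g x) x, h.rot.form hB hex]
            ring
          have hel : B (g (x - g x)) e = 0 := by
            rw [hB.symm]; exact h.rot.orth_apply (by rw [hB.symm]; exact hf.h23)
          have hlx : s (g (x - g x)) = -g (x - g x) := by
            rw [hgl, map_add, map_smul, h1, h3]; module
          refine h.rot.ext hB hx.1 hex ?_ ?_ ?_
          · rw [h2, tau_of_orth hel]
          · rw [h1, tau_of_orth hxl]
          · have e1 : g x = (1 / 2 : ℚ) • (g (x - g x) - x) := by rw [hgl]; module
            have e2 : tau B (g (x - g x)) (g x) = (1 / 2 : ℚ) • (-g (x - g x) - x) := by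
              nth_rewrite 2 [e1]
              rw [map_smul, map_sub, tau_self hB, tau_of_orth hxl]
            rw [e2, hgl, h3]; module
        have h4 : IsSym B M (g (x - g x)) := ⟨(LinearEquiv.map_ne_zero_iff g).2 hf.ne2, hsl ▸ hs⟩
        have h5 := (h4.map h.mem).map h.mem
        rwa [hcube] at h5
    · intro c hc
      simp only [Finset.mem_singleton] at hc
      subst hc
      exact ⟨1, one_mem _, rfl, rfl, by simp [comb]⟩
  · rw [ncard_symmetries hB hu {![1, 0, 0], ![0, 0, 1], ![1, 0, 1]} (by decide)]
    · decide
    · intro c hc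
      simp only [Finset.mem_insert, Finset.mem_singleton] at hc
      rcases hc with rfl | rfl | rfl
      · simpa [comb] using hx
      · simpa [comb] using hgx
      · simpa [comb] using hp
    · intro z hz
      obtain ⟨r, -, h1 | h1 | h1⟩ := hplane z hz
      · exact ⟨![1, 0, 0], by simp, r, by simp [comb, h1]⟩
      · exact ⟨![0, 0, 1], by simp, r, by simp [comb, h1]⟩
      · exact ⟨![1, 0, 1], by simp, r, by simp [comb, h1]⟩
  · intro y z hy hz
    have hq := hM.pos x hx.1
    have hxx : B x (g x) = -1 / 2 * B x x := h.rot.form hB hex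
    have hxx' : B (g x) x = -1 / 2 * B x x := by rw [hB.symm, hxx]
    have hgg := h.rot.orth x x
    obtain ⟨a, ha, h1⟩ := hplane y hy
    obtain ⟨b, hb, h2⟩ := hplane z hz
    rcases h1 with rfl | rfl | rfl <;> rcases h2 with rfl | rfl | rfl <;>
    · simp only [map_add, map_smul, LinearMap.add_apply, LinearMap.smul_apply, smul_eq_mul, hxx',
        hxx, hgg]
      intro h0
      have h0 : a * b * B x x = 0 := by linarith
      exact mul_ne_zero (mul_ne_zero ha hb) hq.ne' h0

theorem IsAxial.hexagonal (hM : IsIntLattice B M) {e : V} {g : V ≃ₗ[ℚ] V}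
    (h : IsAxial B M e (-1) g) (he : IsSym B M e) :
    Nat.card (isometryGroup B M) = 24 ∧ (symmetries B M).ncard = 7 := by
  have hB := hM.toIsTernaryForm
  obtain ⟨x, -, hex, hx, -⟩ := (hM.rot_structure h.rot h.mem).2
  have hu := h.rot.indep hB hx.1 hex
  have hgx := hx.map h.mem
  have hp := h.rot.symm_add hB h.mem hx hex
  obtain ⟨hf, hlong⟩ := h.rot.long_sym hM h.mem hx hex
  have hl := hlong.2 he
  have hl1 := hl.map h.mem
  have hl2 := hl1.map h.mem
  have hgg : g (g x) = (-1 : ℚ) • g x - x := h.rot.quad x hex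
  have l1 : g (x - g x) = x + (2 : ℚ) • g x := by rw [map_sub, hgg]; module
  have l2 : g (g (x - g x)) = (-2 : ℚ) • x - g x := by rw [l1, map_add, map_smul, hgg]; module
  constructor
  · rw [h.card_three hM hx hex {![0, 0, 1], ![-1, 0, -1]}]
    · rfl
    · intro s hs h1 h2
      rcases h.rot.fix_two hB hx.1 hex hs.1 h1 h2 with h3 | h3
      · exact ⟨![0, 0, 1], by simp, by simp [comb, h3]⟩
      · exact ⟨![-1, 0, -1], by simp, by simp [comb, h3]; abel⟩
    · intro c hc
      simp only [Finset.mem_insert, Finset.mem_singleton] at hc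
      rcases hc with rfl | rfl
      · exact ⟨1, one_mem _, rfl, rfl, by simp [comb]⟩
      · have hxl : B (g (x - g x)) x = 0 := by
          rw [l1]
          simp only [map_add, map_smul, LinearMap.add_apply, LinearMap.smul_apply, smul_eq_mul,
            hB.symm (g x) x, h.rot.form hB hex]
          ring
        have hel : B (g (x - g x)) e = 0 := by
          rw [hB.symm]; exact h.rot.orth_apply (by rw [hB.symm]; exact hf.h23)
        refine ⟨_, hl1.2, tau_of_orth hxl, tau_of_orth hel, ?_⟩
        have e1 : g x = (1 / 2 : ℚ) • (g (x - g x) - x) := by rw [l1]; module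
        have e2 : tau B (g (x - g x)) (g x) = (1 / 2 : ℚ) • (-g (x - g x) - x) := by
          nth_rewrite 2 [e1]
          rw [map_smul, map_sub, tau_self hB, tau_of_orth hxl]
        rw [e2, l1]
        simp [comb]
        module
  · rw [ncard_symmetries hB hu {![1, 0, 0], ![0, 0, 1], ![1, 0, 1], ![1, 0, -1], ![1, 0, 2],
      ![-2, 0, -1], ![0, 1, 0]} (by decide)]
    · decide
    · intro c hc
      simp only [Finset.mem_insert, Finset.mem_singleton] at hc
      rw [l1] at hl1
      rw [l2] at hl2
      rcases hc with rfl | rfl | rfl | rfl | rfl | rfl | rfl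
      · simpa [comb] using hx
      · simpa [comb] using hgx
      · simpa [comb] using hp
      · simpa [comb, ← sub_eq_add_neg] using hl
      · simpa [comb] using hl1
      · simpa [comb, ← sub_eq_add_neg] using hl2
      · simpa [comb] using he
    · intro z hz
      rcases h.syms z hz with h1 | ⟨r, h1⟩
      · obtain ⟨r, (h1 | h1 | h1) | (h1 | h1 | h1)⟩ := h.rot.plane_syms hM hx hex hz h1
        · exact ⟨![1, 0, 0], by simp, r, by simp [comb, h1]⟩
        · exact ⟨![0, 0, 1], by simp, r, by simp [comb, h1]⟩
        · exact ⟨![1, 0, 1], by simp, r, by simp [comb, h1]⟩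
        · exact ⟨![1, 0, -1], by simp, r, by simp [comb, h1, sub_eq_add_neg]⟩
        · exact ⟨![1, 0, 2], by simp, r, by rw [h1, l1]; simp [comb]⟩
        · exact ⟨![-2, 0, -1], by simp, r, by rw [h1, l2]; simp [comb, sub_eq_add_neg]⟩
      · exact ⟨![0, 1, 0], by simp, r, by simp [comb, h1]⟩

end

section

/-! ### Cubic lattices -/

theorem cubic_coords {a b c : ℚ} {k l m : ℕ} (hS : a ^ 2 + b ^ 2 + c ^ 2 ≠ 0)
    (ha : 4 * a ^ 2 = k * (a ^ 2 + b ^ 2 + c ^ 2)) (hb : 4 * b ^ 2 = l * (a ^ 2 + b ^ 2 + c ^ 2))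
    (hc : 4 * c ^ 2 = m * (a ^ 2 + b ^ 2 + c ^ 2)) :
    ((b = 0 ∧ c = 0) ∨ (a = 0 ∧ c = 0) ∨ (a = 0 ∧ b = 0)) ∨
    (c = 0 ∧ (a = b ∨ a = -b)) ∨ (b = 0 ∧ (a = c ∨ a = -c)) ∨ (a = 0 ∧ (b = c ∨ b = -c)) := by
  have hk : k + l + m = 4 := by
    have : ((k + l + m : ℕ) : ℚ) * (a ^ 2 + b ^ 2 + c ^ 2) = 4 * (a ^ 2 + b ^ 2 + c ^ 2) := by
      push_cast; linarith
    exact_mod_cast mul_right_cancel₀ hS this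
  have two : ∀ {x y : ℚ}, x ^ 2 = y ^ 2 → x = y ∨ x = -y := fun h => sq_eq_sq_iff_eq_or_eq_neg.1 h
  have plane : ∀ {x y : ℚ} {i j : ℕ}, x ^ 2 + y ^ 2 ≠ 0 → i + j = 4 →
      4 * x ^ 2 = i * (x ^ 2 + y ^ 2) → 4 * y ^ 2 = j * (x ^ 2 + y ^ 2) →
      x = 0 ∨ y = 0 ∨ (x = y ∨ x = -y) := by
    intro x y i j _ hij hx hy
    have hi : i ≤ 4 := by omega
    obtain rfl : j = 4 - i := by omega
    interval_cases i
    · left; simpa using hx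
    · left
      norm_num at hx hy
      exact eq_zero_of_sq_eq_three_mul (a := y) (b := x) (by linarith)
    · right; right
      norm_num at hx
      exact two (by linarith)
    · right; left
      norm_num at hx hy
      exact eq_zero_of_sq_eq_three_mul (a := x) (b := y) (by linarith)
    · right; left; simpa using hy
  have z0 : ∀ {x : ℚ} {i : ℕ}, 4 * x ^ 2 = i * (a ^ 2 + b ^ 2 + c ^ 2) → i = 0 → x = 0 := by
    rintro x i h rfl; simpa using h
  have hzero : k = 0 ∨ l = 0 ∨ m = 0 := by
    by_contra hne
    have : (k = 1 ∧ l = 1 ∧ m = 2) ∨ (k = 1 ∧ l = 2 ∧ m = 1) ∨ (k = 2 ∧ l = 1 ∧ m = 1) := by omega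
    apply hS
    rcases this with ⟨rfl, rfl, rfl⟩ | ⟨rfl, rfl, rfl⟩ | ⟨rfl, rfl, rfl⟩ <;> norm_num at ha hb hc
    · have := eq_zero_of_sq_eq_two_mul (a := c) (b := a) (by linarith)
      rw [this] at ha; linarith
    · have := eq_zero_of_sq_eq_two_mul (a := b) (b := a) (by linarith)
      rw [this] at ha; linarith
    · have := eq_zero_of_sq_eq_two_mul (a := a) (b := b) (by linarith)
      rw [this] at hb; linarith
  rcases hzero with h | h | h
  · have h0 := z0 ha h
    subst h0
    rcases plane (x := b) (y := c) (i := l) (j := m) (by simpa using hS) (by omega)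
      (by simpa using hb) (by simpa using hc) with h1 | h1 | h1 <;> simp [h1]
  · have h0 := z0 hb h
    subst h0
    rcases plane (x := a) (y := c) (i := k) (j := m) (by simpa using hS) (by omega)
      (by simpa using ha) (by simpa using hc) with h1 | h1 | h1 <;> simp [h1]
  · have h0 := z0 hc h
    subst h0
    rcases plane (x := a) (y := b) (i := k) (j := l) (by simpa using hS) (by omega)
      (by simpa using ha) (by simpa using hb) with h1 | h1 | h1 <;> simp [h1]

theorem tau_swap (hB : IsTernaryForm B) {x y : V} (hq : B y y = B x x) (h : x ≠ y) :
    tau B (x - y) x = y := by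
  have hd : B (x - y) (x - y) = 2 * B (x - y) x := by
    simp only [map_sub, LinearMap.sub_apply, hq, hB.symm y x]; ring
  rw [tau_apply, ← hd, div_self (hB.ne_zero (sub_ne_zero.2 h)), one_smul, sub_sub_cancel]

namespace IsCubic

variable {f₁ f₂ f₃ : V}

theorem rotate (hB : IsTernaryForm B) (h : IsCubic B M f₁ f₂ f₃) : IsCubic B M f₂ f₃ f₁ := by
  refine ⟨h.toIsFrame.rotate hB, by rw [h.q3, h.q2], by rw [h.q2], h.s2, h.s3, h.s1, h.s23, ?_⟩
  have h1 := h.s23.map h.s12.2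
  have hne : f₁ ≠ f₂ := fun h0 => h.s12.1 (sub_eq_zero.2 h0)
  have e1 := tau_tau (B := B) (f₁ - f₂) f₁
  rw [tau_swap hB h.q2 hne] at e1
  have e2 : tau B (f₁ - f₂) f₃ = f₃ := tau_of_orth (by
    simp [h.h13, h.h23])
  rw [map_sub, e1, e2] at h1
  have := h1.smul (c := -1) (by norm_num)
  simpa using this

theorem s31 (hB : IsTernaryForm B) (h : IsCubic B M f₁ f₂ f₃) : IsSym B M (f₃ - f₁) :=
  (h.rotate hB).s23

theorem add12 (hB : IsTernaryForm B) (h : IsCubic B M f₁ f₂ f₃) : IsSym B M (f₁ + f₂) := by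
  have := h.s12.map h.s2.2
  rwa [map_sub, tau_self hB, tau_of_orth (by rw [hB.symm, h.h12]), sub_neg_eq_add] at this

theorem swap12 (hB : IsTernaryForm B) (h : IsCubic B M f₁ f₂ f₃) :
    tau B (f₁ - f₂) f₁ = f₂ ∧ tau B (f₁ - f₂) f₂ = f₁ ∧ tau B (f₁ - f₂) f₃ = f₃ := by
  have hne : f₁ ≠ f₂ := fun h0 => h.s12.1 (sub_eq_zero.2 h0)
  have := tau_swap hB h.q2 hne
  have h2 := tau_tau (B := B) (f₁ - f₂) f₁
  rw [this] at h2
  exact ⟨this, h2, tau_of_orth (by simp [h.h13, h.h23])⟩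

theorem sym_cases (hM : IsIntLattice B M) (h : IsCubic B M f₁ f₂ f₃) {z : V} (hz : IsSym B M z) :
    ∃ r : ℚ, (z = r • f₁ ∨ z = r • f₂ ∨ z = r • f₃) ∨ (z = r • (f₁ + f₂) ∨ z = r • (f₁ - f₂)) ∨
      (z = r • (f₃ + f₁) ∨ z = r • (f₃ - f₁)) ∨ (z = r • (f₂ + f₃) ∨ z = r • (f₂ - f₃)) := by
  have hB := hM.toIsTernaryForm
  have hq := hM.pos f₁ h.ne1
  obtain ⟨k, -, hk⟩ := hM.cos_sq h.s1 hz
  obtain ⟨l, -, hl⟩ := hM.cos_sq h.s2 hz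
  obtain ⟨m, -, hm⟩ := hM.cos_sq h.s3 hz
  have hexp := h.toIsFrame.expand hB z
  rw [h.q2] at hl
  rw [h.q3] at hm
  rw [h.q2, h.q3] at hexp
  set q := B f₁ f₁
  have hzz : B z z = (B f₁ z ^ 2 + B f₂ z ^ 2 + B f₃ z ^ 2) / q := by
    have := congrArg (B z) hexp
    simp only [map_add, map_smul, smul_eq_mul, hB.symm z f₁, hB.symm z f₂, hB.symm z f₃] at this
    rw [this]; ring
  set a := B f₁ z
  set b := B f₂ z
  set c := B f₃ z
  have hqz : q * B z z = a ^ 2 + b ^ 2 + c ^ 2 := by rw [hzz]; field_simp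
  rw [hqz] at hk hl hm
  have hS : a ^ 2 + b ^ 2 + c ^ 2 ≠ 0 := by
    rw [← hqz]; exact (mul_pos hq (hM.pos z hz.1)).ne'
  rw [hexp]
  rcases cubic_coords hS hk hl hm with (⟨h1, h2⟩ | ⟨h1, h2⟩ | ⟨h1, h2⟩) | ⟨h1, h2 | h2⟩ |
    ⟨h1, h2 | h2⟩ | ⟨h1, h2 | h2⟩
  · exact ⟨a / q, Or.inl (Or.inl (by rw [h1, h2]; module))⟩
  · exact ⟨b / q, Or.inl (Or.inr (Or.inl (by rw [h1, h2]; module)))⟩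
  · exact ⟨c / q, Or.inl (Or.inr (Or.inr (by rw [h1, h2]; module)))⟩
  · exact ⟨b / q, Or.inr (Or.inl (Or.inl (by rw [h1, h2]; module)))⟩
  · exact ⟨-b / q, Or.inr (Or.inl (Or.inr (by rw [h1, h2]; module)))⟩
  · exact ⟨c / q, Or.inr (Or.inr (Or.inl (Or.inl (by rw [h1, h2]; module))))⟩
  · exact ⟨c / q, Or.inr (Or.inr (Or.inl (Or.inr (by rw [h1, h2]; module))))⟩
  · exact ⟨c / q, Or.inr (Or.inr (Or.inr (Or.inl (by rw [h1, h2]; module))))⟩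
  · exact ⟨-c / q, Or.inr (Or.inr (Or.inr (Or.inr (by rw [h1, h2]; module))))⟩

theorem short_cases (hM : IsIntLattice B M) (h : IsCubic B M f₁ f₂ f₃) {z : V} (hz : IsSym B M z)
    (hq : B z z = B f₁ f₁) :
    (z = f₁ ∨ z = -f₁) ∨ (z = f₂ ∨ z = -f₂) ∨ (z = f₃ ∨ z = -f₃) := by
  have hB := hM.toIsTernaryForm
  have hp := hM.pos f₁ h.ne1
  have hlong : ∀ (r : ℚ) (v : V), B v v = 2 * B f₁ f₁ → z ≠ r • v := by
    rintro r v hv rfl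
    simp only [map_smul, LinearMap.smul_apply, smul_eq_mul, hv] at hq
    have : (2 * r) ^ 2 = 2 * 1 ^ 2 := by
      apply mul_right_cancel₀ hp.ne'; linarith
    have := eq_zero_of_sq_eq_two_mul this
    norm_num at this
  have h21 : B f₂ f₁ = 0 := by rw [hB.symm, h.h12]
  have h31 : B f₃ f₁ = 0 := by rw [hB.symm, h.h13]
  have h32 : B f₃ f₂ = 0 := by rw [hB.symm, h.h23]
  obtain ⟨r, (h1 | h1 | h1) | (h1 | h1) | (h1 | h1) | (h1 | h1)⟩ := h.sym_cases hM hz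
  · exact Or.inl (eq_or_neg_of_eq_smul hB h.ne1 h1 hq)
  · exact Or.inr (Or.inl (eq_or_neg_of_eq_smul hB h.ne2 h1 (by rw [hq, h.q2])))
  · exact Or.inr (Or.inr (eq_or_neg_of_eq_smul hB h.ne3 h1 (by rw [hq, h.q3])))
  all_goals
    refine absurd h1 (hlong _ _ ?_)
    simp only [map_add, map_sub, LinearMap.add_apply, LinearMap.sub_apply, h.h12, h.h13, h.h23, h21,
      h31, h32, h.q2, h.q3]
    ring

theorem card (hM : IsIntLattice B M) (h : IsCubic B M f₁ f₂ f₃) :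
    Nat.card (isometryGroup B M) = 48 ∧ (symmetries B M).ncard = 9 := by
  have hB := hM.toIsTernaryForm
  have hf := h.toIsFrame
  have hu := hf.linearIndependent hB
  have h21 : B f₂ f₁ = 0 := by rw [hB.symm, h.h12]
  have h31 : B f₃ f₁ = 0 := by rw [hB.symm, h.h13]
  have h32 : B f₃ f₂ = 0 := by rw [hB.symm, h.h23]
  obtain ⟨a1, a2, a3⟩ := h.swap12 hB
  obtain ⟨b2, b3, b1⟩ := (h.rotate hB).swap12 hB
  have hn := neg_mem_isometryGroup (B := B) (M := M)
  have t22 := tau_self hB f₂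
  have t33 := tau_self hB f₃
  have t21 := tau_of_orth h21
  have t31 := tau_of_orth h31
  have t32 := tau_of_orth h32
  have t23 := tau_of_orth h.h23
  have hnn : ∀ {x : V}, x ≠ 0 → B x x ≠ 0 := fun hx => hB.ne_zero hx
  constructor
  · rw [card_chain (isometryGroup B M) hu {![1, 0, 0], ![-1, 0, 0], ![0, 1, 0], ![0, -1, 0],
      ![0, 0, 1], ![0, 0, -1]} {![0, 1, 0], ![0, -1, 0], ![0, 0, 1], ![0, 0, -1]}
      {![0, 0, 1], ![0, 0, -1]}]
    · decide
    · intro g hg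
      rcases h.short_cases hM (h.s1.map hg) (hg.1 _ _) with (h1 | h1) | (h1 | h1) | (h1 | h1)
      · exact ⟨![1, 0, 0], by simp, by simp [comb, h1]⟩
      · exact ⟨![-1, 0, 0], by simp, by simp [comb, h1]⟩
      · exact ⟨![0, 1, 0], by simp, by simp [comb, h1]⟩
      · exact ⟨![0, -1, 0], by simp, by simp [comb, h1]⟩
      · exact ⟨![0, 0, 1], by simp, by simp [comb, h1]⟩
      · exact ⟨![0, 0, -1], by simp, by simp [comb, h1]⟩
    · intro c hc
      simp only [Finset.mem_insert, Finset.mem_singleton] at hc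
      rcases hc with rfl | rfl | rfl | rfl | rfl | rfl
      · exact ⟨1, one_mem _, by simp [comb]⟩
      · exact ⟨_, hn, by simp [comb]⟩
      · exact ⟨_, h.s12.2, by simp [comb, a1]⟩
      · exact ⟨_, mul_mem hn h.s12.2, by simp [comb, a1]⟩
      · exact ⟨_, mul_mem h.s23.2 h.s12.2, by simp [comb, a1, b2]⟩
      · exact ⟨_, mul_mem hn (mul_mem h.s23.2 h.s12.2), by simp [comb, a1, b2]⟩
    · intro g hg hg1
      have h0 : B f₁ (g f₂) = 0 := by
        have : g f₁ = f₁ := hg1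
        nth_rewrite 1 [← this]; rw [hg.1, h.h12]
      rcases h.short_cases hM (h.s2.map hg) (by rw [hg.1, h.q2]) with (h1 | h1) | (h1 | h1) |
        (h1 | h1)
      · exact absurd h0 (by rw [h1]; exact hnn h.ne1)
      · exact absurd h0 (by rw [h1, map_neg]; exact neg_ne_zero.2 (hnn h.ne1))
      · exact ⟨![0, 1, 0], by simp, by simp [comb, h1]⟩
      · exact ⟨![0, -1, 0], by simp, by simp [comb, h1]⟩
      · exact ⟨![0, 0, 1], by simp, by simp [comb, h1]⟩
      · exact ⟨![0, 0, -1], by simp, by simp [comb, h1]⟩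
    · intro c hc
      simp only [Finset.mem_insert, Finset.mem_singleton] at hc
      rcases hc with rfl | rfl | rfl | rfl
      · exact ⟨1, one_mem _, by simp [comb]⟩
      · exact ⟨_, h.s2.2, by simp [comb, t21, t22]⟩
      · exact ⟨_, h.s23.2, by simp [comb, b1, b2]⟩
      · exact ⟨_, mul_mem h.s3.2 h.s23.2, by simp [comb, b1, b2, t33, t31]⟩
    · intro g hg hg1 hg2
      have h0 : B f₁ (g f₃) = 0 := by
        have : g f₁ = f₁ := hg1
        nth_rewrite 1 [← this]; rw [hg.1, h.h13]
      have h0' : B f₂ (g f₃) = 0 := by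
        have : g f₂ = f₂ := hg2
        nth_rewrite 1 [← this]; rw [hg.1, h.h23]
      rcases h.short_cases hM (h.s3.map hg) (by rw [hg.1, h.q3]) with (h1 | h1) | (h1 | h1) |
        (h1 | h1)
      · exact absurd h0 (by rw [h1]; exact hnn h.ne1)
      · exact absurd h0 (by rw [h1, map_neg]; exact neg_ne_zero.2 (hnn h.ne1))
      · exact absurd h0' (by rw [h1]; exact hnn h.ne2)
      · exact absurd h0' (by rw [h1, map_neg]; exact neg_ne_zero.2 (hnn h.ne2))
      · exact ⟨![0, 0, 1], by simp, by simp [comb, h1]⟩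
      · exact ⟨![0, 0, -1], by simp, by simp [comb, h1]⟩
    · intro c hc
      simp only [Finset.mem_insert, Finset.mem_singleton] at hc
      rcases hc with rfl | rfl
      · exact ⟨1, one_mem _, by simp [comb]⟩
      · exact ⟨_, h.s3.2, by simp [comb, t31, t32, t33]⟩
    · intro g hg h1 h2 h3
      exact hf.ext hB h1 h2 h3
  · rw [ncard_symmetries hB hu {![1, 0, 0], ![0, 1, 0], ![0, 0, 1], ![1, 1, 0], ![1, -1, 0],
      ![1, 0, 1], ![-1, 0, 1], ![0, 1, 1], ![0, 1, -1]} (by decide)]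
    · decide
    · intro c hc
      simp only [Finset.mem_insert, Finset.mem_singleton] at hc
      rcases hc with rfl | rfl | rfl | rfl | rfl | rfl | rfl | rfl | rfl
      · simpa [comb] using h.s1
      · simpa [comb] using h.s2
      · simpa [comb] using h.s3
      · simpa [comb] using h.add12 hB
      · simpa [comb, ← sub_eq_add_neg] using h.s12
      · simpa [comb, add_comm] using ((h.rotate hB).rotate hB).add12 hB
      · simpa [comb, neg_add_eq_sub] using h.s31 hB
      · simpa [comb] using (h.rotate hB).add12 hB
      · simpa [comb, ← sub_eq_add_neg] using h.s23
    · intro w hw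
      obtain ⟨c, (hc | hc | hc) | (hc | hc) | (hc | hc) | (hc | hc)⟩ := h.sym_cases hM hw
      · exact ⟨![1, 0, 0], by simp, c, by simpa [comb] using hc⟩
      · exact ⟨![0, 1, 0], by simp, c, by simpa [comb] using hc⟩
      · exact ⟨![0, 0, 1], by simp, c, by simpa [comb] using hc⟩
      · exact ⟨![1, 1, 0], by simp, c, by simpa [comb] using hc⟩
      · exact ⟨![1, -1, 0], by simp, c, by simpa [comb, ← sub_eq_add_neg] using hc⟩
      · exact ⟨![1, 0, 1], by simp, c, by rw [hc]; simp [comb, add_comm]⟩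
      · exact ⟨![-1, 0, 1], by simp, c, by rw [hc]; simp [comb, neg_add_eq_sub]⟩
      · exact ⟨![0, 1, 1], by simp, c, by simpa [comb] using hc⟩
      · exact ⟨![0, 1, -1], by simp, c, by simpa [comb, ← sub_eq_add_neg] using hc⟩

end IsCubic

end

section

namespace IsCubic

variable {f₁ f₂ f₃ : V}

theorem diag_ne (hB : IsTernaryForm B) (h : IsCubic B M f₁ f₂ f₃) : f₁ + f₂ + f₃ ≠ 0 := by
  intro h0
  have := congrArg (B f₁) h0
  simp only [map_add, h.h12, h.h13, map_zero, add_zero] at this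
  exact hB.ne_zero h.ne1 this

theorem diag_not_sym (hM : IsIntLattice B M) (h : IsCubic B M f₁ f₂ f₃) :
    ¬ IsSym B M (f₁ + f₂ + f₃) := by
  intro hs
  have hB := hM.toIsTernaryForm
  have h21 : B f₂ f₁ = 0 := by rw [hB.symm, h.h12]
  have h31 : B f₃ f₁ = 0 := by rw [hB.symm, h.h13]
  have h32 : B f₃ f₂ = 0 := by rw [hB.symm, h.h23]
  have n1 := hB.ne_zero h.ne1
  have n2 := hB.ne_zero h.ne2
  have n3 := hB.ne_zero h.ne3
  have c1 : B f₁ (f₁ + f₂ + f₃) = B f₁ f₁ := by simp [h.h12, h.h13]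
  have c2 : B f₂ (f₁ + f₂ + f₃) = B f₂ f₂ := by simp [h21, h.h23]
  have c3 : B f₃ (f₁ + f₂ + f₃) = B f₃ f₃ := by simp [h31, h32]
  obtain ⟨r, (h1 | h1 | h1) | (h1 | h1) | (h1 | h1) | (h1 | h1)⟩ := h.sym_cases hM hs <;>
    rw [h1] at c1 c2 c3 <;>
    simp only [map_add, map_sub, map_smul, h.h12, h.h13, h.h23, h21, h31, h32, smul_eq_mul,
      mul_zero, add_zero, sub_zero, zero_add] at c1 c2 c3
  · exact n2 c2.symm
  · exact n1 c1.symm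
  · exact n1 c1.symm
  · exact n3 c3.symm
  · exact n3 c3.symm
  · exact n2 c2.symm
  · exact n2 c2.symm
  · exact n1 c1.symm
  · exact n1 c1.symm

theorem rot_diag (hB : IsTernaryForm B) (h : IsCubic B M f₁ f₂ f₃) :
    ∃ ρ ∈ isometryGroup B M, IsRot B (f₁ + f₂ + f₃) (-1) ρ := by
  obtain ⟨a1, a2, a3⟩ := h.swap12 hB
  obtain ⟨b2, b3, b1⟩ := (h.rotate hB).swap12 hB
  have hm := mul_mem h.s23.2 h.s12.2
  have e1 : (tau B (f₂ - f₃) * tau B (f₁ - f₂) : V ≃ₗ[ℚ] V) f₁ = f₃ := by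
    rw [LinearEquiv.mul_apply, a1, b2]
  have e2 : (tau B (f₂ - f₃) * tau B (f₁ - f₂) : V ≃ₗ[ℚ] V) f₂ = f₁ := by
    rw [LinearEquiv.mul_apply, a2, b1]
  have e3 : (tau B (f₂ - f₃) * tau B (f₁ - f₂) : V ≃ₗ[ℚ] V) f₃ = f₂ := by
    rw [LinearEquiv.mul_apply, a3, b3]
  refine ⟨_, hm, h.diag_ne hB, hm.1, ?_, ?_, by norm_num, by norm_num⟩
  · rw [map_add, map_add, e1, e2, e3]; abel
  · intro v hv
    have hexp := h.toIsFrame.expand hB v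
    rw [h.q2, h.q3] at hexp
    simp only [map_add, LinearMap.add_apply] at hv
    set a := B f₁ v
    set b := B f₂ v
    rw [show B f₃ v = -a - b by linarith] at hexp
    set q := B f₁ f₁
    rw [hexp]
    simp only [map_add, map_smul, e1, e2, e3]
    module

theorem rot_four (hB : IsTernaryForm B) (h : IsCubic B M f₁ f₂ f₃) :
    ∃ g ∈ isometryGroup B M, IsRot B f₁ 0 g := by
  obtain ⟨b2, b3, b1⟩ := (h.rotate hB).swap12 hB
  have hm := mul_mem h.s23.2 h.s2.2
  have h21 : B f₂ f₁ = 0 := by rw [hB.symm, h.h12]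
  have e1 : (tau B (f₂ - f₃) * tau B f₂ : V ≃ₗ[ℚ] V) f₁ = f₁ := by
    rw [LinearEquiv.mul_apply, tau_of_orth h21, b1]
  have e2 : (tau B (f₂ - f₃) * tau B f₂ : V ≃ₗ[ℚ] V) f₂ = -f₃ := by
    rw [LinearEquiv.mul_apply, tau_self hB, map_neg, b2]
  have e3 : (tau B (f₂ - f₃) * tau B f₂ : V ≃ₗ[ℚ] V) f₃ = f₂ := by
    rw [LinearEquiv.mul_apply, tau_of_orth h.h23, b3]
  refine ⟨_, hm, h.ne1, hm.1, e1, ?_, by norm_num, by norm_num⟩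
  intro v hv
  have hexp := h.toIsFrame.expand hB v
  rw [hv] at hexp
  rw [hexp]
  simp only [map_add, map_smul, e1, e2, e3, map_neg]
  module

theorem three_axis (hM : IsIntLattice B M) (h : IsCubic B M f₁ f₂ f₃) {e : V} {ρ : V ≃ₗ[ℚ] V}
    (hρ : ρ ∈ isometryGroup B M) (hr : IsRot B e (-1) ρ) :
    ∃ σ ∈ isometryGroup B M, ∃ c : ℚ, f₁ + f₂ + f₃ = c • σ e := by
  have hB := hM.toIsTernaryForm
  have hcube := hr.cube hB
  have n1 := hB.ne_zero h.ne1
  have key : ∃ f₂' f₃', (f₂' = f₂ ∨ f₂' = -f₂) ∧ (f₃' = f₃ ∨ f₃' = -f₃) ∧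
      ∃ c : ℚ, f₁ + f₂' + f₃' = c • e := by
    have hfix : ∀ v, ρ v = v → ∃ c : ℚ, v = c • e := by
      intro v hv
      refine ⟨B e v / B e e, ?_⟩
      have ho : B e (v - (B e v / B e e) • e) = 0 := by
        rw [map_sub, map_smul, smul_eq_mul, div_mul_cancel₀ _ (hB.ne_zero hr.ne), sub_self]
      have h1 := hr.quad _ ho
      have h2 : ρ (v - (B e v / B e e) • e) = v - (B e v / B e e) • e := by
        rw [map_sub, map_smul, hv, hr.fix]
      rw [h2, h2] at h1
      have h3 : (3 : ℚ) • (v - (B e v / B e e) • e) = 0 := by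
        have := sub_eq_zero.2 h1
        rw [← this]; module
      exact sub_eq_zero.1 ((smul_eq_zero.1 h3).resolve_left (by norm_num))
    have hne1 : ¬ ∃ c : ℚ, f₁ = c • e := by
      rintro ⟨c, hc⟩
      have hc0 : c ≠ 0 := by rintro rfl; exact h.ne1 (by rw [hc, zero_smul])
      have he2 : B e f₂ = 0 := by
        have := h.h12
        rw [hc] at this
        simpa [hc0] using this
      have he3 : B e f₃ = 0 := by
        have := h.h13
        rw [hc] at this
        simpa [hc0] using this
      have h1 := hr.form hB he2
      have h2 : B f₂ f₂ ≠ 0 := hB.ne_zero h.ne2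
      rcases h.short_cases hM (h.s2.map hρ) (by rw [hρ.1, h.q2]) with (h3 | h3) | (h3 | h3) |
        (h3 | h3) <;> rw [h3] at h1 <;>
        (try simp only [map_neg, h.h23, hB.symm f₂ f₁, h.h12] at h1) <;> apply h2 <;> linarith
    have hone : ρ f₁ ≠ f₁ := fun h1 => hne1 (hfix _ h1)
    have hneg : ρ f₁ ≠ -f₁ := by
      intro h1
      have h2 := hcube f₁
      rw [h1, map_neg, h1, neg_neg, h1] at h2
      exact neg_ne h.ne1 h2
    obtain ⟨c, hc⟩ := hfix (f₁ + ρ f₁ + ρ (ρ f₁)) (by rw [map_add, map_add, hcube]; abel)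
    have ho : B f₁ (ρ f₁) = 0 := by
      rcases h.short_cases hM (h.s1.map hρ) (hρ.1 _ _) with (h3 | h3) | (h3 | h3) | (h3 | h3)
      · exact absurd h3 hone
      · exact absurd h3 hneg
      all_goals rw [h3]; simp [h.h12, h.h13]
    have ho2 : B f₁ (ρ (ρ f₁)) = 0 := by
      rw [hB.symm, ← hρ.1, hcube, ho]
    have ho3 : B (ρ f₁) (ρ (ρ f₁)) = 0 := by rw [hρ.1, ho]
    have n2 := hB.ne_zero h.ne2
    have n3 := hB.ne_zero h.ne3
    have q2 : B (ρ (ρ f₁)) (ρ (ρ f₁)) = B f₁ f₁ := by rw [hρ.1, hρ.1]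
    rcases h.short_cases hM (h.s1.map hρ) (hρ.1 _ _) with (h3 | h3) | (h3 | h3) | (h3 | h3)
    · exact absurd h3 hone
    · exact absurd h3 hneg
    · rcases h.short_cases hM ((h.s1.map hρ).map hρ) q2 with (h4 | h4) | (h4 | h4) | h4
      · rw [h4] at ho2; exact absurd ho2 n1
      · rw [h4] at ho2; simp [n1] at ho2
      · rw [h3] at ho3 h4; rw [h4] at ho3; exact absurd ho3 n2
      · rw [h3] at ho3 h4; rw [h4] at ho3; simp [n2] at ho3
      · exact ⟨ρ f₁, ρ (ρ f₁), Or.inl h3, h4, c, hc⟩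
    · rcases h.short_cases hM ((h.s1.map hρ).map hρ) q2 with (h4 | h4) | (h4 | h4) | h4
      · rw [h4] at ho2; exact absurd ho2 n1
      · rw [h4] at ho2; simp [n1] at ho2
      · rw [h3] at ho3 h4; rw [h4] at ho3; simp [n2] at ho3
      · rw [h3] at ho3 h4; rw [h4] at ho3; simp [n2] at ho3
      · exact ⟨ρ f₁, ρ (ρ f₁), Or.inr h3, h4, c, hc⟩
    · rcases h.short_cases hM ((h.s1.map hρ).map hρ) q2 with (h4 | h4) | h4 | (h4 | h4)
      · rw [h4] at ho2; exact absurd ho2 n1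
      · rw [h4] at ho2; simp [n1] at ho2
      · exact ⟨ρ (ρ f₁), ρ f₁, h4, Or.inl h3, c, by rw [← hc]; abel⟩
      · rw [h3] at ho3 h4; rw [h4] at ho3; exact absurd ho3 n3
      · rw [h3] at ho3 h4; rw [h4] at ho3; simp [n3] at ho3
    · rcases h.short_cases hM ((h.s1.map hρ).map hρ) q2 with (h4 | h4) | h4 | (h4 | h4)
      · rw [h4] at ho2; exact absurd ho2 n1
      · rw [h4] at ho2; simp [n1] at ho2
      · exact ⟨ρ (ρ f₁), ρ f₁, h4, Or.inr h3, c, by rw [← hc]; abel⟩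
      · rw [h3] at ho3 h4; rw [h4] at ho3; simp [n3] at ho3
      · rw [h3] at ho3 h4; rw [h4] at ho3; simp [n3] at ho3
  obtain ⟨f₂', f₃', h2, h3, c, hc⟩ := key
  have h21 : B f₂ f₁ = 0 := by rw [hB.symm, h.h12]
  have h31 : B f₃ f₁ = 0 := by rw [hB.symm, h.h13]
  have h32 : B f₃ f₂ = 0 := by rw [hB.symm, h.h23]
  suffices hσ : ∃ σ ∈ isometryGroup B M, σ (f₁ + f₂' + f₃') = f₁ + f₂ + f₃ by
    obtain ⟨σ, hσ, h4⟩ := hσ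
    exact ⟨σ, hσ, c, by rw [← h4, hc, map_smul]⟩
  rcases h2 with rfl | rfl <;> rcases h3 with rfl | rfl
  · exact ⟨1, one_mem _, rfl⟩
  · exact ⟨_, h.s3.2, by simp [tau_self hB, tau_of_orth h31, tau_of_orth h32]⟩
  · exact ⟨_, h.s2.2, by simp [tau_self hB, tau_of_orth h21, tau_of_orth h.h23]⟩
  · exact ⟨_, mul_mem h.s3.2 h.s2.2, by simp [tau_self hB, tau_of_orth h21, tau_of_orth h.h23,
      tau_of_orth h31, tau_of_orth h32]⟩

theorem four_axis (hM : IsIntLattice B M) (h : IsCubic B M f₁ f₂ f₃) {e : V} {g : V ≃ₗ[ℚ] V}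
    (hg : g ∈ isometryGroup B M) (hr : IsRot B e 0 g) :
    ∃ σ ∈ isometryGroup B M, ∃ c : ℚ, f₁ = c • σ e := by
  have hB := hM.toIsTernaryForm
  have he := hr.sym_axis hB hg
  have key : ∀ f₁ f₂ f₃ : V, IsCubic B M f₁ f₂ f₃ → ∀ r s : ℚ, e = r • (f₁ + s • f₂) → s ≠ 0 →
      False := by
    intro f₁ f₂ f₃ h r s her hs
    have hr0 : r ≠ 0 := by rintro rfl; exact hr.ne (by rw [her, zero_smul])
    have h21 : B f₂ f₁ = 0 := by rw [hB.symm, h.h12]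
    have he3 : B e f₃ = 0 := by rw [her]; simp [h.h13, h.h23]
    have h1 := hr.orth_apply he3
    have h2 := hr.form hB he3
    rcases h.short_cases hM (h.s3.map hg) (by rw [hg.1, h.q3]) with (h3 | h3) | (h3 | h3) |
      (h3 | h3) <;> rw [h3] at h1 h2 <;>
      simp [her, hr0, hs, h21, h.h12, hB.ne_zero h.ne1, hB.ne_zero h.ne2, hB.ne_zero h.ne3] at h1 h2
  have hinv : ∀ {r : ℚ} {v : V}, e = r • v → ∃ c : ℚ, v = c • e := by
    intro r v hv
    have hr0 : r ≠ 0 := by rintro rfl; exact hr.ne (by rw [hv, zero_smul])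
    exact ⟨r⁻¹, by rw [hv, smul_smul, inv_mul_cancel₀ hr0, one_smul]⟩
  have hr2 := h.rotate hB
  have hr3 := hr2.rotate hB
  obtain ⟨r, (h1 | h1 | h1) | (h1 | h1) | (h1 | h1) | (h1 | h1)⟩ := h.sym_cases hM he
  · obtain ⟨c, hc⟩ := hinv h1
    exact ⟨1, one_mem _, c, hc⟩
  · obtain ⟨c, hc⟩ := hinv h1
    refine ⟨_, h.s12.2, c, ?_⟩
    rw [← map_smul, ← hc, (h.swap12 hB).2.1]
  · obtain ⟨c, hc⟩ := hinv h1
    refine ⟨_, (h.s31 hB).2, c, ?_⟩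
    rw [← map_smul, ← hc, (hr3.swap12 hB).1]
  · exact (key _ _ _ h r 1 (by rw [h1, one_smul]) (by norm_num)).elim
  · exact (key _ _ _ h r (-1) (by rw [h1, neg_one_smul, sub_eq_add_neg]) (by norm_num)).elim
  · exact (key _ _ _ hr3 r 1 (by rw [h1, one_smul]) (by norm_num)).elim
  · exact (key _ _ _ hr3 r (-1) (by rw [h1, neg_one_smul, sub_eq_add_neg]) (by norm_num)).elim
  · exact (key _ _ _ hr2 r 1 (by rw [h1, one_smul]) (by norm_num)).elim
  · exact (key _ _ _ hr2 r (-1) (by rw [h1, neg_one_smul, sub_eq_add_neg]) (by norm_num)).elim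

theorem exists_orth (hM : IsIntLattice B M) (h : IsCubic B M f₁ f₂ f₃) {z : V}
    (hz : IsSym B M z) : ∃ y, IsSym B M y ∧ B z y = 0 := by
  have hB := hM.toIsTernaryForm
  have h21 : B f₂ f₁ = 0 := by rw [hB.symm, h.h12]
  have h31 : B f₃ f₁ = 0 := by rw [hB.symm, h.h13]
  have h32 : B f₃ f₂ = 0 := by rw [hB.symm, h.h23]
  obtain ⟨r, (rfl | rfl | rfl) | (rfl | rfl) | (rfl | rfl) | (rfl | rfl)⟩ := h.sym_cases hM hz
  · exact ⟨f₂, h.s2, by simp [h.h12]⟩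
  · exact ⟨f₃, h.s3, by simp [h.h23]⟩
  · exact ⟨f₁, h.s1, by simp [h31]⟩
  · exact ⟨f₃, h.s3, by simp [h.h13, h.h23]⟩
  · exact ⟨f₃, h.s3, by simp [h.h13, h.h23]⟩
  · exact ⟨f₂, h.s2, by simp [h.h12, h32]⟩
  · exact ⟨f₂, h.s2, by simp [h.h12, h32]⟩
  · exact ⟨f₁, h.s1, by simp [h21, h31]⟩
  · exact ⟨f₁, h.s1, by simp [h21, h31]⟩

end IsCubic

/-! ### The possible isometry groups -/

/-- The seven possible types of isometry groups. -/
theorem IsIntLattice.holohedry (hM : IsIntLattice B M) :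
    ((∀ x, ¬ IsSym B M x) ∧ NoRot B M ∧
      Nat.card (isometryGroup B M) = 2 ∧ (symmetries B M).ncard = 0) ∨
    ((∃ x, IsSym B M x ∧ ∀ y, IsSym B M y → ∃ c : ℚ, y = c • x) ∧ NoRot B M ∧
      Nat.card (isometryGroup B M) = 4 ∧ (symmetries B M).ncard = 1) ∨
    ((∃ x y z, IsFrame B x y z ∧ IsSym B M x ∧ IsSym B M y ∧ IsSym B M z ∧
        ∀ w, IsSym B M w → ∃ c : ℚ, w = c • x ∨ w = c • y ∨ w = c • z) ∧
      NoRot B M ∧ Nat.card (isometryGroup B M) = 8 ∧ (symmetries B M).ncard = 3) ∨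
    ((∃ e g, IsAxial B M e (-1) g ∧ ¬ IsSym B M e) ∧
      (∀ y z, IsSym B M y → IsSym B M z → B y z ≠ 0) ∧
      Nat.card (isometryGroup B M) = 12 ∧ (symmetries B M).ncard = 3) ∨
    ((∃ e g, IsAxial B M e 0 g) ∧
      Nat.card (isometryGroup B M) = 16 ∧ (symmetries B M).ncard = 5) ∨
    ((∃ e g, IsAxial B M e (-1) g ∧ IsSym B M e) ∧
      Nat.card (isometryGroup B M) = 24 ∧ (symmetries B M).ncard = 7) ∨
    ((∃ f₁ f₂ f₃, IsCubic B M f₁ f₂ f₃) ∧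
      Nat.card (isometryGroup B M) = 48 ∧ (symmetries B M).ncard = 9) := by
  have hB := hM.toIsTernaryForm
  by_cases hc : ∃ f₁ f₂ f₃, IsCubic B M f₁ f₂ f₃
  · obtain ⟨f₁, f₂, f₃, h⟩ := hc
    iterate 6 right
    exact ⟨⟨_, _, _, h⟩, h.card hM⟩
  by_cases hr : NoRot B M
  · by_cases hs : ∃ x, IsSym B M x
    · obtain ⟨x, hx⟩ := hs
      by_cases h1 : ∀ y, IsSym B M y → ∃ c : ℚ, y = c • x
      · exact Or.inr (Or.inl ⟨⟨x, hx, h1⟩, hr, card_of_one_sym hB hr hx h1⟩)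
      · push Not at h1
        obtain ⟨y, hy, hyx⟩ := h1
        have h0 := (hr.orth hB hx hy).resolve_right (by simpa using hyx)
        obtain ⟨z, hf⟩ := exists_frame_of_orth hB hx.1 hy.1 h0
        obtain ⟨h2, h3⟩ := card_of_ortho hB hr hf hx hy
        exact Or.inr (Or.inr (Or.inl ⟨⟨x, y, z, hf, hx, hy, hx.third hB hf hy, h2⟩, hr, h3⟩))
    · push Not at hs
      exact Or.inl ⟨hs, hr, card_of_no_sym hB hr hs⟩
  · unfold NoRot at hr
    push Not at hr
    obtain ⟨e, t₀, g₀, hg₀, h₀⟩ := hr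
    obtain ⟨t, g, ht, hg, h⟩ := hM.normal_rot h₀ hg₀
    have hax : IsAxial B M e t g := by
      refine ⟨h, hg, fun z hz => ?_, fun e' t' g' hg' h' => ?_⟩
      · by_contra hne
        push Not at hne
        exact hc (hM.cubic_of_oblique h hg hz hne.1 (by simpa using hne.2))
      · by_contra hne
        exact hc (hM.cubic_of_two_axes h hg h' hg' hne)
    rcases ht with rfl | rfl
    · exact Or.inr (Or.inr (Or.inr (Or.inr (Or.inl ⟨⟨e, g, hax⟩, hax.tetragonal hM⟩))))
    · by_cases he : IsSym B M e
      · exact Or.inr (Or.inr (Or.inr (Or.inr (Or.inr (Or.inl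
          ⟨⟨e, g, hax, he⟩, hax.hexagonal hM he⟩)))))
      · obtain ⟨h1, h2⟩ := hax.trigonal hM he
        exact Or.inr (Or.inr (Or.inr (Or.inl ⟨⟨e, g, hax, he⟩, h2, h1⟩)))

end

section

/-! ### Divisibility by a prime -/

/-- The rational number `c` is an integral multiple of `p`. -/
def PDvd (p : ℕ) (c : ℚ) : Prop := ∃ k : ℤ, c = (p : ℚ) * k

variable {p : ℕ}

theorem pdvd_intCast {k : ℤ} : PDvd p (k : ℚ) ↔ (p : ℤ) ∣ k := by
  constructor
  · rintro ⟨m, hm⟩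
    exact ⟨m, by exact_mod_cast hm⟩
  · rintro ⟨m, hm⟩
    exact ⟨m, by exact_mod_cast hm⟩

theorem PDvd.add {a b : ℚ} (ha : PDvd p a) (hb : PDvd p b) : PDvd p (a + b) := by
  obtain ⟨k, rfl⟩ := ha
  obtain ⟨l, rfl⟩ := hb
  exact ⟨k + l, by push_cast; ring⟩

theorem PDvd.neg {a : ℚ} (ha : PDvd p a) : PDvd p (-a) := by
  obtain ⟨k, rfl⟩ := ha
  exact ⟨-k, by push_cast; ring⟩

theorem PDvd.sub {a b : ℚ} (ha : PDvd p a) (hb : PDvd p b) : PDvd p (a - b) := by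
  rw [sub_eq_add_neg]; exact ha.add hb.neg

theorem PDvd.int_mul {a : ℚ} (ha : PDvd p a) (n : ℤ) : PDvd p (n * a) := by
  obtain ⟨k, rfl⟩ := ha
  exact ⟨n * k, by push_cast; ring⟩

theorem pdvd_zero : PDvd p 0 := ⟨0, by simp⟩

theorem pdvd_self_mul (k : ℤ) : PDvd p ((p : ℚ) * k) := ⟨k, rfl⟩

/-- `x ∈ pM`. -/
def InMul (p : ℕ) (M : Submodule ℤ V) (x : V) : Prop := ∃ v ∈ M, x = (p : ℤ) • v

omit [Module ℚ V] in
theorem InMul.mem {x : V} (h : InMul p M x) : x ∈ M := by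
  obtain ⟨v, hv, rfl⟩ := h
  exact M.smul_mem _ hv

omit [Module ℚ V] in
theorem InMul.add {x y : V} (hx : InMul p M x) (hy : InMul p M y) : InMul p M (x + y) := by
  obtain ⟨v, hv, rfl⟩ := hx
  obtain ⟨w, hw, rfl⟩ := hy
  exact ⟨v + w, M.add_mem hv hw, by rw [smul_add]⟩

omit [Module ℚ V] in
theorem InMul.smul {x : V} (hx : InMul p M x) (n : ℤ) : InMul p M (n • x) := by
  obtain ⟨v, hv, rfl⟩ := hx
  exact ⟨n • v, M.smul_mem _ hv, by rw [smul_comm]⟩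

omit [Module ℚ V] in
theorem InMul.neg {x : V} (hx : InMul p M x) : InMul p M (-x) := by
  simpa using hx.smul (-1)

omit [Module ℚ V] in
theorem InMul.sub {x y : V} (hx : InMul p M x) (hy : InMul p M y) : InMul p M (x - y) := by
  rw [sub_eq_add_neg]; exact hx.add hy.neg

omit [Module ℚ V] in
/-- If `p ∤ n` and `nx`, `px` both lie in a lattice, then so does `x`. -/
theorem mem_of_smul_mem (hp : p.Prime) {n : ℤ} (hn : ¬ (p : ℤ) ∣ n) {x : V} (h1 : n • x ∈ M)
    (h2 : (p : ℤ) • x ∈ M) : x ∈ M := by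
  have hc : IsCoprime (p : ℤ) n := (Prime.coprime_iff_not_dvd (Nat.prime_iff_prime_int.1 hp)).2 hn
  obtain ⟨a, b, hab⟩ := hc
  have : x = a • (p : ℤ) • x + b • n • x := by
    rw [smul_smul, smul_smul, ← add_smul, hab, one_smul]
  rw [this]
  exact M.add_mem (M.smul_mem _ h2) (M.smul_mem _ h1)

omit [Module ℚ V] in
theorem inMul_of_smul (hp : p.Prime) {n : ℤ} (hn : ¬ (p : ℤ) ∣ n) {x : V} (hx : x ∈ M)
    (h1 : InMul p M (n • x)) : InMul p M x := by
  have hc : IsCoprime (p : ℤ) n := (Prime.coprime_iff_not_dvd (Nat.prime_iff_prime_int.1 hp)).2 hn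
  obtain ⟨a, b, hab⟩ := hc
  have : x = (p : ℤ) • a • x + b • n • x := by
    rw [smul_smul, smul_smul, ← add_smul, mul_comm, hab, one_smul]
  rw [this]
  exact InMul.add ⟨_, M.smul_mem _ hx, rfl⟩ (h1.smul b)

/-! ### The lattice `Λ_p(M)` -/

theorem mem_watson (hp : p.Prime) (hp2 : p ≠ 2) (hM : IsIntLattice B M) {x : V} :
    x ∈ watson B p M ↔ x ∈ M ∧ ∀ y ∈ M, PDvd p (B x y) := by
  change (x ∈ M ∧ ∀ y ∈ M, ∃ k : ℤ, B (x + y) (x + y) - B y y = (p : ℚ) * k) ↔ _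
  have hexp : ∀ y, B (x + y) (x + y) - B y y = B x x + 2 * B x y := by
    intro y
    simp only [map_add, LinearMap.add_apply, hM.symm y x]; ring
  constructor
  · rintro ⟨hx, h⟩
    refine ⟨hx, fun y hy => ?_⟩
    obtain ⟨k, hk⟩ := h y hy
    obtain ⟨k₀, hk₀⟩ := h 0 M.zero_mem
    obtain ⟨b, hb⟩ := hM.integral x hx y hy
    rw [hexp] at hk hk₀
    rw [map_zero, mul_zero, add_zero] at hk₀
    rw [hb]
    rw [hk₀, hb] at hk
    rw [pdvd_intCast]
    have h2 : (p : ℤ) ∣ 2 * b := ⟨k - k₀, by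
      have : (2 * b : ℚ) = p * (k - k₀) := by linarith
      exact_mod_cast this⟩
    refine ((Nat.prime_iff_prime_int.1 hp).dvd_or_dvd h2).resolve_left ?_
    intro h3
    exact hp2 ((Nat.prime_dvd_prime_iff_eq hp Nat.prime_two).1 (by exact_mod_cast h3))
  · rintro ⟨hx, h⟩
    refine ⟨hx, fun y hy => ?_⟩
    rw [hexp]
    have h2 : PDvd p (B x x + 2 * B x y) := by exact_mod_cast (h x hx).add ((h y hy).int_mul 2)
    exact h2

theorem isLattice_watson (hp : p.Prime) (hp2 : p ≠ 2) (hM : IsIntLattice B M) :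
    IsIntLattice B (watson B p M) := by
  have hle : watson B p M ≤ M := fun x hx => ((mem_watson hp hp2 hM).1 hx).1
  have hl := hM.lattice
  refine ⟨hM.toIsTernaryForm, ⟨?_, ?_⟩, fun x hx y hy => hM.integral x (hle hx) y (hle hy)⟩
  · have : IsNoetherian ℤ M := isNoetherian_of_isNoetherianRing_of_finite ℤ M
    rw [← Module.Finite.iff_fg]
    have : IsNoetherian ℤ ↥(watson B p M) := isNoetherian_of_le hle
    infer_instance
  · rw [eq_top_iff, ← hl.span_eq_top, Submodule.span_le]
    intro x hx
    have hpx : (p : ℤ) • x ∈ watson B p M := by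
      rw [mem_watson hp hp2 hM]
      refine ⟨M.smul_mem _ hx, fun y hy => ?_⟩
      obtain ⟨b, hb⟩ := hM.integral x hx y hy
      rw [← Int.cast_smul_eq_zsmul ℚ, map_smul, LinearMap.smul_apply, hb]
      exact ⟨b, by simp⟩
    have : x = (p : ℚ)⁻¹ • ((p : ℤ) • x) := by
      rw [← Int.cast_smul_eq_zsmul ℚ, smul_smul, Int.cast_natCast,
        inv_mul_cancel₀ (by exact_mod_cast hp.ne_zero), one_smul]
    rw [SetLike.mem_coe, this]
    exact Submodule.smul_mem _ _ (Submodule.subset_span hpx)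

/-- `M` is integral, and its form is neither zero nor non-degenerate modulo the odd prime `p`. -/
structure Adm (p : ℕ) (B : LinearMap.BilinForm ℚ V) (M : Submodule ℤ V) : Prop
    extends IsIntLattice B M where
  prime : p.Prime
  odd : p ≠ 2
  ndeg : ∃ x ∈ M, ∃ y ∈ M, ¬ PDvd p (B x y)
  radical : ∃ x ∈ watson B p M, ¬ InMul p M x

/-- The form on `M` has rank at most one modulo `p`. -/
def RankOne (p : ℕ) (B : LinearMap.BilinForm ℚ V) (M : Submodule ℤ V) : Prop :=
  ∀ x ∈ M, ∀ y ∈ M, ∀ z ∈ M, ∀ w ∈ M, PDvd p (B x y * B z w - B x w * B z y)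

namespace Adm

theorem mem_watson (h : Adm p B M) {x : V} :
    x ∈ watson B p M ↔ x ∈ M ∧ ∀ y ∈ M, PDvd p (B x y) :=
  TernaryLattice.mem_watson h.prime h.odd h.toIsIntLattice

theorem prime_int (h : Adm p B M) : Prime (p : ℤ) := Nat.prime_iff_prime_int.1 h.prime

theorem watson_le (h : Adm p B M) : watson B p M ≤ M := fun _ hx => (h.mem_watson.1 hx).1

theorem inMul_mem_watson (h : Adm p B M) {x : V} (hx : InMul p M x) : x ∈ watson B p M := by
  refine h.mem_watson.2 ⟨hx.mem, fun y hy => ?_⟩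
  obtain ⟨v, hv, rfl⟩ := hx
  obtain ⟨b, hb⟩ := h.integral v hv y hy
  rw [← Int.cast_smul_eq_zsmul ℚ, map_smul, LinearMap.smul_apply, hb]
  exact ⟨b, by simp⟩

theorem two_not_dvd (h : Adm p B M) : ¬ (p : ℤ) ∣ 2 := fun h3 =>
  h.odd ((Nat.prime_dvd_prime_iff_eq h.prime Nat.prime_two).1 (by exact_mod_cast h3))

theorem smul_mem_watson (h : Adm p B M) {n : ℤ} (hn : ¬ (p : ℤ) ∣ n) {x : V} (hx : x ∈ M)
    (h1 : n • x ∈ watson B p M) : x ∈ watson B p M :=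
  mem_of_smul_mem h.prime hn h1 (h.inMul_mem_watson ⟨x, hx, rfl⟩)

theorem exists_relation (h : Adm p B M) (v : Fin 4 → V) (hv : ∀ i, v i ∈ M) :
    ∃ c : Fin 4 → ℤ, (∃ i, ¬ (p : ℤ) ∣ c i) ∧ InMul p M (∑ i, c i • v i) := by
  have hl := h.lattice
  have : Fact p.Prime := ⟨h.prime⟩
  have hfree : Module.Free ℤ M := Submodule.IsLattice.free ℚ M
  have hrank : Module.finrank ℤ M = 3 := by
    rw [← h.finrank_eq]
    simp only [Module.finrank, Submodule.IsLattice.rank' ℚ M]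
  let b : Module.Basis (Fin 3) ℤ M := Module.finBasisOfFinrankEq ℤ M hrank
  let u : Fin 4 → Fin 3 → ZMod p := fun i j => ((b.repr ⟨v i, hv i⟩ j : ℤ) : ZMod p)
  have hdep : ¬ LinearIndependent (ZMod p) u := by
    intro hli
    have := hli.fintype_card_le_finrank
    simp at this
  rw [Fintype.not_linearIndependent_iff] at hdep
  obtain ⟨g, hg, i, hi⟩ := hdep
  refine ⟨fun i => (g i).val, ⟨i, ?_⟩, ?_⟩
  · intro hd
    apply hi
    rw [← ZMod.natCast_zmod_val (g i)]
    have := (ZMod.intCast_zmod_eq_zero_iff_dvd ((g i).val : ℤ) p).2 hd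
    exact_mod_cast this
  · set m : M := ∑ i, ((g i).val : ℤ) • (⟨v i, hv i⟩ : M) with hm
    have hco : ∀ j, (p : ℤ) ∣ b.repr m j := by
      intro j
      have h1 := congrFun hg j
      rw [Finset.sum_apply] at h1
      simp only [Pi.smul_apply, smul_eq_mul, Pi.zero_apply, u] at h1
      rw [← ZMod.intCast_zmod_eq_zero_iff_dvd, hm]
      simp only [map_sum, map_smul, Finsupp.coe_finsetSum, Finset.sum_apply, Finsupp.smul_apply,
        smul_eq_mul, Int.cast_sum, Int.cast_mul]
      rw [← h1]
      refine Finset.sum_congr rfl fun i _ => ?_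
      rw [Int.cast_natCast, ZMod.natCast_zmod_val]
    choose c hc using hco
    refine ⟨((∑ j, c j • b j : M) : V), Submodule.coe_mem _, ?_⟩
    have h2 : m = (p : ℤ) • ∑ j, c j • b j := by
      conv_lhs => rw [← b.sum_repr m]
      rw [Finset.smul_sum]
      refine Finset.sum_congr rfl fun j _ => ?_
      rw [hc, mul_smul]
    have h3 := congrArg (Subtype.val) h2
    rw [hm] at h3
    simpa using h3

/-- If the form has rank one, then `M/Λ_p(M)` is generated by any of its nonzero elements. -/
theorem cyclic_quot (h : Adm p B M) (h1 : RankOne p B M) {g : V} (hg : g ∈ M)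
    (hgn : g ∉ watson B p M) {v : V} (hv : v ∈ M) : ∃ a : ℤ, v - a • g ∈ watson B p M := by
  have : ∃ y ∈ M, ¬ PDvd p (B g y) := by
    by_contra hne
    push Not at hne
    exact hgn (h.mem_watson.2 ⟨hg, hne⟩)
  obtain ⟨y, hy, hgy⟩ := this
  obtain ⟨b, hb⟩ := h.integral g hg y hy
  obtain ⟨d, hd⟩ := h.integral v hv y hy
  rw [hb, pdvd_intCast] at hgy
  obtain ⟨r, s, hrs⟩ := (Prime.coprime_iff_not_dvd h.prime_int).2 hgy
  refine ⟨s * d, h.mem_watson.2 ⟨M.sub_mem hv (M.smul_mem _ hg), fun z hz => ?_⟩⟩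
  obtain ⟨e, he⟩ := h.integral v hv z hz
  obtain ⟨f, hf⟩ := h.integral g hg z hz
  have h2 := h1 v hv z hz g hg y hy
  rw [he, hb, hd, hf] at h2
  rw [← Int.cast_smul_eq_zsmul ℚ, map_sub, map_smul, LinearMap.sub_apply, LinearMap.smul_apply,
    he, hf]
  have h3 := (h2.int_mul s).add (pdvd_self_mul (r * e))
  convert h3 using 1
  have : (r * p + s * b : ℚ) = 1 := by exact_mod_cast hrs
  push_cast
  simp only [smul_eq_mul]
  linear_combination (-e : ℚ) * this

theorem relation_of_not_rankOne (h : Adm p B M) (h1 : ¬ RankOne p B M) {m n : V}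
    (hm : m ∈ watson B p M) (hn : n ∈ watson B p M) :
    ∃ a b : ℤ, (¬ (p : ℤ) ∣ a ∨ ¬ (p : ℤ) ∣ b) ∧ InMul p M (a • m + b • n) := by
  unfold RankOne at h1
  push Not at h1
  obtain ⟨x, hx, y, hy, z, hz, w, hw, hne⟩ := h1
  obtain ⟨xy, exy⟩ := h.integral x hx y hy
  obtain ⟨xw, exw⟩ := h.integral x hx w hw
  obtain ⟨zy, ezy⟩ := h.integral z hz y hy
  obtain ⟨zw, ezw⟩ := h.integral z hz w hw
  obtain ⟨c, hc, hs⟩ := h.exists_relation ![x, z, m, n] (by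
    intro i; fin_cases i
    exacts [hx, hz, h.watson_le hm, h.watson_le hn])
  rw [Fin.sum_univ_four] at hs
  simp only [Matrix.cons_val_zero, Matrix.cons_val_one, Matrix.cons_val] at hs
  have hkill : ∀ u ∈ M, PDvd p (c 0 * B x u + c 1 * B z u) := by
    intro u hu
    have e1 := (h.mem_watson.1 (h.inMul_mem_watson hs)).2 u hu
    have e2 := ((h.mem_watson.1 hm).2 u hu).int_mul (c 2)
    have e3 := ((h.mem_watson.1 hn).2 u hu).int_mul (c 3)
    simp only [← Int.cast_smul_eq_zsmul ℚ, map_add, map_smul, LinearMap.add_apply,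
      LinearMap.smul_apply, smul_eq_mul] at e1
    convert (e1.sub e2).sub e3 using 1; ring
  have k1 := hkill y hy
  have k2 := hkill w hw
  rw [exy, ezy] at k1
  rw [exw, ezw] at k2
  rw [exy, exw, ezy, ezw] at hne
  have hdet : ∀ i : ℤ, PDvd p (i * (xy * zw - xw * zy)) → (p : ℤ) ∣ i := by
    intro i hi
    have h2 : (p : ℤ) ∣ i * (xy * zw - xw * zy) := by
      rw [← pdvd_intCast]; push_cast; exact hi
    refine (h.prime_int.dvd_or_dvd h2).resolve_right fun h3 => hne ?_
    rw [← pdvd_intCast] at h3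
    exact_mod_cast h3
  have c0 : (p : ℤ) ∣ c 0 := by
    apply hdet
    convert (k1.int_mul zw).sub (k2.int_mul zy) using 1; ring
  have c1 : (p : ℤ) ∣ c 1 := by
    apply hdet
    convert (k2.int_mul xy).sub (k1.int_mul xw) using 1; ring
  refine ⟨c 2, c 3, ?_, ?_⟩
  · obtain ⟨i, hi⟩ := hc
    fin_cases i
    · exact absurd c0 hi
    · exact absurd c1 hi
    · exact Or.inl hi
    · exact Or.inr hi
  · obtain ⟨d0, e0⟩ := c0
    obtain ⟨d1, e1⟩ := c1
    have h4 : InMul p M (c 0 • x) := ⟨d0 • x, M.smul_mem _ hx, by rw [e0, mul_smul]⟩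
    have h5 : InMul p M (c 1 • z) := ⟨d1 • z, M.smul_mem _ hz, by rw [e1, mul_smul]⟩
    convert (hs.sub h4).sub h5 using 1; abel

/-- If the form does not have rank one, then `Λ_p(M)/pM` is cyclic. -/
theorem cyclic_radical (h : Adm p B M) (h1 : ¬ RankOne p B M) {g : V} (hg : g ∈ watson B p M)
    (hgn : ¬ InMul p M g) {v : V} (hv : v ∈ watson B p M) : ∃ a : ℤ, InMul p M (v - a • g) := by
  obtain ⟨a, b, hab, hs⟩ := h.relation_of_not_rankOne h1 hv hg
  have ha : ¬ (p : ℤ) ∣ a := by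
    intro ha
    have hb := hab.resolve_left (not_not.2 ha)
    obtain ⟨d, rfl⟩ := ha
    have h4 : InMul p M ((p * d : ℤ) • v) := ⟨d • v, M.smul_mem _ (h.watson_le hv), by
      rw [mul_smul]⟩
    refine hgn (inMul_of_smul h.prime hb (h.watson_le hg) ?_)
    convert hs.sub h4 using 1; abel
  obtain ⟨r, s, hrs⟩ := (Prime.coprime_iff_not_dvd h.prime_int).2 ha
  refine ⟨-(s * b), ?_⟩
  have h5 : InMul p M ((p : ℤ) • r • v) := ⟨r • v, M.smul_mem _ (h.watson_le hv), rfl⟩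
  convert (hs.smul s).add h5 using 1
  have : v = (r * p + s * a) • v := by rw [hrs, one_smul]
  nth_rewrite 1 [this]
  simp only [smul_add, smul_smul, add_smul, neg_smul, sub_neg_eq_add]
  rw [mul_comm (p : ℤ) r]; abel

end Adm

end

section

variable {p : ℕ}

theorem zsmul_cancel {n : ℤ} (hn : n ≠ 0) {x y : V} (h : n • x = n • y) : x = y := by
  by_contra hne
  exact zsmul_ne_zero hn (sub_ne_zero.2 hne) (by rw [smul_sub, h, sub_self])

/-- `e` is a primitive vector of `M`, and `c B(e, M) ⊆ Q(e)ℤ`. -/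
structure IsAxisVec (c : ℤ) (B : LinearMap.BilinForm ℚ V) (M : Submodule ℤ V) (e : V) : Prop where
  primitive : IsPrimitiveVector M e
  coeff : ∀ v ∈ M, ∃ k : ℤ, c * B e v = k * B e e

/-- `e` generates the anisotropic line of `M` modulo `p` (rank one), or its radical (rank two). -/
def Spec (p : ℕ) (B : LinearMap.BilinForm ℚ V) (M : Submodule ℤ V) (e : V) : Prop :=
  (RankOne p B M ∧ e ∉ watson B p M) ∨ (¬ RankOne p B M ∧ e ∈ watson B p M)

theorem IsIntLattice.axisVec_of_sym (hM : IsIntLattice B M) {x : V} (hx : IsPrimitiveVector M x)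
    (hs : IsSym B M x) : IsAxisVec 2 B M x :=
  ⟨hx, fun v hv => by simpa using hM.root_integral hx hs.2 hv⟩

namespace Adm

theorem coprime_cancel (h : Adm p B M) {a b : ℤ} (hab : (p : ℤ) ∣ a * b) (ha : ¬ (p : ℤ) ∣ a) :
    (p : ℤ) ∣ b := (h.prime_int.dvd_or_dvd hab).resolve_left ha

theorem not_inMul_of_primitive (h : Adm p B M) {e : V} (he : IsPrimitiveVector M e) :
    ¬ InMul p M e := by
  rintro ⟨v, hv, hev⟩
  exact h.prime_int.not_isUnit (he.2 _ v hv hev)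

theorem axis_mem_watson_iff (h : Adm p B M) {c : ℤ} (hc : ¬ (p : ℤ) ∣ c) {e : V}
    (he : IsAxisVec c B M e) : e ∈ watson B p M ↔ PDvd p (B e e) := by
  refine ⟨fun h1 => (h.mem_watson.1 h1).2 e he.primitive.1,
    fun h1 => h.mem_watson.2 ⟨he.primitive.1, fun v hv => ?_⟩⟩
  obtain ⟨k, hk⟩ := he.coeff v hv
  obtain ⟨b, hb⟩ := h.integral e he.primitive.1 v hv
  have h2 := h1.int_mul k
  rw [← hk, hb] at h2
  rw [hb, pdvd_intCast]
  refine h.coprime_cancel ?_ hc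
  rw [← pdvd_intCast]; push_cast; exact h2

theorem primitive_watson_of_mem (h : Adm p B M) {e : V} (he : IsPrimitiveVector M e)
    (h1 : e ∈ watson B p M) : IsPrimitiveVector (watson B p M) e :=
  ⟨h1, fun n y hy => he.2 n y (h.watson_le hy)⟩

theorem primitive_watson_of_not_mem (h : Adm p B M) {e : V} (he : IsPrimitiveVector M e)
    (h1 : e ∉ watson B p M) : IsPrimitiveVector (watson B p M) ((p : ℤ) • e) := by
  refine ⟨h.inMul_mem_watson ⟨e, he.1, rfl⟩, fun n y hy hny => ?_⟩
  have hp0 : (p : ℚ) ≠ 0 := by exact_mod_cast h.prime.ne_zero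
  have hn0 : (n : ℚ) ≠ 0 := by
    rintro h0
    have : n = 0 := by exact_mod_cast h0
    rw [this, zero_smul] at hny
    exact zsmul_ne_zero (by exact_mod_cast h.prime.ne_zero) he.ne_zero hny
  have hye : y = ((p : ℚ) / n) • e := by
    rw [← Int.cast_smul_eq_zsmul ℚ, ← Int.cast_smul_eq_zsmul ℚ] at hny
    rw [div_eq_inv_mul, mul_smul]
    have := congrArg (fun z => (n : ℚ)⁻¹ • z) hny
    simp only [smul_smul] at this
    rw [inv_mul_cancel₀ hn0, one_smul] at this
    rw [← this, smul_smul, Int.cast_natCast]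
  obtain ⟨k, hk⟩ := h.toIsIntLattice.primitive_dvd he (h.watson_le hy) hye
  have hpk : (p : ℤ) = n * k := by
    have : (p : ℚ) = n * k := by rw [← hk]; field_simp
    exact_mod_cast this
  have hpk2 : (p : ℤ) ∣ k := by
    by_contra hpk2
    apply h1
    refine h.smul_mem_watson hpk2 he.1 ?_
    rw [← Int.cast_smul_eq_zsmul ℚ, ← hk, ← hye]
    exact hy
  obtain ⟨d, rfl⟩ := hpk2
  refine IsUnit.of_mul_eq_one d ?_
  have : (p : ℤ) * 1 = p * (n * d) := by
    linear_combination hpk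
  exact (mul_left_cancel₀ h.prime_int.ne_zero this).symm

theorem le_of_spec {M' : Submodule ℤ V} (h : Adm p B M) (h' : Adm p B M')
    (hw : watson B p M = watson B p M') (hr : RankOne p B M ↔ RankOne p B M') {c : ℤ}
    (hc : ¬ (p : ℤ) ∣ c) {e e' : V} (he : IsAxisVec c B M e) (he' : IsAxisVec c B M' e')
    (hpar : ∃ r : ℚ, e' = r • e) (hs : Spec p B M e) (hs' : Spec p B M' e') : M ≤ M' := by
  obtain ⟨r, hr'⟩ := hpar
  have hN := isLattice_watson h.prime h.odd h.toIsIntLattice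
  have hpz : (p : ℤ) ≠ 0 := h.prime_int.ne_zero
  intro v hv
  rcases hs with ⟨h1, h2⟩ | ⟨h1, h2⟩
  · have h2' := (hs'.resolve_right fun h3 => h3.1 (hr.1 h1)).2
    have p1 := h.primitive_watson_of_not_mem he.primitive h2
    have p2 := h'.primitive_watson_of_not_mem he'.primitive h2'
    rw [← hw] at p2
    have hee : e' = e ∨ e' = -e := by
      have := hN.primitive_unique p1 p2 (r := r) (by rw [hr', smul_comm])
      rcases this with h3 | h3
      · exact Or.inl (zsmul_cancel hpz h3)
      · right
        rw [← smul_neg] at h3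
        exact zsmul_cancel hpz h3
    have heM : e ∈ M' := by
      rcases hee with rfl | h3
      · exact he'.primitive.1
      · rw [← neg_neg e, ← h3]; exact M'.neg_mem he'.primitive.1
    obtain ⟨a, ha⟩ := h.cyclic_quot h1 he.primitive.1 h2 hv
    rw [hw] at ha
    have := M'.add_mem (h'.watson_le ha) (M'.smul_mem a heM)
    simpa using this
  · have h1' : ¬ RankOne p B M' := fun h3 => h1 (hr.2 h3)
    have h2' := (hs'.resolve_left fun h3 => h1' h3.1).2
    have p1 := h.primitive_watson_of_mem he.primitive h2
    have p2 := h'.primitive_watson_of_mem he'.primitive h2'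
    rw [← hw] at p2
    have hpv : (p : ℤ) • v ∈ watson B p M' := hw ▸ h.inMul_mem_watson ⟨v, hv, rfl⟩
    obtain ⟨a, m, hm, ham⟩ := h'.cyclic_radical h1' h2' (h'.not_inMul_of_primitive he'.primitive) hpv
    obtain ⟨k, hk⟩ := he.coeff v hv
    obtain ⟨k', hk'⟩ := he'.coeff m hm
    have hq := h.toIsTernaryForm.ne_zero he'.primitive.ne_zero
    have hkv : ∃ l : ℤ, c * B e' v = l * B e' e' := by
      rcases hN.primitive_unique p1 p2 hr' with rfl | rfl
      · exact ⟨k, hk⟩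
      · refine ⟨-k, ?_⟩
        simp only [map_neg, LinearMap.neg_apply]
        push_cast
        linarith
    obtain ⟨l, hl⟩ := hkv
    have h4 := congrArg (fun z => c * B e' z) ham
    simp only [← Int.cast_smul_eq_zsmul ℚ, map_sub, map_smul, smul_eq_mul, Int.cast_natCast] at h4
    have h5 : (p : ℚ) * l - c * a = p * k' := by
      apply mul_right_cancel₀ hq
      linear_combination h4 - p * hl + p * hk'
    have h6 : (p : ℤ) ∣ c * a := ⟨l - k', by
      have : (c * a : ℚ) = p * (l - k') := by linarith
      exact_mod_cast this⟩
    obtain ⟨d, rfl⟩ := h.coprime_cancel h6 hc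
    have h7 : v = d • e' + m := by
      apply zsmul_cancel hpz
      rw [smul_add, ← ham, smul_smul]; abel
    rw [h7]
    exact M'.add_mem (M'.smul_mem _ he'.primitive.1) hm

/-- A lattice is determined by `Λ_p(M)` and the line of a special vector. -/
theorem eq_of_spec {M' : Submodule ℤ V} (h : Adm p B M) (h' : Adm p B M')
    (hw : watson B p M = watson B p M') (hr : RankOne p B M ↔ RankOne p B M') {c : ℤ}
    (hc : ¬ (p : ℤ) ∣ c) {e e' : V} (he : IsAxisVec c B M e) (he' : IsAxisVec c B M' e')
    (hpar : ∃ r : ℚ, e' = r • e) (hs : Spec p B M e) (hs' : Spec p B M' e') : M = M' := by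
  refine le_antisymm (h.le_of_spec h' hw hr hc he he' hpar hs hs')
    (h'.le_of_spec h hw.symm hr.symm hc he' he ?_ hs' hs)
  obtain ⟨r, hr⟩ := hpar
  have hr0 : r ≠ 0 := by
    rintro rfl; exact he'.primitive.ne_zero (by rw [hr, zero_smul])
  exact ⟨r⁻¹, by rw [hr, smul_smul, inv_mul_cancel₀ hr0, one_smul]⟩

theorem not_spec_of_orth (h : Adm p B M) {c : ℤ} (hc : ¬ (p : ℤ) ∣ c) {x y : V}
    (hx : IsAxisVec c B M x) (hy : IsPrimitiveVector M y) (hxy : B x y = 0)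
    (hsx : Spec p B M x) : ¬ Spec p B M y := by
  intro hsy
  rcases hsx with ⟨h1, h2⟩ | ⟨h1, h2⟩
  · have h2' := (hsy.resolve_right fun h3 => h3.1 h1).2
    obtain ⟨a, ha⟩ := h.cyclic_quot h1 hx.primitive.1 h2 hy.1
    have h3 := (h.mem_watson.1 ha).2 x hx.primitive.1
    obtain ⟨q, hq⟩ := h.integral x hx.primitive.1 x hx.primitive.1
    rw [← Int.cast_smul_eq_zsmul ℚ, map_sub, map_smul, LinearMap.sub_apply, LinearMap.smul_apply,
      h.symm y x, hxy, hq, smul_eq_mul, zero_sub] at h3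
    have h4 : (p : ℤ) ∣ a * q := by
      rw [← pdvd_intCast]; push_cast; simpa using h3.neg
    rcases h.prime_int.dvd_or_dvd h4 with ⟨d, rfl⟩ | h5
    · apply h2'
      have h6 : (p * d : ℤ) • x ∈ watson B p M :=
        h.inMul_mem_watson ⟨d • x, M.smul_mem _ hx.primitive.1, by rw [mul_smul]⟩
      simpa using Submodule.add_mem _ ha h6
    · exact h2 ((h.axis_mem_watson_iff hc hx).2 (by rw [hq, pdvd_intCast]; exact h5))
  · have h2' := (hsy.resolve_left fun h3 => h1 h3.1).2
    obtain ⟨a, m, hm, ham⟩ := h.cyclic_radical h1 h2 (h.not_inMul_of_primitive hx.primitive) h2'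
    obtain ⟨k, hk⟩ := hx.coeff m hm
    have hq := h.toIsTernaryForm.ne_zero hx.primitive.ne_zero
    have h4 := congrArg (fun z => c * B x z) ham
    simp only [← Int.cast_smul_eq_zsmul ℚ, map_sub, map_smul, smul_eq_mul, Int.cast_natCast,
      hxy] at h4
    have h5 : (c * a : ℚ) = p * (-k) := by
      apply mul_right_cancel₀ hq
      linear_combination -h4 - p * hk
    have h6 : (p : ℤ) ∣ c * a := ⟨-k, by exact_mod_cast h5⟩
    obtain ⟨d, rfl⟩ := h.coprime_cancel h6 hc
    refine h.not_inMul_of_primitive hy ⟨d • x + m, M.add_mem (M.smul_mem _ hx.primitive.1) hm, ?_⟩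
    rw [smul_add, ← ham, smul_smul]; abel

theorem exists_spec_of_frame (h : Adm p B M) {x y z : V} (hf : IsFrame B x y z)
    (hx : IsAxisVec 2 B M x) (hy : IsAxisVec 2 B M y) (hz : IsAxisVec 2 B M z) :
    Spec p B M x ∨ Spec p B M y ∨ Spec p B M z := by
  have hB := h.toIsTernaryForm
  have h2 := h.two_not_dvd
  have hexp : ∀ v ∈ M, ∃ a b c : ℤ, (2 : ℤ) • v = a • x + b • y + c • z ∧
      2 * B x v = a * B x x ∧ 2 * B y v = b * B y y ∧ 2 * B z v = c * B z z := by
    intro v hv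
    obtain ⟨a, ha⟩ := hx.coeff v hv
    obtain ⟨b, hb⟩ := hy.coeff v hv
    obtain ⟨c, hc⟩ := hz.coeff v hv
    have qx := hB.ne_zero hf.ne1
    have qy := hB.ne_zero hf.ne2
    have qz := hB.ne_zero hf.ne3
    push_cast at ha hb hc
    refine ⟨a, b, c, ?_, ha, hb, hc⟩
    have h1 := hf.expand hB v
    simp only [← Int.cast_smul_eq_zsmul ℚ]
    rw [h1, eq_div_of_mul_eq qx ha.symm, eq_div_of_mul_eq qy hb.symm, eq_div_of_mul_eq qz hc.symm]
    simp only [mul_div_assoc, smul_add, smul_smul]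
    push_cast
    rfl
  by_contra hne
  unfold Spec at hne
  push Not at hne
  obtain ⟨⟨x1, x2⟩, ⟨y1, y2⟩, z1, z2⟩ := hne
  by_cases hr : RankOne p B M
  · obtain ⟨v, hv, w, hw, hvw⟩ := h.ndeg
    obtain ⟨a, b, c, he, -⟩ := hexp v hv
    have h3 : (2 : ℤ) • v ∈ watson B p M := by
      rw [he]
      exact add_mem (add_mem (Submodule.smul_mem _ _ (x1 hr)) (Submodule.smul_mem _ _ (y1 hr)))
        (Submodule.smul_mem _ _ (z1 hr))
    exact hvw ((h.mem_watson.1 (h.smul_mem_watson h2 hv h3)).2 w hw)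
  · obtain ⟨n, hn, hnn⟩ := h.radical
    obtain ⟨a, b, c, he, ha, hb, hc⟩ := hexp n (h.watson_le hn)
    have key : ∀ {u : V} {a : ℤ}, IsAxisVec 2 B M u → u ∉ watson B p M →
        2 * B u n = a * B u u → InMul p M (a • u) := by
      intro u a hu hun hau
      obtain ⟨q, hq⟩ := h.integral u hu.primitive.1 u hu.primitive.1
      have h3 := ((h.mem_watson.1 hn).2 u hu.primitive.1).int_mul 2
      rw [h.symm n u] at h3
      push_cast at h3
      rw [hau, hq] at h3
      have h4 : (p : ℤ) ∣ q * a := by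
        rw [← pdvd_intCast, mul_comm]; push_cast; exact h3
      obtain ⟨d, rfl⟩ := h.coprime_cancel h4 (fun h5 => hun ((h.axis_mem_watson_iff h2 hu).2 (by
        rw [hq, pdvd_intCast]; exact h5)))
      exact ⟨d • u, M.smul_mem _ hu.primitive.1, by rw [mul_smul]⟩
    apply hnn
    apply inMul_of_smul h.prime h2 (h.watson_le hn)
    rw [he]
    exact ((key hx (x2 hr) ha).add (key hy (y2 hr) hb)).add (key hz (z2 hr) hc)

end Adm

theorem IsRot.trace (hB : IsTernaryForm B) {e : V} {g : V ≃ₗ[ℚ] V} (h : IsRot B e (-1) g) (v : V) :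
    v + g v + g (g v) = (3 * B e v / B e e) • e := by
  have ho : B e (v - (B e v / B e e) • e) = 0 := by
    rw [map_sub, map_smul, smul_eq_mul, div_mul_cancel₀ _ (hB.ne_zero h.ne), sub_self]
  have h1 := h.quad _ ho
  simp only [map_sub, map_smul, h.fix] at h1
  have h2 : g (g v) = (-1 : ℚ) • (g v - (B e v / B e e) • e) - (v - (B e v / B e e) • e) +
      (B e v / B e e) • e := by rw [← h1]; abel
  rw [h2, mul_div_assoc]
  module

theorem IsIntLattice.axisVec_of_rot (hM : IsIntLattice B M) {e : V} {g : V ≃ₗ[ℚ] V}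
    (h : IsRot B e (-1) g) (hg : g ∈ isometryGroup B M) (he : IsPrimitiveVector M e) :
    IsAxisVec 3 B M e := by
  refine ⟨he, fun v hv => ?_⟩
  have h1 := h.trace hM.toIsTernaryForm v
  have h2 : v + g v + g (g v) ∈ M :=
    M.add_mem (M.add_mem hv (map_mem hg hv)) (map_mem hg (map_mem hg hv))
  obtain ⟨k, hk⟩ := hM.primitive_dvd he h2 h1
  refine ⟨k, ?_⟩
  rw [← hk]
  have := hM.ne_zero he.ne_zero
  push_cast
  field_simp

end

section

variable {p : ℕ}

theorem orth_smul_integral (hM : IsIntLattice B M) {σ : V ≃ₗ[ℚ] V} (hσ : σ ∈ orthogonalGroup B) :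
    IsIntLattice B (σ • M) := by
  have hl := hM.lattice
  refine ⟨hM.toIsTernaryForm, ⟨?_, ?_⟩, ?_⟩
  · exact Submodule.FG.map _ hl.fg
  · rw [eq_top_iff]
    intro x _
    have hx : σ⁻¹ x ∈ Submodule.span ℚ (M : Set V) := by rw [hl.span_eq_top]; trivial
    have := Submodule.mem_map_of_mem (f := (σ : V →ₗ[ℚ] V)) hx
    rw [Submodule.map_span] at this
    have hx' : (σ : V →ₗ[ℚ] V) (σ⁻¹ x) = x := by
      change σ (σ⁻¹ x) = x
      rw [← LinearEquiv.mul_apply, mul_inv_cancel]; rfl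
    rw [hx'] at this
    exact this
  · intro x hx y hy
    rw [mem_smul_iff] at hx hy
    obtain ⟨k, hk⟩ := hM.integral _ hx _ hy
    have := inv_mem hσ x y
    exact ⟨k, by rw [← hk, this]⟩

theorem watson_smul {σ : V ≃ₗ[ℚ] V} (hσ : σ ∈ orthogonalGroup B) :
    watson B p (σ • M) = σ • watson B p M := by
  have hi : ∀ z, σ (σ⁻¹ z) = z := fun z => by
    rw [← LinearEquiv.mul_apply, mul_inv_cancel]; rfl
  have hi' : ∀ z, σ⁻¹ (σ z) = z := fun z => by
    rw [← LinearEquiv.mul_apply, inv_mul_cancel]; rfl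
  have key : ∀ {σ : V ≃ₗ[ℚ] V}, σ ∈ orthogonalGroup B → ∀ {M : Submodule ℤ V} {x : V},
      x ∈ watson B p M → σ x ∈ watson B p (σ • M) := by
    rintro σ hσ M x ⟨hx, h⟩
    refine ⟨smul_mem_smul_iff.2 hx, fun y hy => ?_⟩
    obtain ⟨k, hk⟩ := h _ (mem_smul_iff.1 hy)
    have hy' : y = σ (σ⁻¹ y) := by rw [← LinearEquiv.mul_apply, mul_inv_cancel]; rfl
    refine ⟨k, ?_⟩
    rw [hy', ← map_add, hσ, hσ, hk]
  ext x
  rw [mem_smul_iff]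
  constructor
  · intro hx
    have := key (inv_mem hσ) hx
    rwa [smul_smul, inv_mul_cancel, one_smul] at this
  · intro hx
    have := key hσ hx
    rwa [hi] at this

theorem isometryGroup_le_watson : isometryGroup B M ≤ isometryGroup B (watson B p M) := by
  intro σ hσ
  refine ⟨hσ.1, ?_⟩
  have := watson_smul (p := p) (M := M) hσ.1
  rw [hσ.2] at this
  exact this.symm

namespace Adm

theorem not_pdvd_self (h : Adm p B M) (h1 : RankOne p B M) {v : V} (hv : v ∈ M)
    (hvn : v ∉ watson B p M) : ¬ PDvd p (B v v) := by
  intro hd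
  apply hvn
  refine h.mem_watson.2 ⟨hv, fun y hy => ?_⟩
  obtain ⟨b, hb⟩ := h.integral v hv y hy
  obtain ⟨d, hdd⟩ := h.integral y hy y hy
  have h2 := (hd.int_mul d).sub (h1 v hv v hv y hy y hy)
  rw [h.symm y v, hb, hdd] at h2
  rw [hb, pdvd_intCast]
  have h3 : (p : ℤ) ∣ b * b := by
    rw [← pdvd_intCast]; push_cast; convert h2 using 1; ring
  exact (h.prime_int.dvd_or_dvd h3).elim id id

theorem dvd_of_smul_mem (h : Adm p B M) {v : V} (hv : v ∈ M) (hvn : v ∉ watson B p M) {n : ℤ}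
    (hn : n • v ∈ watson B p M) : (p : ℤ) ∣ n := by
  by_contra h1
  exact hvn (h.smul_mem_watson h1 hv hn)

theorem dvd_of_smul_inMul (h : Adm p B M) {v : V} (hv : v ∈ M) (hvn : ¬ InMul p M v) {n : ℤ}
    (hn : InMul p M (n • v)) : (p : ℤ) ∣ n := by
  by_contra h1
  exact hvn (inMul_of_smul h.prime h1 hv hn)

theorem three_not_dvd (h : Adm p B M) (hp3 : p ≠ 3) : ¬ (p : ℤ) ∣ 3 := fun h3 =>
  hp3 ((Nat.prime_dvd_prime_iff_eq h.prime Nat.prime_three).1 (by exact_mod_cast h3))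

/-- The axis of a threefold rotation is special if `p ≠ 3`. -/
theorem spec_of_rot (h : Adm p B M) (hp3 : p ≠ 3) {e : V} {g : V ≃ₗ[ℚ] V} (hr : IsRot B e (-1) g)
    (hg : g ∈ isometryGroup B M) (he : IsPrimitiveVector M e) : Spec p B M e := by
  have hB := h.toIsTernaryForm
  have hM := h.toIsIntLattice
  have hgN : g ∈ isometryGroup B (watson B p M) := isometryGroup_le_watson hg
  have hax := hM.axisVec_of_rot hr hg he
  have h3 := h.three_not_dvd hp3
  have htr : ∀ v ∈ M, ∃ k : ℤ, v + g v + g (g v) = k • e ∧ 3 * B e v = k * B e e := by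
    intro v hv
    obtain ⟨k, hk⟩ := hax.coeff v hv
    push_cast at hk
    refine ⟨k, ?_, hk⟩
    rw [hr.trace hB, hk, mul_div_cancel_right₀ _ (hB.ne_zero hr.ne), Int.cast_smul_eq_zsmul]
  by_cases h1 : RankOne p B M
  · refine Or.inl ⟨h1, fun heN => ?_⟩
    obtain ⟨v, hv, w, hw, hvw⟩ := h.ndeg
    have hvn : v ∉ watson B p M := fun h0 => hvw ((h.mem_watson.1 h0).2 w hw)
    obtain ⟨a, ha⟩ := h.cyclic_quot h1 hv hvn (map_mem hg hv)
    set n := g v - a • v with hn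
    have e1 : g v = a • v + n := by rw [hn]; abel
    have e2 : g (g v) = (a * a) • v + (a • n + g n) := by
      nth_rewrite 1 [e1]
      rw [map_add, map_zsmul, e1, smul_add, mul_smul]; abel
    have e3 : v = (a * a * a) • v + ((a * a) • n + a • g n + g (g n)) := by
      nth_rewrite 1 [← hr.cube hB v]
      rw [e2, map_add, map_zsmul, map_add, map_zsmul, e1, smul_add, mul_smul (a * a) a v]; abel
    have hgn := map_mem hgN ha
    have hggn := map_mem hgN hgn
    have d3 : (p : ℤ) ∣ 1 - a * a * a := by
      refine h.dvd_of_smul_mem hv hvn ?_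
      have : (1 - a * a * a) • v = (a * a) • n + a • g n + g (g n) := by
        rw [sub_smul, one_smul]; nth_rewrite 1 [e3]; abel
      rw [this]
      exact add_mem (add_mem (Submodule.smul_mem _ _ ha) (Submodule.smul_mem _ _ hgn)) hggn
    have d2 : (p : ℤ) ∣ a * a - 1 := by
      obtain ⟨q, hq⟩ := h.integral v hv v hv
      have f1 : B (g v) (g v) = B v v := hg.1 v v
      rw [e1] at f1
      have f2 := ((h.mem_watson.1 ha).2 v hv).int_mul (2 * a)
      have f3 := (h.mem_watson.1 ha).2 n (h.watson_le ha)
      simp only [← Int.cast_smul_eq_zsmul ℚ, map_add, map_smul, LinearMap.add_apply,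
        LinearMap.smul_apply, smul_eq_mul, h.symm v n] at f1
      have f4 : (p : ℤ) ∣ q * (a * a - 1) := by
        rw [← pdvd_intCast]
        push_cast at f2 ⊢
        rw [← hq]
        convert (f2.add f3).neg using 1
        linear_combination f1
      refine h.coprime_cancel f4 fun h0 => h.not_pdvd_self h1 hv hvn ?_
      rw [hq, pdvd_intCast]; exact h0
    obtain ⟨k, hk, -⟩ := htr v hv
    have d1 : (p : ℤ) ∣ 1 + a + a * a := by
      refine h.dvd_of_smul_mem hv hvn ?_
      have : (1 + a + a * a) • v = k • e - (n + (a • n + g n)) := by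
        rw [← hk, e2, add_smul, add_smul, one_smul, e1]; abel
      rw [this]
      exact sub_mem (Submodule.smul_mem _ _ heN)
        (add_mem ha (add_mem (Submodule.smul_mem _ _ ha) hgn))
    apply h3
    obtain ⟨x, hx⟩ := d1
    obtain ⟨y, hy⟩ := d2
    obtain ⟨z, hz⟩ := d3
    exact ⟨x - y + z + a * y, by linear_combination hx - hy + hz + a * hy⟩
  · refine Or.inr ⟨h1, ?_⟩
    obtain ⟨n, hn, hnn⟩ := h.radical
    have hnM := h.watson_le hn
    have hgn := map_mem hgN hn
    have hggn := map_mem hgN hgn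
    obtain ⟨k, hk, hk'⟩ := htr n hnM
    by_cases hkp : (p : ℤ) ∣ k
    swap
    · refine h.smul_mem_watson hkp he.1 ?_
      rw [← hk]; exact add_mem (add_mem hn hgn) hggn
    exfalso
    obtain ⟨x, hxp, hex, hx, hgen⟩ := (hM.rot_structure hr hg).2
    have hmo : B e ((3 : ℤ) • n - k • e) = 0 := by
      simp only [← Int.cast_smul_eq_zsmul ℚ, map_sub, map_smul, smul_eq_mul]
      push_cast; linarith
    have hpe : InMul p M (k • e) := by
      obtain ⟨d, rfl⟩ := hkp
      exact ⟨d • e, M.smul_mem _ he.1, by rw [mul_smul]⟩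
    have hmN : (3 : ℤ) • n - k • e ∈ watson B p M :=
      sub_mem (Submodule.smul_mem _ _ hn) (h.inMul_mem_watson hpe)
    obtain ⟨α, β, hαβ⟩ := hgen _ (h.watson_le hmN) hmo
    have hnot : ¬ ((p : ℤ) ∣ α ∧ (p : ℤ) ∣ β) := by
      rintro ⟨⟨α', rfl⟩, β', rfl⟩
      apply hnn
      refine inMul_of_smul h.prime h3 hnM ?_
      have : (3 : ℤ) • n = (p : ℤ) • (α' • x + β' • g x) + k • e := by
        rw [smul_add, ← mul_smul, ← mul_smul, ← hαβ]; abel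
      rw [this]
      exact InMul.add ⟨_, add_mem (M.smul_mem _ hxp.1) (M.smul_mem _ (map_mem hg hxp.1)), rfl⟩ hpe
    obtain ⟨q, hq⟩ := h.integral x hxp.1 x hxp.1
    have hf := hr.form hB hex
    have m1 := ((h.mem_watson.1 hmN).2 x hxp.1).int_mul 2
    have m2 := ((h.mem_watson.1 hmN).2 (g x) (map_mem hg hxp.1)).int_mul 2
    rw [hαβ] at m1 m2
    simp only [← Int.cast_smul_eq_zsmul ℚ, map_add, map_smul, LinearMap.add_apply,
      LinearMap.smul_apply, smul_eq_mul, h.symm (g x) x, hf, hr.orth x x, hq] at m1 m2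
    have hxN : x ∈ watson B p M := by
      rw [h.axis_mem_watson_iff h.two_not_dvd (hM.axisVec_of_sym hxp hx), hq, pdvd_intCast]
      by_contra hqp
      have n1 : (p : ℤ) ∣ 2 * α - β := by
        refine h.coprime_cancel (a := q) ?_ hqp
        rw [← pdvd_intCast]; push_cast at m1 ⊢; convert m1 using 1; ring
      have n2 : (p : ℤ) ∣ 2 * β - α := by
        refine h.coprime_cancel (a := q) ?_ hqp
        rw [← pdvd_intCast]; push_cast at m2 ⊢; convert m2 using 1; ring
      apply hnot
      constructor
      · refine h.coprime_cancel (a := 3) ?_ h3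
        rw [show 3 * α = 2 * (2 * α - β) + (2 * β - α) by ring]
        exact dvd_add (n1.mul_left 2) n2
      · refine h.coprime_cancel (a := 3) ?_ h3
        rw [show 3 * β = 2 * (2 * β - α) + (2 * α - β) by ring]
        exact dvd_add (n2.mul_left 2) n1
    obtain ⟨a, v, hv, hav⟩ := h.cyclic_radical h1 hxN (h.not_inMul_of_primitive hxp)
      (map_mem hgN hxN)
    have hp0 := h.prime_int.ne_zero
    have hev : B e v = 0 := by
      have h4 := congrArg (B e) hav
      simp only [← Int.cast_smul_eq_zsmul ℚ, map_sub, map_smul, smul_eq_mul, hex,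
        hr.orth_apply hex, mul_zero, sub_zero] at h4
      exact (mul_eq_zero.1 h4.symm).resolve_left (by exact_mod_cast hp0)
    obtain ⟨c, d, hcd⟩ := hgen v hv hev
    have hzero : (1 - (p : ℤ) * d) • g x = (a + p * c) • x := by
      rw [hcd, smul_add, ← mul_smul, ← mul_smul] at hav
      rw [sub_smul, add_smul, one_smul]
      have := sub_eq_iff_eq_add.1 hav
      nth_rewrite 1 [this]; abel
    have hd1 : (1 - (p : ℤ) * d) ≠ 0 := by
      intro h0
      exact h.prime_int.not_isUnit (IsUnit.of_mul_eq_one d (by linarith))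
    rw [← Int.cast_smul_eq_zsmul ℚ, ← Int.cast_smul_eq_zsmul ℚ] at hzero
    apply hr.not_parallel hB hx.1 hex ((((1 - (p : ℤ) * d : ℤ) : ℚ))⁻¹ * ((a + p * c : ℤ) : ℚ))
    rw [mul_smul, ← hzero, smul_smul, inv_mul_cancel₀ (by exact_mod_cast hd1), one_smul]

/-- For `p = 3`, the reflection along the axis of a threefold rotation of `M` is a symmetry of
`Λ_3(M)`. -/
theorem sym_axis_three (h : Adm 3 B M) {e : V} {g : V ≃ₗ[ℚ] V} (hr : IsRot B e (-1) g)
    (hg : g ∈ isometryGroup B M) : IsSym B (watson B 3 M) e := by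
  have hB := h.toIsTernaryForm
  have hM := h.toIsIntLattice
  obtain ⟨r, hr0, hep⟩ := hM.exists_primitive hr.ne
  have hr' := hr.smul hr0
  suffices hs : IsSym B (watson B 3 M) (r • e) by
    have := hs.smul (inv_ne_zero hr0)
    rwa [smul_smul, inv_mul_cancel₀ hr0, one_smul] at this
  clear hr
  generalize r • e = e at *
  have hgN : g ∈ isometryGroup B (watson B 3 M) := isometryGroup_le_watson hg
  have hax := hM.axisVec_of_rot hr' hg hep
  have hqe := hB.ne_zero hep.ne_zero
  refine ⟨hep.ne_zero, ?_⟩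
  have of_coeff : ∀ K : Submodule ℤ V, (∀ v ∈ K, ∃ k : ℤ, B e v = k * B e e ∧ k • e ∈ K) →
      tau B e ∈ isometryGroup B K := by
    intro K hK
    have hmem : ∀ v ∈ K, tau B e v ∈ K := by
      intro v hv
      obtain ⟨k, hk, hke⟩ := hK v hv
      have : tau B e v = v - (2 : ℤ) • k • e := by
        rw [tau_apply, hk, ← Int.cast_smul_eq_zsmul ℚ, ← Int.cast_smul_eq_zsmul ℚ, smul_smul,
          mul_div_assoc, mul_div_cancel_right₀ _ hqe]
        push_cast; rfl
      rw [this]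
      exact K.sub_mem hv (K.smul_mem _ hke)
    exact mem_isometryGroup_of (tau_mem hB e) hmem (by rw [tau_inv]; exact hmem)
  by_cases hglue : ∀ v ∈ M, ∃ k : ℤ, B e v = k * B e e
  · refine isometryGroup_le_watson (of_coeff M fun v hv => ?_)
    obtain ⟨k, hk⟩ := hglue v hv
    exact ⟨k, hk, M.smul_mem _ hep.1⟩
  push Not at hglue
  obtain ⟨v, hv, hvk⟩ := hglue
  obtain ⟨κ, hκ⟩ := hax.coeff v hv
  push_cast at hκ
  have hκ3 : ¬ (3 : ℤ) ∣ κ := by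
    rintro ⟨d, rfl⟩
    apply hvk d
    push_cast at hκ; linarith
  obtain ⟨x, hxp, hex, hx, hgen⟩ := (hM.rot_structure hr' hg).2
  have hxx := hr'.form hB hex
  have hgx := map_mem hg hxp.1
  have hqx := hB.ne_zero hx.1
  have hind : ∀ a b : ℤ, a • x + b • g x = 0 → a = 0 ∧ b = 0 := by
    intro a b hab
    have h0 := Fintype.linearIndependent_iff.1 (hr'.indep hB hx.1 hex) ![(a : ℚ), 0, b] (by
      simp only [Fin.sum_univ_three, Matrix.cons_val_zero, Matrix.cons_val_one, Matrix.cons_val,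
        Int.cast_smul_eq_zsmul, zero_smul, add_zero]
      exact hab)
    have h1 := h0 0
    have h2 := h0 2
    simp only [Matrix.cons_val_zero, Matrix.cons_val] at h1 h2
    exact ⟨by exact_mod_cast h1, by exact_mod_cast h2⟩
  have hdec : ∀ w ∈ M, ∀ k : ℤ, 3 * B e w = k * B e e →
      ∃ a b : ℤ, (3 : ℤ) • w = k • e + (a • x + b • g x) := by
    intro w hw k hk
    have ho : B e ((3 : ℤ) • w - k • e) = 0 := by
      simp only [← Int.cast_smul_eq_zsmul ℚ, map_sub, map_smul, smul_eq_mul]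
      push_cast; linarith
    obtain ⟨a, b, hab⟩ := hgen _ (M.sub_mem (M.smul_mem _ hw) (M.smul_mem _ hep.1)) ho
    exact ⟨a, b, by rw [← hab]; abel⟩
  obtain ⟨α, β, hαβ⟩ := hdec v hv κ hκ
  obtain ⟨q, hq⟩ := h.integral x hxp.1 x hxp.1
  have hgg : g (g x) = -g x - x := by rw [hr'.quad x hex, neg_one_smul]
  have hsum : (3 : ℤ) ∣ α + β := by
    have ho : B e (v - g v) = 0 := by
      have : B e (g v) = B e v := by nth_rewrite 1 [← hr'.fix]; rw [hg.1]
      rw [map_sub, this, sub_self]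
    obtain ⟨a, b, hab⟩ := hgen _ (M.sub_mem hv (map_mem hg hv)) ho
    have h1 := congrArg g hαβ
    simp only [map_zsmul, map_add, hr'.fix, hgg] at h1
    have h2 : (3 : ℤ) • (v - g v) = (α + β) • x + (2 * β - α) • g x := by
      rw [smul_sub, hαβ, h1]
      simp only [← Int.cast_smul_eq_zsmul ℚ]
      push_cast; module
    rw [hab] at h2
    have h3 : (3 * a - (α + β)) • x + (3 * b - (2 * β - α)) • g x = 0 := by
      rw [← sub_eq_zero] at h2
      rw [← h2]
      simp only [← Int.cast_smul_eq_zsmul ℚ]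
      push_cast; module
    exact ⟨a, by linarith [(hind _ _ h3).1]⟩
  obtain ⟨γ, hγ⟩ := hsum
  obtain rfl : β = 3 * γ - α := by linarith
  -- modulo `3M`, a multiple of `e` is a multiple of `x - g x`
  have hge : (3 : ℤ) • v = κ • e + α • (x - g x) + (3 : ℤ) • γ • g x := by
    rw [hαβ]
    simp only [← Int.cast_smul_eq_zsmul ℚ]
    push_cast; module
  have hem : InMul 3 M (κ • e + α • (x - g x)) := by
    refine ⟨v - γ • g x, M.sub_mem hv (M.smul_mem _ hgx), ?_⟩
    rw [Nat.cast_ofNat, smul_sub (3 : ℤ), hge]; abel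
  have hα3 : ¬ (3 : ℤ) ∣ α := by
    rintro ⟨d, rfl⟩
    refine h.not_inMul_of_primitive hep (inMul_of_smul h.prime hκ3 hep.1 ?_)
    have h4 : InMul 3 M ((3 * d : ℤ) • (x - g x)) :=
      ⟨d • (x - g x), M.smul_mem _ (M.sub_mem hxp.1 hgx), by rw [mul_smul]; rfl⟩
    simpa using hem.sub h4
  by_cases hq3 : (3 : ℤ) ∣ q
  · have hxN : x ∈ watson B 3 M := by
      rw [h.axis_mem_watson_iff h.two_not_dvd (hM.axisVec_of_sym hxp hx), hq, pdvd_intCast]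
      exact hq3
    have hgxN := map_mem hgN hxN
    have heN : e ∈ watson B 3 M := by
      refine h.smul_mem_watson hκ3 hep.1 ?_
      have := sub_mem (h.inMul_mem_watson hem)
        (Submodule.smul_mem (watson B 3 M) α (sub_mem hxN hgxN))
      simpa using this
    refine of_coeff _ fun n hn => ?_
    obtain ⟨k, hk⟩ := hax.coeff n (h.watson_le hn)
    push_cast at hk
    by_cases hk3 : (3 : ℤ) ∣ k
    · obtain ⟨d, rfl⟩ := hk3
      exact ⟨d, by push_cast at hk; linarith, Submodule.smul_mem _ _ heN⟩
    · exfalso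
      have hall : ∀ m ∈ M, m ∈ watson B 3 M := by
        intro m hm
        obtain ⟨l, hl⟩ := hax.coeff m hm
        push_cast at hl
        refine h.smul_mem_watson hk3 hm ?_
        have hl' : 3 * B e (k • m - l • n) = (0 : ℤ) * B e e := by
          simp only [← Int.cast_smul_eq_zsmul ℚ, map_sub, map_smul, smul_eq_mul]
          push_cast; linear_combination (k : ℚ) * hl - l * hk
        have hmn : k • m - l • n ∈ M :=
          M.sub_mem (M.smul_mem _ hm) (M.smul_mem _ (h.watson_le hn))
        obtain ⟨a, b, hab⟩ := hgen _ hmn (by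
          rw [Int.cast_zero, zero_mul] at hl'
          linarith)
        have : k • m = l • n + (a • x + b • g x) := by rw [← hab]; abel
        rw [this]
        exact add_mem (Submodule.smul_mem _ _ hn)
          (add_mem (Submodule.smul_mem _ _ hxN) (Submodule.smul_mem _ _ hgxN))
      obtain ⟨a, ha, b, hb, hab⟩ := h.ndeg
      exact hab ((h.mem_watson.1 (hall a ha)).2 b hb)
  · exfalso
    have hdN : x - g x ∉ watson B 3 M := by
      intro hd
      have h5 := ((h.mem_watson.1 hd).2 v hv).int_mul 2
      have h6 := congrArg (B (x - g x)) hαβ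
      simp only [← Int.cast_smul_eq_zsmul ℚ, map_add, map_sub, map_smul, LinearMap.sub_apply,
        smul_eq_mul, h.symm x e, h.symm (g x) e, hex, hr'.orth_apply hex, h.symm (g x) x, hxx,
        hr'.orth x x, hq] at h6
      rw [LinearMap.map_sub, LinearMap.sub_apply] at h5
      have h7 : (3 : ℤ) ∣ q * (2 * α - 3 * γ) := by
        rw [← Nat.cast_ofNat, ← pdvd_intCast]
        push_cast at h5 h6 ⊢
        convert h5 using 1
        linear_combination (-2 / 3 : ℚ) * h6
      have h8 := h.coprime_cancel (by exact_mod_cast h7) hq3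
      apply hα3
      refine h.coprime_cancel (a := 2) ?_ h.two_not_dvd
      have h9 : (3 : ℤ) ∣ 2 * α - 3 * γ := h8
      exact_mod_cast (show (3 : ℤ) ∣ 2 * α by omega)
    obtain ⟨n, hn, hnn⟩ := h.radical
    have hnM := h.watson_le hn
    obtain ⟨k, hk⟩ := hax.coeff n hnM
    push_cast at hk
    obtain ⟨a, b, hab⟩ := hdec n hnM k hk
    have key : ∀ y ∈ M, ∀ s t : ℤ, 2 * (a * B x y + b * B (g x) y) = q * (s * a + t * b) →
        B e y = 0 → (9 : ℤ) ∣ s * a + t * b := by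
      intro y hy s t hst hey
      obtain ⟨m, hm⟩ := (h.mem_watson.1 hn).2 y hy
      have h6 := congrArg (fun z => B z y) hab
      simp only [← Int.cast_smul_eq_zsmul ℚ, map_add, map_smul, LinearMap.add_apply,
        LinearMap.smul_apply, smul_eq_mul, hey, hm] at h6
      have h7 : q * (s * a + t * b) = 9 * (2 * m) := by
        have : (q * (s * a + t * b) : ℚ) = 9 * (2 * m) := by
          rw [← hst]; push_cast at h6; linarith
        exact_mod_cast this
      have hc9 : IsCoprime (9 : ℤ) q := by
        have : IsCoprime (3 : ℤ) q := (Prime.coprime_iff_not_dvd Int.prime_three).2 hq3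
        have := this.pow_left (m := 2)
        simpa using this
      exact hc9.dvd_of_dvd_mul_left ⟨_, h7⟩
    have n1 := key x hxp.1 2 (-1) (by rw [h.symm (g x) x, hxx, hq]; push_cast; ring) hex
    have n2 := key (g x) hgx (-1) 2 (by rw [hr'.orth x x, hxx, hq]; push_cast; ring)
      (hr'.orth_apply hex)
    obtain ⟨a', rfl⟩ : (3 : ℤ) ∣ a := by omega
    obtain ⟨b', rfl⟩ : (3 : ℤ) ∣ b := by omega
    have hk3 : (3 : ℤ) ∣ k := by
      refine h.dvd_of_smul_inMul hep.1 (h.not_inMul_of_primitive hep) ?_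
      refine ⟨n - a' • x - b' • g x, M.sub_mem (M.sub_mem hnM (M.smul_mem _ hxp.1))
        (M.smul_mem _ hgx), ?_⟩
      rw [smul_sub, smul_sub, Nat.cast_ofNat, hab, mul_smul, mul_smul]; abel
    obtain ⟨k', rfl⟩ := hk3
    obtain ⟨δ, hδ⟩ : (3 : ℤ) ∣ a' + b' := by omega
    have hn3 : n = k' • e + a' • (x - g x) + (3 : ℤ) • δ • g x := by
      apply zsmul_cancel (n := 3) (by norm_num)
      rw [hab]
      obtain rfl : b' = 3 * δ - a' := by linarith
      simp only [← Int.cast_smul_eq_zsmul ℚ]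
      push_cast; module
    -- eliminate `e`: `κ n ≡ (κ a' - k' α)(x - g x)` modulo `3M`
    have hκn : InMul 3 M (κ • n - (κ * a' - k' * α) • (x - g x)) := by
      have h4 : InMul 3 M ((3 : ℤ) • δ • g x) := ⟨δ • g x, M.smul_mem _ hgx, rfl⟩
      convert (hem.smul k').add (h4.smul κ) using 1
      rw [hn3]
      simp only [← Int.cast_smul_eq_zsmul ℚ]
      push_cast; module
    have hd3 : (3 : ℤ) ∣ κ * a' - k' * α := by
      refine h.dvd_of_smul_mem (M.sub_mem hxp.1 hgx) hdN ?_
      have := sub_mem (Submodule.smul_mem (watson B 3 M) κ hn) (h.inMul_mem_watson hκn)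
      simpa using this
    obtain ⟨d, hd⟩ := hd3
    apply hnn
    refine inMul_of_smul h.prime hκ3 hnM ?_
    rw [hd] at hκn
    have h4 : InMul 3 M ((3 * d : ℤ) • (x - g x)) :=
      ⟨d • (x - g x), M.smul_mem _ (M.sub_mem hxp.1 hgx), by rw [mul_smul]; rfl⟩
    simpa using hκn.add h4

end Adm

end

section

variable {p : ℕ}

theorem IsPrimitiveVector.map {x : V} (h : IsPrimitiveVector M x) (σ : V ≃ₗ[ℚ] V) :
    IsPrimitiveVector (σ • M) (σ x) := by
  refine ⟨smul_mem_smul_iff.2 h.1, fun n y hy hn => h.2 n (σ⁻¹ y) (mem_smul_iff.1 hy) ?_⟩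
  rw [← map_zsmul, ← hn, ← LinearEquiv.mul_apply, inv_mul_cancel]; rfl

theorem IsAxisVec.map {c : ℤ} {x : V} (h : IsAxisVec c B M x) {σ : V ≃ₗ[ℚ] V}
    (hσ : σ ∈ orthogonalGroup B) : IsAxisVec c B (σ • M) (σ x) := by
  refine ⟨h.primitive.map σ, fun v hv => ?_⟩
  obtain ⟨k, hk⟩ := h.coeff _ (mem_smul_iff.1 hv)
  refine ⟨k, ?_⟩
  rw [hσ, ← hk]
  congr 1
  have hv' : v = σ (σ⁻¹ v) := by rw [← LinearEquiv.mul_apply, mul_inv_cancel]; rfl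
  nth_rewrite 1 [hv']
  rw [hσ]

theorem RankOne.map (h : RankOne p B M) {σ : V ≃ₗ[ℚ] V} (hσ : σ ∈ orthogonalGroup B) :
    RankOne p B (σ • M) := by
  intro x hx y hy z hz w hw
  have := h _ (mem_smul_iff.1 hx) _ (mem_smul_iff.1 hy) _ (mem_smul_iff.1 hz) _ (mem_smul_iff.1 hw)
  have hi := inv_mem hσ
  rwa [hi, hi, hi, hi] at this

theorem rankOne_smul {σ : V ≃ₗ[ℚ] V} (hσ : σ ∈ orthogonalGroup B) :
    RankOne p B (σ • M) ↔ RankOne p B M := by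
  refine ⟨fun h => ?_, fun h => h.map hσ⟩
  have := h.map (inv_mem hσ)
  rwa [smul_smul, inv_mul_cancel, one_smul] at this

theorem spec_smul {σ : V ≃ₗ[ℚ] V} (hσ : σ ∈ orthogonalGroup B) {x : V} :
    Spec p B (σ • M) (σ x) ↔ Spec p B M x := by
  unfold Spec
  rw [rankOne_smul hσ, watson_smul hσ, smul_mem_smul_iff]

theorem Spec.map {x : V} (h : Spec p B M x) {g : V ≃ₗ[ℚ] V} (hg : g ∈ isometryGroup B M) :
    Spec p B M (g x) := by
  have := (spec_smul hg.1).2 h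
  rwa [hg.2] at this

theorem isSym_of_smul {x : V} {r : ℚ} (h : IsSym B M (r • x)) : IsSym B M x := by
  have hr : r ≠ 0 := by rintro rfl; exact h.1 (zero_smul _ _)
  have := h.smul (inv_ne_zero hr)
  rwa [smul_smul, inv_mul_cancel₀ hr, one_smul] at this

namespace Adm

theorem not_spec_pair (h : Adm p B M) {x y : V} (hx : IsPrimitiveVector M x)
    (hy : IsPrimitiveVector M y) (hsx : IsSym B M x) (hxy : B x y = 0) (h1 : Spec p B M x) :
    ¬ Spec p B M y :=
  h.not_spec_of_orth h.two_not_dvd (h.toIsIntLattice.axisVec_of_sym hx hsx) hy hxy h1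

/-- Three mutually orthogonal symmetries are not permuted transitively by the isometries. -/
theorem not_cubic (h : Adm p B M) (f₁ f₂ f₃ : V) : ¬ IsCubic B M f₁ f₂ f₃ := by
  intro hc
  have hB := h.toIsTernaryForm
  have hM := h.toIsIntLattice
  obtain ⟨r, hr, hp⟩ := hM.exists_primitive hc.ne1
  have hs := hc.s1.smul hr
  obtain ⟨a1, -, -⟩ := hc.swap12 hB
  obtain ⟨b2, -, -⟩ := (hc.rotate hB).swap12 hB
  have e2 : tau B (f₁ - f₂) (r • f₁) = r • f₂ := by rw [map_smul, a1]
  have e3 : tau B (f₂ - f₃) (r • f₂) = r • f₃ := by rw [map_smul, b2]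
  have p2 := hp.map (tau B (f₁ - f₂))
  rw [hc.s12.2.2, e2] at p2
  have p3 := p2.map (tau B (f₂ - f₃))
  rw [hc.s23.2.2, e3] at p3
  have s2 := hc.s2.smul hr
  have s3 := hc.s3.smul hr
  have o12 : B (r • f₁) (r • f₂) = 0 := by simp [hc.h12]
  have o13 : B (r • f₁) (r • f₃) = 0 := by simp [hc.h13]
  have o23 : B (r • f₂) (r • f₃) = 0 := by simp [hc.h23]
  have hf : IsFrame B (r • f₁) (r • f₂) (r • f₃) := ⟨hs.1, s2.1, s3.1, o12, o13, o23⟩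
  have k12 : Spec p B M (r • f₁) → Spec p B M (r • f₂) := fun h1 => e2 ▸ h1.map hc.s12.2
  have k23 : Spec p B M (r • f₂) → Spec p B M (r • f₃) := fun h1 => e3 ▸ h1.map hc.s23.2
  have k32 : Spec p B M (r • f₃) → Spec p B M (r • f₂) := fun h1 => by
    have := h1.map hc.s23.2
    rwa [map_smul, (hc.rotate hB).swap12 hB |>.2.1] at this
  have n12 := h.not_spec_pair hp p2 hs o12
  have n23 := h.not_spec_pair p2 p3 s2 o23
  rcases h.exists_spec_of_frame hf (hM.axisVec_of_sym hp hs) (hM.axisVec_of_sym p2 s2)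
    (hM.axisVec_of_sym p3 s3) with h1 | h1 | h1
  · exact n12 h1 (k12 h1)
  · exact n23 h1 (k23 h1)
  · exact n23 (k32 h1) h1

theorem exists_spec_of_orth (h : Adm p B M) {x y : V} (hx : IsSym B M x) (hy : IsSym B M y)
    (hxy : B x y = 0) : ∃ z, IsPrimitiveVector M z ∧ IsSym B M z ∧ Spec p B M z := by
  have hB := h.toIsTernaryForm
  have hM := h.toIsIntLattice
  obtain ⟨z, hf⟩ := exists_frame_of_orth hB hx.1 hy.1 hxy
  have hz := hx.third hB hf hy
  obtain ⟨a, ha, pa⟩ := hM.exists_primitive hx.1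
  obtain ⟨b, hb, pb⟩ := hM.exists_primitive hy.1
  obtain ⟨c, hc, pc⟩ := hM.exists_primitive hz.1
  have sa := hx.smul ha
  have sb := hy.smul hb
  have sc := hz.smul hc
  have hf' : IsFrame B (a • x) (b • y) (c • z) :=
    ⟨sa.1, sb.1, sc.1, by simp [hf.h12], by simp [hf.h13], by simp [hf.h23]⟩
  rcases h.exists_spec_of_frame hf' (hM.axisVec_of_sym pa sa) (hM.axisVec_of_sym pb sb)
    (hM.axisVec_of_sym pc sc) with h1 | h1 | h1
  exacts [⟨_, pa, sa, h1⟩, ⟨_, pb, sb, h1⟩, ⟨_, pc, sc, h1⟩]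

/-- The symmetry vectors orthogonal to a fourfold axis are not special. -/
theorem not_spec_of_four (h : Adm p B M) {e : V} {g : V ≃ₗ[ℚ] V} (hr : IsRot B e 0 g)
    (hg : g ∈ isometryGroup B M) {x : V} (hx : IsPrimitiveVector M x) (hs : IsSym B M x)
    (hex : B e x = 0) : ¬ Spec p B M x := by
  intro h1
  have hgx := hx.map g
  rw [hg.2] at hgx
  exact h.not_spec_pair hx hgx hs (by rw [hr.form h.toIsTernaryForm hex]; ring) h1 (h1.map hg)

theorem spec_of_four (h : Adm p B M) {e : V} {g : V ≃ₗ[ℚ] V} (hr : IsRot B e 0 g)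
    (hg : g ∈ isometryGroup B M) (he : IsPrimitiveVector M e) : Spec p B M e := by
  have hB := h.toIsTernaryForm
  have hM := h.toIsIntLattice
  obtain ⟨x, hxp, hex, hx, -⟩ := (hM.rot_structure hr hg).2
  have hse := hr.sym_axis hB hg
  have hgx := hxp.map g
  rw [hg.2] at hgx
  have hf : IsFrame B x (g x) e := ⟨hx.1, by simpa using hx.1, hr.ne,
    by rw [hr.form hB hex]; ring, by rw [hB.symm, hex], by rw [hB.symm, hr.orth_apply hex]⟩
  have n1 := h.not_spec_of_four hr hg hxp hx hex
  have n2 := h.not_spec_of_four hr hg hgx (hx.map hg) (hr.orth_apply hex)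
  have := h.exists_spec_of_frame hf (hM.axisVec_of_sym hxp hx)
    (hM.axisVec_of_sym hgx (hx.map hg)) (hM.axisVec_of_sym he hse)
  exact (this.resolve_left n1).resolve_left n2

end Adm

/-- `σ` is the reflection along a special vector of `M`. -/
def SpecSym (p : ℕ) (B : LinearMap.BilinForm ℚ V) (M : Submodule ℤ V) (σ : V ≃ₗ[ℚ] V) : Prop :=
  ∃ x, IsPrimitiveVector M x ∧ IsSym B M x ∧ σ = tau B x ∧ Spec p B M x

theorem tau_eq_of_parallel {x y : V} (hx : x ≠ 0) {r : ℚ} (h : x = r • y) : tau B x = tau B y := by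
  have hr : r ≠ 0 := by rintro rfl; exact hx (by rw [h, zero_smul])
  rw [h, tau_smul hr]

theorem parallel_symm {x y : V} (hx : x ≠ 0) {r : ℚ} (h : x = r • y) : ∃ s : ℚ, y = s • x := by
  have hr : r ≠ 0 := by rintro rfl; exact hx (by rw [h, zero_smul])
  exact ⟨r⁻¹, by rw [h, smul_smul, inv_mul_cancel₀ hr, one_smul]⟩

/-- A set of lattices like `Γ_p^L(N)`. -/
structure IsFam (p : ℕ) (B : LinearMap.BilinForm ℚ V) (N : Submodule ℤ V)
    (Γ : Set (Submodule ℤ V)) : Prop where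
  adm : ∀ M ∈ Γ, Adm p B M
  wat : ∀ M ∈ Γ, watson B p M = N
  rank : ∀ M ∈ Γ, ∀ M' ∈ Γ, (RankOne p B M ↔ RankOne p B M')
  stable : ∀ σ ∈ isometryGroup B N, ∀ M ∈ Γ, σ • M ∈ Γ

theorem conj_mem_smul {σ g : V ≃ₗ[ℚ] V} (hg : g ∈ isometryGroup B M)
    (hσ : σ ∈ orthogonalGroup B) : σ * g * σ⁻¹ ∈ isometryGroup B (σ • M) := by
  refine ⟨(orthogonalGroup B).mul_mem ((orthogonalGroup B).mul_mem hσ hg.1)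
    ((orthogonalGroup B).inv_mem hσ), ?_⟩
  change (σ * g * σ⁻¹) • σ • M = σ • M
  rw [smul_smul, mul_assoc, mul_assoc, inv_mul_cancel, mul_one, mul_smul, hg.2]

namespace IsFam

variable {Γ : Set (Submodule ℤ V)} {M' : Submodule ℤ V}

theorem le (h : IsFam p B N Γ) (hM : M ∈ Γ) : isometryGroup B M ≤ isometryGroup B N := by
  rw [← h.wat M hM]; exact isometryGroup_le_watson

theorem lattice (h : IsFam p B N Γ) (hM : M ∈ Γ) : IsIntLattice B N := by
  have := h.adm M hM
  rw [← h.wat M hM]; exact isLattice_watson this.prime this.odd this.toIsIntLattice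

theorem isSym (h : IsFam p B N Γ) (hM : M ∈ Γ) {x : V} (hx : IsSym B M x) : IsSym B N x :=
  ⟨hx.1, h.le hM hx.2⟩

theorem eq_of_spec (h : IsFam p B N Γ) (hM : M ∈ Γ) (hM' : M' ∈ Γ) {c : ℤ} (hc : ¬ (p : ℤ) ∣ c)
    {e e' : V} (he : IsAxisVec c B M e) (he' : IsAxisVec c B M' e') (hpar : ∃ r : ℚ, e' = r • e)
    (hs : Spec p B M e) (hs' : Spec p B M' e') : M = M' :=
  (h.adm M hM).eq_of_spec (h.adm M' hM') (by rw [h.wat M hM, h.wat M' hM']) (h.rank M hM M' hM')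
    hc he he' hpar hs hs'

theorem eq_of_specSym (h : IsFam p B N Γ) (hM : M ∈ Γ) (hM' : M' ∈ Γ) {σ : V ≃ₗ[ℚ] V}
    (h1 : SpecSym p B M σ) (h2 : SpecSym p B M' σ) : M = M' := by
  obtain ⟨x, hx, hsx, rfl, hx'⟩ := h1
  obtain ⟨y, hy, hsy, hxy, hy'⟩ := h2
  have a := h.adm M hM
  obtain ⟨c, -, hc⟩ := tau_eq_tau a.toIsTernaryForm hsy.1 hxy
  exact h.eq_of_spec hM hM' a.two_not_dvd (a.toIsIntLattice.axisVec_of_sym hx hsx)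
    ((h.adm M' hM').toIsIntLattice.axisVec_of_sym hy hsy) ⟨c, hc⟩ hx' hy'

theorem eq_of_three (h : IsFam p B N Γ) (hp3 : p ≠ 3) (hM : M ∈ Γ) (hM' : M' ∈ Γ) {e e' : V}
    {g g' : V ≃ₗ[ℚ] V} (hr : IsRot B e (-1) g) (hr' : IsRot B e' (-1) g')
    (hg : g ∈ isometryGroup B M) (hg' : g' ∈ isometryGroup B M') (hpar : ∃ r : ℚ, e' = r • e) :
    M = M' := by
  have a := h.adm M hM
  have a' := h.adm M' hM'
  obtain ⟨c, hc, pe⟩ := a.toIsIntLattice.exists_primitive hr.ne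
  obtain ⟨c', hc', pe'⟩ := a'.toIsIntLattice.exists_primitive hr'.ne
  have h1 := hr.smul hc
  have h2 := hr'.smul hc'
  refine h.eq_of_spec hM hM' (a.three_not_dvd hp3) (a.toIsIntLattice.axisVec_of_rot h1 hg pe)
    (a'.toIsIntLattice.axisVec_of_rot h2 hg' pe') ?_ (a.spec_of_rot hp3 h1 hg pe)
    (a'.spec_of_rot hp3 h2 hg' pe')
  obtain ⟨r, hr⟩ := hpar
  exact ⟨c' * r * c⁻¹, by
    rw [hr, smul_smul, smul_smul, mul_assoc (c' * r), inv_mul_cancel₀ hc, mul_one]⟩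

theorem eq_of_four (h : IsFam p B N Γ) (hM : M ∈ Γ) (hM' : M' ∈ Γ) {e e' : V}
    {g g' : V ≃ₗ[ℚ] V} (hr : IsRot B e 0 g) (hr' : IsRot B e' 0 g')
    (hg : g ∈ isometryGroup B M) (hg' : g' ∈ isometryGroup B M') (hpar : ∃ r : ℚ, e' = r • e) :
    M = M' := by
  have a := h.adm M hM
  have a' := h.adm M' hM'
  obtain ⟨c, hc, pe⟩ := a.toIsIntLattice.exists_primitive hr.ne
  obtain ⟨c', hc', pe'⟩ := a'.toIsIntLattice.exists_primitive hr'.ne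
  have h1 := hr.smul hc
  have h2 := hr'.smul hc'
  have e1 := a.toIsIntLattice.axisVec_of_sym pe (h1.sym_axis a.toIsTernaryForm hg)
  have e2 := a'.toIsIntLattice.axisVec_of_sym pe' (h2.sym_axis a.toIsTernaryForm hg')
  refine h.eq_of_spec hM hM' a.two_not_dvd e1 e2 ?_ (a.spec_of_four h1 hg pe)
    (a'.spec_of_four h2 hg' pe')
  obtain ⟨r, hr⟩ := hpar
  exact ⟨c' * r * c⁻¹, by
    rw [hr, smul_smul, smul_smul, mul_assoc (c' * r), inv_mul_cancel₀ hc, mul_one]⟩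

/-- If `σ` preserves the axis of a threefold rotation of `M`, then `σ ∈ O(M)`. -/
theorem mem_of_three (h : IsFam p B N Γ) (hp3 : p ≠ 3) (hM : M ∈ Γ) {e : V} {g : V ≃ₗ[ℚ] V}
    (hr : IsRot B e (-1) g) (hg : g ∈ isometryGroup B M) {σ : V ≃ₗ[ℚ] V}
    (hσ : σ ∈ isometryGroup B N) (he : ∃ r : ℚ, σ e = r • e) : σ ∈ isometryGroup B M :=
  ⟨hσ.1, (h.eq_of_three hp3 hM (h.stable σ hσ M hM) hr (hr.conj hσ.1) hg
    (conj_mem_smul hg hσ.1) he).symm⟩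

theorem mem_of_specSym (h : IsFam p B N Γ) (hM : M ∈ Γ) {x : V} (hx : IsPrimitiveVector M x)
    (hs : IsSym B M x) (hsp : Spec p B M x) {σ : V ≃ₗ[ℚ] V} (hσ : σ ∈ isometryGroup B N)
    (he : ∃ r : ℚ, σ x = r • x) : σ ∈ isometryGroup B M := by
  have hax := (h.adm M hM).toIsIntLattice.axisVec_of_sym hx hs
  exact ⟨hσ.1, (h.eq_of_spec hM (h.stable σ hσ M hM) (h.adm M hM).two_not_dvd hax
    (hax.map hσ.1) he hsp ((spec_smul hσ.1).2 hsp)).symm⟩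

end IsFam

end

section

variable {p : ℕ}

/-- The number of lattices in `Γ` with isometry group of order `n`. -/
def xCount (B : LinearMap.BilinForm ℚ V) (Γ : Set (Submodule ℤ V)) (n : ℕ) : ℕ :=
  {M | M ∈ Γ ∧ Nat.card (isometryGroup B M) = n}.ncard

/-- The number of classes of lattices in `Γ` with isometry group of order `n`. -/
def hCount (B : LinearMap.BilinForm ℚ V) (Γ : Set (Submodule ℤ V)) (n : ℕ) : ℕ :=
  {C : Set (Submodule ℤ V) |
    ∃ M ∈ Γ, Nat.card (isometryGroup B M) = n ∧ C = isometryClass B M}.ncard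

theorem IsIntLattice.card_mem (hM : IsIntLattice B M) :
    Nat.card (isometryGroup B M) ∈ ({2, 4, 8, 12, 16, 24, 48} : Finset ℕ) := by
  have := hM.holohedry
  simp only [Finset.mem_insert, Finset.mem_singleton]
  tauto

theorem IsIntLattice.finite_group (hM : IsIntLattice B M) : Finite (isometryGroup B M) := by
  refine Nat.finite_of_card_ne_zero fun h0 => ?_
  have := hM.card_mem
  rw [h0] at this
  revert this
  decide

theorem IsIntLattice.basis (hM : IsIntLattice B M) : Nonempty (Module.Basis (Fin 3) ℤ M) := by
  have hl := hM.lattice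
  have hfree : Module.Free ℤ M := Submodule.IsLattice.free ℚ M
  have hrank : Module.finrank ℤ M = 3 := by
    rw [← hM.finrank_eq]
    simp only [Module.finrank, Submodule.IsLattice.rank' ℚ M]
  exact ⟨Module.finBasisOfFinrankEq ℤ M hrank⟩

namespace IsFam

variable {Γ : Set (Submodule ℤ V)} {M' : Submodule ℤ V}

theorem le_lattice (h : IsFam p B N Γ) (hM : M ∈ Γ) : N ≤ M := by
  rw [← h.wat M hM]; exact (h.adm M hM).watson_le

theorem smul_mem (h : IsFam p B N Γ) (hM : M ∈ Γ) {v : V} (hv : v ∈ M) : (p : ℤ) • v ∈ N := by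
  rw [← h.wat M hM]; exact (h.adm M hM).inMul_mem_watson ⟨v, hv, rfl⟩

theorem finite (h : IsFam p B N Γ) : Γ.Finite := by
  rcases Γ.eq_empty_or_nonempty with rfl | ⟨M₀, hM₀⟩
  · exact Set.finite_empty
  have hp := (h.adm M₀ hM₀).prime
  have hpz : (p : ℤ) ≠ 0 := by exact_mod_cast hp.ne_zero
  have : NeZero p := ⟨hp.ne_zero⟩
  obtain ⟨b⟩ := (h.lattice hM₀).basis
  refine Set.Finite.of_injOn (t := Set.univ)
    (f := fun M => {c : Fin 3 → Fin p | ∃ m ∈ M, (p : ℤ) • m = ∑ i, ((c i : ℕ) : ℤ) • (b i : V)})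
    (fun _ _ => Set.mem_univ _) ?_ Set.finite_univ
  have key : ∀ M ∈ Γ, ∀ M' ∈ Γ, {c : Fin 3 → Fin p | ∃ m ∈ M, (p : ℤ) • m =
      ∑ i, ((c i : ℕ) : ℤ) • (b i : V)} ⊆ {c : Fin 3 → Fin p | ∃ m ∈ M', (p : ℤ) • m =
      ∑ i, ((c i : ℕ) : ℤ) • (b i : V)} → M ≤ M' := by
    intro M hM M' hM' hsub v hv
    have hpv := h.smul_mem hM hv
    set k := b.repr ⟨_, hpv⟩ with hk
    have hsum : (p : ℤ) • v = ∑ i, k i • (b i : V) := by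
      have := congrArg (N.subtype) (b.sum_repr ⟨_, hpv⟩)
      rw [map_sum] at this
      exact this.symm
    set n : V := ∑ i, (k i / p) • (b i : V) with hn
    have hnN : n ∈ N := Submodule.sum_mem _ fun i _ => N.smul_mem _ (b i).2
    have hm : (p : ℤ) • (v - n) = ∑ i, (k i % p) • (b i : V) := by
      rw [smul_sub, hsum, hn, Finset.smul_sum, ← Finset.sum_sub_distrib]
      refine Finset.sum_congr rfl fun i _ => ?_
      rw [smul_smul, ← sub_smul]
      congr 1
      have := Int.emod_add_mul_ediv (k i) p
      linarith
    let c : Fin 3 → Fin p := fun i => ⟨(k i % p).toNat, by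
      have h1 := Int.emod_lt_of_pos (k i) (show (0 : ℤ) < p by exact_mod_cast hp.pos)
      have h2 := Int.emod_nonneg (k i) hpz
      omega⟩
    have hc : ∀ i, ((c i : ℕ) : ℤ) = k i % p := fun i =>
      Int.toNat_of_nonneg (Int.emod_nonneg (k i) hpz)
    have hcm : c ∈ {c : Fin 3 → Fin p | ∃ m ∈ M, (p : ℤ) • m =
        ∑ i, ((c i : ℕ) : ℤ) • (b i : V)} := by
      refine ⟨v - n, M.sub_mem hv (h.le_lattice hM hnN), ?_⟩
      rw [hm]
      exact Finset.sum_congr rfl fun i _ => by rw [hc]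
    obtain ⟨m', hm', e⟩ := hsub hcm
    have : v - n = m' := by
      apply zsmul_cancel hpz
      rw [e, hm]
      exact Finset.sum_congr rfl fun i _ => by rw [hc]
    rw [← sub_add_cancel v n, this]
    exact M'.add_mem hm' (h.le_lattice hM' hnN)
  intro M hM M' hM' heq
  exact le_antisymm (key M hM M' hM' heq.subset) (key M' hM' M hM heq.symm.subset)

theorem isometryClass_eq_iff (h : IsFam p B N Γ) (hM : M ∈ Γ) (hM' : M' ∈ Γ) :
    isometryClass B M' = isometryClass B M ↔ ∃ σ ∈ isometryGroup B N, σ • M = M' := by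
  constructor
  · intro heq
    have : M' ∈ isometryClass B M := heq ▸ ⟨1, one_mem _, by simp⟩
    obtain ⟨σ, hσ, rfl⟩ := this
    refine ⟨σ, ⟨hσ, ?_⟩, rfl⟩
    have := watson_smul (p := p) (M := M) hσ
    rw [h.wat _ hM', h.wat _ hM] at this
    exact this.symm
  · rintro ⟨σ, hσ, rfl⟩
    ext K
    constructor
    · rintro ⟨τ, hτ, rfl⟩
      exact ⟨τ * σ, mul_mem hτ hσ.1, (mul_smul _ _ _).symm⟩
    · rintro ⟨τ, hτ, rfl⟩
      exact ⟨τ * σ⁻¹, mul_mem hτ (inv_mem hσ.1), by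
        rw [smul_smul, mul_assoc, inv_mul_cancel, mul_one]⟩

theorem card_conj {σ : V ≃ₗ[ℚ] V} (hσ : σ ∈ orthogonalGroup B) (M : Submodule ℤ V) :
    Nat.card (isometryGroup B (σ • M)) = Nat.card (isometryGroup B M) := by
  have hback : ∀ g ∈ isometryGroup B (σ • M), σ⁻¹ * g * σ ∈ isometryGroup B M := by
    intro g hg
    have := conj_mem_smul hg (inv_mem hσ)
    rwa [inv_inv, smul_smul, inv_mul_cancel, one_smul] at this
  exact (Nat.card_congr ⟨fun g => ⟨σ * g * σ⁻¹, conj_mem_smul g.2 hσ⟩,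
    fun g => ⟨σ⁻¹ * g * σ, hback g g.2⟩, fun g => Subtype.ext (by simp [mul_assoc]),
    fun g => Subtype.ext (by simp [mul_assoc])⟩).symm

theorem card_orbit (h : IsFam p B N Γ) (hM : M ∈ Γ) :
    {M' | M' ∈ Γ ∧ isometryClass B M' = isometryClass B M}.ncard *
      Nat.card (isometryGroup B M) = Nat.card (isometryGroup B N) := by
  have horb : {M' | M' ∈ Γ ∧ isometryClass B M' = isometryClass B M} =
      MulAction.orbit (isometryGroup B N) M := by
    ext M'
    constructor
    · rintro ⟨hM', h1⟩
      obtain ⟨σ, hσ, h2⟩ := (h.isometryClass_eq_iff hM hM').1 h1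
      exact ⟨⟨σ, hσ⟩, h2⟩
    · rintro ⟨σ, rfl⟩
      have h2 := h.stable σ.1 σ.2 M hM
      exact ⟨h2, (h.isometryClass_eq_iff hM h2).2 ⟨σ, σ.2, rfl⟩⟩
  rw [horb, ← MulAction.index_stabilizer]
  have hcard : Nat.card (isometryGroup B M) =
      Nat.card (MulAction.stabilizer (isometryGroup B N) M) := by
    refine Nat.card_congr ⟨fun g => ⟨⟨g, h.le hM g.2⟩, g.2.2⟩, fun g => ⟨g.1.1, g.1.2.1, g.2⟩,
      fun g => rfl, fun g => rfl⟩
  rw [hcard, mul_comm]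
  exact Subgroup.card_mul_index _

/-- Orbit counting. -/
theorem xCount_mul (h : IsFam p B N Γ) (n : ℕ) :
    xCount B Γ n * n = hCount B Γ n * Nat.card (isometryGroup B N) := by
  classical
  have hfin : {M | M ∈ Γ ∧ Nat.card (isometryGroup B M) = n}.Finite :=
    h.finite.subset fun M hM => hM.1
  set A := hfin.toFinset with hA
  have hx : xCount B Γ n = A.card := Set.ncard_eq_toFinset_card _ hfin
  have hh : hCount B Γ n = (A.image (isometryClass B)).card := by
    have : {C : Set (Submodule ℤ V) | ∃ M ∈ Γ, Nat.card (isometryGroup B M) = n ∧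
        C = isometryClass B M} = ((A.image (isometryClass B) : Finset _) : Set _) := by
      ext C
      simp only [Set.mem_ofPred_eq, Finset.coe_image, Set.mem_image, hA, Set.Finite.coe_toFinset]
      constructor
      · rintro ⟨M, h1, h2, rfl⟩; exact ⟨M, ⟨h1, h2⟩, rfl⟩
      · rintro ⟨M, ⟨h1, h2⟩, rfl⟩; exact ⟨M, h1, h2, rfl⟩
    rw [hCount, this, Set.ncard_coe_finset]
  rw [hx, hh, Finset.card_eq_sum_card_image (isometryClass B) A, Finset.sum_mul,
    ← smul_eq_mul, ← Finset.sum_const]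
  refine Finset.sum_congr rfl fun C hC => ?_
  obtain ⟨M, hM, rfl⟩ := Finset.mem_image.1 hC
  have hM' := hfin.mem_toFinset.1 hM
  rw [← h.card_orbit hM'.1, hM'.2, ← Set.ncard_coe_finset]
  congr 2
  ext M'
  simp only [Finset.coe_filter, Set.mem_ofPred_eq, hA, Set.Finite.mem_toFinset]
  constructor
  · rintro ⟨⟨h1, -⟩, h2⟩; exact ⟨h1, h2⟩
  · rintro ⟨h1, h2⟩
    refine ⟨⟨h1, ?_⟩, h2⟩
    obtain ⟨σ, hσ, rfl⟩ := (h.isometryClass_eq_iff hM'.1 h1).1 h2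
    rw [card_conj hσ.1, hM'.2]

theorem sum_card (h : IsFam p B N Γ) (φ : ℕ → ℕ) :
    ∑ M ∈ h.finite.toFinset, φ (Nat.card (isometryGroup B M)) =
      φ 2 * xCount B Γ 2 + φ 4 * xCount B Γ 4 + φ 8 * xCount B Γ 8 + φ 12 * xCount B Γ 12 +
      φ 16 * xCount B Γ 16 + φ 24 * xCount B Γ 24 + φ 48 * xCount B Γ 48 := by
  classical
  have hx : ∀ n, xCount B Γ n =
      (h.finite.toFinset.filter fun M => Nat.card (isometryGroup B M) = n).card := by
    intro n
    rw [xCount, ← Set.ncard_coe_finset]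
    congr 1
    ext M
    simp
  rw [← Finset.sum_fiberwise_of_maps_to (t := {2, 4, 8, 12, 16, 24, 48})
    (g := fun M => Nat.card (isometryGroup B M))
    fun M hM => (h.adm M (h.finite.mem_toFinset.1 hM)).toIsIntLattice.card_mem]
  have : ∀ n, ∑ M ∈ h.finite.toFinset with Nat.card (isometryGroup B M) = n,
      φ (Nat.card (isometryGroup B M)) = φ n * xCount B Γ n := by
    intro n
    rw [hx, Finset.sum_congr rfl (g := fun _ => φ n) fun M hM => by rw [(Finset.mem_filter.1 hM).2],
      Finset.sum_const, smul_eq_mul, mul_comm]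
  simp only [this]
  rw [Finset.sum_insert (by decide), Finset.sum_insert (by decide), Finset.sum_insert (by decide),
    Finset.sum_insert (by decide), Finset.sum_insert (by decide), Finset.sum_insert (by decide),
    Finset.sum_singleton]
  ring

theorem ncard_eq (h : IsFam p B N Γ) : Γ.ncard =
    xCount B Γ 2 + xCount B Γ 4 + xCount B Γ 8 + xCount B Γ 12 + xCount B Γ 16 + xCount B Γ 24 +
      xCount B Γ 48 := by
  have := h.sum_card fun _ => 1
  simp only [one_mul, Finset.sum_const, smul_eq_mul, mul_one] at this
  rw [← this, Set.ncard_eq_toFinset_card _ h.finite]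

theorem finite_symmetries (h : IsFam p B N Γ) (hM : M ∈ Γ) : (symmetries B N).Finite := by
  have := (h.lattice hM).finite_group
  exact Set.Finite.subset (Set.toFinite (isometryGroup B N : Set (V ≃ₗ[ℚ] V))) fun σ hσ => hσ.1

theorem sum_fixed (h : IsFam p B N Γ) :
    ∑ᶠ σ ∈ symmetries B N, {M | M ∈ Γ ∧ σ • M = M}.ncard =
    xCount B Γ 4 + 3 * xCount B Γ 8 + 3 * xCount B Γ 12 + 5 * xCount B Γ 16 + 7 * xCount B Γ 24 +
      9 * xCount B Γ 48 := by
  classical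
  rcases Γ.eq_empty_or_nonempty with rfl | ⟨M₀, hM₀⟩
  · simp [xCount]
  have hS := h.finite_symmetries hM₀
  rw [finsum_mem_eq_finite_toFinset_sum _ hS]
  have e1 : ∀ σ : V ≃ₗ[ℚ] V, {M | M ∈ Γ ∧ σ • M = M}.ncard =
      (h.finite.toFinset.filter fun M => σ • M = M).card := by
    intro σ
    rw [← Set.ncard_coe_finset]
    congr 1
    ext M
    simp
  simp only [e1]
  have e2 := Finset.sum_card_bipartiteAbove_eq_sum_card_bipartiteBelow
    (s := hS.toFinset) (t := h.finite.toFinset)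
    (fun (σ : V ≃ₗ[ℚ] V) (M : Submodule ℤ V) => σ • M = M)
  simp only [Finset.bipartiteAbove, Finset.bipartiteBelow] at e2
  rw [e2]
  let φ : ℕ → ℕ := fun n => if n = 4 then 1 else if n = 8 then 3 else if n = 12 then 3 else
    if n = 16 then 5 else if n = 24 then 7 else if n = 48 then 9 else 0
  have e3 : ∀ M ∈ h.finite.toFinset, (hS.toFinset.filter fun σ => σ • M = M).card =
      φ (Nat.card (isometryGroup B M)) := by
    intro M hM
    have hM := h.finite.mem_toFinset.1 hM
    have : (hS.toFinset.filter fun σ => σ • M = M).card = (symmetries B M).ncard := by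
      rw [← Set.ncard_coe_finset]
      congr 1
      ext σ
      simp only [Finset.coe_filter, Set.Finite.mem_toFinset, Set.mem_ofPred_eq]
      constructor
      · rintro ⟨⟨h1, h2⟩, h3⟩; exact ⟨⟨h1.1, h3⟩, h2⟩
      · rintro ⟨h1, h2⟩; exact ⟨⟨h.le hM h1, h2⟩, h1.2⟩
    rw [this]
    rcases (h.adm M hM).toIsIntLattice.holohedry with h1 | h1 | h1 | h1 | h1 | h1 | h1
    · rw [h1.2.2.1, h1.2.2.2]; rfl
    · rw [h1.2.2.1, h1.2.2.2]; rfl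
    · rw [h1.2.2.1, h1.2.2.2]; rfl
    · rw [h1.2.2.1, h1.2.2.2]; rfl
    · rw [h1.2.1, h1.2.2]; rfl
    · rw [h1.2.1, h1.2.2]; rfl
    · rw [h1.2.1, h1.2.2]; rfl
  rw [Finset.sum_congr rfl e3, h.sum_card φ]
  simp [φ]

end IsFam

end

section

variable {p : ℕ}

theorem IsIntLattice.ortho_of_card (hM : IsIntLattice B M)
    (h : Nat.card (isometryGroup B M) = 8) : ∃ x y z, IsFrame B x y z ∧ IsSym B M x ∧
      IsSym B M y ∧ IsSym B M z ∧
      ∀ w, IsSym B M w → ∃ c : ℚ, w = c • x ∨ w = c • y ∨ w = c • z := by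
  rcases hM.holohedry with h1 | h1 | h1 | h1 | h1 | h1 | h1
  · omega
  · omega
  · exact h1.1
  all_goals omega

theorem IsIntLattice.trigonal_of_card (hM : IsIntLattice B M)
    (h : Nat.card (isometryGroup B M) = 12) :
    ∃ e g, IsAxial B M e (-1) g ∧ ¬ IsSym B M e := by
  rcases hM.holohedry with h1 | h1 | h1 | h1 | h1 | h1 | h1
  · omega
  · omega
  · omega
  · exact h1.1
  all_goals omega

theorem IsIntLattice.tetragonal_of_card (hM : IsIntLattice B M)
    (h : Nat.card (isometryGroup B M) = 16) : ∃ e g, IsAxial B M e 0 g := by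
  rcases hM.holohedry with h1 | h1 | h1 | h1 | h1 | h1 | h1
  · omega
  · omega
  · omega
  · omega
  · exact h1.1
  all_goals omega

theorem IsIntLattice.hexagonal_of_card (hM : IsIntLattice B M)
    (h : Nat.card (isometryGroup B M) = 24) : ∃ e g, IsAxial B M e (-1) g ∧ IsSym B M e := by
  rcases hM.holohedry with h1 | h1 | h1 | h1 | h1 | h1 | h1
  · omega
  · omega
  · omega
  · omega
  · omega
  · exact h1.1
  · omega

theorem IsIntLattice.cubic_of_card (hM : IsIntLattice B M)
    (h : Nat.card (isometryGroup B M) = 48) : ∃ f₁ f₂ f₃, IsCubic B M f₁ f₂ f₃ := by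
  rcases hM.holohedry with h1 | h1 | h1 | h1 | h1 | h1 | h1
  · omega
  · omega
  · omega
  · omega
  · omega
  · omega
  · exact h1.1

theorem IsAxial.exists_plane_sym (hM : IsIntLattice B M) {e : V} {t : ℚ} {g : V ≃ₗ[ℚ] V}
    (h : IsAxial B M e t g) : ∃ x, IsSym B M x ∧ B e x = 0 := by
  obtain ⟨x, -, hex, hx, -⟩ := (hM.rot_structure h.rot h.mem).2
  exact ⟨x, hx, hex⟩

theorem IsAxial.exists_orth (hM : IsIntLattice B M) {e : V} {t : ℚ} {g : V ≃ₗ[ℚ] V}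
    (h : IsAxial B M e t g) (he : IsSym B M e) {z : V} (hz : IsSym B M z) :
    ∃ y, IsSym B M y ∧ B z y = 0 := by
  rcases h.syms z hz with h1 | ⟨c, rfl⟩
  · exact ⟨e, he, by rw [hM.symm, h1]⟩
  · obtain ⟨x, hx, hex⟩ := h.exists_plane_sym hM
    exact ⟨x, hx, by simp [hex]⟩

/-- If `|O(M)|` is `8`, `16`, `24` or `48`, each symmetry has an orthogonal one. -/
theorem IsIntLattice.exists_orth_sym (hM : IsIntLattice B M)
    (h : Nat.card (isometryGroup B M) ∈ ({8, 16, 24, 48} : Finset ℕ)) {z : V}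
    (hz : IsSym B M z) : ∃ y, IsSym B M y ∧ B z y = 0 := by
  have hB := hM.toIsTernaryForm
  simp only [Finset.mem_insert, Finset.mem_singleton] at h
  rcases h with h | h | h | h
  · obtain ⟨x, y, w, hf, hx, hy, hw, hall⟩ := hM.ortho_of_card h
    obtain ⟨c, rfl | rfl | rfl⟩ := hall z hz
    · exact ⟨y, hy, by simp [hf.h12]⟩
    · exact ⟨w, hw, by simp [hf.h23]⟩
    · exact ⟨x, hx, by simp [hB.symm w x, hf.h13]⟩
  · obtain ⟨e, g, hax⟩ := hM.tetragonal_of_card h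
    exact hax.exists_orth hM (hax.rot.sym_axis hB hax.mem) hz
  · obtain ⟨e, g, hax, he⟩ := hM.hexagonal_of_card h
    exact hax.exists_orth hM he hz
  · obtain ⟨f₁, f₂, f₃, hc⟩ := hM.cubic_of_card h
    exact hc.exists_orth hM hz

/-- If there are orthogonal symmetries, then `|O(M)|` is `8`, `16`, `24` or `48`. -/
theorem IsIntLattice.card_of_orth_syms (hM : IsIntLattice B M) {x y : V} (hx : IsSym B M x)
    (hy : IsSym B M y) (hxy : B x y = 0) :
    Nat.card (isometryGroup B M) ∈ ({8, 16, 24, 48} : Finset ℕ) := by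
  simp only [Finset.mem_insert, Finset.mem_singleton]
  rcases hM.holohedry with h1 | h1 | h1 | h1 | h1 | h1 | h1
  · exact absurd hx (h1.1 x)
  · obtain ⟨⟨z, hz, hall⟩, -⟩ := h1
    obtain ⟨a, rfl⟩ := hall x hx
    obtain ⟨b, rfl⟩ := hall y hy
    have ha : a ≠ 0 := by rintro rfl; exact hx.1 (zero_smul _ _)
    have hb : b ≠ 0 := by rintro rfl; exact hy.1 (zero_smul _ _)
    simp [ha, hb, hM.ne_zero hz.1] at hxy
  · omega
  · exact absurd hxy (h1.2.1 x y hx hy)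
  all_goals omega

theorem Adm.specSym_unique (h : Adm p B M)
    (hc : Nat.card (isometryGroup B M) ∈ ({8, 16, 24} : Finset ℕ))
    (h24 : Nat.card (isometryGroup B M) = 24 → p ≠ 3) {σ σ' : V ≃ₗ[ℚ] V}
    (h1 : SpecSym p B M σ) (h2 : SpecSym p B M σ') : σ = σ' := by
  have hB := h.toIsTernaryForm
  have hM := h.toIsIntLattice
  obtain ⟨x, hx, hsx, rfl, hx'⟩ := h1
  obtain ⟨y, hy, hsy, rfl, hy'⟩ := h2
  have hno : B x y ≠ 0 := fun h0 => h.not_spec_pair hx hy hsx h0 hx' hy'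
  simp only [Finset.mem_insert, Finset.mem_singleton] at hc
  rcases hc with hc | hc | hc
  · obtain ⟨u, v, w, hf, -, -, -, hall⟩ := hM.ortho_of_card hc
    have f21 : B v u = 0 := by rw [hB.symm, hf.h12]
    have f31 : B w u = 0 := by rw [hB.symm, hf.h13]
    have f32 : B w v = 0 := by rw [hB.symm, hf.h23]
    obtain ⟨a, ha⟩ := hall x hsx
    obtain ⟨b, hb⟩ := hall y hsy
    rcases ha with ha | ha | ha <;> rcases hb with hb | hb | hb
    on_goal 1 => rw [tau_eq_of_parallel hsx.1 ha, tau_eq_of_parallel hsy.1 hb]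
    on_goal 4 => rw [tau_eq_of_parallel hsx.1 ha, tau_eq_of_parallel hsy.1 hb]
    on_goal 7 => rw [tau_eq_of_parallel hsx.1 ha, tau_eq_of_parallel hsy.1 hb]
    all_goals exact absurd (by rw [ha, hb]; simp [hf.h12, hf.h13, hf.h23, f21, f31, f32]) hno
  · obtain ⟨e, g, hax⟩ := hM.tetragonal_of_card hc
    have key : ∀ z, IsPrimitiveVector M z → IsSym B M z → Spec p B M z → tau B z = tau B e := by
      intro z hz hsz hz'
      rcases hax.syms z hsz with h1 | ⟨c, h1⟩
      · exact absurd hz' (h.not_spec_of_four hax.rot hax.mem hz hsz h1)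
      · exact tau_eq_of_parallel hsz.1 h1
    rw [key x hx hsx hx', key y hy hsy hy']
  · obtain ⟨e, g, hax, he⟩ := hM.hexagonal_of_card hc
    obtain ⟨c, hc0, hp⟩ := hM.exists_primitive he.1
    have hr := hax.rot.smul hc0
    have hsp := h.spec_of_rot (h24 hc) hr hax.mem hp
    have key : ∀ z, IsPrimitiveVector M z → IsSym B M z → Spec p B M z → tau B z = tau B e := by
      intro z hz hsz hz'
      rcases hax.syms z hsz with h1 | ⟨d, h1⟩
      · exact absurd hsp (h.not_spec_pair hz hp hsz (by rw [map_smul, hB.symm, h1, smul_zero]) hz')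
      · exact tau_eq_of_parallel hsz.1 h1
    rw [key x hx hsx hx', key y hy hsy hy']

namespace IsFam

variable {Γ : Set (Submodule ℤ V)} {M' : Submodule ℤ V}

theorem xCount_eq_zero {n : ℕ} (hn : ∀ M ∈ Γ, Nat.card (isometryGroup B M) ≠ n) :
    xCount B Γ n = 0 := by
  have : {M | M ∈ Γ ∧ Nat.card (isometryGroup B M) = n} = ∅ := by
    ext M
    simp only [Set.mem_ofPred_eq, Set.mem_empty_iff_false, iff_false, not_and]
    exact hn M
  rw [xCount, this, Set.ncard_empty]

theorem hCount_eq_zero {n : ℕ} (hn : ∀ M ∈ Γ, Nat.card (isometryGroup B M) ≠ n) :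
    hCount B Γ n = 0 := by
  have : {C : Set (Submodule ℤ V) |
    ∃ M ∈ Γ, Nat.card (isometryGroup B M) = n ∧ C = isometryClass B M} = ∅ := by
    ext C
    simp only [Set.mem_ofPred_eq, Set.mem_empty_iff_false, iff_false]
    rintro ⟨M, h1, h2, -⟩
    exact hn M h1 h2
  rw [hCount, this, Set.ncard_empty]

theorem card_dvd (h : IsFam p B N Γ) (hM : M ∈ Γ) :
    Nat.card (isometryGroup B M) ∣ Nat.card (isometryGroup B N) :=
  Subgroup.card_dvd_of_le (h.le hM)

theorem card_ne_48 (h : IsFam p B N Γ) (hM : M ∈ Γ) : Nat.card (isometryGroup B M) ≠ 48 := by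
  intro hc
  obtain ⟨f₁, f₂, f₃, hcu⟩ := (h.adm M hM).toIsIntLattice.cubic_of_card hc
  exact (h.adm M hM).not_cubic _ _ _ hcu

theorem card_ne_24 (h : IsFam p B N Γ) (ho : Nat.card (isometryGroup B N) = 48) (hM : M ∈ Γ) :
    Nat.card (isometryGroup B M) ≠ 24 := by
  intro hc
  have hN := h.lattice hM
  obtain ⟨e, g, hax, he⟩ := (h.adm M hM).toIsIntLattice.hexagonal_of_card hc
  obtain ⟨f₁, f₂, f₃, hcu⟩ := hN.cubic_of_card ho
  obtain ⟨σ, hσ, c, hσe⟩ := hcu.three_axis hN (h.le hM hax.mem) hax.rot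
  have hc0 : c ≠ 0 := by
    rintro rfl
    exact hcu.diag_ne hN.toIsTernaryForm (by rw [hσe, zero_smul])
  apply hcu.diag_not_sym hN
  rw [hσe]
  exact ((h.isSym hM he).map hσ).smul hc0

theorem card_12_ne_three (h : IsFam p B N Γ) (hM : M ∈ Γ)
    (hc : Nat.card (isometryGroup B M) = 12) (ho : Nat.card (isometryGroup B N) = 12 ∨
      Nat.card (isometryGroup B N) = 48) : p ≠ 3 := by
  rintro rfl
  have hN := h.lattice hM
  obtain ⟨e, g, hax, -⟩ := (h.adm M hM).toIsIntLattice.trigonal_of_card hc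
  have hs := (h.adm M hM).sym_axis_three hax.rot hax.mem
  rw [h.wat M hM] at hs
  rcases ho with ho | ho
  · obtain ⟨e', g', hax', hne⟩ := hN.trigonal_of_card ho
    obtain ⟨c, rfl⟩ := hax'.axes _ _ _ (h.le hM hax.mem) hax.rot
    exact hne (isSym_of_smul hs)
  · obtain ⟨f₁, f₂, f₃, hcu⟩ := hN.cubic_of_card ho
    obtain ⟨σ, hσ, c, hσe⟩ := hcu.three_axis hN (h.le hM hax.mem) hax.rot
    have hc0 : c ≠ 0 := by
      rintro rfl
      exact hcu.diag_ne hN.toIsTernaryForm (by rw [hσe, zero_smul])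
    apply hcu.diag_not_sym hN
    rw [hσe]
    exact (hs.map hσ).smul hc0

theorem eq_of_axial_three (h : IsFam p B N Γ) (hp3 : p ≠ 3) {e₀ : V} {g₀ : V ≃ₗ[ℚ] V}
    (hax : IsAxial B N e₀ (-1) g₀) (hM : M ∈ Γ) (hM' : M' ∈ Γ) {e e' : V}
    {g g' : V ≃ₗ[ℚ] V} (hr : IsRot B e (-1) g) (hr' : IsRot B e' (-1) g')
    (hg : g ∈ isometryGroup B M) (hg' : g' ∈ isometryGroup B M') : M = M' := by
  refine h.eq_of_three hp3 hM hM' hr hr' hg hg' ?_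
  obtain ⟨c, rfl⟩ := hax.axes _ _ _ (h.le hM hg) hr
  obtain ⟨d, rfl⟩ := hax.axes _ _ _ (h.le hM' hg') hr'
  obtain ⟨s, hs⟩ := parallel_symm hr.ne rfl
  exact ⟨d * s, by rw [mul_smul, ← hs]⟩

theorem exists_rot_three (h : IsFam p B N Γ) (hM : M ∈ Γ)
    (hc : Nat.card (isometryGroup B M) = 12 ∨ Nat.card (isometryGroup B M) = 24) :
    ∃ e g, IsAxial B M e (-1) g := by
  rcases hc with hc | hc
  · obtain ⟨e, g, hax, -⟩ := (h.adm M hM).toIsIntLattice.trigonal_of_card hc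
    exact ⟨e, g, hax⟩
  · obtain ⟨e, g, hax, -⟩ := (h.adm M hM).toIsIntLattice.hexagonal_of_card hc
    exact ⟨e, g, hax⟩

theorem xCount_12_le (h : IsFam p B N Γ) (ho : Nat.card (isometryGroup B N) = 12) :
    xCount B Γ 12 ≤ 1 := by
  rw [xCount, Set.ncard_le_one (h.finite.subset fun _ h => h.1)]
  rintro M ⟨hM, hc⟩ M' ⟨hM', hc'⟩
  have hN := h.lattice hM
  obtain ⟨e₀, g₀, hax, -⟩ := hN.trigonal_of_card ho
  obtain ⟨e, g, hr⟩ := h.exists_rot_three hM (Or.inl hc)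
  obtain ⟨e', g', hr'⟩ := h.exists_rot_three hM' (Or.inl hc')
  exact h.eq_of_axial_three (h.card_12_ne_three hM hc (Or.inl ho)) hax hM hM' hr.rot hr'.rot
    hr.mem hr'.mem

theorem xCount_24_le (h : IsFam p B N Γ) (ho : Nat.card (isometryGroup B N) = 24) (hp3 : p ≠ 3) :
    xCount B Γ 24 ≤ 1 := by
  rw [xCount, Set.ncard_le_one (h.finite.subset fun _ h => h.1)]
  rintro M ⟨hM, hc⟩ M' ⟨hM', hc'⟩
  have hN := h.lattice hM
  obtain ⟨e₀, g₀, hax, -⟩ := hN.hexagonal_of_card ho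
  obtain ⟨e, g, hr⟩ := h.exists_rot_three hM (Or.inr hc)
  obtain ⟨e', g', hr'⟩ := h.exists_rot_three hM' (Or.inr hc')
  exact h.eq_of_axial_three hp3 hax hM hM' hr.rot hr'.rot hr.mem hr'.mem

theorem card_ne_12 (h : IsFam p B N Γ) (ho : Nat.card (isometryGroup B N) = 24) (hp3 : p ≠ 3)
    (hM : M ∈ Γ) : Nat.card (isometryGroup B M) ≠ 12 := by
  intro hc
  have hN := h.lattice hM
  have hB := hN.toIsTernaryForm
  obtain ⟨e₀, g₀, hax, -⟩ := hN.hexagonal_of_card ho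
  obtain ⟨e, g, hr⟩ := h.exists_rot_three hM (Or.inl hc)
  have hle : isometryGroup B N ≤ isometryGroup B M := by
    intro σ hσ
    refine h.mem_of_three hp3 hM hr.rot hr.mem hσ ?_
    obtain ⟨c, rfl⟩ := hax.axes _ _ _ (h.le hM hr.mem) hr.rot
    rcases hax.map_axis hB hσ with h1 | h1
    · exact ⟨1, by rw [map_smul, h1, one_smul]⟩
    · exact ⟨-1, by rw [map_smul, h1, smul_neg, neg_one_smul]⟩
  have := le_antisymm hle (h.le hM)
  rw [this, hc] at ho
  omega

theorem xCount_16_le (h : IsFam p B N Γ) (ho : Nat.card (isometryGroup B N) = 16) :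
    xCount B Γ 16 ≤ 1 := by
  rw [xCount, Set.ncard_le_one (h.finite.subset fun _ h => h.1)]
  rintro M ⟨hM, hc⟩ M' ⟨hM', hc'⟩
  have hN := h.lattice hM
  obtain ⟨e₀, g₀, hax⟩ := hN.tetragonal_of_card ho
  obtain ⟨e, g, hr⟩ := (h.adm M hM).toIsIntLattice.tetragonal_of_card hc
  obtain ⟨e', g', hr'⟩ := (h.adm M' hM').toIsIntLattice.tetragonal_of_card hc'
  refine h.eq_of_four hM hM' hr.rot hr'.rot hr.mem hr'.mem ?_
  obtain ⟨c, rfl⟩ := hax.axes _ _ _ (h.le hM hr.mem) hr.rot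
  obtain ⟨d, rfl⟩ := hax.axes _ _ _ (h.le hM' hr'.mem) hr'.rot
  obtain ⟨s, hs⟩ := parallel_symm hr.rot.ne rfl
  exact ⟨d * s, by rw [mul_smul, ← hs]⟩

/-- The number of symmetries special to some lattice in `Γ` which they fix. -/
theorem ncard_special (h : IsFam p B N Γ)
    (ho : Nat.card (isometryGroup B N) ∈ ({8, 16, 24, 48} : Finset ℕ))
    (h24 : Nat.card (isometryGroup B N) = 24 → p ≠ 3) :
    {σ | σ ∈ symmetries B N ∧ ∃ M ∈ Γ, σ • M = M ∧ SpecSym p B M σ}.ncard =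
      xCount B Γ 8 + xCount B Γ 16 + xCount B Γ 24 := by
  classical
  let T : Finset ℕ := {8, 16, 24}
  have hA : {M | M ∈ Γ ∧ Nat.card (isometryGroup B M) ∈ T}.ncard =
      xCount B Γ 8 + xCount B Γ 16 + xCount B Γ 24 := by
    have e1 := h.sum_card fun n => if n ∈ T then 1 else 0
    rw [← Finset.card_filter] at e1
    have e2 : (h.finite.toFinset.filter fun M => Nat.card (isometryGroup B M) ∈ T).card =
        {M | M ∈ Γ ∧ Nat.card (isometryGroup B M) ∈ T}.ncard := by
      rw [← Set.ncard_coe_finset]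
      congr 1
      ext M
      simp
    rw [← e2, e1]
    simp [T]
  have hp3 : ∀ M ∈ Γ, Nat.card (isometryGroup B M) = 24 → p ≠ 3 := by
    intro M hM hc
    apply h24
    have := h.card_dvd hM
    rw [hc] at this
    simp only [Finset.mem_insert, Finset.mem_singleton] at ho
    rcases ho with ho | ho | ho | ho
    · rw [ho] at this; omega
    · rw [ho] at this; omega
    · exact ho
    · exact absurd hc (h.card_ne_24 ho hM)
  have hex : ∀ M ∈ {M | M ∈ Γ ∧ Nat.card (isometryGroup B M) ∈ T}, ∃ σ, SpecSym p B M σ := by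
    rintro M ⟨hM, hc⟩
    have hI := (h.adm M hM).toIsIntLattice
    have hc' : Nat.card (isometryGroup B M) ∈ ({8, 16, 24, 48} : Finset ℕ) := by
      simp only [T, Finset.mem_insert, Finset.mem_singleton] at hc ⊢; tauto
    have : ∃ x, IsSym B M x := by
      by_contra hne
      push Not at hne
      rcases hI.holohedry with h1 | h1 | h1 | h1 | h1 | h1 | h1
      · rw [h1.2.2.1] at hc; revert hc; decide
      · obtain ⟨⟨x, hx, -⟩, -⟩ := h1; exact hne x hx
      · obtain ⟨⟨x, -, -, -, hx, -⟩, -⟩ := h1; exact hne x hx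
      · obtain ⟨⟨e, g, hax, -⟩, -⟩ := h1
        obtain ⟨x, hx, -⟩ := hax.exists_plane_sym hI; exact hne x hx
      · obtain ⟨⟨e, g, hax⟩, -⟩ := h1
        obtain ⟨x, hx, -⟩ := hax.exists_plane_sym hI; exact hne x hx
      · obtain ⟨⟨e, g, hax, -⟩, -⟩ := h1
        obtain ⟨x, hx, -⟩ := hax.exists_plane_sym hI; exact hne x hx
      · obtain ⟨⟨f₁, f₂, f₃, hx⟩, -⟩ := h1; exact hne f₁ hx.s1
    obtain ⟨x, hx⟩ := this
    obtain ⟨y, hy, hxy⟩ := hI.exists_orth_sym hc' hx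
    obtain ⟨z, hz, hsz, hsp⟩ := (h.adm M hM).exists_spec_of_orth hx hy hxy
    exact ⟨_, z, hz, hsz, rfl, hsp⟩
  rw [← hA]
  choose! F hF using hex
  symm
  refine Set.ncard_congr (fun M _ => F M) ?_ ?_ ?_
  · intro M hM
    have := hF M hM
    obtain ⟨x, hx, hsx, hFx, -⟩ := this
    rw [Set.mem_ofPred_eq, hFx]
    refine ⟨mem_symmetries_iff.2 ⟨x, h.isSym hM.1 hsx, rfl⟩, M, hM.1, hsx.2.2, ?_⟩
    rw [← hFx]; exact hF M hM
  · intro M M' hM hM' heq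
    exact h.eq_of_specSym hM.1 hM'.1 (hF M hM) (by rw [heq]; exact hF M' hM')
  · rintro σ ⟨-, M, hM, -, hsp⟩
    have hI := (h.adm M hM).toIsIntLattice
    have hB := hI.toIsTernaryForm
    have hMT : M ∈ {M | M ∈ Γ ∧ Nat.card (isometryGroup B M) ∈ T} := by
      obtain ⟨x, hx, hsx, rfl, hx'⟩ := hsp
      obtain ⟨y, hy, hxy⟩ := (h.lattice hM).exists_orth_sym ho (h.isSym hM hsx)
      have hyM := h.mem_of_specSym hM hx hsx hx' hy.2 ⟨1, by
        rw [tau_of_orth (by rw [hB.symm, hxy]), one_smul]⟩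
      have := hI.card_of_orth_syms hsx ⟨hy.1, hyM⟩ hxy
      have h48 := h.card_ne_48 hM
      refine ⟨hM, ?_⟩
      simp only [T, Finset.mem_insert, Finset.mem_singleton] at this ⊢
      tauto
    exact ⟨M, hMT, (h.adm M hM).specSym_unique hMT.2 (hp3 M hM) (hF M hMT) hsp⟩

/-- In the cubic case there is at most one class with a threefold (`n = 12`) and at most one with
a fourfold axis (`n = 16`). -/
theorem hCount_cubic (h : IsFam p B N Γ) (ho : Nat.card (isometryGroup B N) = 48) {n : ℕ}
    (hn : n = 12 ∨ n = 16) :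
    ((∃ M ∈ Γ, Nat.card (isometryGroup B M) = n) → hCount B Γ n = 1) ∧
    ((¬ ∃ M ∈ Γ, Nat.card (isometryGroup B M) = n) → hCount B Γ n = 0) := by
  refine ⟨?_, fun hne => hCount_eq_zero fun M hM hc => hne ⟨M, hM, hc⟩⟩
  rintro ⟨M, hM, hc⟩
  rw [hCount, Set.ncard_eq_one]
  refine ⟨isometryClass B M, ?_⟩
  ext C
  simp only [Set.mem_ofPred_eq, Set.mem_singleton_iff]
  constructor
  swap
  · rintro rfl; exact ⟨M, hM, hc, rfl⟩
  rintro ⟨M', hM', hc', rfl⟩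
  rw [h.isometryClass_eq_iff hM hM']
  have hN := h.lattice hM
  obtain ⟨f₁, f₂, f₃, hcu⟩ := hN.cubic_of_card ho
  have key : ∀ {u e e' : V} {σ σ' : V ≃ₗ[ℚ] V}, u ≠ 0 → (∃ c : ℚ, u = c • σ e) →
      (∃ c : ℚ, u = c • σ' e') → ∃ r : ℚ, e' = r • (σ'⁻¹ * σ : V ≃ₗ[ℚ] V) e := by
    rintro u e e' σ σ' hu ⟨c, hc⟩ ⟨d, hd⟩
    obtain ⟨s, hs⟩ := parallel_symm hu hd
    refine ⟨s * c, ?_⟩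
    rw [mul_smul, LinearEquiv.mul_apply, ← map_smul σ'⁻¹, ← hc, ← map_smul, ← hs,
      ← LinearEquiv.mul_apply, inv_mul_cancel]
    rfl
  rcases hn with rfl | rfl
  · obtain ⟨e, g, hr⟩ := h.exists_rot_three hM (Or.inl hc)
    obtain ⟨e', g', hr'⟩ := h.exists_rot_three hM' (Or.inl hc')
    obtain ⟨σ, hσ, h1⟩ := hcu.three_axis hN (h.le hM hr.mem) hr.rot
    obtain ⟨σ', hσ', h2⟩ := hcu.three_axis hN (h.le hM' hr'.mem) hr'.rot
    have hτ := mul_mem (inv_mem hσ') hσ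
    refine ⟨_, hτ, ?_⟩
    exact h.eq_of_three (h.card_12_ne_three hM hc (Or.inr ho)) (h.stable _ hτ M hM) hM'
      (hr.rot.conj hτ.1) hr'.rot (conj_mem_smul hr.mem hτ.1) hr'.mem
      (key (hcu.diag_ne hN.toIsTernaryForm) h1 h2)
  · obtain ⟨e, g, hr⟩ := (h.adm M hM).toIsIntLattice.tetragonal_of_card hc
    obtain ⟨e', g', hr'⟩ := (h.adm M' hM').toIsIntLattice.tetragonal_of_card hc'
    obtain ⟨σ, hσ, h1⟩ := hcu.four_axis hN (h.le hM hr.mem) hr.rot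
    obtain ⟨σ', hσ', h2⟩ := hcu.four_axis hN (h.le hM' hr'.mem) hr'.rot
    have hτ := mul_mem (inv_mem hσ') hσ
    refine ⟨_, hτ, ?_⟩
    exact h.eq_of_four (h.stable _ hτ M hM) hM' (hr.rot.conj hτ.1) hr'.rot
      (conj_mem_smul hr.mem hτ.1) hr'.mem (key hcu.ne1 h1 h2)

/-- In the cubic case, a lattice fixed by a threefold (fourfold) rotation has `|O(M)| = 12`
(`|O(M)| = 16`). -/
theorem card_of_rot (h : IsFam p B N Γ) (ho : Nat.card (isometryGroup B N) = 48) (hM : M ∈ Γ)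
    {e : V} {g : V ≃ₗ[ℚ] V} (hg : g ∈ isometryGroup B M) :
    (IsRot B e (-1) g → Nat.card (isometryGroup B M) = 12) ∧
    (IsRot B e 0 g → Nat.card (isometryGroup B M) = 16) := by
  have hI := (h.adm M hM).toIsIntLattice
  have hB := hI.toIsTernaryForm
  have h48 := h.card_ne_48 hM
  have h24 := h.card_ne_24 ho hM
  constructor
  · intro hr
    rcases hI.holohedry with h1 | h1 | h1 | h1 | h1 | h1 | h1
    · exact absurd hr (h1.2.1 _ _ _ hg)
    · exact absurd hr (h1.2.1 _ _ _ hg)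
    · exact absurd hr (h1.2.1 _ _ _ hg)
    · exact h1.2.2.1
    · exfalso
      obtain ⟨⟨e', g', hax⟩, -⟩ := h1
      obtain ⟨c, rfl⟩ := hax.axes _ _ _ hg hr
      obtain ⟨x, hxp, hex, hx, -⟩ := (hI.rot_structure hax.rot hax.mem).2
      have hex' : B (c • e') x = 0 := by simp [hex]
      have hgx := hr.orth_apply hex'
      have hgx' : B e' (g x) = 0 := by
        have hc : c ≠ 0 := by rintro rfl; exact hr.ne (zero_smul _ _)
        simpa [hc] using hgx
      obtain ⟨a, b, hab⟩ := hax.rot.expand hB hx.1 hex hgx'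
      have q := hI.pos x hx.1
      have f1 := hax.rot.form hB hex
      have f2 := hr.form hB hex'
      have f3 := hr.orth x x
      rw [hab] at f2 f3
      simp only [map_add, map_smul, LinearMap.add_apply, LinearMap.smul_apply, smul_eq_mul, f1,
        hB.symm (g' x) x, hax.rot.orth x x] at f2 f3
      have ha : a = -1 / 2 := by
        apply mul_right_cancel₀ q.ne'; linarith
      have hb : a ^ 2 + b ^ 2 = 1 := by
        apply mul_right_cancel₀ q.ne'; linarith
      have := eq_zero_of_sq_eq_three_mul (a := 2 * b) (b := 1) (by rw [ha] at hb; linarith)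
      norm_num at this
    · exact absurd h1.2.1 h24
    · exact absurd h1.2.1 h48
  · intro hr
    have hs := hr.sym_axis hB hg
    obtain ⟨x, hxp, hex, hx, -⟩ := (hI.rot_structure hr hg).2
    have := hI.card_of_orth_syms hs hx hex
    simp only [Finset.mem_insert, Finset.mem_singleton] at this
    rcases this with h1 | h1 | h1 | h1
    · exfalso
      rcases hI.holohedry with h2 | h2 | h2 | h2 | h2 | h2 | h2
      · omega
      · omega
      · exact h2.2.1 _ _ _ hg hr
      all_goals omega
    · exact h1
    · exact absurd h1 h24
    · exact absurd h1 h48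

end IsFam

end

section

variable {p : ℕ}

/-- The table of class numbers, up to the values of `h₁₂` and `h₁₆` in the cubic case. -/
theorem IsFam.table {Γ : Set (Submodule ℤ V)} (hΓ : IsFam p B N Γ) (hne : Γ.Nonempty) (o w : ℕ)
    (ho : o = Nat.card (isometryGroup B N)) (h24 : o = 24 → p ≠ 3) (hw : w = Γ.ncard) (h : ℕ → ℚ)
    (hh : ∀ n, h n = hCount B Γ n) (f s w₂ w₃ : ℚ)
    (hf : f = ((∑ᶠ σ ∈ symmetries B N, {M | M ∈ Γ ∧ σ • M = M}.ncard : ℕ) : ℚ))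
    (hs : s = ({σ | σ ∈ symmetries B N ∧ ∃ M ∈ Γ, σ • M = M ∧ SpecSym p B M σ}.ncard : ℚ))
    (hw₂ : w₂ = ((w % 2 : ℕ) : ℚ)) (hw₃ : w₃ = ((w % 3 : ℕ) : ℚ)) :
    (o = 2 ∨ o = 4 ∨ o = 8 ∨ o = 12 ∨ o = 16 ∨ o = 24 ∨ o = 48) ∧
    (∀ n : ℕ, n ≠ 2 → n ≠ 4 → n ≠ 8 → n ≠ 12 → n ≠ 16 → n ≠ 24 → h n = 0) ∧
    (o = 2 → h 2 = w ∧ h 4 = 0 ∧ h 8 = 0 ∧ h 12 = 0 ∧ h 16 = 0 ∧ h 24 = 0) ∧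
    (o = 4 → h 2 = (w - f) / 2 ∧ h 4 = f ∧ h 8 = 0 ∧ h 12 = 0 ∧ h 16 = 0 ∧ h 24 = 0) ∧
    (o = 8 → h 2 = (w - f + 2 * s) / 4 ∧ h 4 = (f - 3 * s) / 2 ∧ h 8 = s ∧
      h 12 = 0 ∧ h 16 = 0 ∧ h 24 = 0) ∧
    (o = 12 → h 2 = (w - f + 2 * w₃) / 6 ∧ h 4 = (f - 3 * w₃) / 3 ∧ h 8 = 0 ∧
      h 12 = w₃ ∧ h 16 = 0 ∧ h 24 = 0) ∧
    (o = 16 → h 2 = (w - f + 2 * s + 2 * w₂) / 8 ∧ h 4 = (f - 3 * s - 2 * w₂) / 4 ∧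
      h 8 = (s - w₂) / 2 ∧ h 12 = 0 ∧ h 16 = w₂ ∧ h 24 = 0) ∧
    (o = 24 → h 2 = (w - f + 2 * s + 4 * w₃) / 12 ∧ h 4 = (f - 3 * s - 4 * w₃) / 6 ∧
      h 8 = (s - w₃) / 3 ∧ h 12 = 0 ∧ h 16 = 0 ∧ h 24 = w₃) ∧
    (o = 48 → h 24 = 0 ∧ h 48 = 0 ∧
      h 8 = (s - 3 * h 16) / 6 ∧
      h 4 = (f - 18 * h 8 - 12 * h 12 - 15 * h 16) / 12 ∧
      h 2 = (w - f + 12 * h 8 + 8 * h 12 + 12 * h 16) / 24) := by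
  obtain ⟨M₀, hM₀⟩ := hne
  have hN := hΓ.lattice hM₀
  have hmem := hN.card_mem
  rw [← ho] at hmem
  have hzero : ∀ n, (¬ n ∣ o ∨ n ∉ ({2, 4, 8, 12, 16, 24} : Finset ℕ)) →
      hCount B Γ n = 0 ∧ xCount B Γ n = 0 := by
    intro n hn
    have hn' : ∀ M ∈ Γ, Nat.card (isometryGroup B M) ≠ n := by
      rintro M hM rfl
      rcases hn with hn | hn
      · exact hn (ho ▸ hΓ.card_dvd hM)
      · have h1 := (hΓ.adm M hM).toIsIntLattice.card_mem
        have h2 := hΓ.card_ne_48 hM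
        simp only [Finset.mem_insert, Finset.mem_singleton] at h1 hn
        tauto
    exact ⟨IsFam.hCount_eq_zero hn', IsFam.xCount_eq_zero hn'⟩
  have hx48 := (hzero 48 (Or.inr (by decide))).2
  have hmul := fun n => hΓ.xCount_mul n
  rw [← ho] at hmul
  have hwx := hΓ.ncard_eq
  rw [← hw, hx48] at hwx
  have hfx := hΓ.sum_fixed
  rw [hfx, hx48] at hf
  clear hfx
  have hsx : o ∈ ({8, 16, 24, 48} : Finset ℕ) →
      s = (xCount B Γ 8 + xCount B Γ 16 + xCount B Γ 24 : ℕ) := by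
    intro h1
    rw [hs, hΓ.ncard_special (ho ▸ h1) fun h2 => h24 (ho ▸ h2)]
  have m2 := hmul 2
  have m4 := hmul 4
  have m8 := hmul 8
  have m12 := hmul 12
  have m16 := hmul 16
  have m24 := hmul 24
  have z := fun n hn => (hzero n hn).1
  have zx := fun n hn => (hzero n hn).2
  refine ⟨by simpa using hmem, fun n n2 n4 n8 n12 n16 n24 => ?_, ?_, ?_, ?_, ?_, ?_, ?_, ?_⟩
  · rw [hh, z n (Or.inr (by simp [n2, n4, n8, n12, n16, n24])), Nat.cast_zero]
  · intro h1
    subst h1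
    simp only [hh]
    have y4 := hzero 4 (Or.inl (by decide))
    have y8 := hzero 8 (Or.inl (by decide))
    have y12 := hzero 12 (Or.inl (by decide))
    have y16 := hzero 16 (Or.inl (by decide))
    have y24 := hzero 24 (Or.inl (by decide))
    refine ⟨?_, by simp [y4], by simp [y8], by simp [y12], by simp [y16], by simp [y24]⟩
    have : hCount B Γ 2 = w := by omega
    rw [this]
  · intro h1
    subst h1
    simp only [hh]
    have y8 := hzero 8 (Or.inl (by decide))
    have y12 := hzero 12 (Or.inl (by decide))
    have y16 := hzero 16 (Or.inl (by decide))
    have y24 := hzero 24 (Or.inl (by decide))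
    rw [y8.2, y12.2, y16.2, y24.2] at hf hwx
    have k4 : xCount B Γ 4 = hCount B Γ 4 := by omega
    have k2 : xCount B Γ 2 = 2 * hCount B Γ 2 := by omega
    rw [k2, k4] at hwx
    rw [k4] at hf
    refine ⟨?_, ?_, by simp [y8], by simp [y12], by simp [y16], by simp [y24]⟩
    · rw [hf, hwx]; push_cast; ring
    · rw [hf]; push_cast; ring
  · intro h1
    subst h1
    have hsx := hsx (by decide)
    simp only [hh]
    have y12 := hzero 12 (Or.inl (by decide))
    have y16 := hzero 16 (Or.inl (by decide))
    have y24 := hzero 24 (Or.inl (by decide))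
    have k8 : xCount B Γ 8 = hCount B Γ 8 := by omega
    have k4 : xCount B Γ 4 = 2 * hCount B Γ 4 := by omega
    have k2 : xCount B Γ 2 = 4 * hCount B Γ 2 := by omega
    rw [y12.2, y16.2, y24.2, k8, k4] at hf hwx
    rw [k2] at hwx
    rw [y16.2, y24.2, k8] at hsx
    refine ⟨?_, ?_, ?_, by simp [y12], by simp [y16], by simp [y24]⟩
    · rw [hf, hwx, hsx]; push_cast; ring
    · rw [hf, hsx]; push_cast; ring
    · rw [hsx]; push_cast; ring
  · intro h1
    subst h1
    simp only [hh]
    have y8 := hzero 8 (Or.inl (by decide))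
    have y16 := hzero 16 (Or.inl (by decide))
    have y24 := hzero 24 (Or.inl (by decide))
    have k12 : xCount B Γ 12 = hCount B Γ 12 := by omega
    have k4 : xCount B Γ 4 = 3 * hCount B Γ 4 := by omega
    have k2 : xCount B Γ 2 = 6 * hCount B Γ 2 := by omega
    have hle := hΓ.xCount_12_le ho.symm
    rw [y8.2, y16.2, y24.2, k12, k4] at hf hwx
    rw [k2] at hwx
    have hw3 : w % 3 = hCount B Γ 12 := by omega
    rw [hw3] at hw₃
    refine ⟨?_, ?_, by simp [y8], ?_, by simp [y16], by simp [y24]⟩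
    · rw [hf, hwx, hw₃]; push_cast; ring
    · rw [hf, hw₃]; push_cast; ring
    · rw [hw₃]
  · intro h1
    subst h1
    have hsx := hsx (by decide)
    simp only [hh]
    have y12 := hzero 12 (Or.inl (by decide))
    have y24 := hzero 24 (Or.inl (by decide))
    have k16 : xCount B Γ 16 = hCount B Γ 16 := by omega
    have k8 : xCount B Γ 8 = 2 * hCount B Γ 8 := by omega
    have k4 : xCount B Γ 4 = 4 * hCount B Γ 4 := by omega
    have k2 : xCount B Γ 2 = 8 * hCount B Γ 2 := by omega
    have hle := hΓ.xCount_16_le ho.symm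
    rw [y12.2, y24.2, k16, k8, k4] at hf hwx
    rw [k2] at hwx
    rw [y24.2, k8, k16] at hsx
    have hw2 : w % 2 = hCount B Γ 16 := by omega
    rw [hw2] at hw₂
    refine ⟨?_, ?_, ?_, by simp [y12], ?_, by simp [y24]⟩
    · rw [hf, hwx, hw₂, hsx]; push_cast; ring
    · rw [hf, hw₂, hsx]; push_cast; ring
    · rw [hw₂, hsx]; push_cast; ring
    · rw [hw₂]
  · intro h1
    subst h1
    have hsx := hsx (by decide)
    have hp3 := h24 rfl
    simp only [hh]
    have y16 := hzero 16 (Or.inl (by decide))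
    have hn12 := fun M (hM : M ∈ Γ) => hΓ.card_ne_12 ho.symm hp3 hM
    have y12 := IsFam.xCount_eq_zero hn12
    have y12' := IsFam.hCount_eq_zero hn12
    have k24 : xCount B Γ 24 = hCount B Γ 24 := by omega
    have k8 : xCount B Γ 8 = 3 * hCount B Γ 8 := by omega
    have k4 : xCount B Γ 4 = 6 * hCount B Γ 4 := by omega
    have k2 : xCount B Γ 2 = 12 * hCount B Γ 2 := by omega
    have hle := hΓ.xCount_24_le ho.symm hp3
    rw [y12, y16.2, k24, k8, k4] at hf hwx
    rw [k2] at hwx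
    rw [y16.2, k8, k24] at hsx
    have hw3 : w % 3 = hCount B Γ 24 := by omega
    rw [hw3] at hw₃
    refine ⟨?_, ?_, ?_, by simp [y12'], by simp [y16], ?_⟩
    · rw [hf, hwx, hw₃, hsx]; push_cast; ring
    · rw [hf, hw₃, hsx]; push_cast; ring
    · rw [hw₃, hsx]; push_cast; ring
    · rw [hw₃]
  · intro h1
    subst h1
    have hsx := hsx (by decide)
    have hn24 := fun M (hM : M ∈ Γ) => hΓ.card_ne_24 ho.symm hM
    have y24 := IsFam.xCount_eq_zero hn24
    have y24' := IsFam.hCount_eq_zero hn24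
    have y48 := z 48 (Or.inr (by decide))
    have k16 : xCount B Γ 16 = 3 * hCount B Γ 16 := by omega
    have k12 : xCount B Γ 12 = 4 * hCount B Γ 12 := by omega
    have k8 : xCount B Γ 8 = 6 * hCount B Γ 8 := by omega
    have k4 : xCount B Γ 4 = 12 * hCount B Γ 4 := by omega
    have k2 : xCount B Γ 2 = 24 * hCount B Γ 2 := by omega
    rw [y24, k16, k12, k8, k4] at hf hwx
    rw [k2] at hwx
    rw [y24, k8, k16] at hsx
    simp only [hh]
    refine ⟨by simp [y24'], by simp [y48], ?_, ?_, ?_⟩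
    · rw [hsx]; push_cast; ring
    · rw [hf]; push_cast; ring
    · rw [hf, hwx]; push_cast; ring

end

section

variable {V' : Type v} [AddCommGroup V'] [Module ℚ V'] {B' : LinearMap.BilinForm ℚ V'}
  {M' N' : Submodule ℤ V'} {p : ℕ} [Fact p.Prime]

/-! ### Localization -/

/-- The canonical map `V → V_p`. -/
def iota (p : ℕ) [Fact p.Prime] : V →ₗ[ℚ] ℚ_[p] ⊗[ℚ] V := TensorProduct.mk ℚ ℚ_[p] V 1

theorem iota_smul (c : ℚ) (x : V) : iota p (c • x) = (c : ℚ_[p]) • iota p x := by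
  simp only [iota, TensorProduct.mk_apply, TensorProduct.tmul_smul, TensorProduct.smul_tmul']
  congr 1

theorem iota_zsmul (c : ℤ) (x : V) : iota p (c • x) = (c : ℚ_[p]) • iota p x := by
  rw [← Int.cast_smul_eq_zsmul ℚ, iota_smul]; simp

theorem iota_psmul (x : V) : iota p ((p : ℤ) • x) = (p : ℚ_[p]) • iota p x := by
  rw [iota_zsmul]; simp

theorem iota_mem {x : V} (hx : x ∈ M) : iota p x ∈ localize p M :=
  Submodule.subset_span ⟨x, hx, rfl⟩

theorem localForm_iota (x y : V) :
    localForm p B (iota p x) (iota p y) = ((B x y : ℚ) : ℚ_[p]) := by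
  simp [localForm, iota, LinearMap.BilinForm.baseChange_tmul, Algebra.smul_def]

theorem p_ne_zero : (p : ℚ_[p]) ≠ 0 := by
  exact_mod_cast (Fact.out : p.Prime).ne_zero

theorem int_smul_mem {K : Submodule ℤ_[p] (ℚ_[p] ⊗[ℚ] V)} (c : ℤ_[p]) {y : ℚ_[p] ⊗[ℚ] V}
    (hy : y ∈ K) : (c : ℚ_[p]) • y ∈ K := by
  have := K.smul_mem c hy
  rwa [← algebraMap_smul ℚ_[p] c y] at this

theorem norm_smul_mem {K : Submodule ℤ_[p] (ℚ_[p] ⊗[ℚ] V)} {c : ℚ_[p]} (hc : ‖c‖ ≤ 1)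
    {y : ℚ_[p] ⊗[ℚ] V} (hy : y ∈ K) : c • y ∈ K := int_smul_mem ⟨c, hc⟩ hy

theorem localize_induction {P : ℚ_[p] ⊗[ℚ] V → Prop} (h1 : ∀ x ∈ M, P (iota p x))
    (h2 : ∀ y z, P y → P z → P (y + z)) (h3 : ∀ (c : ℤ_[p]) y, P y → P ((c : ℚ_[p]) • y))
    {y : ℚ_[p] ⊗[ℚ] V} (hy : y ∈ localize p M) : P y := by
  induction hy using Submodule.span_induction with
  | mem x hx => obtain ⟨v, hv, rfl⟩ := hx; exact h1 v hv
  | zero => have := h1 0 M.zero_mem; rwa [map_zero] at this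
  | add x y _ _ hx hy => exact h2 x y hx hy
  | smul c x _ hx => have := h3 c x hx; rwa [← algebraMap_smul ℚ_[p] c x]

theorem pdvd_iff_norm {k : ℤ} : PDvd p (k : ℚ) ↔ ‖(((k : ℚ) : ℚ_[p]))‖ < 1 := by
  rw [pdvd_intCast, ← Padic.norm_intCast_lt_one_iff]; simp

theorem IsIntLattice.pdvd_iff (hM : IsIntLattice B M) {x y : V} (hx : x ∈ M) (hy : y ∈ M) :
    PDvd p (B x y) ↔ ‖localForm p B (iota p x) (iota p y)‖ < 1 := by
  obtain ⟨k, hk⟩ := hM.integral x hx y hy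
  rw [localForm_iota, hk, pdvd_iff_norm]

theorem localForm_symm (hB : IsTernaryForm B) (x y : ℚ_[p] ⊗[ℚ] V) :
    localForm p B x y = localForm p B y x := by
  induction x using TensorProduct.induction_on with
  | zero => simp
  | add a b ha hb => simp only [map_add, LinearMap.add_apply, ha, hb]
  | tmul a v =>
    induction y using TensorProduct.induction_on with
    | zero => simp
    | add a b ha hb => simp only [map_add, LinearMap.add_apply, ha, hb]
    | tmul b w => simp [localForm, LinearMap.BilinForm.baseChange_tmul, hB.symm v w, mul_comm]

/-- The form is integral on the completion of an integral lattice. -/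
theorem norm_form_le {M₁ M₂ : Submodule ℤ V} (h : ∀ x ∈ M₁, ∀ y ∈ M₂, ∃ k : ℤ, B x y = k)
    {y z : ℚ_[p] ⊗[ℚ] V} (hy : y ∈ localize p M₁) (hz : z ∈ localize p M₂) :
    ‖localForm p B y z‖ ≤ 1 := by
  refine localize_induction (P := fun y => ‖localForm p B y z‖ ≤ 1) (fun x hx => ?_)
    (fun a b ha hb => ?_) (fun c a ha => ?_) hy
  · refine localize_induction (P := fun z => ‖localForm p B (iota p x) z‖ ≤ 1) (fun w hw => ?_)
      (fun a b ha hb => ?_) (fun c a ha => ?_) hz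
    · obtain ⟨k, hk⟩ := h x hx w hw
      rw [localForm_iota, hk]; simpa using Padic.norm_int_le_one (p := p) k
    · rw [map_add]; exact (Padic.nonarchimedean _ _).trans (max_le ha hb)
    · rw [map_smul, smul_eq_mul, norm_mul]; exact mul_le_one₀ c.2 (norm_nonneg _) ha
  · rw [map_add]; exact (Padic.nonarchimedean _ _).trans (max_le ha hb)
  · rw [map_smul, LinearMap.smul_apply, smul_eq_mul, norm_mul]
    exact mul_le_one₀ c.2 (norm_nonneg _) ha

theorem exists_approx {y : ℚ_[p] ⊗[ℚ] V} (hy : y ∈ localize p M) :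
    ∃ x ∈ M, ∃ z ∈ localize p M, y = iota p x + (p : ℚ_[p]) • z := by
  refine localize_induction (P := fun y => ∃ x ∈ M, ∃ z ∈ localize p M,
    y = iota p x + (p : ℚ_[p]) • z) (fun x hx => ⟨x, hx, 0, zero_mem _, by simp⟩) ?_ ?_ hy
  · rintro _ _ ⟨x, hx, z, hz, rfl⟩ ⟨x', hx', z', hz', rfl⟩
    exact ⟨x + x', add_mem hx hx', z + z', add_mem hz hz', by rw [map_add]; module⟩
  · rintro c _ ⟨x, hx, z, hz, rfl⟩
    obtain ⟨n, -, hn⟩ := PadicInt.exists_mem_range (p := p) c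
    rw [PadicInt.maximalIdeal_eq_span_p, Ideal.mem_span_singleton] at hn
    obtain ⟨d, hd⟩ := hn
    have hd' : (c : ℚ_[p]) = n + p * d := by
      have := congrArg (fun t : ℤ_[p] => (t : ℚ_[p])) hd
      push_cast at this
      linear_combination this
    refine ⟨(n : ℤ) • x, M.smul_mem _ hx, (d : ℚ_[p]) • iota p x + (c : ℚ_[p]) • z,
      add_mem (int_smul_mem d (iota_mem hx)) (int_smul_mem c hz), ?_⟩
    rw [iota_zsmul, hd']
    push_cast
    module

theorem not_dvd_den {r : ℚ} (h : ‖(r : ℚ_[p])‖ ≤ 1) : ¬ (p : ℤ) ∣ (r.den : ℤ) := by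
  intro hd
  have h2 := PadicInt.isUnit_iff.1 (PadicInt.isUnit_den _ h)
  rw [PadicInt.norm_def] at h2
  have := (Padic.norm_intCast_lt_one_iff (p := p)).2 hd
  push_cast at h2 this
  linarith

theorem exists_zsmul_mem (hM : M.IsLattice ℚ) {x : V} (hx : iota p x ∈ localize p M) :
    ∃ n : ℤ, ¬ (p : ℤ) ∣ n ∧ n • x ∈ M := by
  have hfree : Module.Free ℤ M := Submodule.IsLattice.free ℚ M
  have hfin : Module.Finite ℤ M := Module.Finite.iff_fg.2 hM.fg
  let b := Module.Free.chooseBasis ℤ M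
  let b' := b.extendOfIsLattice ℚ
  let c := Algebra.TensorProduct.basis ℚ_[p] b'
  have hb' : ∀ i, b' i = b i := fun i => Module.Basis.extendOfIsLattice_apply ℚ b i
  have hc : ∀ (v : V) i, c.repr (iota p v) i = ((b'.repr v i : ℚ) : ℚ_[p]) := by
    intro v i
    simp [c, iota, Algebra.TensorProduct.basis_repr_tmul]
  have hint : ∀ v ∈ M, ∀ i, ∃ k : ℤ, b'.repr v i = k := by
    intro v hv i
    refine ⟨b.repr ⟨v, hv⟩ i, ?_⟩
    have h1 : v = ∑ j, ((b.repr ⟨v, hv⟩ j : ℤ) : ℚ) • b' j := by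
      have := congrArg Subtype.val (b.sum_repr ⟨v, hv⟩)
      simp only [Submodule.coe_sum, Submodule.coe_smul] at this
      conv_lhs => rw [← this]
      exact Finset.sum_congr rfl fun j _ => by rw [hb', Int.cast_smul_eq_zsmul]
    conv_lhs => rw [h1]
    rw [b'.repr_sum_self]
  have hloc : ∀ i, ‖c.repr (iota p x) i‖ ≤ 1 := by
    intro i
    refine localize_induction (P := fun y => ‖c.repr y i‖ ≤ 1) (fun v hv => ?_)
      (fun a b ha hb => ?_) (fun d a ha => ?_) hx
    · obtain ⟨k, hk⟩ := hint v hv i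
      rw [hc, hk]; simpa using Padic.norm_int_le_one (p := p) k
    · rw [map_add, Finsupp.add_apply]; exact (Padic.nonarchimedean _ _).trans (max_le ha hb)
    · rw [map_smul, Finsupp.smul_apply, smul_eq_mul, norm_mul]
      exact mul_le_one₀ d.2 (norm_nonneg _) ha
  refine ⟨∏ i, ((b'.repr x i).den : ℤ), ?_, ?_⟩
  · intro h
    obtain ⟨i, -, hi⟩ := (Nat.prime_iff_prime_int.1 (Fact.out : p.Prime)).exists_mem_finset_dvd h
    exact not_dvd_den (by rw [← hc]; exact hloc i) hi
  · have hx' := b'.sum_repr x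
    rw [← hx', Finset.smul_sum, hx']
    refine M.sum_mem fun i _ => ?_
    have : (∏ i, ((b'.repr x i).den : ℤ)) • (b'.repr x i) • b' i =
        ((∏ j ∈ Finset.univ.erase i, ((b'.repr x j).den : ℤ)) * (b'.repr x i).num) •
          (b i : V) := by
      rw [← Finset.prod_erase_mul _ _ (Finset.mem_univ i), hb', ← Int.cast_smul_eq_zsmul ℚ,
        ← Int.cast_smul_eq_zsmul ℚ, smul_smul]
      congr 1
      push_cast
      rw [mul_assoc, Rat.den_mul_eq_num]
    rw [this]
    exact M.smul_mem _ (Submodule.coe_mem _)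

theorem mem_of_iota (hM : M.IsLattice ℚ) {x : V} (hx : iota p x ∈ localize p M)
    (hpx : (p : ℤ) • x ∈ M) : x ∈ M := by
  obtain ⟨n, hn, h⟩ := exists_zsmul_mem hM hx
  exact mem_of_smul_mem Fact.out hn h hpx

theorem localize_mono (h : N ≤ M) : localize p N ≤ localize p M :=
  Submodule.span_mono (Set.image_mono h)

theorem psmul_mem_localize (h : ∀ v ∈ M, (p : ℤ) • v ∈ N) {y : ℚ_[p] ⊗[ℚ] V}
    (hy : y ∈ localize p M) : (p : ℚ_[p]) • y ∈ localize p N := by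
  refine localize_induction (P := fun y => (p : ℚ_[p]) • y ∈ localize p N) (fun x hx => ?_)
    (fun a b ha hb => ?_) (fun d a ha => ?_) hy
  · rw [← iota_psmul]; exact iota_mem (h x hx)
  · rw [smul_add]; exact add_mem ha hb
  · rw [smul_comm]; exact int_smul_mem d ha

theorem localize_eq_of_ne {q : ℕ} [Fact q.Prime] (hq : q ≠ p) (h : N ≤ M)
    (h1 : ∀ v ∈ M, (p : ℤ) • v ∈ N) : localize q M = localize q N := by
  refine le_antisymm (Submodule.span_le.2 ?_) (localize_mono h)
  rintro _ ⟨x, hx, rfl⟩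
  have hn : ‖((p : ℚ_[q]))‖ = 1 := by
    have h2 : ¬ ‖((p : ℤ) : ℚ_[q])‖ < 1 := by
      rw [Padic.norm_intCast_lt_one_iff]
      intro h3
      exact hq ((Nat.prime_dvd_prime_iff_eq Fact.out Fact.out).1 (by exact_mod_cast h3))
    have h3 := Padic.norm_int_le_one (p := q) p
    push_cast at h2 h3
    exact le_antisymm h3 (not_lt.1 h2)
  have h0 : (p : ℚ_[q]) ≠ 0 := by
    intro h0; rw [h0, norm_zero] at hn; exact zero_ne_one hn
  have h2 := norm_smul_mem (c := (p : ℚ_[q])⁻¹) (by rw [norm_inv, hn, inv_one])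
    (iota_mem (p := q) (h1 x hx))
  rw [iota_zsmul, Int.cast_natCast, inv_smul_smul₀ h0] at h2
  exact h2

end

section

variable {V' : Type v} [AddCommGroup V'] [Module ℚ V'] {B' : LinearMap.BilinForm ℚ V'}
  {M' N' : Submodule ℤ V'} {p : ℕ} [Fact p.Prime]

/-! ### Local isometries -/

/-- `χ` is an isometry `V_p ≃ V'_p` carrying `M_p` onto `M'_p`. -/
structure LocIso (p : ℕ) [Fact p.Prime] (B : LinearMap.BilinForm ℚ V) (M : Submodule ℤ V)
    (B' : LinearMap.BilinForm ℚ V') (M' : Submodule ℤ V')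
    (χ : (ℚ_[p] ⊗[ℚ] V) ≃ₗ[ℚ_[p]] (ℚ_[p] ⊗[ℚ] V')) : Prop where
  form : ∀ x y, localForm p B' (χ x) (χ y) = localForm p B x y
  mem : ∀ y, χ y ∈ localize p M' ↔ y ∈ localize p M

theorem locallyIsometric_iff :
    LocallyIsometric p B M B' M' ↔ ∃ χ, LocIso p B M B' M' χ := by
  refine exists_congr fun χ => ⟨fun h => ⟨h.1, fun y => ?_⟩, fun h => ⟨h.form, ?_⟩⟩
  · rw [← h.2, Submodule.mem_map]
    refine ⟨?_, fun hy => ⟨y, hy, rfl⟩⟩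
    rintro ⟨z, hz, hzy⟩
    rwa [← χ.injective hzy]
  · ext y
    rw [Submodule.mem_map]
    constructor
    · rintro ⟨z, hz, rfl⟩
      exact (h.mem z).2 hz
    · intro hy
      refine ⟨χ.symm y, (h.mem _).1 ?_, χ.apply_symm_apply y⟩
      rwa [χ.apply_symm_apply]

theorem norm_p_mul_lt {c : ℚ_[p]} (hc : ‖c‖ ≤ 1) : ‖(p : ℚ_[p]) * c‖ < 1 := by
  rw [norm_mul]
  exact mul_lt_one_of_nonneg_of_lt_one_left (norm_nonneg _) Padic.norm_p_lt_one hc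

/-- The extension of an isometry to `V_p`. -/
def bc (p : ℕ) [Fact p.Prime] (σ : V ≃ₗ[ℚ] V) : (ℚ_[p] ⊗[ℚ] V) ≃ₗ[ℚ_[p]] (ℚ_[p] ⊗[ℚ] V) :=
  LinearEquiv.baseChange ℚ ℚ_[p] V V σ

theorem bc_iota (σ : V ≃ₗ[ℚ] V) (x : V) : bc p σ (iota p x) = iota p (σ x) :=
  LinearEquiv.baseChange_tmul _ _ _ _ _ _

theorem bc_inv_apply (σ : V ≃ₗ[ℚ] V) (y : ℚ_[p] ⊗[ℚ] V) : bc p σ⁻¹ (bc p σ y) = y := by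
  induction y using TensorProduct.induction_on with
  | zero => simp
  | add a b ha hb => simp only [map_add, ha, hb]
  | tmul a v =>
    simp only [bc, LinearEquiv.baseChange_tmul]
    rw [← LinearEquiv.mul_apply, inv_mul_cancel]; rfl

theorem bc_form {σ : V ≃ₗ[ℚ] V} (hσ : σ ∈ orthogonalGroup B) (x y : ℚ_[p] ⊗[ℚ] V) :
    localForm p B (bc p σ x) (bc p σ y) = localForm p B x y := by
  induction x using TensorProduct.induction_on with
  | zero => simp
  | add a b ha hb => simp only [map_add, LinearMap.add_apply, ha, hb]
  | tmul a v =>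
    induction y using TensorProduct.induction_on with
    | zero => simp
    | add a b ha hb => simp only [map_add, ha, hb]
    | tmul b w =>
      simp only [bc, LinearEquiv.baseChange_tmul, localForm, LinearMap.BilinForm.baseChange_tmul]
      rw [hσ v w]

theorem locIso_smul {σ : V ≃ₗ[ℚ] V} (hσ : σ ∈ orthogonalGroup B) :
    LocIso p B M B (σ • M) (bc p σ) := by
  have key : ∀ (τ : V ≃ₗ[ℚ] V) (K : Submodule ℤ V), ∀ y ∈ localize p K,
      bc p τ y ∈ localize p (τ • K) := by
    intro τ K y hy
    refine localize_induction (P := fun y => bc p τ y ∈ localize p (τ • K)) (fun x hx => ?_)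
      (fun a b ha hb => ?_) (fun d a ha => ?_) hy
    · rw [bc_iota]; exact iota_mem (smul_mem_smul_iff.2 hx)
    · rw [map_add]; exact add_mem ha hb
    · rw [map_smul]; exact int_smul_mem d ha
  refine ⟨bc_form hσ, fun y => ⟨fun h => ?_, key σ M y⟩⟩
  have := key σ⁻¹ _ _ h
  rwa [bc_inv_apply, smul_smul, inv_mul_cancel, one_smul] at this

namespace LocIso

variable {χ : (ℚ_[p] ⊗[ℚ] V) ≃ₗ[ℚ_[p]] (ℚ_[p] ⊗[ℚ] V')}

theorem refl : LocIso p B M B M (LinearEquiv.refl _ _) := ⟨fun _ _ => rfl, fun _ => Iff.rfl⟩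

theorem symm (h : LocIso p B M B' M' χ) : LocIso p B' M' B M χ.symm :=
  ⟨fun x y => by rw [← h.form]; simp, fun y => by rw [← h.mem]; simp⟩

theorem trans (h : LocIso p B M B' M' χ) {W : Type*} [AddCommGroup W] [Module ℚ W]
    {C : LinearMap.BilinForm ℚ W} {K : Submodule ℤ W}
    {ψ : (ℚ_[p] ⊗[ℚ] V') ≃ₗ[ℚ_[p]] (ℚ_[p] ⊗[ℚ] W)} (h' : LocIso p B' M' C K ψ) :
    LocIso p B M C K (χ.trans ψ) :=
  ⟨fun x y => by simp [h'.form, h.form], fun y => by simp [h'.mem, h.mem]⟩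

/-- The vectors `x`, `x'` correspond to each other modulo `p`. -/
def Approx (χ : (ℚ_[p] ⊗[ℚ] V) ≃ₗ[ℚ_[p]] (ℚ_[p] ⊗[ℚ] V')) (M' : Submodule ℤ V') (x : V)
    (x' : V') : Prop :=
  ∃ z ∈ localize p M', χ (iota p x) = iota p x' + (p : ℚ_[p]) • z

theorem approx (h : LocIso p B M B' M' χ) {x : V} (hx : x ∈ M) : ∃ x' ∈ M', Approx χ M' x x' := by
  obtain ⟨x', hx', z, hz, e⟩ := exists_approx ((h.mem _).2 (iota_mem (p := p) hx))
  exact ⟨x', hx', z, hz, e⟩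

theorem approx_symm (h : LocIso p B M B' M' χ) {x' : V'} (hx : x' ∈ M') :
    ∃ x ∈ M, Approx χ M' x x' := by
  obtain ⟨x, hx, z, hz, e⟩ := h.symm.approx hx
  refine ⟨x, hx, -χ z, neg_mem ((h.mem _).2 hz), ?_⟩
  have := congrArg χ e
  rw [LinearEquiv.apply_symm_apply, map_add, map_smul] at this
  rw [this]; module

theorem approx_form (h : LocIso p B M B' M' χ) (hM : IsIntLattice B M) (hM' : IsIntLattice B' M')
    {x y : V} {x' y' : V'} (hx : x ∈ M) (hy : y ∈ M) (hx' : x' ∈ M') (hy' : y' ∈ M')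
    (ax : Approx χ M' x x') (ay : Approx χ M' y y') : PDvd p (B x y - B' x' y') := by
  obtain ⟨a, ha⟩ := hM.integral x hx y hy
  obtain ⟨b, hb⟩ := hM'.integral x' hx' y' hy'
  obtain ⟨z, hz, ez⟩ := ax
  obtain ⟨w, hw, ew⟩ := ay
  have e : ((B x y - B' x' y' : ℚ) : ℚ_[p]) = p * (localForm p B' (iota p x') w +
      localForm p B' z (iota p y') + p * localForm p B' z w) := by
    have := h.form (iota p x) (iota p y)
    rw [ez, ew] at this
    simp only [map_add, map_smul, LinearMap.add_apply, LinearMap.smul_apply, smul_eq_mul,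
      localForm_iota] at this
    push_cast
    linear_combination -this
  have i1 := norm_form_le hM'.integral (iota_mem hx') hw
  have i2 := norm_form_le hM'.integral hz (iota_mem hy')
  have i3 := norm_form_le hM'.integral hz hw
  have : B x y - B' x' y' = ((a - b : ℤ) : ℚ) := by rw [ha, hb]; push_cast; ring
  rw [this, pdvd_iff_norm, ← this, e]
  exact norm_p_mul_lt ((Padic.nonarchimedean _ _).trans (max_le
    ((Padic.nonarchimedean _ _).trans (max_le i1 i2)) (norm_p_mul_lt i3).le))

theorem pdvd_form_iff (h : LocIso p B M B' M' χ) (hM : IsIntLattice B M)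
    (hM' : IsIntLattice B' M') {x y : V} {x' y' : V'} (hx : x ∈ M) (hy : y ∈ M) (hx' : x' ∈ M')
    (hy' : y' ∈ M') (ax : Approx χ M' x x') (ay : Approx χ M' y y') :
    PDvd p (B x y) ↔ PDvd p (B' x' y') := by
  have := h.approx_form hM hM' hx hy hx' hy' ax ay
  refine ⟨fun h1 => ?_, fun h1 => ?_⟩
  · convert h1.sub this using 1; ring
  · convert this.add h1 using 1; ring

theorem rankOne (h : LocIso p B M B' M' χ) (hM : IsIntLattice B M) (hM' : IsIntLattice B' M')
    (h1 : RankOne p B' M') : RankOne p B M := by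
  intro x hx y hy z hz w hw
  obtain ⟨x', hx', ax⟩ := h.approx hx
  obtain ⟨y', hy', ay⟩ := h.approx hy
  obtain ⟨z', hz', az⟩ := h.approx hz
  obtain ⟨w', hw', aw⟩ := h.approx hw
  have f := fun {x y x' y'} hx hy hx' hy' ax ay =>
    h.approx_form hM hM' (x := x) (y := y) (x' := x') (y' := y') hx hy hx' hy' ax ay
  obtain ⟨b, eb⟩ := hM.integral z hz w hw
  obtain ⟨d, ed⟩ := hM.integral z hz y hy
  obtain ⟨a', ea'⟩ := hM'.integral x' hx' y' hy'
  obtain ⟨c', ec'⟩ := hM'.integral x' hx' w' hw'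
  have g1 := (f hx hy hx' hy' ax ay).int_mul b
  have g2 := (f hz hw hz' hw' az aw).int_mul a'
  have g3 := (f hx hw hx' hw' ax aw).int_mul d
  have g4 := (f hz hy hz' hy' az ay).int_mul c'
  convert (((g1.add g2).sub g3).sub g4).add (h1 x' hx' y' hy' z' hz' w' hw') using 1
  rw [← eb, ← ed, ← ea', ← ec']; ring

theorem rankOne_iff (h : LocIso p B M B' M' χ) (hM : IsIntLattice B M) (hM' : IsIntLattice B' M') :
    RankOne p B M ↔ RankOne p B' M' := ⟨h.symm.rankOne hM' hM, h.rankOne hM hM'⟩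

theorem approx_watson (h : LocIso p B M B' M' χ) (hp : p ≠ 2) (hM : IsIntLattice B M)
    (hM' : IsIntLattice B' M') {x : V} {x' : V'} (hx : x ∈ watson B p M) (hx' : x' ∈ M')
    (ax : Approx χ M' x x') : x' ∈ watson B' p M' := by
  have hx1 := (TernaryLattice.mem_watson Fact.out hp hM).1 hx
  refine (TernaryLattice.mem_watson Fact.out hp hM').2 ⟨hx', fun y' hy' => ?_⟩
  obtain ⟨y, hy, ay⟩ := h.approx_symm hy'
  exact (h.pdvd_form_iff hM hM' hx1.1 hy hx' hy' ax ay).1 (hx1.2 y hy)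

theorem adm (h : LocIso p B M B' M' χ) (a : Adm p B M) (hM' : IsIntLattice B' M') :
    Adm p B' M' := by
  refine ⟨hM', a.prime, a.odd, ?_, ?_⟩
  · obtain ⟨x, hx, y, hy, hn⟩ := a.ndeg
    obtain ⟨x', hx', ax⟩ := h.approx hx
    obtain ⟨y', hy', ay⟩ := h.approx hy
    exact ⟨x', hx', y', hy',
      fun h1 => hn ((h.pdvd_form_iff a.toIsIntLattice hM' hx hy hx' hy' ax ay).2 h1)⟩
  · obtain ⟨x, hx, hn⟩ := a.radical
    obtain ⟨x', hx', ax⟩ := h.approx (a.watson_le hx)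
    refine ⟨x', h.approx_watson a.odd a.toIsIntLattice hM' hx hx' ax, ?_⟩
    rintro ⟨v, hv, rfl⟩
    obtain ⟨z, hz, e⟩ := ax
    apply hn
    refine ⟨(p : ℚ)⁻¹ • x, mem_of_iota (p := p) a.lattice ?_ ?_, ?_⟩
    · rw [← h.mem, iota_smul, map_smul, e, iota_psmul, ← smul_add, smul_smul]
      have := p_ne_zero (p := p)
      push_cast
      rw [inv_mul_cancel₀ this, one_smul]
      exact add_mem (iota_mem hv) hz
    all_goals
      rw [← Int.cast_smul_eq_zsmul ℚ, smul_smul, Int.cast_natCast,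
        mul_inv_cancel₀ (by exact_mod_cast a.prime.ne_zero), one_smul]
    exact a.watson_le hx

/-- A local isometry carries `Λ_p(M)_p` onto `Λ_p(M')_p`. -/
theorem watson (h : LocIso p B M B' M' χ) (hp : p ≠ 2) (hM : IsIntLattice B M)
    (hM' : IsIntLattice B' M') :
    LocIso p B (watson B p M) B' (TernaryLattice.watson B' p M') χ := by
  have hpM : ∀ {K : Submodule ℤ V'}, IsIntLattice B' K → ∀ v ∈ K,
      (p : ℤ) • v ∈ TernaryLattice.watson B' p K := by
    intro K hK v hv
    refine (TernaryLattice.mem_watson Fact.out hp hK).2 ⟨K.smul_mem _ hv, fun y hy => ?_⟩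
    obtain ⟨b, hb⟩ := hK.integral v hv y hy
    rw [← Int.cast_smul_eq_zsmul ℚ, map_smul, LinearMap.smul_apply, hb]
    exact ⟨b, by simp⟩
  have hpM' : ∀ v ∈ M, (p : ℤ) • v ∈ TernaryLattice.watson B p M := by
    intro v hv
    refine (TernaryLattice.mem_watson Fact.out hp hM).2 ⟨M.smul_mem _ hv, fun y hy => ?_⟩
    obtain ⟨b, hb⟩ := hM.integral v hv y hy
    rw [← Int.cast_smul_eq_zsmul ℚ, map_smul, LinearMap.smul_apply, hb]
    exact ⟨b, by simp⟩
  refine ⟨h.form, fun y => ⟨fun hy => ?_, fun hy => ?_⟩⟩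
  · suffices ∀ y' ∈ localize p (TernaryLattice.watson B' p M'),
        χ.symm y' ∈ localize p (TernaryLattice.watson B p M) by simpa using this _ hy
    intro y' hy'
    refine localize_induction (P := fun y => χ.symm y ∈ localize p (TernaryLattice.watson B p M))
      (fun x hx => ?_) (fun a b ha hb => by rw [map_add]; exact add_mem ha hb)
      (fun d a ha => by rw [map_smul]; exact int_smul_mem d ha) hy'
    obtain ⟨x', hx', ax⟩ := h.symm.approx ((TernaryLattice.mem_watson Fact.out hp hM').1 hx).1
    have := h.symm.approx_watson hp hM' hM hx hx' ax
    obtain ⟨z, hz, e⟩ := ax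
    rw [e]
    exact add_mem (iota_mem this) (psmul_mem_localize hpM' hz)
  · refine localize_induction (P := fun y => χ y ∈ localize p (TernaryLattice.watson B' p M'))
      (fun x hx => ?_) (fun a b ha hb => by rw [map_add]; exact add_mem ha hb)
      (fun d a ha => by rw [map_smul]; exact int_smul_mem d ha) hy
    obtain ⟨x', hx', ax⟩ := h.approx ((TernaryLattice.mem_watson Fact.out hp hM).1 hx).1
    have := h.approx_watson hp hM hM' hx hx' ax
    obtain ⟨z, hz, e⟩ := ax
    rw [e]
    exact add_mem (iota_mem this) (psmul_mem_localize (hpM hM') hz)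

end LocIso

/-! ### Primitive lattices and their genera -/

theorem IsPrimitiveTernary.isIntLattice (h : IsPrimitiveTernary B M) : IsIntLattice B M := by
  refine ⟨⟨h.finrank_eq, h.symm, h.pos⟩, h.lattice, fun x hx y hy => ?_⟩
  have : B x y ∈ scale B M := Submodule.subset_span ⟨x, hx, y, hy, rfl⟩
  rw [h.primitive, Submodule.mem_one] at this
  obtain ⟨k, hk⟩ := this
  exact ⟨k, by rw [← hk]; simp⟩

/-- If `c B(M, M) ⊆ dℤ`, then `d ∣ c`. -/
theorem IsPrimitiveTernary.dvd (h : IsPrimitiveTernary B M) {c d : ℤ}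
    (hd : ∀ x ∈ M, ∀ y ∈ M, ∃ k : ℤ, c * B x y = d * k) : d ∣ c := by
  have h1 : (1 : ℚ) ∈ scale B M := by rw [h.primitive]; exact Submodule.one_le.1 le_rfl
  have key : ∀ t ∈ scale B M, ∃ k : ℤ, (c : ℚ) * t = d * k := by
    intro t ht
    induction ht using Submodule.span_induction with
    | mem t ht => obtain ⟨x, hx, y, hy, rfl⟩ := ht; exact hd x hx y hy
    | zero => exact ⟨0, by simp⟩
    | add a b _ _ ha hb =>
      obtain ⟨k, hk⟩ := ha
      obtain ⟨l, hl⟩ := hb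
      exact ⟨k + l, by push_cast; linear_combination hk + hl⟩
    | smul n a _ ha =>
      obtain ⟨k, hk⟩ := ha
      exact ⟨n * k, by rw [zsmul_eq_mul]; push_cast; linear_combination (n : ℚ) * hk⟩
  obtain ⟨k, hk⟩ := key 1 h1
  exact ⟨k, by exact_mod_cast (mul_one (c : ℚ)) ▸ hk⟩

theorem IsPrimitiveTernary.adm (h : IsPrimitiveTernary B M) (hp : p ≠ 2)
    (hdisc : ∃ k : ℤ, IsDisc B M ((p : ℚ) ^ 2 * k)) : Adm p B M := by
  have hM := h.isIntLattice
  refine ⟨hM, Fact.out, hp, ?_, ?_⟩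
  · by_contra hne
    push Not at hne
    have := h.dvd (c := 1) (d := p) fun x hx y hy => by simpa [PDvd] using hne x hx y hy
    exact (Nat.prime_iff_prime_int.1 (Fact.out : p.Prime)).not_isUnit (isUnit_of_dvd_one this)
  · obtain ⟨k, b, hd⟩ := hdisc
    choose G hG using fun i j => hM.integral (b i) (b i).2 (b j) (b j).2
    have hdet : ((Matrix.of G).map (Int.castRingHom (ZMod p))).det = 0 := by
      rw [← RingHom.mapMatrix_apply, ← RingHom.map_det]
      have h1 : (Matrix.of fun i j => B (b i : V) (b j : V)) =
          (Int.castRingHom ℚ).mapMatrix (Matrix.of G) := by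
        ext i j; simp [hG]
      rw [h1, ← RingHom.map_det] at hd
      have h2 : (Matrix.of G).det = p ^ 2 * k := by
        rw [eq_intCast] at hd
        exact_mod_cast hd.symm
      rw [h2]; simp
    obtain ⟨v, hv, hv0⟩ := Matrix.exists_mulVec_eq_zero_iff.2 hdet
    set m : M := ∑ i, ((v i).val : ℤ) • b i with hm
    refine ⟨m, ?_, ?_⟩
    · refine (TernaryLattice.mem_watson Fact.out hp hM).2 ⟨m.2, fun y hy => ?_⟩
      have hbm : ∀ i, PDvd p (B (m : V) (b i)) := by
        intro i
        have e : B (m : V) (b i) = ((∑ j, G i j * ((v j).val : ℤ) : ℤ) : ℚ) := by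
          rw [h.symm, hm]
          push_cast
          simp only [← Int.cast_smul_eq_zsmul ℚ, map_sum, map_smul, hG, smul_eq_mul]
          exact Finset.sum_congr rfl fun j _ => by push_cast; ring
        rw [e, pdvd_intCast, ← ZMod.intCast_zmod_eq_zero_iff_dvd]
        have := congrFun hv0 i
        simp only [Matrix.mulVec, dotProduct, Matrix.map_apply, Matrix.of_apply,
          Int.coe_castRingHom, Pi.zero_apply] at this
        push_cast
        simpa using this
      have e : y = ∑ i, (b.repr ⟨y, hy⟩ i) • (b i : V) := by
        have := congrArg Subtype.val (b.sum_repr ⟨y, hy⟩)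
        rw [Submodule.coe_sum] at this
        exact this.symm
      rw [e]
      simp only [map_sum, ← Int.cast_smul_eq_zsmul ℚ, map_smul, smul_eq_mul]
      exact Finset.sum_induction _ (PDvd p) (fun _ _ => PDvd.add) pdvd_zero
        fun i _ => (hbm i).int_mul _
    · rintro ⟨w, hw, hmw⟩
      apply hv
      funext i
      have h1 : m = (p : ℤ) • (⟨w, hw⟩ : M) := Subtype.ext hmw
      have h2 := congrArg (fun t => b.repr t i) h1
      simp only [hm] at h2
      rw [b.repr_sum_self, map_smul, Finsupp.smul_apply] at h2
      have h3 := congrArg (fun t : ℤ => (t : ZMod p)) h2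
      simpa using h3

theorem isIntLattice_of_genus {L : Submodule ℤ V} (hL : IsIntLattice B L) (hM : M ∈ genus B L) :
    IsIntLattice B M := by
  refine ⟨hL.toIsTernaryForm, hM.1, fun x hx y hy => ⟨(B x y).num, ?_⟩⟩
  have hden : (B x y).den = 1 := by
    by_contra hne
    obtain ⟨q, hq, hqd⟩ := Nat.exists_prime_and_dvd hne
    have : Fact q.Prime := ⟨hq⟩
    obtain ⟨χ, h⟩ := locallyIsometric_iff.1 (hM.2 q)
    have h1 := norm_form_le hL.integral ((h.symm.mem _).2 (iota_mem hx))
      ((h.symm.mem _).2 (iota_mem hy))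
    rw [h.symm.form, localForm_iota] at h1
    exact not_dvd_den h1 (by exact_mod_cast hqd)
  nth_rewrite 1 [← Rat.num_div_den (B x y)]
  rw [hden]; simp

theorem LocallyIsometric.refl : LocallyIsometric p B M B M :=
  locallyIsometric_iff.2 ⟨_, LocIso.refl⟩

theorem LocallyIsometric.symm (h : LocallyIsometric p B M B' M') :
    LocallyIsometric p B' M' B M := by
  obtain ⟨χ, h⟩ := locallyIsometric_iff.1 h
  exact locallyIsometric_iff.2 ⟨_, h.symm⟩

theorem LocallyIsometric.trans (h : LocallyIsometric p B M B' M') {W : Type*} [AddCommGroup W]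
    [Module ℚ W] {C : LinearMap.BilinForm ℚ W} {K : Submodule ℤ W}
    (h' : LocallyIsometric p B' M' C K) : LocallyIsometric p B M C K := by
  obtain ⟨χ, h⟩ := locallyIsometric_iff.1 h
  obtain ⟨ψ, h'⟩ := locallyIsometric_iff.1 h'
  exact locallyIsometric_iff.2 ⟨_, h.trans h'⟩

variable {L : Submodule ℤ V}

theorem Adm.of_gam (hL : Adm p B L) (hM : M ∈ Gam B p L N) : Adm p B M := by
  obtain ⟨χ, h⟩ := locallyIsometric_iff.1 (hM.1.2 p)
  exact h.adm hL (isIntLattice_of_genus hL.toIsIntLattice hM.1)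

theorem Adm.rankOne_gam (hL : Adm p B L) (hM : M ∈ Gam B p L N) :
    RankOne p B L ↔ RankOne p B M := by
  obtain ⟨χ, h⟩ := locallyIsometric_iff.1 (hM.1.2 p)
  exact h.rankOne_iff hL.toIsIntLattice (hL.of_gam hM).toIsIntLattice

omit [Fact p.Prime] in
theorem Adm.self_mem_gam (hL : Adm p B L) : L ∈ Gam B p L (watson B p L) :=
  ⟨⟨hL.lattice, fun _ _ => LocallyIsometric.refl⟩, rfl⟩

/-- The set `Γ_p^L(N)` is stable under `O(N)`. -/
theorem Adm.isFam (hL : Adm p B L) : IsFam p B N (Gam B p L N) where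
  adm _ hM := hL.of_gam hM
  wat _ hM := hM.2
  rank _ hM _ hM' := by rw [← hL.rankOne_gam hM, ← hL.rankOne_gam hM']
  stable σ hσ M hM := by
    refine ⟨⟨(orth_smul_integral (hL.of_gam hM).toIsIntLattice hσ.1).lattice, fun q _ =>
      (hM.1.2 q).trans (locallyIsometric_iff.2 ⟨_, locIso_smul hσ.1⟩)⟩, ?_⟩
    rw [watson_smul hσ.1, hM.2]
    exact hσ.2

end

section

variable {V' : Type v} [AddCommGroup V'] [Module ℚ V'] {B' : LinearMap.BilinForm ℚ V'}
  {M' N' : Submodule ℤ V'} {p : ℕ} [Fact p.Prime]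

/-! ### Transport of lattices along a local isometry -/

theorem inMul_iff (hM : M.IsLattice ℚ) {x : V} (hx : x ∈ M) :
    InMul p M x ↔ (p : ℚ_[p])⁻¹ • iota p x ∈ localize p M := by
  have hp0 : (p : ℚ) ≠ 0 := by exact_mod_cast (Fact.out : p.Prime).ne_zero
  constructor
  · rintro ⟨v, hv, rfl⟩
    rw [iota_psmul, inv_smul_smul₀ p_ne_zero]
    exact iota_mem hv
  · intro h
    have e : x = (p : ℤ) • (p : ℚ)⁻¹ • x := by
      rw [← Int.cast_smul_eq_zsmul ℚ, smul_smul, Int.cast_natCast, mul_inv_cancel₀ hp0, one_smul]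
    refine ⟨(p : ℚ)⁻¹ • x, mem_of_iota (p := p) hM ?_ (by rw [← e]; exact hx), e⟩
    rw [iota_smul]
    push_cast
    exact h

/-- The lattice `M'` with `pM' ⊆ N'` and `M'_p = χ(M_p)`. -/
def transport (χ : (ℚ_[p] ⊗[ℚ] V) ≃ₗ[ℚ_[p]] (ℚ_[p] ⊗[ℚ] V')) (N' : Submodule ℤ V')
    (M : Submodule ℤ V) : Submodule ℤ V' where
  carrier := {v | (p : ℤ) • v ∈ N' ∧ χ.symm (iota p v) ∈ localize p M}
  zero_mem' := by simp
  add_mem' := by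
    rintro a b ⟨h1, h2⟩ ⟨h3, h4⟩
    exact ⟨by rw [smul_add]; exact add_mem h1 h3, by
      rw [map_add, map_add]; exact add_mem h2 h4⟩
  smul_mem' := by
    rintro n a ⟨h1, h2⟩
    refine ⟨by rw [smul_comm]; exact N'.smul_mem _ h1, ?_⟩
    rw [iota_zsmul, map_smul]
    have := int_smul_mem (n : ℤ_[p]) h2
    exact_mod_cast this

/-- `χ` carries `N_p = Λ_p(L)_p` onto `N'_p = Λ_p(L')_p`, where `L` and `L'` are isometric at `p`. -/
structure Corr (p : ℕ) [Fact p.Prime] (B : LinearMap.BilinForm ℚ V) (L N : Submodule ℤ V)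
    (B' : LinearMap.BilinForm ℚ V') (L' N' : Submodule ℤ V')
    (χ : (ℚ_[p] ⊗[ℚ] V) ≃ₗ[ℚ_[p]] (ℚ_[p] ⊗[ℚ] V')) : Prop where
  adm : Adm p B L
  adm' : Adm p B' L'
  wat : watson B p L = N
  wat' : watson B' p L' = N'
  loc : LocallyIsometric p B L B' L'
  iso : LocIso p B N B' N' χ

namespace Corr

variable {χ : (ℚ_[p] ⊗[ℚ] V) ≃ₗ[ℚ_[p]] (ℚ_[p] ⊗[ℚ] V')} {L : Submodule ℤ V}
  {L' : Submodule ℤ V'}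

theorem symm (h : Corr p B L N B' L' N' χ) : Corr p B' L' N' B L N χ.symm :=
  ⟨h.adm', h.adm, h.wat', h.wat, h.loc.symm, h.iso.symm⟩

theorem le_transport (h : Corr p B L N B' L' N' χ) (hM : M ∈ Gam B p L N) :
    N' ≤ transport χ N' M := by
  intro v hv
  refine ⟨N'.smul_mem _ hv, localize_mono (h.adm.isFam.le_lattice hM) ?_⟩
  exact (h.iso.symm.mem _).2 (iota_mem hv)

theorem locIso (h : Corr p B L N B' L' N' χ) (hM : M ∈ Gam B p L N) :
    LocIso p B M B' (transport χ N' M) χ := by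
  refine ⟨h.iso.form, fun y => ⟨fun hy => ?_, fun hy => ?_⟩⟩
  · rw [← χ.symm_apply_apply y]
    refine localize_induction (M := transport χ N' M) (P := fun z => χ.symm z ∈ localize p M)
      (fun x hx => hx.2)
      (fun a b ha hb => by rw [map_add]; exact add_mem ha hb)
      (fun d a ha => by rw [map_smul]; exact int_smul_mem d ha) hy
  · have h1 : (p : ℚ_[p]) • χ y ∈ localize p N' := by
      rw [← map_smul, h.iso.mem]
      exact psmul_mem_localize (fun v => h.adm.isFam.smul_mem hM) hy
    obtain ⟨n, hn, z, hz, e⟩ := exists_approx h1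
    have hp0 : (p : ℚ) ≠ 0 := by exact_mod_cast (Fact.out : p.Prime).ne_zero
    have e1 : χ y = iota p ((p : ℚ)⁻¹ • n) + z := by
      rw [iota_smul, ← inv_smul_smul₀ (p_ne_zero (p := p)) (χ y), e, smul_add,
        inv_smul_smul₀ p_ne_zero]
      push_cast; rfl
    have h2 : (p : ℚ)⁻¹ • n ∈ transport χ N' M := by
      constructor
      · rw [← Int.cast_smul_eq_zsmul ℚ, smul_smul, Int.cast_natCast, mul_inv_cancel₀ hp0, one_smul]
        exact hn
      · rw [← sub_eq_iff_eq_add] at e1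
        rw [← e1, map_sub, χ.symm_apply_apply]
        exact sub_mem hy (localize_mono (h.adm.isFam.le_lattice hM) ((h.iso.symm.mem _).2 hz))
    rw [e1]
    exact add_mem (iota_mem h2) (localize_mono (h.le_transport hM) hz)

theorem isLattice (h : Corr p B L N B' L' N' χ) (hM : M ∈ Gam B p L N) :
    (transport χ N' M).IsLattice ℚ := by
  have hN' := (h.adm'.isFam.lattice (h.wat' ▸ h.adm'.self_mem_gam)).lattice
  refine ⟨?_, ?_⟩
  · rw [← Module.Finite.iff_fg]
    have : Module.Finite ℤ N' := Module.Finite.iff_fg.2 hN'.fg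
    let φ : transport χ N' M →ₗ[ℤ] N' :=
      { toFun := fun v => ⟨(p : ℤ) • v, v.2.1⟩
        map_add' := fun a b => by ext; simp
        map_smul' := fun n a => Subtype.ext (smul_comm (p : ℤ) n (a : V')) }
    refine Module.Finite.of_injective φ fun a b hab => Subtype.ext ?_
    exact zsmul_cancel (h.adm.prime_int.ne_zero) (congrArg Subtype.val hab)
  · rw [eq_top_iff, ← hN'.span_eq_top]
    exact Submodule.span_mono (h.le_transport hM)

theorem mem_gam (h : Corr p B L N B' L' N' χ) (hM : M ∈ Gam B p L N) :
    transport χ N' M ∈ Gam B' p L' N' := by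
  have hfam := h.adm'.isFam (N := N')
  have hL' : L' ∈ Gam B' p L' N' := h.wat' ▸ h.adm'.self_mem_gam
  have hgen : transport χ N' M ∈ genus B' L' := by
    refine ⟨h.isLattice hM, fun q _ => ?_⟩
    by_cases hq : q = p
    · subst hq
      exact h.loc.symm.trans ((hM.1.2 q).trans (locallyIsometric_iff.2 ⟨_, h.locIso hM⟩))
    · have e1 := localize_eq_of_ne hq (hfam.le_lattice hL') fun v => hfam.smul_mem hL'
      have e2 := localize_eq_of_ne hq (h.le_transport hM) fun v hv => hv.1
      refine locallyIsometric_iff.2 ⟨LinearEquiv.refl _ _, fun _ _ => rfl, fun y => ?_⟩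
      rw [e2, e1]; rfl
  have hI := isIntLattice_of_genus h.adm'.toIsIntLattice hgen
  have aM := h.adm.of_gam hM
  have hw := (h.locIso hM).watson aM.odd aM.toIsIntLattice hI
  rw [hM.2] at hw
  have aT := (h.locIso hM).adm aM hI
  refine ⟨hgen, le_antisymm (fun v hv => ?_) fun v hv => ?_⟩
  · have hvT := aT.watson_le hv
    refine mem_of_iota (p := p) (hfam.lattice hL').lattice ?_ hvT.1
    rw [← χ.apply_symm_apply (iota p v), h.iso.mem, ← hw.mem, χ.apply_symm_apply]
    exact iota_mem hv
  · have hvT := h.le_transport hM hv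
    refine mem_of_iota (p := p)
      (isLattice_watson aT.prime aT.odd hI).lattice ?_ (aT.inMul_mem_watson ⟨v, hvT, rfl⟩)
    rw [← χ.apply_symm_apply (iota p v), hw.mem, ← h.iso.mem, χ.apply_symm_apply]
    exact iota_mem hv

theorem injOn (h : Corr p B L N B' L' N' χ) : Set.InjOn (transport χ N') (Gam B p L N) := by
  have key : ∀ M₁ ∈ Gam B p L N, ∀ M₂ ∈ Gam B p L N, transport χ N' M₁ = transport χ N' M₂ →
      M₁ ≤ M₂ := by
    intro M₁ h1 M₂ h2 e v hv
    refine mem_of_iota (p := p) h2.1.1 ?_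
      (h.adm.isFam.le_lattice h2 (h.adm.isFam.smul_mem h1 hv))
    rw [← (h.locIso h2).mem, ← e, (h.locIso h1).mem]
    exact iota_mem hv
  exact fun M₁ h1 M₂ h2 e => le_antisymm (key _ h1 _ h2 e) (key _ h2 _ h1 e.symm)

theorem ncard_le (h : Corr p B L N B' L' N' χ) :
    (Gam B p L N).ncard ≤ (Gam B' p L' N').ncard :=
  Set.ncard_le_ncard_of_injOn _ (fun _ => h.mem_gam) h.injOn h.adm'.isFam.finite

end Corr

/-! ### Local reflections -/

/-- The reflection of `V_p` along `z`. -/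
def lrefl (B : LinearMap.BilinForm ℚ V) {z : ℚ_[p] ⊗[ℚ] V} (hz : localForm p B z z ≠ 0) :
    (ℚ_[p] ⊗[ℚ] V) ≃ₗ[ℚ_[p]] (ℚ_[p] ⊗[ℚ] V) :=
  Module.reflection (x := z) (f := (2 / localForm p B z z) • localForm p B z)
    (by rw [LinearMap.smul_apply, smul_eq_mul, div_mul_cancel₀ _ hz])

theorem lrefl_apply {z : ℚ_[p] ⊗[ℚ] V} (hz : localForm p B z z ≠ 0) (y : ℚ_[p] ⊗[ℚ] V) :
    lrefl B hz y = y - (2 * localForm p B z y / localForm p B z z) • z := by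
  rw [lrefl, Module.reflection_apply, LinearMap.smul_apply, smul_eq_mul, div_mul_eq_mul_div]

theorem lrefl_form (hB : IsTernaryForm B) {z : ℚ_[p] ⊗[ℚ] V} (hz : localForm p B z z ≠ 0)
    (x y : ℚ_[p] ⊗[ℚ] V) :
    localForm p B (lrefl B hz x) (lrefl B hz y) = localForm p B x y := by
  simp only [lrefl_apply, map_sub, map_smul, LinearMap.sub_apply, LinearMap.smul_apply,
    smul_eq_mul, localForm_symm hB x z]
  field_simp
  ring

theorem bc_tau (hB : IsTernaryForm B) {x : V} (hx : x ≠ 0) (y : ℚ_[p] ⊗[ℚ] V) :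
    bc p (tau B x) y = y - (2 * localForm p B (iota p x) y / localForm p B (iota p x) (iota p x)) •
      iota p x := by
  have hq : ((B x x : ℚ) : ℚ_[p]) ≠ 0 := by exact_mod_cast hB.ne_zero hx
  induction y using TensorProduct.induction_on with
  | zero => simp
  | add a b ha hb => rw [map_add, ha, hb, map_add]; module
  | tmul a v =>
    have e : (a ⊗ₜ[ℚ] v : ℚ_[p] ⊗[ℚ] V) = a • iota p v := by
      simp [iota, TensorProduct.smul_tmul']
    rw [e, map_smul, bc_iota, tau_apply, map_sub, iota_smul, map_smul, smul_eq_mul,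
      localForm_iota, localForm_iota]
    push_cast
    module

theorem norm_two (hp : p ≠ 2) : ‖(2 : ℚ_[p])‖ = 1 := by
  have h3 : ¬ ‖((2 : ℤ) : ℚ_[p])‖ < 1 := by
    rw [Padic.norm_intCast_lt_one_iff]
    intro h3
    exact hp ((Nat.prime_dvd_prime_iff_eq Fact.out Nat.prime_two).1 (by exact_mod_cast h3))
  have h4 := Padic.norm_int_le_one (p := p) 2
  push_cast at h3 h4
  exact le_antisymm h4 (not_lt.1 h3)

/-- Two vectors of equal norm, along which reflections preserve `N_p`, are related by an isometry
of `N_p`. -/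
theorem exists_locIso (hB : IsTernaryForm B) (hp : p ≠ 2) {x x' : ℚ_[p] ⊗[ℚ] V}
    (hx : x ∈ localize p N) (hx' : x' ∈ localize p N)
    (hq : localForm p B x' x' = localForm p B x x) (hne : localForm p B x x ≠ 0)
    (h1 : ∀ y ∈ localize p N, ‖localForm p B x y‖ ≤ ‖localForm p B x x‖)
    (h2 : ∀ y ∈ localize p N, ‖localForm p B x' y‖ ≤ ‖localForm p B x x‖) :
    ∃ χ, LocIso p B N B N χ ∧ (χ x = x' ∨ χ x = -x') := by
  have two := norm_two hp
  have key : ∀ z, z ∈ localize p N → (∀ y ∈ localize p N,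
      ‖localForm p B z y‖ ≤ ‖localForm p B x x‖) →
      ‖localForm p B x x‖ ≤ ‖localForm p B z z‖ → 2 * localForm p B z x = localForm p B z z →
      ∃ χ, LocIso p B N B N χ ∧ χ x = x - z := by
    intro z hz hzy hzz hzx
    have hz0 : localForm p B z z ≠ 0 := by
      intro h0
      rw [h0, norm_zero] at hzz
      exact hne (norm_le_zero_iff.1 hzz)
    have hmap : ∀ y ∈ localize p N, lrefl B hz0 y ∈ localize p N := by
      intro y hy
      rw [lrefl_apply]
      refine sub_mem hy (norm_smul_mem ?_ hz)
      rw [norm_div, norm_mul, two, one_mul]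
      exact div_le_one_of_le₀ ((hzy y hy).trans hzz) (norm_nonneg _)
    refine ⟨lrefl B hz0, ⟨lrefl_form hB hz0, fun y => ⟨fun hy => ?_, hmap y⟩⟩, ?_⟩
    · have := hmap _ hy
      rwa [lrefl, Module.involutive_reflection] at this
    · rw [lrefl_apply, hzx, div_self hz0, one_smul]
  have hs := localForm_symm hB x' x
  have hsum : localForm p B x x * 2 * 2 =
      localForm p B (x - x') (x - x') + localForm p B (x + x') (x + x') := by
    simp only [map_sub, map_add, LinearMap.sub_apply, LinearMap.add_apply, hq, hs]; ring
  have hmax : ‖localForm p B x x‖ ≤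
      max ‖localForm p B (x - x') (x - x')‖ ‖localForm p B (x + x') (x + x')‖ := by
    have := Padic.nonarchimedean (localForm p B (x - x') (x - x')) (localForm p B (x + x') (x + x'))
    rwa [← hsum, norm_mul, norm_mul, two, mul_one, mul_one] at this
  rcases le_max_iff.1 hmax with h3 | h3
  · obtain ⟨χ, hχ, e⟩ := key (x - x') (sub_mem hx hx') (fun y hy => by
      rw [map_sub, LinearMap.sub_apply, sub_eq_add_neg]
      refine (Padic.nonarchimedean _ _).trans (max_le (h1 y hy) ?_)
      rw [norm_neg]; exact h2 y hy) h3 (by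
      simp only [map_sub, LinearMap.sub_apply, hq, hs]; ring)
    exact ⟨χ, hχ, Or.inl (by rw [e]; abel)⟩
  · obtain ⟨χ, hχ, e⟩ := key (x + x') (add_mem hx hx') (fun y hy => by
      rw [map_add, LinearMap.add_apply]
      exact (Padic.nonarchimedean _ _).trans (max_le (h1 y hy) (h2 y hy))) h3 (by
      simp only [map_add, LinearMap.add_apply, hq, hs]; ring)
    exact ⟨χ, hχ, Or.inr (by rw [e]; abel)⟩

end

section

variable {V' : Type v} [AddCommGroup V'] [Module ℚ V'] {B' : LinearMap.BilinForm ℚ V'}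
  {M' N' : Submodule ℤ V'} {p : ℕ} [Fact p.Prime]

/-! ### Unimodular Jordan components -/

theorem exists_p_mul {t : ℚ_[p]} (h : ‖t‖ < 1) : ∃ c : ℤ_[p], t = (p : ℚ_[p]) * c := by
  obtain ⟨c, hc⟩ := (PadicInt.norm_lt_one_iff_dvd (⟨t, h.le⟩ : ℤ_[p])).1 h
  refine ⟨c, ?_⟩
  have := congrArg (fun s : ℤ_[p] => (s : ℚ_[p])) hc
  simpa using this

/-- Vectors with Gram determinant prime to `p` and form divisible by `p` on the orthogonal
complement span a unimodular component. -/
theorem Adm.isUnimodularComponent (a : Adm p B M) {r : ℕ} {g : Fin r → V} (hg : ∀ i, g i ∈ M)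
    {G : Matrix (Fin r) (Fin r) ℤ} (hG : ∀ i j, B (g i) (g j) = G i j)
    (hdet : ¬ (p : ℤ) ∣ G.det)
    (hort : ∀ x ∈ M, ∀ y ∈ M, (∀ i, PDvd p (B (g i) x)) → (∀ i, PDvd p (B (g i) y)) →
      PDvd p (B x y)) :
    ∃ d : ℤ_[p]ˣ, (d : ℤ_[p]) = (G.det : ℤ) ∧
      IsUnimodularComponent p B M (fun i => iota p (g i)) d := by
  set Gp : Matrix (Fin r) (Fin r) ℤ_[p] := (Int.castRingHom ℤ_[p]).mapMatrix G with hGp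
  have hGdet : Gp.det = (G.det : ℤ) := by rw [hGp, ← RingHom.map_det]; rfl
  have hu : IsUnit Gp.det := by
    rw [hGdet, PadicInt.isUnit_iff]
    refine le_antisymm (PadicInt.norm_le_one _) (not_lt.1 fun h => hdet ?_)
    exact PadicInt.norm_intCast_lt_one_iff.1 h
  have hform : ∀ i j, localForm p B (iota p (g i)) (iota p (g j)) = (Gp i j : ℚ_[p]) := by
    intro i j
    rw [localForm_iota, hG]; simp [hGp]
  refine ⟨hu.unit, hGdet, ⟨Gp, hform, rfl⟩, localize p M ⊓
    ⨅ i, (LinearMap.ker (localForm p B (iota p (g i)))).restrictScalars ℤ_[p], ?_, ?_, ?_⟩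
  · refine le_antisymm (sup_le (Submodule.span_le.2 ?_) inf_le_left) fun v hv => ?_
    · rintro _ ⟨i, rfl⟩
      exact iota_mem (hg i)
    · let w : Fin r → ℤ_[p] := fun i =>
        ⟨localForm p B (iota p (g i)) v, norm_form_le a.integral (iota_mem (hg i)) hv⟩
      let c := Gp⁻¹.mulVec w
      have hc : Gp.mulVec c = w := by
        rw [Matrix.mulVec_mulVec, Matrix.mul_nonsing_inv _ hu, Matrix.one_mulVec]
      have hs : ∑ i, c i • iota p (g i) ∈ Submodule.span ℤ_[p]
          (Set.range fun i => iota p (g i)) :=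
        Submodule.sum_mem _ fun i _ => Submodule.smul_mem _ _ (Submodule.subset_span ⟨i, rfl⟩)
      rw [← add_sub_cancel (∑ i, c i • iota p (g i)) v]
      refine add_mem (Submodule.mem_sup_left hs) (Submodule.mem_sup_right ⟨?_, ?_⟩)
      · exact sub_mem hv (Submodule.sum_mem _ fun i _ => Submodule.smul_mem _ _ (iota_mem (hg i)))
      · rw [SetLike.mem_coe, Submodule.mem_iInf]
        intro i
        rw [Submodule.restrictScalars_mem, LinearMap.mem_ker, map_sub, sub_eq_zero]
        have h1 : localForm p B (iota p (g i)) v = ((Gp.mulVec c i : ℤ_[p]) : ℚ_[p]) := by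
          rw [hc]
        rw [h1, Matrix.mulVec, dotProduct, map_sum, PadicInt.coe_sum]
        refine Finset.sum_congr rfl fun j _ => ?_
        rw [← algebraMap_smul ℚ_[p] (c j), map_smul, hform, smul_eq_mul, PadicInt.coe_mul, mul_comm]
        rfl
  · rintro i y ⟨-, hy⟩
    rw [SetLike.mem_coe, Submodule.mem_iInf] at hy
    exact hy i
  · rintro y ⟨hy, hy0⟩ z ⟨hz, hz0⟩
    rw [SetLike.mem_coe, Submodule.mem_iInf] at hy0 hz0
    have hdiv : ∀ {y x w}, (∀ i, localForm p B (iota p (g i)) y = 0) → x ∈ M →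
        w ∈ localize p M → y = iota p x + (p : ℚ_[p]) • w → ∀ i, PDvd p (B (g i) x) := by
      intro y x w hy hx hw e i
      rw [a.pdvd_iff (hg i) hx]
      have h1 := hy i
      rw [e, map_add, map_smul, smul_eq_mul] at h1
      rw [eq_neg_of_add_eq_zero_left h1, norm_neg]
      exact norm_p_mul_lt (norm_form_le a.integral (iota_mem (hg i)) hw)
    obtain ⟨x, hx, w, hw, e⟩ := exists_approx hy
    obtain ⟨x', hx', w', hw', e'⟩ := exists_approx hz
    have h1 := hort x hx x' hx' (hdiv hy0 hx hw e) (hdiv hz0 hx' hw' e')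
    rw [a.pdvd_iff hx hx'] at h1
    apply exists_p_mul
    have h2 : localForm p B y z = localForm p B (iota p x) (iota p x') + p *
        (localForm p B (iota p x) w' + localForm p B w z) := by
      rw [e']
      nth_rewrite 1 [e]
      simp only [map_add, map_smul, LinearMap.add_apply, LinearMap.smul_apply, smul_eq_mul]
      ring
    rw [h2]
    refine (Padic.nonarchimedean _ _).trans_lt (max_lt h1 (norm_p_mul_lt ?_))
    exact (Padic.nonarchimedean _ _).trans (max_le (norm_form_le a.integral (iota_mem hx) hw')
      (norm_form_le a.integral hw hz))

theorem IsUnimodularComponent.congr_gram (hB : IsTernaryForm B) {r r' : ℕ}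
    {b : Fin r → ℚ_[p] ⊗[ℚ] V} {b' : Fin r' → ℚ_[p] ⊗[ℚ] V} {d d' : ℤ_[p]ˣ}
    (h : IsUnimodularComponent p B M b d) (h' : IsUnimodularComponent p B M b' d')
    {G : Matrix (Fin r) (Fin r) ℤ_[p]} {G' : Matrix (Fin r') (Fin r') ℤ_[p]}
    (hG : ∀ i j, localForm p B (b i) (b j) = (G i j : ℚ_[p]))
    (hG' : ∀ i j, localForm p B (b' i) (b' j) = (G' i j : ℚ_[p])) :
    ∃ A : Matrix (Fin r') (Fin r) (ZMod p), G'.map PadicInt.toZMod =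
      A * G.map PadicInt.toZMod * A.transpose := by
  obtain ⟨J, hs, ho, hp⟩ := h.splits
  obtain ⟨J', hs', -, -⟩ := h'.splits
  have hb : ∀ i, b' i ∈ Submodule.span ℤ_[p] (Set.range b) ⊔ J := by
    intro i
    rw [hs, ← hs']
    exact Submodule.mem_sup_left (Submodule.subset_span ⟨i, rfl⟩)
  have hA : ∀ i, ∃ c : Fin r → ℤ_[p], ∃ y ∈ J, b' i = ∑ j, (c j : ℚ_[p]) • b j + y := by
    intro i
    obtain ⟨x, hx, y, hy, e⟩ := Submodule.mem_sup.1 (hb i)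
    obtain ⟨c, rfl⟩ := (Submodule.mem_span_range_iff_exists_fun ℤ_[p]).1 hx
    refine ⟨c, y, hy, by rw [← e]; congr 1⟩
  choose A y hy e using hA
  choose C hC using fun i j => hp (y i) (hy i) (y j) (hy j)
  refine ⟨(Matrix.of A).map PadicInt.toZMod, ?_⟩
  have hmat : G' = Matrix.of A * G * (Matrix.of A).transpose + (p : ℤ_[p]) • Matrix.of C := by
    ext i k
    have h1 := hG' i k
    rw [e, e] at h1
    simp only [map_add, map_sum, map_smul, LinearMap.add_apply, LinearMap.sum_apply,
      LinearMap.smul_apply, smul_eq_mul, hG, ho _ _ (hy _), hC, localForm_symm hB (y i),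
      mul_zero, Finset.sum_const_zero, add_zero, zero_add] at h1
    refine PadicInt.ext ?_
    rw [← h1]
    simp only [Matrix.add_apply, Matrix.mul_apply, Matrix.smul_apply, Matrix.of_apply,
      Matrix.transpose_apply, smul_eq_mul]
    simp only [PadicInt.coe_add, PadicInt.coe_mul, PadicInt.coe_sum, PadicInt.coe_natCast]
    congr 1
    exact Finset.sum_congr rfl fun j _ => mul_comm _ _
  rw [hmat]
  ext i k
  simp [Matrix.mul_apply, map_sum]

/-- The discriminants of two unimodular components agree up to squares. -/
theorem IsUnimodularDisc.legendre_eq (hB : IsTernaryForm B) {d d' : ℤ_[p]ˣ}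
    (h : IsUnimodularDisc p B M d) (h' : IsUnimodularDisc p B M d') :
    legendre p (d : ℤ_[p]) = legendre p (d' : ℤ_[p]) := by
  obtain ⟨r, b, h⟩ := h
  obtain ⟨r', b', h'⟩ := h'
  obtain ⟨G, hG, hd⟩ := h.gram
  obtain ⟨G', hG', hd'⟩ := h'.gram
  have hdet : ∀ {n} (G : Matrix (Fin n) (Fin n) ℤ_[p]),
      (G.map PadicInt.toZMod).det = PadicInt.toZMod G.det := by
    intro n G; rw [RingHom.map_det]; rfl
  have hle : ∀ {r r' : ℕ} {G : Matrix (Fin r) (Fin r) ℤ_[p]}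
      {G' : Matrix (Fin r') (Fin r') ℤ_[p]} {A : Matrix (Fin r') (Fin r) (ZMod p)},
      IsUnit G'.det → G'.map PadicInt.toZMod = A * G.map PadicInt.toZMod * A.transpose →
      r' ≤ r := by
    intro r r' G G' A hu e
    have h1 : IsUnit (G'.map PadicInt.toZMod) := by
      rw [Matrix.isUnit_iff_isUnit_det, hdet]; exact hu.map _
    have h2 := Matrix.rank_of_isUnit _ h1
    rw [e, Matrix.mul_assoc, Fintype.card_fin] at h2
    rw [← h2]
    exact (Matrix.rank_mul_le_left _ _).trans (by simpa using A.rank_le_width)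
  obtain ⟨A, hA⟩ := h.congr_gram hB h' hG hG'
  obtain ⟨A', hA'⟩ := h'.congr_gram hB h hG' hG
  obtain rfl := le_antisymm (hle (hd ▸ d.isUnit) hA') (hle (hd' ▸ d'.isUnit) hA)
  have e := congrArg Matrix.det hA
  rw [Matrix.det_mul, Matrix.det_mul, Matrix.det_transpose, hdet, hdet, hd, hd'] at e
  have hne : A.det ≠ 0 := by
    rintro h0
    rw [h0, zero_mul, zero_mul] at e
    exact (d'.isUnit.map (PadicInt.toZMod (p := p))).ne_zero e
  unfold legendre
  rw [e, mul_right_comm, ← pow_two, map_mul, map_pow, quadraticChar_sq_one hne, one_mul]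

theorem LocIso.isUnimodularDisc {χ : (ℚ_[p] ⊗[ℚ] V) ≃ₗ[ℚ_[p]] (ℚ_[p] ⊗[ℚ] V')}
    (h : LocIso p B M B' M' χ) {d : ℤ_[p]ˣ} (hd : IsUnimodularDisc p B M d) :
    IsUnimodularDisc p B' M' d := by
  obtain ⟨r, b, ⟨G, hG, hd⟩, J, hs, ho, hJ⟩ := hd
  let φ := χ.toLinearMap.restrictScalars ℤ_[p]
  refine ⟨r, fun i => χ (b i), ⟨G, fun i j => by rw [h.form, hG], hd⟩, J.map φ, ?_, ?_, ?_⟩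
  · have e : Set.range (fun i => χ (b i)) = φ '' Set.range b := by
      rw [← Set.range_comp]; rfl
    rw [e, ← Submodule.map_span, ← Submodule.map_sup, hs]
    ext y
    rw [Submodule.mem_map]
    constructor
    · rintro ⟨z, hz, rfl⟩
      exact (h.mem z).2 hz
    · intro hy
      refine ⟨χ.symm y, (h.mem _).1 ?_, χ.apply_symm_apply y⟩
      rwa [χ.apply_symm_apply]
  · rintro i _ ⟨z, hz, rfl⟩
    exact (h.form _ _).trans (ho i z hz)
  · rintro _ ⟨y, hy, rfl⟩ _ ⟨z, hz, rfl⟩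
    obtain ⟨c, hc⟩ := hJ y hy z hz
    exact ⟨c, (h.form _ _).trans hc⟩

namespace Adm

omit [Fact p.Prime] in
theorem exists_not_pdvd_self (a : Adm p B M) : ∃ g ∈ M, ¬ PDvd p (B g g) := by
  obtain ⟨x, hx, y, hy, hxy⟩ := a.ndeg
  by_contra hne
  push Not at hne
  have h1 := ((hne _ (add_mem hx hy)).sub (hne x hx)).sub (hne y hy)
  simp only [map_add, LinearMap.add_apply, a.symm y x] at h1
  obtain ⟨k, hk⟩ := a.integral x hx y hy
  have h2 : PDvd p ((2 * k : ℤ) : ℚ) := by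
    convert h1 using 1; rw [hk]; push_cast; ring
  apply hxy
  rw [hk, pdvd_intCast]
  exact a.coprime_cancel (pdvd_intCast.1 h2) a.two_not_dvd

omit [Fact p.Prime] in
theorem exists_gram_not_pdvd (a : Adm p B M) (h1 : ¬ RankOne p B M) :
    ∃ g ∈ M, ∃ y ∈ M, ¬ PDvd p (B g g * B y y - B g y * B g y) := by
  obtain ⟨g, hg, hgg⟩ := a.exists_not_pdvd_self
  by_contra hne
  push Not at hne
  obtain ⟨q, hq⟩ := a.integral g hg g hg
  rw [hq, pdvd_intCast] at hgg
  have hpol : ∀ x ∈ M, ∀ y ∈ M, PDvd p (B g g * B x y - B g x * B g y) := by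
    intro x hx y hy
    have h2 := ((hne g hg _ (add_mem hx hy)).sub (hne g hg x hx)).sub (hne g hg y hy)
    simp only [map_add, LinearMap.add_apply, a.symm y x] at h2
    obtain ⟨k, hk⟩ := a.integral x hx y hy
    obtain ⟨l, hl⟩ := a.integral g hg x hx
    obtain ⟨m, hm⟩ := a.integral g hg y hy
    rw [hq, hk, hl, hm] at h2 ⊢
    have h3 : PDvd p ((2 * (q * k - l * m) : ℤ) : ℚ) := by
      convert h2 using 1; push_cast; ring
    have := pdvd_intCast.2 (a.coprime_cancel (pdvd_intCast.1 h3) a.two_not_dvd)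
    exact_mod_cast this
  apply h1
  intro x hx y hy z hz w hw
  obtain ⟨k1, e1⟩ := a.integral x hx y hy
  obtain ⟨k2, e2⟩ := a.integral z hz w hw
  obtain ⟨k3, e3⟩ := a.integral x hx w hw
  obtain ⟨k4, e4⟩ := a.integral z hz y hy
  obtain ⟨l1, f1⟩ := a.integral g hg x hx
  obtain ⟨l2, f2⟩ := a.integral g hg y hy
  obtain ⟨l3, f3⟩ := a.integral g hg z hz
  obtain ⟨l4, f4⟩ := a.integral g hg w hw
  have p1 := hpol x hx y hy
  have p2 := hpol z hz w hw
  have p3 := hpol x hx w hw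
  have p4 := hpol z hz y hy
  rw [e1, e2, e3, e4]
  rw [hq, e1, f1, f2] at p1
  rw [hq, e2, f3, f4] at p2
  rw [hq, e3, f1, f4] at p3
  rw [hq, e4, f3, f2] at p4
  have h4 : PDvd p ((q * (q * (k1 * k2 - k3 * k4)) : ℤ) : ℚ) := by
    convert (((p1.int_mul (q * k2)).add (p2.int_mul (l1 * l2))).sub (p3.int_mul (q * k4))).sub
      (p4.int_mul (l1 * l4)) using 1
    push_cast; ring
  have := pdvd_intCast.2 (a.coprime_cancel (a.coprime_cancel (pdvd_intCast.1 h4) hgg) hgg)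
  exact_mod_cast this

theorem disc_rankOne (a : Adm p B M) (h1 : RankOne p B M) {g : V} (hg : g ∈ M) {D : ℤ}
    (hD : B g g = D) (hn : ¬ (p : ℤ) ∣ D) :
    ∃ d : ℤ_[p]ˣ, (d : ℤ_[p]) = D ∧
      IsUnimodularComponent p B M (fun i : Fin 1 => iota p ((fun _ => g) i)) d := by
  have := a.isUnimodularComponent (r := 1) (g := fun _ => g) (fun _ => hg)
    (G := Matrix.of fun _ _ => D) (fun _ _ => by rw [hD]; rfl) (by simpa using hn)
    (fun x hx y hy hgx hgy => ?_)
  · simpa using this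
  · obtain ⟨k, hk⟩ := a.integral x hx y hy
    have h2 := h1 x hx y hy g hg g hg
    obtain ⟨l, hl⟩ := a.integral g hg y hy
    have h3 := (hgx 0).int_mul l
    rw [← hl, mul_comm, a.symm g x] at h3
    have h4 : PDvd p ((D * k : ℤ) : ℚ) := by
      convert h2.add h3 using 1; rw [hk, hD]; push_cast; ring
    rw [hk, pdvd_intCast]
    exact a.coprime_cancel (pdvd_intCast.1 h4) hn

theorem disc_rankTwo (a : Adm p B M) {g y : V} (hg : g ∈ M) (hy : y ∈ M) {D : ℤ}
    (hD : B g g * B y y - B g y * B g y = D) (hn : ¬ (p : ℤ) ∣ D) :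
    ∃ d : ℤ_[p]ˣ, (d : ℤ_[p]) = D ∧ IsUnimodularDisc p B M d := by
  obtain ⟨q, hq⟩ := a.integral g hg g hg
  obtain ⟨l, hl⟩ := a.integral g hg y hy
  obtain ⟨r, hr⟩ := a.integral y hy y hy
  have hDi : q * r - l * l = D := by
    rw [hq, hl, hr] at hD; exact_mod_cast hD
  have hcomb : ∀ {s t : ℤ}, PDvd p (s * q + t * l) → PDvd p (s * l + t * r) →
      (p : ℤ) ∣ s ∧ (p : ℤ) ∣ t := by
    intro s t h1 h2
    constructor
    · refine a.coprime_cancel (a := D) ?_ hn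
      rw [← pdvd_intCast]
      convert (h1.int_mul r).sub (h2.int_mul l) using 1
      rw [← hDi]; push_cast; ring
    · refine a.coprime_cancel (a := D) ?_ hn
      rw [← pdvd_intCast]
      convert (h2.int_mul q).sub (h1.int_mul l) using 1
      rw [← hDi]; push_cast; ring
  have := a.isUnimodularComponent (r := 2) (g := ![g, y])
    (fun i => by fin_cases i; exacts [hg, hy]) (G := !![q, l; l, r])
    (fun i j => by
      fin_cases i <;> fin_cases j
      exacts [hq, hl, (a.symm y g).trans hl, hr])
    (by rw [Matrix.det_fin_two_of, hDi]; exact hn) (fun x hx z hz hgx hgz => ?_)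
  · obtain ⟨d, hd, h⟩ := this
    rw [Matrix.det_fin_two_of, hDi] at hd
    exact ⟨d, hd, _, _, h⟩
  · obtain ⟨e, he, hen⟩ := a.radical
    obtain ⟨c, hc, hs⟩ := a.exists_relation ![g, y, e, x] (by
      intro i; fin_cases i
      exacts [hg, hy, a.watson_le he, hx])
    rw [Fin.sum_univ_four] at hs
    simp only [Matrix.cons_val_zero, Matrix.cons_val_one, Matrix.cons_val] at hs
    have hkill : ∀ u ∈ M, PDvd p (B u x) → PDvd p (c 0 * B u g + c 1 * B u y) := by
      intro u hu hux
      have e1 := (a.mem_watson.1 (a.inMul_mem_watson hs)).2 u hu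
      have e2 := ((a.mem_watson.1 he).2 u hu).int_mul (c 2)
      rw [a.symm] at e1
      simp only [← Int.cast_smul_eq_zsmul ℚ, map_add, map_smul, smul_eq_mul, a.symm u e] at e1
      convert (e1.sub e2).sub (hux.int_mul (c 3)) using 1; ring
    have k1 := hkill g hg (hgx 0)
    have k2 := hkill y hy (hgx 1)
    rw [hq, hl] at k1
    rw [a.symm y g, hl, hr] at k2
    obtain ⟨⟨c0, e0⟩, c1, e1⟩ := hcomb k1 k2
    have h4 : InMul p M (c 0 • g) := ⟨c0 • g, M.smul_mem _ hg, by rw [e0, mul_smul]⟩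
    have h5 : InMul p M (c 1 • y) := ⟨c1 • y, M.smul_mem _ hy, by rw [e1, mul_smul]⟩
    have h6 : InMul p M (c 2 • e + c 3 • x) := by
      convert (hs.sub h4).sub h5 using 1; abel
    have h3 : ¬ (p : ℤ) ∣ c 3 := by
      rintro ⟨c3, e3⟩
      have h7 : InMul p M (c 3 • x) := ⟨c3 • x, M.smul_mem _ hx, by rw [e3, mul_smul]⟩
      have h8 : InMul p M (c 2 • e) := by convert h6.sub h7 using 1; abel
      have h9 : (p : ℤ) ∣ c 2 := by
        by_contra h9
        exact hen (inMul_of_smul a.prime h9 (a.watson_le he) h8)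
      obtain ⟨i, hi⟩ := hc
      fin_cases i
      exacts [hi ⟨c0, e0⟩, hi ⟨c1, e1⟩, hi h9, hi ⟨c3, e3⟩]
    have hxw : x ∈ TernaryLattice.watson B p M := by
      refine a.smul_mem_watson h3 hx ?_
      have := sub_mem (a.inMul_mem_watson h6) (Submodule.smul_mem _ (c 2) he)
      convert this using 1; abel
    exact (a.mem_watson.1 hxw).2 z hz

theorem exists_unimodularDisc (a : Adm p B M) : ∃ d, IsUnimodularDisc p B M d := by
  by_cases h1 : RankOne p B M
  · obtain ⟨g, hg, hgg⟩ := a.exists_not_pdvd_self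
    obtain ⟨D, hD⟩ := a.integral g hg g hg
    rw [hD, pdvd_intCast] at hgg
    obtain ⟨d, -, h⟩ := a.disc_rankOne h1 hg hD hgg
    exact ⟨d, _, _, h⟩
  · obtain ⟨g, hg, y, hy, hgy⟩ := a.exists_gram_not_pdvd h1
    obtain ⟨q, hq⟩ := a.integral g hg g hg
    obtain ⟨l, hl⟩ := a.integral g hg y hy
    obtain ⟨r, hr⟩ := a.integral y hy y hy
    have hD : B g g * B y y - B g y * B g y = (q * r - l * l : ℤ) := by
      rw [hq, hl, hr]; push_cast; ring
    rw [hD, pdvd_intCast] at hgy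
    obtain ⟨d, -, h⟩ := a.disc_rankTwo hg hy hD hgy
    exact ⟨d, h⟩

theorem unimodularRankEq_one_iff (a : Adm p B M) :
    UnimodularRankEq p B M 1 ↔ RankOne p B M := by
  refine ⟨fun h => ?_, fun h1 => ?_⟩
  · obtain ⟨b, d, ⟨G, hG, -⟩, J, hs, ho, hJ⟩ := h
    have hdec : ∀ x ∈ M, ∃ c : ℤ_[p], ∃ y ∈ J, iota p x = (c : ℚ_[p]) • b 0 + y := by
      intro x hx
      have := iota_mem (p := p) hx
      rw [← hs] at this
      obtain ⟨u, hu, y, hy, e⟩ := Submodule.mem_sup.1 this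
      obtain ⟨c, rfl⟩ := (Submodule.mem_span_range_iff_exists_fun ℤ_[p]).1 hu
      refine ⟨c 0, y, hy, ?_⟩
      rw [← e, Fin.sum_univ_one]; rfl
    intro x hx y hy z hz w hw
    obtain ⟨k, hk⟩ : ∃ k : ℤ, B x y * B z w - B x w * B z y = k := by
      obtain ⟨k1, e1⟩ := a.integral x hx y hy
      obtain ⟨k2, e2⟩ := a.integral z hz w hw
      obtain ⟨k3, e3⟩ := a.integral x hx w hw
      obtain ⟨k4, e4⟩ := a.integral z hz y hy
      exact ⟨k1 * k2 - k3 * k4, by rw [e1, e2, e3, e4]; push_cast; ring⟩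
    have hf : ∀ {x y} {c c' : ℤ_[p]} {j j'}, j ∈ J → j' ∈ J →
        iota p x = (c : ℚ_[p]) • b 0 + j → iota p y = (c' : ℚ_[p]) • b 0 + j' →
        ∃ m : ℤ_[p], ((B x y : ℚ) : ℚ_[p]) = c * c' * G 0 0 + p * m := by
      intro x y c c' j j' hj hj' e e'
      obtain ⟨m, hm⟩ := hJ j hj j' hj'
      refine ⟨m, ?_⟩
      rw [← localForm_iota (B := B), e, e']
      simp only [map_add, map_smul, LinearMap.add_apply, LinearMap.smul_apply, smul_eq_mul, hG,
        ho _ _ hj', localForm_symm a.toIsTernaryForm j (b 0), ho _ _ hj, hm]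
      ring
    obtain ⟨c1, j1, i1, e1⟩ := hdec x hx
    obtain ⟨c2, j2, i2, e2⟩ := hdec y hy
    obtain ⟨c3, j3, i3, e3⟩ := hdec z hz
    obtain ⟨c4, j4, i4, e4⟩ := hdec w hw
    obtain ⟨m1, f1⟩ := hf i1 i2 e1 e2
    obtain ⟨m2, f2⟩ := hf i3 i4 e3 e4
    obtain ⟨m3, f3⟩ := hf i1 i4 e1 e4
    obtain ⟨m4, f4⟩ := hf i3 i2 e3 e2
    rw [hk, pdvd_iff_norm, ← hk]
    push_cast
    rw [f1, f2, f3, f4]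
    have : ∀ t : ℤ_[p], ‖(p : ℚ_[p]) * t‖ < 1 := fun t => norm_p_mul_lt t.2
    convert this (c1 * c2 * G 0 0 * m2 + c3 * c4 * G 0 0 * m1 + p * m1 * m2 -
      c1 * c4 * G 0 0 * m4 - c3 * c2 * G 0 0 * m3 - p * m3 * m4) using 2
    push_cast; ring
  · obtain ⟨g, hg, hgg⟩ := a.exists_not_pdvd_self
    obtain ⟨D, hD⟩ := a.integral g hg g hg
    rw [hD, pdvd_intCast] at hgg
    obtain ⟨d, -, h⟩ := a.disc_rankOne h1 hg hD hgg
    exact ⟨_, d, h⟩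

end Adm

end

section

variable {V' : Type v} [AddCommGroup V'] [Module ℚ V'] {B' : LinearMap.BilinForm ℚ V'}
  {M' N' : Submodule ℤ V'} {p : ℕ} [Fact p.Prime]

/-! ### Special symmetries -/

omit [Fact p.Prime] in
theorem Adm.specSym_iff (a : Adm p B M) {x : V} (hx : IsPrimitiveVector (watson B p M) x)
    (hs : tau B x ∈ isometryGroup B M) :
    SpecSym p B M (tau B x) ↔ (InMul p M x ↔ RankOne p B M) := by
  have hM := a.toIsIntLattice
  have hN := isLattice_watson a.prime a.odd hM
  obtain ⟨c, hc, hy⟩ := hM.exists_primitive hx.ne_zero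
  have hsx : IsSym B M x := ⟨hx.ne_zero, hs⟩
  have h1 : SpecSym p B M (tau B x) ↔ Spec p B M (c • x) := by
    refine ⟨?_, fun h => ⟨_, hy, hsx.smul hc, (tau_smul hc).symm, h⟩⟩
    rintro ⟨z, hz, hsz, e, h⟩
    obtain ⟨r, hr, rfl⟩ := tau_eq_tau hM.toIsTernaryForm hsz.1 e
    rcases hM.primitive_unique hz hy (r := c * r⁻¹)
      (by rw [smul_smul, mul_assoc, inv_mul_cancel₀ hr, mul_one]) with e | e
    · rwa [e]
    · rw [e]; simpa [Spec] using h
  have h2 : InMul p M x ↔ c • x ∉ watson B p M := by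
    constructor
    · intro h3 h4
      rcases hN.primitive_unique hx (a.primitive_watson_of_mem hy h4) rfl with e | e
      · exact a.not_inMul_of_primitive hy (by rw [e]; exact h3)
      · exact a.not_inMul_of_primitive hy (by rw [e]; exact h3.neg)
    · intro h4
      rcases hN.primitive_unique hx (a.primitive_watson_of_not_mem hy h4) (r := p * c)
        (by rw [← Int.cast_smul_eq_zsmul ℚ, smul_smul]; simp) with e | e
      · exact ⟨_, hy.1, e.symm⟩
      · have : InMul p M (-x) := ⟨_, hy.1, e.symm⟩
        simpa using this.neg
  rw [h1, h2, Spec]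
  tauto

theorem Adm.isSpecial_iff (a : Adm p B M) {σ : V ≃ₗ[ℚ] V} (hσ : σ ∈ isometryGroup B M) :
    IsSpecial p B M σ ↔ SpecSym p B M σ := by
  have key : ∀ x, IsPrimitiveVector M x → IsSym B M x →
      (x ∈ watson B p M ↔ ∃ k : ℤ, B x x = (p : ℚ) * k) := fun x hx hs =>
    a.axis_mem_watson_iff a.two_not_dvd (a.toIsIntLattice.axisVec_of_sym hx hs)
  unfold IsSpecial
  rw [a.unimodularRankEq_one_iff]
  constructor
  · rintro ⟨c, ⟨x, hx, hs, rfl⟩, h⟩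
    have e := hs.eq_tau
    have hsx : IsSym B M x := ⟨hs.1, e ▸ hσ⟩
    refine ⟨x, hx, hsx, e, ?_⟩
    rwa [Spec, key x hx hsx]
  · rintro ⟨x, hx, hsx, rfl, h⟩
    refine ⟨_, ⟨x, hx, isSymmetryAlong_tau hsx.1, rfl⟩, ?_⟩
    rwa [Spec, key x hx hsx] at h

theorem norm_form_le_of {x : V} {C : ℝ} (h : ∀ v ∈ M, ‖((B x v : ℚ) : ℚ_[p])‖ ≤ C)
    {y : ℚ_[p] ⊗[ℚ] V} (hy : y ∈ localize p M) : ‖localForm p B (iota p x) y‖ ≤ C := by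
  refine localize_induction (P := fun y => ‖localForm p B (iota p x) y‖ ≤ C) (fun v hv => ?_)
    (fun a b ha hb => ?_) (fun c a ha => ?_) hy
  · rw [localForm_iota]; exact h v hv
  · rw [map_add]; exact (Padic.nonarchimedean _ _).trans (max_le ha hb)
  · rw [map_smul, smul_eq_mul, norm_mul]
    exact (mul_le_of_le_one_left (norm_nonneg _) c.2).trans ha

theorem root_norm (hp : p ≠ 2) {x : V} (hN : IsIntLattice B N) (hx : IsPrimitiveVector N x)
    (hs : tau B x ∈ isometryGroup B N) {y : ℚ_[p] ⊗[ℚ] V} (hy : y ∈ localize p N) :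
    ‖localForm p B (iota p x) y‖ ≤ ‖localForm p B (iota p x) (iota p x)‖ := by
  refine norm_form_le_of (fun v hv => ?_) hy
  obtain ⟨k, hk⟩ := hN.root_integral hx hs hv
  have h1 : (2 : ℚ_[p]) * localForm p B (iota p x) (iota p v) =
      k * localForm p B (iota p x) (iota p x) := by
    rw [localForm_iota, localForm_iota]; exact_mod_cast hk
  have h2 := congrArg norm h1
  rw [norm_mul, norm_mul, norm_two hp, one_mul, localForm_iota] at h2
  rw [h2]
  exact mul_le_of_le_one_left (norm_nonneg _) (Padic.norm_int_le_one k)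

namespace Corr

variable {χ : (ℚ_[p] ⊗[ℚ] V) ≃ₗ[ℚ_[p]] (ℚ_[p] ⊗[ℚ] V')} {L : Submodule ℤ V}
  {L' : Submodule ℤ V'} {x : V} {x' : V'}

theorem lattice (h : Corr p B L N B' L' N' χ) : IsIntLattice B N := by
  rw [← h.wat]; exact isLattice_watson h.adm.prime h.adm.odd h.adm.toIsIntLattice

/-- `χ` can be chosen compatible with a pair of symmetries of equal norm. -/
theorem adapt (h : Corr p B L N B' L' N' χ) (hx : IsPrimitiveVector N x)
    (hs : tau B x ∈ isometryGroup B N) (hx' : IsPrimitiveVector N' x')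
    (hs' : tau B' x' ∈ isometryGroup B' N') (hq : B' x' x' = B x x) :
    ∃ ψ, Corr p B L N B' L' N' ψ ∧ (ψ (iota p x) = iota p x' ∨ ψ (iota p x) = -iota p x') := by
  have hN := h.lattice
  have hN' := h.symm.lattice
  have e1 : localForm p B' (iota p x') (iota p x') =
      localForm p B' (χ (iota p x)) (χ (iota p x)) := by
    rw [h.iso.form, localForm_iota, localForm_iota, hq]
  obtain ⟨ψ, hψ, e⟩ := exists_locIso hN'.toIsTernaryForm h.adm.odd
    ((h.iso.mem _).2 (iota_mem hx.1)) (iota_mem hx'.1) e1 (by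
      rw [h.iso.form, localForm_iota]; exact_mod_cast hN.ne_zero hx.ne_zero)
    (fun y hy => by
      rw [← χ.apply_symm_apply y, h.iso.form, h.iso.form]
      exact root_norm h.adm.odd hN hx hs ((h.iso.symm.mem y).2 hy))
    (fun y hy => by
      rw [← e1]; exact root_norm h.adm.odd hN' hx' hs' hy)
  exact ⟨χ.trans ψ, ⟨h.adm, h.adm', h.wat, h.wat', h.loc, h.iso.trans hψ⟩, e⟩

theorem comm (h : Corr p B L N B' L' N' χ) (hx : x ≠ 0) (hx' : x' ≠ 0)
    (hχ : χ (iota p x) = iota p x' ∨ χ (iota p x) = -iota p x') (y : ℚ_[p] ⊗[ℚ] V) :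
    χ (bc p (tau B x) y) = bc p (tau B' x') (χ y) := by
  rw [bc_tau h.adm.toIsTernaryForm hx, bc_tau h.adm'.toIsTernaryForm hx', map_sub, map_smul,
    ← h.iso.form, ← h.iso.form]
  rcases hχ with e | e <;> rw [e]
  simp only [map_neg, LinearMap.neg_apply, neg_neg, mul_neg, neg_div, smul_neg, neg_smul]

theorem fix (h : Corr p B L N B' L' N' χ) (hx : x ≠ 0) (hx' : x' ≠ 0)
    (hs' : tau B' x' ∈ isometryGroup B' N')
    (hχ : χ (iota p x) = iota p x' ∨ χ (iota p x) = -iota p x') (hf : tau B x • M = M) :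
    tau B' x' • transport χ N' M = transport χ N' M := by
  have key : ∀ v ∈ transport χ N' M, tau B' x' v ∈ transport χ N' M := by
    rintro v ⟨h1, h2⟩
    refine ⟨by rw [← map_zsmul]; exact map_mem hs' h1, ?_⟩
    rw [← bc_iota, ← χ.apply_symm_apply (iota p v), ← h.comm hx hx' hχ, χ.symm_apply_apply]
    have := ((locIso_smul (p := p) (M := M) (tau_mem h.adm.toIsTernaryForm x)).mem
      (χ.symm (iota p v))).2 h2
    rwa [hf] at this
  exact (mem_isometryGroup_of (tau_mem h.adm'.toIsTernaryForm x') key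
    (by rw [tau_inv]; exact key)).2

theorem gamFix_ncard_le (h : Corr p B L N B' L' N' χ) (hx : x ≠ 0) (hx' : x' ≠ 0)
    (hs' : tau B' x' ∈ isometryGroup B' N')
    (hχ : χ (iota p x) = iota p x' ∨ χ (iota p x) = -iota p x') :
    (GamFix B p L N (tau B x)).ncard ≤ (GamFix B' p L' N' (tau B' x')).ncard :=
  Set.ncard_le_ncard_of_injOn (transport χ N')
    (fun _ hM => ⟨h.mem_gam hM.1, h.fix hx hx' hs' hχ hM.2⟩)
    (h.injOn.mono fun _ hM => hM.1) (h.adm'.isFam.finite.subset fun _ hM => hM.1)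

theorem inMul_iff (h : Corr p B L N B' L' N' χ) (hM : M ∈ Gam B p L N) (hx : x ∈ N) (hx' : x' ∈ N')
    (hχ : χ (iota p x) = iota p x' ∨ χ (iota p x) = -iota p x') :
    InMul p M x ↔ InMul p (transport χ N' M) x' := by
  rw [TernaryLattice.inMul_iff hM.1.1 (h.adm.isFam.le_lattice hM hx),
    TernaryLattice.inMul_iff (h.isLattice hM) (h.le_transport hM hx'), ← (h.locIso hM).mem,
    map_smul]
  rcases hχ with e | e <;> rw [e]
  rw [smul_neg, neg_mem_iff]

theorem specSym (h : Corr p B L N B' L' N' χ) (hM : M ∈ Gam B p L N) (hx : IsPrimitiveVector N x)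
    (hx' : IsPrimitiveVector N' x') (hs' : tau B' x' ∈ isometryGroup B' N')
    (hχ : χ (iota p x) = iota p x' ∨ χ (iota p x) = -iota p x') (hf : tau B x • M = M)
    (hsp : SpecSym p B M (tau B x)) : SpecSym p B' (transport χ N' M) (tau B' x') := by
  have hT := h.mem_gam hM
  have a := h.adm.of_gam hM
  have a' := h.adm'.of_gam hT
  have hf' := h.fix hx.ne_zero hx'.ne_zero hs' hχ hf
  rw [a.specSym_iff (hM.2.symm ▸ hx) ⟨tau_mem a.toIsTernaryForm x, hf⟩] at hsp
  rw [a'.specSym_iff (hT.2.symm ▸ hx') ⟨tau_mem a'.toIsTernaryForm x', hf'⟩,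
    ← h.inMul_iff hM hx.1 hx'.1 hχ, hsp]
  exact (h.locIso hM).rankOne_iff a.toIsIntLattice a'.toIsIntLattice

/-- Symmetries of `N` and `N'` of equal norm have equally many fixed points, and are special at the
same time. -/
theorem of_symNormEq (h : Corr p B L N B' L' N' χ) {σ : V ≃ₗ[ℚ] V} {σ' : V' ≃ₗ[ℚ] V'} {c : ℚ}
    (hσ : σ ∈ isometryGroup B N) (hσ' : σ' ∈ isometryGroup B' N') (hc : SymNormEq B N σ c)
    (hc' : SymNormEq B' N' σ' c) :
    (GamFix B p L N σ).ncard ≤ (GamFix B' p L' N' σ').ncard ∧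
      ((∃ M ∈ GamFix B p L N σ, IsSpecial p B M σ) →
        ∃ M ∈ GamFix B' p L' N' σ', IsSpecial p B' M σ') := by
  obtain ⟨x, hx, hs, rfl⟩ := hc
  obtain ⟨x', hx', hs', hq⟩ := hc'
  obtain rfl := hs.eq_tau
  obtain rfl := hs'.eq_tau
  obtain ⟨ψ, hψ, e⟩ := h.adapt hx hσ hx' hσ' hq
  refine ⟨hψ.gamFix_ncard_le hs.1 hs'.1 hσ' e, ?_⟩
  rintro ⟨M, ⟨hM, hf⟩, hsp⟩
  have hT := hψ.mem_gam hM
  have hf' := hψ.fix hs.1 hs'.1 hσ' e hf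
  rw [(h.adm.of_gam hM).isSpecial_iff ⟨hσ.1, hf⟩] at hsp
  exact ⟨_, ⟨hT, hf'⟩, ((h.adm'.of_gam hT).isSpecial_iff ⟨hσ'.1, hf'⟩).2
    (hψ.specSym hM hx hx' hσ' e hf hsp)⟩

end Corr

theorem SymNormEq.unique (hN : IsIntLattice B N) {σ : V ≃ₗ[ℚ] V} {c d : ℚ}
    (h : SymNormEq B N σ c) (h' : SymNormEq B N σ d) : c = d := by
  obtain ⟨x, hx, hs, rfl⟩ := h
  obtain ⟨y, hy, hs', rfl⟩ := h'
  obtain ⟨r, -, e⟩ := tau_eq_tau hN.toIsTernaryForm hs'.1 (hs.eq_tau.symm.trans hs'.eq_tau)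
  rcases hN.primitive_unique hx hy e with e | e <;> rw [e]
  simp

theorem exists_symNormEq (hN : IsIntLattice B N) {σ : V ≃ₗ[ℚ] V} (hσ : σ ∈ symmetries B N) :
    ∃ c, SymNormEq B N σ c := by
  obtain ⟨-, x, hx⟩ := hσ
  obtain ⟨c, hc, hp⟩ := hN.exists_primitive hx.1
  refine ⟨_, c • x, hp, ?_, rfl⟩
  rw [hx.eq_tau, ← tau_smul hc]
  exact isSymmetryAlong_tau hp.ne_zero

/-- Lattices with the same label have norm-preserving bijections between their symmetries. -/
theorem exists_equiv_of_label (hN : IsIntLattice B N) (hN' : IsIntLattice B' N')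
    (h : label B N = label B' N') : ∃ e : symmetries B N ≃ symmetries B' N',
      ∀ σ c, SymNormEq B N σ.1 c → SymNormEq B' N' (e σ).1 c := by
  have hfin := hN.finite_group
  have hfin' := hN'.finite_group
  have f1 : Finite (symmetries B N) :=
    Set.Finite.subset (Set.toFinite (isometryGroup B N : Set _)) fun _ h => h.1
  have f2 : Finite (symmetries B' N') :=
    Set.Finite.subset (Set.toFinite (isometryGroup B' N' : Set _)) fun _ h => h.1
  choose n hn using fun σ : symmetries B N => exists_symNormEq hN σ.2
  choose n' hn' using fun σ : symmetries B' N' => exists_symNormEq hN' σ.2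
  have hcard : ∀ c, Nat.card {σ // n σ = c} = Nat.card {σ // n' σ = c} := by
    intro c
    have h1 := congrFun (congrArg Prod.snd h) c
    have e1 : Nat.card {σ // n σ = c} = {σ | σ ∈ symmetries B N ∧ SymNormEq B N σ c}.ncard := by
      rw [← Nat.card_coe_set_eq]
      refine Nat.card_congr ((Equiv.subtypeEquivRight fun σ => ?_).trans
        (Equiv.subtypeSubtypeEquivSubtypeInter _ fun σ => SymNormEq B N σ c))
      exact ⟨fun e => e ▸ hn σ, fun h => (hn σ).unique hN h⟩
    have e2 : Nat.card {σ // n' σ = c} =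
        {σ | σ ∈ symmetries B' N' ∧ SymNormEq B' N' σ c}.ncard := by
      rw [← Nat.card_coe_set_eq]
      refine Nat.card_congr ((Equiv.subtypeEquivRight fun σ => ?_).trans
        (Equiv.subtypeSubtypeEquivSubtypeInter _ fun σ => SymNormEq B' N' σ c))
      exact ⟨fun e => e ▸ hn' σ, fun h => (hn' σ).unique hN' h⟩
    rw [e1, e2]
    exact h1
  refine ⟨Equiv.ofFiberEquiv fun c => (Finite.card_eq.1 (hcard c)).some, fun σ c hc => ?_⟩
  have h2 : n' (Equiv.ofFiberEquiv (fun c => (Finite.card_eq.1 (hcard c)).some) σ) = n σ :=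
    Equiv.ofFiberEquiv_map _ σ
  rw [hc.unique hN (hn σ), ← h2]
  exact hn' _

namespace Corr

variable {χ : (ℚ_[p] ⊗[ℚ] V) ≃ₗ[ℚ_[p]] (ℚ_[p] ⊗[ℚ] V')} {L : Submodule ℤ V}
  {L' : Submodule ℤ V'}

/-- The numbers `w`, `f`, `s` are determined by the label and the local structure. -/
theorem counts (h : Corr p B L N B' L' N' χ) (hl : label B N = label B' N') :
    wCount B p L N = wCount B' p L' N' ∧ fCount B p L N = fCount B' p L' N' ∧
      sCount B p L N = sCount B' p L' N' := by
  obtain ⟨e, he⟩ := exists_equiv_of_label h.lattice h.symm.lattice hl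
  have key : ∀ σ : symmetries B N, ∃ c, SymNormEq B N σ.1 c ∧ SymNormEq B' N' (e σ).1 c := by
    intro σ
    obtain ⟨c, hc⟩ := exists_symNormEq h.lattice σ.2
    exact ⟨c, hc, he σ c hc⟩
  refine ⟨le_antisymm h.ncard_le h.symm.ncard_le, ?_, ?_⟩
  · unfold fCount
    rw [← finsum_set_coe_eq_finsum_mem, ← finsum_set_coe_eq_finsum_mem]
    refine finsum_eq_of_bijective e e.bijective fun σ => ?_
    obtain ⟨c, h1, h2⟩ := key σ
    exact le_antisymm (h.of_symNormEq σ.2.1 (e σ).2.1 h1 h2).1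
      (h.symm.of_symNormEq (e σ).2.1 σ.2.1 h2 h1).1
  · unfold sCount
    rw [← Nat.card_coe_set_eq, ← Nat.card_coe_set_eq]
    refine Nat.card_congr (((Equiv.subtypeSubtypeEquivSubtypeInter _ _).symm.trans
      (Equiv.subtypeEquiv e fun σ => ?_)).trans (Equiv.subtypeSubtypeEquivSubtypeInter _ _))
    obtain ⟨c, h1, h2⟩ := key σ
    exact ⟨(h.of_symNormEq σ.2.1 (e σ).2.1 h1 h2).2, (h.symm.of_symNormEq (e σ).2.1 σ.2.1 h2 h1).2⟩

end Corr

end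

section

variable {p : ℕ} {f₁ f₂ f₃ : V} {L : Submodule ℤ V} {m : ℤ}

/-! ### Cubic lattices -/

/-- An orthogonal frame of primitive vectors of norm `(mp)²` of a cubic lattice, with `p ∤ m`. -/
structure IsCubicFrame (p : ℕ) (B : LinearMap.BilinForm ℚ V) (N : Submodule ℤ V) (f₁ f₂ f₃ : V)
    (m : ℤ) : Prop extends IsCubic B N f₁ f₂ f₃ where
  mem1 : f₁ ∈ N
  mem2 : f₂ ∈ N
  mem3 : f₃ ∈ N
  norm : B f₁ f₁ = (m * p : ℚ) ^ 2
  ndvd : ¬ (p : ℤ) ∣ m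
  root1 : ∀ v ∈ N, ∃ k : ℤ, 2 * B f₁ v = k * B f₁ f₁
  root2 : ∀ v ∈ N, ∃ k : ℤ, 2 * B f₂ v = k * B f₁ f₁
  root3 : ∀ v ∈ N, ∃ k : ℤ, 2 * B f₃ v = k * B f₁ f₁

theorem IsCubic.parseval (hB : IsTernaryForm B) (h : IsCubic B N f₁ f₂ f₃) (v w : V) :
    B f₁ f₁ * B v w = B f₁ v * B f₁ w + B f₂ v * B f₂ w + B f₃ v * B f₃ w := by
  have h0 := hB.ne_zero h.ne1
  have e := congrArg (fun z => B z w) (h.toIsFrame.expand hB v)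
  simp only [h.q2, h.q3, map_add, map_smul, LinearMap.add_apply, LinearMap.smul_apply,
    smul_eq_mul] at e
  rw [e]; field_simp

theorem IsCubic.gram_det (hB : IsTernaryForm B) (h : IsCubic B N f₁ f₂ f₃) (x y z : V) :
    B f₁ f₁ ^ 3 * (B x x * B y y * B z z + 2 * B x y * B y z * B x z - B x x * B y z ^ 2 -
      B y y * B x z ^ 2 - B z z * B x y ^ 2) =
    (B f₁ x * (B f₂ y * B f₃ z - B f₃ y * B f₂ z) - B f₂ x * (B f₁ y * B f₃ z - B f₃ y * B f₁ z) +
      B f₃ x * (B f₁ y * B f₂ z - B f₂ y * B f₁ z)) ^ 2 := by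
  have e := h.parseval hB
  calc _ = (B f₁ f₁ * B x x) * (B f₁ f₁ * B y y) * (B f₁ f₁ * B z z) +
        2 * (B f₁ f₁ * B x y) * (B f₁ f₁ * B y z) * (B f₁ f₁ * B x z) -
        (B f₁ f₁ * B x x) * (B f₁ f₁ * B y z) ^ 2 - (B f₁ f₁ * B y y) * (B f₁ f₁ * B x z) ^ 2 -
        (B f₁ f₁ * B z z) * (B f₁ f₁ * B x y) ^ 2 := by ring
    _ = _ := by simp only [e]; ring

theorem IsCubic.smul (h : IsCubic B N f₁ f₂ f₃) {c : ℚ} (hc : c ≠ 0) :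
    IsCubic B N (c • f₁) (c • f₂) (c • f₃) where
  ne1 := smul_ne_zero hc h.ne1
  ne2 := smul_ne_zero hc h.ne2
  ne3 := smul_ne_zero hc h.ne3
  h12 := by simp [h.h12]
  h13 := by simp [h.h13]
  h23 := by simp [h.h23]
  q2 := by simp [h.q2]
  q3 := by simp [h.q3]
  s1 := h.s1.smul hc
  s2 := h.s2.smul hc
  s3 := h.s3.smul hc
  s12 := by rw [← smul_sub]; exact h.s12.smul hc
  s23 := by rw [← smul_sub]; exact h.s23.smul hc

theorem even_of_sums {a b c : ℤ} (h1 : Even (a * a + b * b + c * c))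
    (h2 : Even (a * b + b * c + c * a)) : (2 : ℤ) ∣ a ∧ (2 : ℤ) ∣ b ∧ (2 : ℤ) ∣ c := by
  simp only [← even_iff_two_dvd]
  by_cases ha : Even a <;> by_cases hb : Even b <;> by_cases hc : Even c <;>
    simp_all [Int.even_add, Int.even_mul]

theorem IsCubic.even_coords (hN : IsIntLattice B N) (hc : IsCubic B N f₁ f₂ f₃) (hp : p.Prime)
    (hp2 : p ≠ 2) (hF : B f₁ f₁ = 2 * p ^ 2) : ∀ v ∈ N, ∀ k1 k2 k3 : ℤ,
      2 * B f₁ v = k1 * B f₁ f₁ → 2 * B f₂ v = k2 * B f₁ f₁ → 2 * B f₃ v = k3 * B f₁ f₁ →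
      (2 : ℤ) ∣ k1 ∧ (2 : ℤ) ∣ k2 ∧ (2 : ℤ) ∣ k3 := by
  intro v hv k1 k2 k3 e1 e2 e3
  have hB := hN.toIsTernaryForm
  have hodd : Odd (p : ℤ) := by exact_mod_cast hp.odd_of_ne_two hp2
  obtain ⟨e12, e21, e33⟩ := hc.swap12 hB
  obtain ⟨e23, e32, e11⟩ := (hc.rotate hB).swap12 hB
  have hσ := mul_mem hc.s23.2 hc.s12.2
  have h1 : tau B (f₂ - f₃) (tau B (f₁ - f₂) f₁) = f₃ := by rw [e12, e23]
  have h2 : tau B (f₂ - f₃) (tau B (f₁ - f₂) f₂) = f₁ := by rw [e21, e11]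
  have h3 : tau B (f₂ - f₃) (tau B (f₁ - f₂) f₃) = f₂ := by rw [e33, e32]
  have g2 := hσ.1 f₂ v
  have g3 := hσ.1 f₃ v
  have g1 := hσ.1 f₁ v
  rw [LinearEquiv.mul_apply] at g1 g2 g3
  rw [h1] at g1
  rw [h2] at g2
  rw [h3] at g3
  obtain ⟨q, hq⟩ := hN.integral v hv v hv
  obtain ⟨s, hs⟩ := hN.integral v hv _ (map_mem hσ hv)
  have p1 := hc.parseval hB v v
  have p2 := hc.parseval hB v ((tau B (f₂ - f₃) * tau B (f₁ - f₂)) v)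
  rw [g1, g2, g3, hs] at p2
  rw [hq] at p1
  rw [hF] at e1 e2 e3 p1 p2
  have hp0 : (p : ℚ) ≠ 0 := by exact_mod_cast hp.ne_zero
  have q1 : (2 * q : ℤ) = p ^ 2 * (k1 * k1 + k2 * k2 + k3 * k3) := by
    have : (8 * p ^ 2 : ℚ) * (2 * q) = 8 * p ^ 2 * (p ^ 2 * (k1 * k1 + k2 * k2 + k3 * k3)) := by
      linear_combination 8 * p1 + 2 * (2 * B f₁ v + k1 * (2 * p ^ 2)) * e1 +
        2 * (2 * B f₂ v + k2 * (2 * p ^ 2)) * e2 + 2 * (2 * B f₃ v + k3 * (2 * p ^ 2)) * e3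
    exact_mod_cast mul_left_cancel₀ (by positivity) this
  have q2 : (2 * s : ℤ) = p ^ 2 * (k1 * k2 + k2 * k3 + k3 * k1) := by
    have : (8 * p ^ 2 : ℚ) * (2 * s) = 8 * p ^ 2 * (p ^ 2 * (k1 * k2 + k2 * k3 + k3 * k1)) := by
      linear_combination 8 * p2 + (4 * B f₂ v) * e1 + (2 * k1 * (2 * p ^ 2)) * e2 +
        (4 * B f₃ v) * e2 + (2 * k2 * (2 * p ^ 2)) * e3 + (4 * B f₁ v) * e3 +
        (2 * k3 * (2 * p ^ 2)) * e1
    exact_mod_cast mul_left_cancel₀ (by positivity) this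
  exact even_of_sums
    ((Int.even_mul.1 (q1 ▸ even_two_mul q)).resolve_left (Int.not_even_iff_odd.2 hodd.pow))
    ((Int.even_mul.1 (q2 ▸ even_two_mul s)).resolve_left (Int.not_even_iff_odd.2 hodd.pow))

/-- The norm of the primitive axes of a cubic lattice `Λ_p(L)`, `L` primitive. -/
theorem IsPrimitiveTernary.exists_cubicFrame (hL : IsPrimitiveTernary B L) (a : Adm p B L)
    (ho : Nat.card (isometryGroup B (watson B p L)) = 48) :
    ∃ f₁ f₂ f₃ m, IsCubicFrame p B (watson B p L) f₁ f₂ f₃ m := by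
  have hN := isLattice_watson a.prime a.odd a.toIsIntLattice
  have hB := a.toIsTernaryForm
  obtain ⟨u₁, u₂, u₃, hu⟩ := hN.cubic_of_card ho
  obtain ⟨c, hc0, hprim⟩ := hN.exists_primitive hu.ne1
  have hc := hu.smul hc0
  generalize c • u₁ = f₁, c • u₂ = f₂, c • u₃ = f₃ at hc hprim
  obtain ⟨e12, e21, e33⟩ := hc.swap12 hB
  obtain ⟨e23, e32, e11⟩ := (hc.rotate hB).swap12 hB
  have hp2 : IsPrimitiveVector (watson B p L) f₂ := by
    have := hprim.map (tau B (f₁ - f₂)); rwa [hc.s12.2.2, e12] at this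
  have hp3 : IsPrimitiveVector (watson B p L) f₃ := by
    have := hp2.map (tau B (f₂ - f₃)); rwa [hc.s23.2.2, e23] at this
  have r1 : ∀ v ∈ watson B p L, ∃ k : ℤ, 2 * B f₁ v = k * B f₁ f₁ := fun v hv =>
    hN.root_integral hprim hc.s1.2 hv
  have r2 : ∀ v ∈ watson B p L, ∃ k : ℤ, 2 * B f₂ v = k * B f₁ f₁ := fun v hv => by
    rw [← hc.q2]; exact hN.root_integral hp2 hc.s2.2 hv
  have r3 : ∀ v ∈ watson B p L, ∃ k : ℤ, 2 * B f₃ v = k * B f₁ f₁ := fun v hv => by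
    rw [← hc.q3]; exact hN.root_integral hp3 hc.s3.2 hv
  obtain ⟨F, hF⟩ := hN.integral f₁ hprim.1 f₁ hprim.1
  have hF0 : F ≠ 0 := by
    have := hB.ne_zero hc.ne1
    rw [hF] at this; exact_mod_cast this
  have hF0' : (F : ℚ) ≠ 0 := by exact_mod_cast hF0
  have hpar := hc.parseval hB
  rw [hF] at r1 r2 r3 hpar
  have hpL : ∀ v ∈ L, (p : ℤ) • v ∈ watson B p L := fun v hv => a.inMul_mem_watson ⟨v, hv, rfl⟩
  have hBp : ∀ x y : V, B x ((p : ℤ) • y) = p * B x y := fun x y => by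
    rw [← Int.cast_smul_eq_zsmul ℚ, map_smul]; simp
  have hdvd : (p : ℤ) ∣ F := by
    rw [← pdvd_intCast, ← hF]
    exact (a.mem_watson.1 hprim.1).2 _ (a.watson_le hprim.1)
  have hF4 : F ∣ 4 * p ^ 2 := by
    refine hL.dvd fun x hx y hy => ?_
    obtain ⟨k1, e1⟩ := r1 _ (hpL x hx)
    obtain ⟨k2, e2⟩ := r2 _ (hpL x hx)
    obtain ⟨k3, e3⟩ := r3 _ (hpL x hx)
    obtain ⟨l1, g1⟩ := r1 _ (hpL y hy)
    obtain ⟨l2, g2⟩ := r2 _ (hpL y hy)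
    obtain ⟨l3, g3⟩ := r3 _ (hpL y hy)
    rw [hBp] at e1 e2 e3 g1 g2 g3
    refine ⟨k1 * l1 + k2 * l2 + k3 * l3, ?_⟩
    apply mul_left_cancel₀ hF0'
    push_cast
    linear_combination (4 * p ^ 2 : ℚ) * hpar x y + (2 * p * B f₁ y) * e1 + (k1 * F) * g1 +
      (2 * p * B f₂ y) * e2 + (k2 * F) * g2 + (2 * p * B f₃ y) * e3 + (k3 * F) * g3
  have hp4 : ¬ (p : ℤ) ∣ 4 := fun h4 =>
    a.two_not_dvd (a.coprime_cancel (a := 2) (b := 2) h4 a.two_not_dvd)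
  have hF1 : ¬ F ∣ 4 * p := by
    rintro ⟨k, hk⟩
    obtain ⟨x, hx, y, hy, hxy⟩ := a.ndeg
    refine hxy ((a.mem_watson.1 (a.smul_mem_watson hp4 hx ?_)).2 y hy)
    obtain ⟨k1, e1⟩ := (a.mem_watson.1 hprim.1).2 x hx
    obtain ⟨k2, e2⟩ := (a.mem_watson.1 hp2.1).2 x hx
    obtain ⟨k3, e3⟩ := (a.mem_watson.1 hp3.1).2 x hx
    have hk' : (4 * p : ℚ) = F * k := by exact_mod_cast hk
    have e : (4 : ℤ) • x = (k * k1) • f₁ + (k * k2) • f₂ + (k * k3) • f₃ := by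
      simp only [← Int.cast_smul_eq_zsmul ℚ]
      have hs : ∀ b j : ℚ, b = p * j → 4 * (b / F) = k * j := by
        rintro b j rfl
        field_simp
        linear_combination j * hk'
      have hx4 := congrArg (fun z => (4 : ℚ) • z) (hc.toIsFrame.expand hB x)
      simp only [hc.q2, hc.q3, hF, smul_add, smul_smul] at hx4
      rw [hs _ _ e1, hs _ _ e2, hs _ _ e3] at hx4
      push_cast
      exact hx4
    rw [e]
    exact add_mem (add_mem (Submodule.smul_mem _ _ hprim.1) (Submodule.smul_mem _ _ hp2.1))
      (Submodule.smul_mem _ _ hp3.1)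
  have hF2 : F ≠ 2 * p ^ 2 := by
    intro hF2
    have heven := hc.even_coords hN a.prime a.odd (by rw [hF, hF2]; push_cast; ring)
    rw [hF] at heven
    have : F ∣ p ^ 2 := by
      refine hL.dvd fun x hx y hy => ?_
      obtain ⟨k1, e1⟩ := r1 _ (hpL x hx)
      obtain ⟨k2, e2⟩ := r2 _ (hpL x hx)
      obtain ⟨k3, e3⟩ := r3 _ (hpL x hx)
      obtain ⟨l1, g1⟩ := r1 _ (hpL y hy)
      obtain ⟨l2, g2⟩ := r2 _ (hpL y hy)
      obtain ⟨l3, g3⟩ := r3 _ (hpL y hy)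
      obtain ⟨⟨k1, rfl⟩, ⟨k2, rfl⟩, k3, rfl⟩ := heven _ (hpL x hx) _ _ _ e1 e2 e3
      obtain ⟨⟨l1, rfl⟩, ⟨l2, rfl⟩, l3, rfl⟩ := heven _ (hpL y hy) _ _ _ g1 g2 g3
      rw [hBp] at e1 e2 e3 g1 g2 g3
      push_cast at e1 e2 e3 g1 g2 g3
      refine ⟨k1 * l1 + k2 * l2 + k3 * l3, ?_⟩
      apply mul_left_cancel₀ hF0'
      push_cast
      linear_combination (p ^ 2 : ℚ) * hpar x y + (p * B f₁ y / 2) * e1 + (k1 * F / 2) * g1 +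
        (p * B f₂ y / 2) * e2 + (k2 * F / 2) * g2 + (p * B f₃ y / 2) * e3 + (k3 * F / 2) * g3
    rw [hF2] at this
    have h1 := Int.le_of_dvd (by have := a.prime.pos; positivity) this
    have : (0 : ℤ) < p ^ 2 := by have := a.prime.pos; positivity
    linarith
  have hpz := a.prime_int.ne_zero
  have hpos : 0 < F := by
    have := hB.pos f₁ hc.ne1
    rw [hF] at this; exact_mod_cast this
  obtain ⟨F', rfl⟩ := hdvd
  have d1 : F' ∣ 4 * p := by
    obtain ⟨k, hk⟩ := hF4
    exact ⟨k, mul_left_cancel₀ hpz (by linear_combination hk)⟩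
  have d2 : (p : ℤ) ∣ F' := by
    by_contra h1
    have : IsCoprime F' (p : ℤ) := ((Prime.coprime_iff_not_dvd a.prime_int).2 h1).symm
    obtain ⟨k, hk⟩ := this.dvd_of_dvd_mul_right d1
    exact hF1 ⟨k, by rw [hk]; ring⟩
  obtain ⟨F'', rfl⟩ := d2
  have d3 : F'' ∣ 4 := by
    obtain ⟨k, hk⟩ := d1
    exact ⟨k, mul_left_cancel₀ hpz (by linear_combination hk)⟩
  have hpos' : 0 < F'' := by
    by_contra hneg
    have hpp : (0 : ℤ) < p := by exact_mod_cast a.prime.pos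
    nlinarith [mul_pos hpp hpp]
  have hle := Int.le_of_dvd (by norm_num) d3
  have hm : ∃ m : ℤ, ¬ (p : ℤ) ∣ m ∧ F'' = m ^ 2 := by
    interval_cases F''
    · exact ⟨1, fun h1 => a.prime_int.not_isUnit (isUnit_of_dvd_one h1), rfl⟩
    · exact absurd (by ring) hF2
    · norm_num at d3
    · exact ⟨2, a.two_not_dvd, rfl⟩
  obtain ⟨m, hm, rfl⟩ := hm
  rw [← hF] at r1 r2 r3
  exact ⟨f₁, f₂, f₃, m, hc, hprim.1, hp2.1, hp3.1, by rw [hF]; push_cast; ring, hm, r1, r2, r3⟩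

/-! ### Quadratic residues -/

variable [Fact p.Prime]

theorem legendre_intCast (n : ℤ) : legendre p (n : ℤ_[p]) = quadraticChar (ZMod p) (n : ZMod p) := by
  rw [legendre, map_intCast]

theorem legendre_mul (x y : ℤ_[p]) : legendre p (x * y) = legendre p x * legendre p y := by
  rw [legendre, map_mul, map_mul]; rfl

theorem intCast_ne_zero {n : ℤ} (hn : ¬ (p : ℤ) ∣ n) : (n : ZMod p) ≠ 0 := by
  rwa [Ne, ZMod.intCast_zmod_eq_zero_iff_dvd]

theorem quadraticChar_of_sq {n : ℤ} (hn : ¬ (p : ℤ) ∣ n) {s : ℚ} (h : (n : ℚ) = s ^ 2) :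
    quadraticChar (ZMod p) (n : ZMod p) = 1 := by
  obtain ⟨k, rfl⟩ := Rat.isSquare_intCast_iff.1 ⟨s, by rw [h, pow_two]⟩
  push_cast
  rw [← pow_two]
  exact quadraticChar_sq_one' (intCast_ne_zero fun h => hn (h.mul_left k))

/-- The norm of a special axis determines the discriminant of the unimodular component. -/
theorem IsCubicFrame.legendre_of_spec (hc : IsCubicFrame p B N f₁ f₂ f₃ m) (a : Adm p B M)
    {c : ℤ} (hcp : ¬ (p : ℤ) ∣ c) {e : V} (he : IsAxisVec c B M e) (hs : Spec p B M e) {t : ℤ}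
    (ht : ¬ (p : ℤ) ∣ t) {r : ℚ} (hQ : B e e = t * r ^ 2) {d : ℤ_[p]ˣ}
    (hd : IsUnimodularDisc p B M d) : legendre p (t * (d : ℤ_[p])) = 1 := by
  have hB := a.toIsTernaryForm
  have heM := he.primitive.1
  obtain ⟨Q, hQi⟩ := a.integral e heM e heM
  have hiff := a.axis_mem_watson_iff hcp he
  rw [hQi, pdvd_intCast] at hiff
  have hr0 : r ≠ 0 := by
    rintro rfl
    exact hB.ne_zero he.primitive.ne_zero (by rw [hQ]; ring)
  have hprime := a.prime_int
  rcases hs with ⟨h1, h2⟩ | ⟨h1, h2⟩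
  · rw [hiff] at h2
    obtain ⟨d', hd', hu⟩ := a.disc_rankOne h1 heM hQi h2
    rw [legendre_mul, hd.legendre_eq hB ⟨_, _, hu⟩, hd', ← legendre_mul, ← Int.cast_mul,
      legendre_intCast]
    refine quadraticChar_of_sq (s := t * r) (fun h3 => ?_) ?_
    · exact (hprime.dvd_or_dvd h3).elim ht h2
    · push_cast; rw [← hQi, hQ]; ring
  · rw [hiff] at h2
    obtain ⟨g, hg, y, hy, hgy⟩ := a.exists_gram_not_pdvd h1
    obtain ⟨q, hq⟩ := a.integral g hg g hg
    obtain ⟨l, hl⟩ := a.integral g hg y hy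
    obtain ⟨w, hw⟩ := a.integral y hy y hy
    have hD : B g g * B y y - B g y * B g y = (q * w - l * l : ℤ) := by
      rw [hq, hl, hw]; push_cast; ring
    rw [hD, pdvd_intCast] at hgy
    obtain ⟨d', hd', hu⟩ := a.disc_rankTwo hg hy hD hgy
    rw [legendre_mul, hd.legendre_eq hB hu, hd', ← legendre_mul, ← Int.cast_mul, legendre_intCast]
    obtain ⟨k, hk⟩ := he.coeff g hg
    obtain ⟨k', hk'⟩ := he.coeff y hy
    have hdet := hc.gram_det hB g y e
    set Δ := B f₁ g * (B f₂ y * B f₃ e - B f₃ y * B f₂ e) -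
      B f₂ g * (B f₁ y * B f₃ e - B f₃ y * B f₁ e) + B f₃ g * (B f₁ y * B f₂ e - B f₂ y * B f₁ e)
    have hm0 : (m * p : ℚ) ≠ 0 := fun h0 => hB.ne_zero hc.ne1 (by rw [hc.norm, h0]; ring)
    obtain ⟨μ, hμ⟩ : ∃ μ : ℚ, μ = m * p := ⟨_, rfl⟩
    rw [hc.norm, hq, hl, hw, hB.symm y e, hB.symm g e, ← hμ] at hdet
    rw [← hμ] at hm0
    rw [hQi] at hk hk' hQ hdet
    set n : ℤ := c ^ 2 * (q * w - l * l) - Q * (k ^ 2 * w - 2 * k * k' * l + k' ^ 2 * q)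
    have hQ0 : (Q : ℚ) ≠ 0 := by rw [← hQi]; exact hB.ne_zero he.primitive.ne_zero
    have hn : (t * n : ℚ) = (c * Δ / (μ ^ 3 * r)) ^ 2 := by
      rw [div_pow, mul_pow, ← hdet]
      field_simp
      simp only [n]
      push_cast
      have e1 : (Q : ℚ) * (c ^ 2 * (q * w - l * l) -
          Q * (k ^ 2 * w - 2 * k * k' * l + k' ^ 2 * q)) = c ^ 2 * (q * w * Q +
          2 * l * B e y * B e g - q * B e y ^ 2 - w * B e g ^ 2 - Q * l ^ 2) := by
        linear_combination (w * (c * B e g + k * Q) - 2 * l * (c * B e y)) * hk +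
          (q * (c * B e y + k' * Q) - 2 * l * k * Q) * hk'
      linear_combination e1 - (c ^ 2 * (q * w - l * l) -
          Q * (k ^ 2 * w - 2 * k * k' * l + k' ^ 2 * q) : ℚ) * hQ
    obtain ⟨Q', rfl⟩ := h2
    have hnc : ((n : ℤ) : ZMod p) = (c : ZMod p) ^ 2 * ((q * w - l * l : ℤ) : ZMod p) := by
      simp [n]
    have h3 := quadraticChar_of_sq (n := t * n) (p := p) (fun h3 => by
      have h4 := (hprime.dvd_or_dvd h3).resolve_left ht
      rw [← ZMod.intCast_zmod_eq_zero_iff_dvd, hnc] at h4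
      exact (mul_ne_zero (pow_ne_zero 2 (intCast_ne_zero hcp)) (intCast_ne_zero hgy)) h4)
      (by push_cast; exact hn)
    rw [Int.cast_mul, hnc, map_mul, map_mul, quadraticChar_sq_one' (intCast_ne_zero hcp), one_mul,
      ← map_mul, ← Int.cast_mul] at h3
    exact h3

end

section

variable {p : ℕ} {f₁ f₂ f₃ : V} {L : Submodule ℤ V} {m : ℤ} [Fact p.Prime]

theorem exists_sqrt (hp : p ≠ 2) {n : ℤ} (h : quadraticChar (ZMod p) (n : ZMod p) = 1) :
    ∃ s : ℤ_[p], s ^ 2 = n := by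
  have hn : (n : ZMod p) ≠ 0 := by
    rintro h0; rw [h0, MulChar.map_zero] at h; exact zero_ne_one h
  obtain ⟨b, hb⟩ := (quadraticChar_one_iff_isSquare hn).1 h
  obtain ⟨b, rfl⟩ := ZMod.intCast_surjective b
  have hb0 : ¬ (p : ℤ) ∣ b := by
    rw [← ZMod.intCast_zmod_eq_zero_iff_dvd]
    rintro h0; rw [h0, mul_zero] at hb; exact hn hb
  have hnb : ‖(b : ℤ_[p])‖ = 1 :=
    le_antisymm (PadicInt.norm_le_one _) (not_lt.1 fun h1 => hb0 (PadicInt.norm_intCast_lt_one_iff.1 h1))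
  have h2 : ‖(2 : ℤ_[p])‖ = 1 := by
    have := norm_two (p := p) hp
    rwa [PadicInt.norm_def]
  obtain ⟨z, hz, -⟩ := hensels_lemma (p := p)
    (F := Polynomial.X ^ 2 - Polynomial.C (n : ℤ_[p])) (a := (b : ℤ_[p])) (by
    have e1 : ‖((b ^ 2 - n : ℤ) : ℤ_[p])‖ < 1 := by
      rw [PadicInt.norm_intCast_lt_one_iff, ← ZMod.intCast_zmod_eq_zero_iff_dvd]
      push_cast; rw [hb]; ring
    push_cast at e1
    have h2' : ‖(1 + 1 : ℤ_[p])‖ = 1 := by rw [one_add_one_eq_two]; exact h2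
    simp [norm_mul, hnb, h2', e1])
  refine ⟨z, ?_⟩
  simp only [map_sub, map_pow, Polynomial.aeval_X, Polynomial.aeval_C] at hz
  exact sub_eq_zero.1 hz

/-- A vector of `Λ_p(L)` determining `L`, whose norm gives the discriminant of the unimodular
component of `L_p`. -/
theorem IsCubicFrame.exists_dual (hc : IsCubicFrame p B N f₁ f₂ f₃ m) (a : Adm p B L)
    (hN : watson B p L = N) {d : ℤ_[p]ˣ} (hd : IsUnimodularDisc p B L d) :
    ∃ w ∈ N, ∃ E : ℤ, B w w = p ^ 2 * E ∧ ¬ (p : ℤ) ∣ E ∧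
      quadraticChar (ZMod p) (E : ZMod p) = legendre p (d : ℤ_[p]) ∧
      (∀ v ∈ N, ∃ k : ℤ, 2 * B w v = p ^ 2 * k) ∧ (RankOne p B L → InMul p L w) ∧
      (¬ RankOne p B L → ∀ v ∈ L, ∃ k : ℤ, B w v = p ^ 2 * k) := by
  have hB := a.toIsTernaryForm
  have hmem : ∀ {x}, x ∈ N ↔ x ∈ L ∧ ∀ y ∈ L, PDvd p (B x y) := fun {x} => by
    rw [← hN]; exact a.mem_watson
  have hp0 : (p : ℚ) ≠ 0 := by exact_mod_cast a.prime.ne_zero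
  by_cases h1 : RankOne p B L
  · obtain ⟨g, hg, hgg⟩ := a.exists_not_pdvd_self
    obtain ⟨D, hD⟩ := a.integral g hg g hg
    rw [hD, pdvd_intCast] at hgg
    obtain ⟨d', hd', hu⟩ := a.disc_rankOne h1 hg hD hgg
    have hB1 : ∀ y, B ((p : ℤ) • g) y = p * B g y := fun y => by
      rw [← Int.cast_smul_eq_zsmul ℚ, map_smul]; simp
    refine ⟨(p : ℤ) • g, hN ▸ a.inMul_mem_watson ⟨g, hg, rfl⟩, D, ?_, hgg, ?_, fun v hv => ?_,
      fun _ => ⟨g, hg, rfl⟩, fun h => absurd h1 h⟩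
    · rw [hB1, hB.symm, hB1, hD]; ring
    · rw [hd.legendre_eq hB ⟨_, _, hu⟩, hd', legendre_intCast]
    · obtain ⟨k, hk⟩ := (hmem.1 hv).2 g hg
      exact ⟨2 * k, by rw [hB1, hB.symm, hk]; push_cast; ring⟩
  · obtain ⟨g, hg, y, hy, hgy⟩ := a.exists_gram_not_pdvd h1
    obtain ⟨q, hq⟩ := a.integral g hg g hg
    obtain ⟨l, hl⟩ := a.integral g hg y hy
    obtain ⟨r, hr⟩ := a.integral y hy y hy
    have hD : B g g * B y y - B g y * B g y = (q * r - l * l : ℤ) := by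
      rw [hq, hl, hr]; push_cast; ring
    rw [hD, pdvd_intCast] at hgy
    obtain ⟨d', hd', hu⟩ := a.disc_rankTwo hg hy hD hgy
    obtain ⟨a1, ea1⟩ := (hmem.1 hc.mem1).2 g hg
    obtain ⟨a2, ea2⟩ := (hmem.1 hc.mem2).2 g hg
    obtain ⟨a3, ea3⟩ := (hmem.1 hc.mem3).2 g hg
    obtain ⟨b1, eb1⟩ := (hmem.1 hc.mem1).2 y hy
    obtain ⟨b2, eb2⟩ := (hmem.1 hc.mem2).2 y hy
    obtain ⟨b3, eb3⟩ := (hmem.1 hc.mem3).2 y hy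
    have hmz : (m : ℚ) ≠ 0 := by
      rintro h0; exact hc.ndvd (by rw [show m = 0 by exact_mod_cast h0]; exact dvd_zero _)
    set c1 := a2 * b3 - a3 * b2
    set c2 := a3 * b1 - a1 * b3
    set c3 := a1 * b2 - a2 * b1
    have hBw : ∀ v, B (c1 • f₁ + c2 • f₂ + c3 • f₃) v = c1 * B f₁ v + c2 * B f₂ v + c3 * B f₃ v :=
      fun v => by simp [← Int.cast_smul_eq_zsmul ℚ]
    have hpar := hc.parseval hB
    have n2 := hc.norm
    have hgg : (m ^ 2 * q : ℚ) = a1 ^ 2 + a2 ^ 2 + a3 ^ 2 := by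
      have := hpar g g
      rw [n2, hq, ea1, ea2, ea3] at this
      apply mul_left_cancel₀ (pow_ne_zero 2 hp0); linear_combination this
    have hgl : (m ^ 2 * l : ℚ) = a1 * b1 + a2 * b2 + a3 * b3 := by
      have := hpar g y
      rw [n2, hl, ea1, ea2, ea3, eb1, eb2, eb3] at this
      apply mul_left_cancel₀ (pow_ne_zero 2 hp0); linear_combination this
    have hyy : (m ^ 2 * r : ℚ) = b1 ^ 2 + b2 ^ 2 + b3 ^ 2 := by
      have := hpar y y
      rw [n2, hr, eb1, eb2, eb3] at this
      apply mul_left_cancel₀ (pow_ne_zero 2 hp0); linear_combination this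
    have hE : ¬ (p : ℤ) ∣ m ^ 6 * (q * r - l * l) := fun h =>
      hgy (a.coprime_cancel h fun h => hc.ndvd (a.prime_int.dvd_of_dvd_pow h))
    refine ⟨c1 • f₁ + c2 • f₂ + c3 • f₃, add_mem (add_mem (N.smul_mem _ hc.mem1)
      (N.smul_mem _ hc.mem2)) (N.smul_mem _ hc.mem3), m ^ 6 * (q * r - l * l), ?_, hE, ?_,
      fun v hv => ?_, fun h => absurd h h1, fun _ v hv => ?_⟩
    · have h21 : B f₂ f₁ = 0 := by rw [hB.symm, hc.h12]
      have h31 : B f₃ f₁ = 0 := by rw [hB.symm, hc.h13]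
      have h32 : B f₃ f₂ = 0 := by rw [hB.symm, hc.h23]
      rw [hBw, hB.symm f₁, hB.symm f₂, hB.symm f₃, hBw, hBw, hBw, hc.q2, hc.q3, hc.h12, hc.h13,
        hc.h23, h21, h31, h32, n2]
      simp only [c1, c2, c3]
      push_cast
      linear_combination (-(m ^ 2 * p ^ 2) : ℚ) * ((m ^ 2 * q) * hyy +
        (b1 ^ 2 + b2 ^ 2 + b3 ^ 2) * hgg - (m ^ 2 * l + (a1 * b1 + a2 * b2 + a3 * b3)) * hgl)
    · have : ((m ^ 6 * (q * r - l * l) : ℤ) : ZMod p) =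
          ((m ^ 3 : ℤ) : ZMod p) ^ 2 * ((q * r - l * l : ℤ) : ZMod p) := by push_cast; ring
      rw [this, map_mul, quadraticChar_sq_one' (intCast_ne_zero fun h =>
        hc.ndvd (a.prime_int.dvd_of_dvd_pow h)), one_mul, hd.legendre_eq hB hu, hd',
        legendre_intCast]
    · obtain ⟨k1, e1⟩ := hc.root1 v hv
      obtain ⟨k2, e2⟩ := hc.root2 v hv
      obtain ⟨k3, e3⟩ := hc.root3 v hv
      rw [n2] at e1 e2 e3
      refine ⟨m ^ 2 * (c1 * k1 + c2 * k2 + c3 * k3), ?_⟩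
      rw [hBw]; push_cast
      linear_combination (c1 : ℚ) * e1 + (c2 : ℚ) * e2 + (c3 : ℚ) * e3
    · obtain ⟨v1, e1⟩ := (hmem.1 hc.mem1).2 v hv
      obtain ⟨v2, e2⟩ := (hmem.1 hc.mem2).2 v hv
      obtain ⟨v3, e3⟩ := (hmem.1 hc.mem3).2 v hv
      set δ : ℤ := c1 * v1 + c2 * v2 + c3 * v3
      have hΔ := hc.gram_det hB g y v
      obtain ⟨x1, i1⟩ := a.integral v hv v hv
      obtain ⟨x2, i2⟩ := a.integral g hg v hv
      obtain ⟨x3, i3⟩ := a.integral y hy v hv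
      have hδ : (m ^ 6 * (q * r * x1 + 2 * l * x3 * x2 - q * x3 ^ 2 - r * x2 ^ 2 - x1 * l ^ 2) : ℤ)
          = δ ^ 2 := by
        rw [n2, hq, hl, hr, i1, i2, i3, ea1, ea2, ea3, eb1, eb2, eb3, e1, e2, e3] at hΔ
        have : (p ^ 6 : ℚ) * (m ^ 6 * (q * r * x1 + 2 * l * x3 * x2 - q * x3 ^ 2 - r * x2 ^ 2 -
            x1 * l ^ 2)) = p ^ 6 * δ ^ 2 := by
          simp only [δ, c1, c2, c3]
          push_cast
          linear_combination hΔ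
        exact_mod_cast mul_left_cancel₀ (pow_ne_zero 6 hp0) this
      obtain ⟨e, he, hen⟩ := a.radical
      obtain ⟨c, hcn, hs⟩ := a.exists_relation ![g, y, v, e] (by
        intro i; fin_cases i
        exacts [hg, hy, hv, a.watson_le he])
      rw [Fin.sum_univ_four] at hs
      simp only [Matrix.cons_val_zero, Matrix.cons_val_one, Matrix.cons_val] at hs
      have hkill : ∀ u ∈ L, PDvd p (c 0 * B g u + c 1 * B y u + c 2 * B v u) := by
        intro u hu
        have j1 := (a.mem_watson.1 (a.inMul_mem_watson hs)).2 u hu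
        have j2 := ((a.mem_watson.1 he).2 u hu).int_mul (c 3)
        simp only [← Int.cast_smul_eq_zsmul ℚ, map_add, map_smul, LinearMap.add_apply,
          LinearMap.smul_apply, smul_eq_mul] at j1
        convert j1.sub j2 using 1; ring
      have k1 := hkill g hg
      have k2 := hkill y hy
      have k3 := hkill v hv
      rw [hB.symm y g, hB.symm v g, hq, hl, i2] at k1
      rw [hB.symm v y, hl, hr, i3] at k2
      rw [i2, i3, i1] at k3
      have hpδ : (p : ℤ) ∣ δ := by
        suffices (p : ℤ) ∣ q * r * x1 + 2 * l * x3 * x2 - q * x3 ^ 2 - r * x2 ^ 2 - x1 * l ^ 2 from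
          a.prime_int.dvd_of_dvd_pow (n := 2) (by rw [← hδ]; exact this.mul_left _)
        have hcr : ∀ i : Fin 4, i ≠ 3 → (p : ℤ) ∣ c i *
            (q * r * x1 + 2 * l * x3 * x2 - q * x3 ^ 2 - r * x2 ^ 2 - x1 * l ^ 2) := by
          intro i hi
          rw [← pdvd_intCast]
          fin_cases i
          · convert ((k1.int_mul (r * x1 - x3 ^ 2)).add (k2.int_mul (x2 * x3 - l * x1))).add
              (k3.int_mul (l * x3 - x2 * r)) using 1
            push_cast; ring_nf
          · convert ((k1.int_mul (x2 * x3 - l * x1)).add (k2.int_mul (q * x1 - x2 ^ 2))).add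
              (k3.int_mul (l * x2 - q * x3)) using 1
            push_cast; ring_nf
          · convert ((k1.int_mul (l * x3 - x2 * r)).add (k2.int_mul (l * x2 - q * x3))).add
              (k3.int_mul (q * r - l ^ 2)) using 1
            push_cast; ring_nf
          · exact absurd rfl hi
        by_contra hne
        have hz : ∀ i : Fin 4, i ≠ 3 → (p : ℤ) ∣ c i := fun i hi =>
          (a.prime_int.dvd_or_dvd (hcr i hi)).resolve_right hne
        have hmul : ∀ {i : Fin 4} {x : V}, (p : ℤ) ∣ c i → x ∈ L → InMul p L (c i • x) := by
          rintro i x ⟨j, hj⟩ hx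
          exact ⟨j • x, L.smul_mem _ hx, by rw [hj, mul_smul]⟩
        have h3 : ¬ (p : ℤ) ∣ c 3 := by
          obtain ⟨i, hi⟩ := hcn
          by_cases hi3 : i = 3
          · rwa [← hi3]
          · exact absurd (hz i hi3) hi
        refine hen (inMul_of_smul a.prime h3 (a.watson_le he) ?_)
        convert ((hs.sub (hmul (hz 0 (by decide)) hg)).sub (hmul (hz 1 (by decide)) hy)).sub
          (hmul (hz 2 (by decide)) hv) using 1
        abel
      obtain ⟨k, hk⟩ := hpδ
      refine ⟨k, ?_⟩
      have hk' : (δ : ℚ) = p * k := by exact_mod_cast hk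
      rw [hBw, e1, e2, e3]
      simp only [δ] at hk'
      push_cast at hk'
      linear_combination (p : ℚ) * hk'

end

section

variable {p : ℕ} {f₁ f₂ f₃ : V} {L : Submodule ℤ V} {m : ℤ} [Fact p.Prime]

theorem norm_le_of_two_mul (hp : p ≠ 2) {x C : ℚ} {k : ℤ} (h : 2 * x = k * C) :
    ‖(x : ℚ_[p])‖ ≤ ‖(C : ℚ_[p])‖ := by
  have h1 : (2 : ℚ_[p]) * x = k * C := by exact_mod_cast h
  have h2 := congrArg norm h1
  rw [norm_mul, norm_mul, norm_two hp, one_mul] at h2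
  rw [h2]
  exact mul_le_of_le_one_left (norm_nonneg _) (Padic.norm_int_le_one k)

theorem norm_intCast_eq_one {k : ℤ} (h : ¬ (p : ℤ) ∣ k) : ‖(k : ℚ_[p])‖ = 1 :=
  le_antisymm (Padic.norm_int_le_one k) (not_lt.1 fun h1 => h (Padic.norm_intCast_lt_one_iff.1 h1))

/-- If `t d` is a square modulo `p`, some lattice in `Γ_p^L(N)` is stable under all isometries of
`N` fixing a given root `u` of `N` with `Q(u) = t (mp)²`. -/
theorem IsCubicFrame.exists_stable (hc : IsCubicFrame p B N f₁ f₂ f₃ m) (a : Adm p B L)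
    (hN : watson B p L = N) {d : ℤ_[p]ˣ} (hd : IsUnimodularDisc p B L d) {u : V} (hu : u ∈ N)
    {t : ℤ} (ht : ¬ (p : ℤ) ∣ t) (hq : B u u = t * (m * p) ^ 2)
    (hroot : ∀ v ∈ N, ∃ k : ℤ, 2 * B u v = k * B f₁ f₁)
    (hl : legendre p (t * (d : ℤ_[p])) = 1) :
    ∃ M ∈ Gam B p L N, ∀ g ∈ isometryGroup B N, g u = u → g ∈ isometryGroup B M := by
  have hB := a.toIsTernaryForm
  have hpr := a.prime_int
  have hp0 : (p : ℚ) ≠ 0 := by exact_mod_cast a.prime.ne_zero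
  have hm0 : (m : ℚ) ≠ 0 := by
    intro h; exact hc.ndvd (by rw [Int.cast_eq_zero.1 h]; exact dvd_zero _)
  have ht0 : (t : ℚ) ≠ 0 := by
    intro h; exact ht (by rw [Int.cast_eq_zero.1 h]; exact dvd_zero _)
  have hQ0 : B u u ≠ 0 := by rw [hq]; positivity
  have hu0 : u ≠ 0 := by rintro rfl; simp at hQ0
  have htm : ¬ (p : ℤ) ∣ t * m ^ 2 := fun h =>
    (hpr.dvd_or_dvd h).elim ht fun h => hc.ndvd (hpr.dvd_of_dvd_pow h)
  obtain ⟨w, hw, E, hwE, hE, hEd, hwN, hw1, hw2⟩ := hc.exists_dual a hN hd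
  obtain ⟨s, hs⟩ := exists_sqrt (n := E * (t * m ^ 2)) a.odd (by
    rw [legendre_mul, legendre_intCast] at hl
    push_cast
    rw [map_mul, map_mul, quadraticChar_sq_one' (intCast_ne_zero hc.ndvd), mul_one, hEd, mul_comm]
    exact hl)
  have hE1 := norm_intCast_eq_one hE
  have hE0 : (E : ℚ_[p]) ≠ 0 := norm_ne_zero_iff.1 (by rw [hE1]; exact one_ne_zero)
  set γ : ℚ_[p] := (s : ℚ_[p]) / E with hγ
  have hγ1 : ‖γ‖ ≤ 1 := by rw [hγ, norm_div, hE1, div_one]; exact s.2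
  have hγ2 : γ ^ 2 * E = t * m ^ 2 := by
    have := congrArg (fun z : ℤ_[p] => (z : ℚ_[p])) hs
    push_cast at this
    rw [hγ, div_pow, this]; field_simp
  have hP : ∀ {x : ℚ_[p]}, ‖x‖ ≤ 1 → ‖x * ((p : ℚ) ^ 2 : ℚ)‖ ≤ ‖(((p : ℚ) ^ 2 : ℚ) : ℚ_[p])‖ :=
    fun hx => by rw [norm_mul]; exact mul_le_of_le_one_left (norm_nonneg _) hx
  have e1 : localForm p B (γ • iota p w) (γ • iota p w) =
      ((t * m ^ 2 : ℤ) : ℚ_[p]) * ((p : ℚ) ^ 2 : ℚ) := by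
    simp only [map_smul, LinearMap.smul_apply, smul_eq_mul, localForm_iota, hwE]
    push_cast
    linear_combination (p : ℚ_[p]) ^ 2 * hγ2
  have e2 : localForm p B (iota p u) (iota p u) =
      localForm p B (γ • iota p w) (γ • iota p w) := by
    rw [e1, localForm_iota, hq]; push_cast; ring
  have e3 : ‖localForm p B (γ • iota p w) (γ • iota p w)‖ = ‖(((p : ℚ) ^ 2 : ℚ) : ℚ_[p])‖ := by
    rw [e1, norm_mul, norm_intCast_eq_one htm, one_mul]
  have hwnorm : ∀ {K : Submodule ℤ V}, (∀ v ∈ K, ∃ k : ℤ, 2 * B w v = p ^ 2 * k) →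
      ∀ y ∈ localize p K, ‖localForm p B (γ • iota p w) y‖ ≤ ‖(((p : ℚ) ^ 2 : ℚ) : ℚ_[p])‖ := by
    intro K hK y hy
    rw [map_smul, LinearMap.smul_apply, smul_eq_mul, norm_mul]
    refine (mul_le_of_le_one_left (norm_nonneg _) hγ1).trans (norm_form_le_of (fun v hv => ?_) hy)
    obtain ⟨k, hk⟩ := hK v hv
    exact norm_le_of_two_mul a.odd (k := k) (by rw [hk, mul_comm])
  obtain ⟨χ, hχ, hχw⟩ := exists_locIso (x := γ • iota p w) (x' := iota p u) hB a.odd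
    (norm_smul_mem hγ1 (iota_mem hw)) (iota_mem hu) e2
    (by rw [← e2, localForm_iota]; exact_mod_cast hQ0)
    (fun y hy => by rw [e3]; exact hwnorm hwN y hy)
    (fun y hy => by
      rw [e3]
      refine norm_form_le_of (fun v hv => ?_) hy
      obtain ⟨k, hk⟩ := hroot v hv
      exact norm_le_of_two_mul a.odd (k := k * m ^ 2) (by
        rw [hk, hc.norm]; push_cast; ring))
  have hcorr : Corr p B L N B L N χ := ⟨a, a, hN, hN, LocallyIsometric.refl, hχ⟩
  have hfam := a.isFam (N := N)
  have hL : L ∈ Gam B p L N := hN ▸ a.self_mem_gam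
  have hM := hcorr.mem_gam hL
  have hiso := hcorr.locIso hL
  generalize transport χ N L = M at hM hiso
  have aM := hfam.adm M hM
  have hrank := hfam.rank L hL M hM
  have huM := hfam.le_lattice hM hu
  obtain ⟨r, hr, pe⟩ := aM.toIsIntLattice.exists_primitive hu0
  have hue : u = r⁻¹ • r • u := (inv_smul_smul₀ hr u).symm
  obtain ⟨k, hk⟩ := aM.toIsIntLattice.primitive_dvd pe huM hue
  generalize hre : r • u = e at pe hue
  rw [hk] at hue
  obtain ⟨q, hqe⟩ := aM.integral e pe.1 e pe.1
  have hBu : ∀ v, B u v = k * B e v := fun v => by rw [hue]; simp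
  have hkq : k ^ 2 * q = t * (m * p) ^ 2 := by
    have : B u u = k * (k * B e e) := by rw [hBu, hB.symm, hBu]
    rw [hq, hqe] at this
    exact_mod_cast (by linear_combination -this : (k : ℚ) ^ 2 * q = t * (m * p) ^ 2)
  have hk0 : (k : ℚ) ≠ 0 := by
    intro h; rw [h, zero_smul] at hue; exact hu0 hue
  have hpk : (p : ℤ) ∣ k → ¬ (p : ℤ) ∣ q := by
    rintro ⟨k', rfl⟩ h
    have : k' ^ 2 * q = t * m ^ 2 := by
      have h2 : (p : ℤ) ^ 2 ≠ 0 := pow_ne_zero 2 hpr.ne_zero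
      exact mul_left_cancel₀ h2 (by linear_combination hkq)
    exact htm (this ▸ h.mul_left _)
  have haxis : (∀ v ∈ M, ∃ k₁ : ℤ, 2 * B u (p • v) = k₁ * B f₁ f₁ ∧ (p : ℤ) ∣ k₁ * k) →
      IsAxisVec (2 * t) B M e := by
    refine fun h => ⟨pe, fun v hv => ?_⟩
    obtain ⟨k₁, h1, k₂, h2⟩ := h v hv
    refine ⟨k₂, ?_⟩
    have h3 : (k₁ * k : ℚ) = p * k₂ := by exact_mod_cast h2
    have h4 : (k ^ 2 * q : ℚ) = t * (m * p) ^ 2 := by exact_mod_cast hkq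
    rw [hBu, ← Nat.cast_smul_eq_nsmul ℚ, map_smul, smul_eq_mul, hc.norm] at h1
    apply mul_left_cancel₀ (mul_ne_zero hk0 hp0)
    rw [hqe]; push_cast
    linear_combination (t : ℚ) * h1 - k₁ * h4 + k * q * h3
  have hpv : ∀ v ∈ M, ∃ k₁ : ℤ, 2 * B u (p • v) = k₁ * B f₁ f₁ := fun v hv =>
    hroot _ (by have := hfam.smul_mem hM hv; rwa [natCast_zsmul] at this)
  have hfin : IsAxisVec (2 * t) B M e ∧ Spec p B M e := by
    by_cases h1 : RankOne p B L
    · have h2 : InMul p M u := by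
        rw [inMul_iff hM.1.1 huM]
        have h3 := (hiso.mem _).2 (norm_smul_mem hγ1
          ((inMul_iff (p := p) hL.1.1 (hfam.le_lattice hL hw)).1 (hw1 h1)))
        rw [smul_comm, map_smul] at h3
        rcases hχw with e | e
        · rwa [e] at h3
        · rw [e, smul_neg] at h3; simpa using neg_mem h3
      have hpk' : (p : ℤ) ∣ k := by
        obtain ⟨v, hv, hv'⟩ := h2
        obtain ⟨k', h3⟩ := aM.toIsIntLattice.primitive_dvd pe hv (r := (p : ℚ)⁻¹ * k) (by
          rw [mul_smul, ← hue, hv', ← Int.cast_smul_eq_zsmul ℚ, Int.cast_natCast,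
            inv_smul_smul₀ hp0])
        refine ⟨k', ?_⟩
        rw [inv_mul_eq_iff_eq_mul₀ hp0] at h3
        exact_mod_cast h3
      refine ⟨haxis fun v hv => ?_, Or.inl ⟨hrank.1 h1, fun h => ?_⟩⟩
      · obtain ⟨k₁, h3⟩ := hpv v hv
        exact ⟨k₁, h3, hpk'.mul_left _⟩
      · have := (aM.mem_watson.1 h).2 e pe.1
        rw [hqe, pdvd_intCast] at this
        exact hpk hpk' this
    · have h2 : ∀ v ∈ M, ∃ j : ℤ, B u v = p ^ 2 * j := by
        intro v hv
        obtain ⟨j, hj⟩ := aM.integral u huM v hv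
        have hz := hiso.symm.mem (iota p v) |>.2 (iota_mem hv)
        have h3 := hwnorm (fun v hv => by
          obtain ⟨k, hk⟩ := hw2 h1 v hv
          exact ⟨2 * k, by rw [hk]; push_cast; ring⟩) _ hz
        rw [← hiso.form, χ.apply_symm_apply] at h3
        have h4 : ‖localForm p B (iota p u) (iota p v)‖ ≤ ‖(((p : ℚ) ^ 2 : ℚ) : ℚ_[p])‖ := by
          rcases hχw with e | e
          · rwa [e] at h3
          · rwa [e, map_neg, LinearMap.neg_apply, norm_neg] at h3
        rw [localForm_iota, hj, Rat.cast_intCast] at h4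
        push_cast at h4
        rw [Padic.norm_p_pow, Padic.norm_int_le_pow_iff_dvd] at h4
        obtain ⟨i, rfl⟩ := h4
        exact ⟨i, by rw [hj]; push_cast; ring⟩
      have he : e ∈ watson B p M := by
        have hint : ∀ v ∈ M, ∃ b : ℤ, B e v = b ∧ (p : ℤ) ^ 2 ∣ k * b := by
          intro v hv
          obtain ⟨b, hb⟩ := aM.integral e pe.1 v hv
          obtain ⟨j, hj⟩ := h2 v hv
          rw [hBu, hb] at hj
          exact ⟨b, hb, j, by exact_mod_cast hj⟩
        by_cases h3 : (p : ℤ) ∣ k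
        · obtain ⟨b, hb, h4⟩ := hint e pe.1
          rw [hqe, Int.cast_inj] at hb
          subst hb
          have hpq := hpk h3
          have h5 : (p : ℤ) ^ 2 ∣ k :=
            (IsCoprime.pow_left ((Prime.coprime_iff_not_dvd hpr).2 hpq)).dvd_of_dvd_mul_right h4
          obtain ⟨k', rfl⟩ := h5
          refine absurd (?_ : (p : ℤ) ∣ t * m ^ 2) htm
          refine ⟨p * k' ^ 2 * q, mul_left_cancel₀ (pow_ne_zero 2 hpr.ne_zero) ?_⟩
          linear_combination -hkq
        · refine aM.mem_watson.2 ⟨pe.1, fun v hv => ?_⟩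
          obtain ⟨b, hb, h4⟩ := hint v hv
          rw [hb, pdvd_intCast]
          exact aM.coprime_cancel ((dvd_pow_self _ two_ne_zero).trans h4) h3
      refine ⟨haxis fun v hv => ?_, Or.inr ⟨fun h => h1 (hrank.2 h), he⟩⟩
      obtain ⟨k₁, h3⟩ := hpv v hv
      refine ⟨k₁, h3, ?_⟩
      obtain ⟨j, hj⟩ := h2 v hv
      rw [← Nat.cast_smul_eq_nsmul ℚ, map_smul, smul_eq_mul, hj, hc.norm] at h3
      have h4 : 2 * p * j = m ^ 2 * k₁ := by
        have h5 : (p : ℚ) ^ 2 * (2 * p * j) = p ^ 2 * (m ^ 2 * k₁) := by linear_combination h3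
        exact_mod_cast mul_left_cancel₀ (pow_ne_zero 2 hp0) h5
      exact (aM.coprime_cancel (a := m ^ 2) ⟨2 * j, by rw [← h4]; ring⟩
        fun h => hc.ndvd (hpr.dvd_of_dvd_pow h)).mul_right _
  refine ⟨M, hM, fun g hg hgu => ⟨hg.1, (hfam.eq_of_spec hM (hfam.stable g hg M hM) (c := 2 * t)
    (fun h => (hpr.dvd_or_dvd h).elim a.two_not_dvd ht) hfin.1 (hfin.1.map hg.1)
    ⟨1, ?_⟩ hfin.2 ((spec_smul hg.1).2 hfin.2)).symm⟩⟩
  rw [one_smul, ← hre, map_smul, hgu]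

theorem IsCubicFrame.legendre_of_axis (hc : IsCubicFrame p B N f₁ f₂ f₃ m) (a : Adm p B L)
    {d : ℤ_[p]ˣ} (hd : IsUnimodularDisc p B L d) (hM : M ∈ Gam B p L N) {c : ℤ}
    (hcp : ¬ (p : ℤ) ∣ c) {e : V} (he : IsAxisVec c B M e) (hs : Spec p B M e) {t : ℤ}
    (ht : ¬ (p : ℤ) ∣ t) {u : V} (hu : u ≠ 0) (hq : B u u = t * (m * p) ^ 2)
    {σ : V ≃ₗ[ℚ] V} (hσ : σ ∈ orthogonalGroup B) {r : ℚ} (hue : u = r • σ e) :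
    legendre p (t * (d : ℤ_[p])) = 1 := by
  obtain ⟨χ, hχ⟩ := locallyIsometric_iff.1 (hM.1.2 p)
  have hr : r ≠ 0 := by rintro rfl; exact hu (by rw [hue, zero_smul])
  refine hc.legendre_of_spec (a.of_gam hM) hcp he hs ht (r := m * p / r) ?_
    (hχ.isUnimodularDisc hd)
  have h1 : B u u = r * (r * B e e) := by
    rw [hue, ← hσ e e]; simp
  rw [div_pow, mul_div_assoc', ← hq, h1]
  field_simp

theorem legendre_eq_one_or_neg_one {t : ℤ} (ht : ¬ (p : ℤ) ∣ t) (d : ℤ_[p]ˣ) :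
    legendre p (t * (d : ℤ_[p])) = 1 ∨ legendre p (t * (d : ℤ_[p])) = -1 := by
  refine quadraticChar_dichotomy ?_
  rw [map_mul, map_intCast]
  exact mul_ne_zero (intCast_ne_zero ht) (d.isUnit.map _).ne_zero

theorem eq_half_one_add_legendre {t : ℤ} (ht : ¬ (p : ℤ) ∣ t) {d : ℤ_[p]ˣ} {P : Prop} {n : ℕ}
    (hn : (P → n = 1) ∧ (¬ P → n = 0)) (h : P ↔ legendre p (t * (d : ℤ_[p])) = 1) :
    (n : ℚ) = (1 + (legendre p (t * (d : ℤ_[p])) : ℚ)) / 2 := by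
  rcases legendre_eq_one_or_neg_one ht d with e | e
  · rw [hn.1 (h.2 e), e]; norm_num
  · rw [hn.2 fun h1 => by rw [h.1 h1] at e; norm_num at e, e]; norm_num

/-- The numbers `h₁₂` and `h₁₆` when `N` is cubic. -/
theorem IsCubicFrame.hCount_eq (hc : IsCubicFrame p B N f₁ f₂ f₃ m) (a : Adm p B L)
    (hN : watson B p L = N) (ho : Nat.card (isometryGroup B N) = 48) {d : ℤ_[p]ˣ}
    (hd : IsUnimodularDisc p B L d) :
    (hCount B (Gam B p L N) 12 : ℚ) =
      (if p = 3 then 0 else (1 + (legendre p (3 * (d : ℤ_[p])) : ℚ)) / 2) ∧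
    (hCount B (Gam B p L N) 16 : ℚ) = (1 + (legendre p (d : ℤ_[p]) : ℚ)) / 2 := by
  have hB := a.toIsTernaryForm
  have hfam := a.isFam (N := N)
  have hNl := hfam.lattice (hN ▸ a.self_mem_gam)
  have hpar : ∀ {u e : V} {c r : ℚ} {σ : V ≃ₗ[ℚ] V}, c ≠ 0 → u = r • σ e →
      u = (r * c⁻¹) • σ (c • e) := fun hc0 h => by
    rw [map_smul, smul_smul, mul_assoc, inv_mul_cancel₀ hc0, mul_one, h]
  constructor
  · split_ifs with h3
    · rw [(hfam.hCount_cubic ho (Or.inl rfl)).2, Nat.cast_zero]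
      rintro ⟨M, hM, hcd⟩
      exact hfam.card_12_ne_three hM hcd (Or.inr ho) h3
    have h3' := a.three_not_dvd h3
    have hq : B (f₁ + f₂ + f₃) (f₁ + f₂ + f₃) = (3 : ℤ) * (m * p) ^ 2 := by
      rw [← hc.norm]
      simp only [map_add, LinearMap.add_apply, hB.symm f₂ f₁, hB.symm f₃ f₁, hB.symm f₃ f₂, hc.h12,
        hc.h13, hc.h23, hc.q2, hc.q3]
      push_cast; ring
    have key := eq_half_one_add_legendre (d := d) h3' (hfam.hCount_cubic ho (Or.inl rfl))
      ⟨?_, fun hl => ?_⟩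
    · simpa using key
    · rintro ⟨M, hM, hcd⟩
      have aM := a.of_gam hM
      obtain ⟨e, g, hax, -⟩ := aM.toIsIntLattice.trigonal_of_card hcd
      obtain ⟨c, hc0, pe⟩ := aM.toIsIntLattice.exists_primitive hax.rot.ne
      obtain ⟨σ, hσ, r, hr⟩ := hc.three_axis hNl (hfam.le hM hax.mem) hax.rot
      have hrot := hax.rot.smul hc0
      exact hc.legendre_of_axis a hd hM h3' (aM.toIsIntLattice.axisVec_of_rot hrot hax.mem pe)
        (aM.spec_of_rot h3 hrot hax.mem pe) h3' (hc.diag_ne hB) hq hσ.1 (hpar hc0 hr)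
    · obtain ⟨M, hM, hst⟩ := hc.exists_stable a hN hd (add_mem (add_mem hc.mem1 hc.mem2) hc.mem3)
        h3' hq (fun v hv => by
          obtain ⟨k1, e1⟩ := hc.root1 v hv
          obtain ⟨k2, e2⟩ := hc.root2 v hv
          obtain ⟨k3, e3⟩ := hc.root3 v hv
          refine ⟨k1 + k2 + k3, ?_⟩
          simp only [map_add, LinearMap.add_apply]
          push_cast
          linear_combination e1 + e2 + e3) hl
      obtain ⟨ρ, hρ, hr⟩ := hc.rot_diag hB
      exact ⟨M, hM, (hfam.card_of_rot ho hM (hst ρ hρ hr.fix)).1 hr⟩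
  · have h1 : ¬ (p : ℤ) ∣ 1 := fun h => a.prime_int.not_isUnit (isUnit_of_dvd_one h)
    have hq : B f₁ f₁ = (1 : ℤ) * (m * p) ^ 2 := by rw [hc.norm]; push_cast; ring
    have key := eq_half_one_add_legendre (d := d) h1 (hfam.hCount_cubic ho (Or.inr rfl))
      ⟨?_, fun hl => ?_⟩
    · simpa using key
    · rintro ⟨M, hM, hcd⟩
      have aM := a.of_gam hM
      obtain ⟨e, g, hax⟩ := aM.toIsIntLattice.tetragonal_of_card hcd
      obtain ⟨c, hc0, pe⟩ := aM.toIsIntLattice.exists_primitive hax.rot.ne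
      obtain ⟨σ, hσ, r, hr⟩ := hc.four_axis hNl (hfam.le hM hax.mem) hax.rot
      have hrot := hax.rot.smul hc0
      exact hc.legendre_of_axis a hd hM a.two_not_dvd
        (aM.toIsIntLattice.axisVec_of_sym pe (hrot.sym_axis hB hax.mem))
        (aM.spec_of_four hrot hax.mem pe) h1 hc.ne1 hq hσ.1 (hpar hc0 hr)
    · obtain ⟨M, hM, hst⟩ := hc.exists_stable a hN hd hc.mem1 h1 hq hc.root1 hl
      obtain ⟨g, hg, hr⟩ := hc.rot_four hB
      exact ⟨M, hM, (hfam.card_of_rot ho hM (hst g hg hr.fix)).2 hr⟩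

end

section

variable {p : ℕ} {L : Submodule ℤ V} [Fact p.Prime]

theorem Adm.sCount_eq (a : Adm p B L) : sCount B p L N =
    {σ | σ ∈ symmetries B N ∧ ∃ M ∈ Gam B p L N, σ • M = M ∧ SpecSym p B M σ}.ncard := by
  unfold sCount
  congr 1
  ext σ
  constructor
  · rintro ⟨h, M, ⟨hM, hσ⟩, hs⟩
    exact ⟨h, M, hM, hσ, ((a.of_gam hM).isSpecial_iff ⟨h.1.1, hσ⟩).1 hs⟩
  · rintro ⟨h, M, hM, hσ, hs⟩
    exact ⟨h, M, ⟨hM, hσ⟩, ((a.of_gam hM).isSpecial_iff ⟨h.1.1, hσ⟩).2 hs⟩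

end

end

end TernaryLattice

theorem theorem6p1
    {V : Type u} [AddCommGroup V] [Module ℚ V]
    (B : LinearMap.BilinForm ℚ V) (L N : Submodule ℤ V)
    (hL : TernaryLattice.IsPrimitiveTernary B L)
    (p : ℕ) [Fact p.Prime] (hp : p ≠ 2)
    (hdisc : ∃ k : ℤ, TernaryLattice.IsDisc B L ((p : ℚ) ^ 2 * k))
    (hN : TernaryLattice.watson B p L = N)
    (h24 : Nat.card (TernaryLattice.isometryGroup B N) = 24 → p ≠ 3)
    (o w : ℕ) (ho : o = Nat.card (TernaryLattice.isometryGroup B N))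
    (hw : w = TernaryLattice.wCount B p L N)
    (h : ℕ → ℚ) (hh : ∀ n, h n = (TernaryLattice.classCount B p L N n : ℚ))
    (f s w₂ w₃ : ℚ)
    (hf : f = (TernaryLattice.fCount B p L N : ℚ))
    (hs : s = (TernaryLattice.sCount B p L N : ℚ))
    (hw₂ : w₂ = ((w % 2 : ℕ) : ℚ)) (hw₃ : w₃ = ((w % 3 : ℕ) : ℚ)) :
    -- the possible orders of `O(N)` and of the isometry groups that occur
    (o = 2 ∨ o = 4 ∨ o = 8 ∨ o = 12 ∨ o = 16 ∨ o = 24 ∨ o = 48) ∧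
    (∀ n : ℕ, n ≠ 2 → n ≠ 4 → n ≠ 8 → n ≠ 12 → n ≠ 16 → n ≠ 24 → h n = 0) ∧
    -- the rows of the table
    (o = 2 → h 2 = w ∧ h 4 = 0 ∧ h 8 = 0 ∧ h 12 = 0 ∧ h 16 = 0 ∧ h 24 = 0) ∧
    (o = 4 → h 2 = (w - f) / 2 ∧ h 4 = f ∧ h 8 = 0 ∧ h 12 = 0 ∧ h 16 = 0 ∧ h 24 = 0) ∧
    (o = 8 → h 2 = (w - f + 2 * s) / 4 ∧ h 4 = (f - 3 * s) / 2 ∧ h 8 = s ∧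
      h 12 = 0 ∧ h 16 = 0 ∧ h 24 = 0) ∧
    (o = 12 → h 2 = (w - f + 2 * w₃) / 6 ∧ h 4 = (f - 3 * w₃) / 3 ∧ h 8 = 0 ∧
      h 12 = w₃ ∧ h 16 = 0 ∧ h 24 = 0) ∧
    (o = 16 → h 2 = (w - f + 2 * s + 2 * w₂) / 8 ∧ h 4 = (f - 3 * s - 2 * w₂) / 4 ∧
      h 8 = (s - w₂) / 2 ∧ h 12 = 0 ∧ h 16 = w₂ ∧ h 24 = 0) ∧
    (o = 24 → h 2 = (w - f + 2 * s + 4 * w₃) / 12 ∧ h 4 = (f - 3 * s - 4 * w₃) / 6 ∧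
      h 8 = (s - w₃) / 3 ∧ h 12 = 0 ∧ h 16 = 0 ∧ h 24 = w₃) ∧
    (o = 48 →
      h 24 = 0 ∧ h 48 = 0 ∧
      (∃ d₀ : ℤ_[p]ˣ, TernaryLattice.IsUnimodularDisc p B L d₀) ∧
      (∀ d₀ : ℤ_[p]ˣ, TernaryLattice.IsUnimodularDisc p B L d₀ →
        h 12 = (if p = 3 then 0
          else (1 + (TernaryLattice.legendre p (3 * (d₀ : ℤ_[p])) : ℚ)) / 2) ∧
        h 16 = (1 + (TernaryLattice.legendre p (d₀ : ℤ_[p]) : ℚ)) / 2) ∧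
      h 8 = (s - 3 * h 16) / 6 ∧
      h 4 = (f - 18 * h 8 - 12 * h 12 - 15 * h 16) / 12 ∧
      h 2 = (w - f + 12 * h 8 + 8 * h 12 + 12 * h 16) / 24) ∧
    -- the numbers `h n` are determined by the label of `N` and the local structure `L_p`
    (∀ (V' : Type v) [AddCommGroup V'] [Module ℚ V']
      (B' : LinearMap.BilinForm ℚ V') (L' N' : Submodule ℤ V'),
      TernaryLattice.IsPrimitiveTernary B' L' →
      TernaryLattice.watson B' p L' = N' →
      TernaryLattice.LocallyIsometric p B L B' L' →
      TernaryLattice.label B N = TernaryLattice.label B' N' →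
      ∀ n : ℕ, TernaryLattice.classCount B p L N n = TernaryLattice.classCount B' p L' N' n) := by
  have a : TernaryLattice.Adm p B L := hL.adm hp hdisc
  obtain ⟨t0, t1, t2, t4, t8, t12, t16, t24, t48⟩ := a.isFam.table ⟨L, hN ▸ a.self_mem_gam⟩ o w ho
    (ho ▸ h24) hw h hh f s w₂ w₃ hf (by rw [hs, a.sCount_eq]) hw₂ hw₃
  have hcubic : o = 48 → ∀ d₀ : ℤ_[p]ˣ, TernaryLattice.IsUnimodularDisc p B L d₀ →
      h 12 = (if p = 3 then 0
        else (1 + (TernaryLattice.legendre p (3 * (d₀ : ℤ_[p])) : ℚ)) / 2) ∧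
      h 16 = (1 + (TernaryLattice.legendre p (d₀ : ℤ_[p]) : ℚ)) / 2 := by
    intro h48 d₀ hd
    obtain ⟨f₁, f₂, f₃, m, hc⟩ := hL.exists_cubicFrame a (by rw [hN, ← ho, h48])
    rw [hN] at hc
    rw [hh, hh]
    exact hc.hCount_eq a hN (ho ▸ h48) hd
  refine ⟨t0, t1, t2, t4, t8, t12, t16, t24, fun h48 => ?_, ?_⟩
  · obtain ⟨e24, e48, e8, e4, e2⟩ := t48 h48
    exact ⟨e24, e48, a.exists_unimodularDisc, hcubic h48, e8, e4, e2⟩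
  intro V' _ _ B' L' N' hL' hN' hloc hlab
  obtain ⟨χ, hχ⟩ := TernaryLattice.locallyIsometric_iff.1 hloc
  have a' := hχ.adm a hL'.isIntLattice
  have hcorr : TernaryLattice.Corr p B L N B' L' N' χ := ⟨a, a', hN, hN', hloc, by
    rw [← hN, ← hN']; exact hχ.watson hp a.toIsIntLattice a'.toIsIntLattice⟩
  obtain ⟨ew, ef, es⟩ := hcorr.counts hlab
  have ho' : o = Nat.card (TernaryLattice.isometryGroup B' N') :=
    ho.trans (congrArg Prod.fst hlab)
  obtain ⟨h', hh'⟩ : ∃ h' : ℕ → ℚ, ∀ n, h' n = TernaryLattice.classCount B' p L' N' n :=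
    ⟨_, fun _ => rfl⟩
  obtain ⟨-, s1, s2, s4, s8, s12, s16, s24, s48⟩ := a'.isFam.table
    ⟨L', hN' ▸ a'.self_mem_gam⟩ o w ho' (ho ▸ h24) (hw.trans ew) h' hh' f s w₂ w₃
    (by rw [hf, ef]; rfl) (by rw [hs, es, a'.sCount_eq]) hw₂ hw₃
  intro n
  suffices h n = h' n by
    rw [hh, hh'] at this; exact_mod_cast this
  have six : ∀ {x2 x4 x8 x12 x16 x24 : ℚ},
      h 2 = x2 ∧ h 4 = x4 ∧ h 8 = x8 ∧ h 12 = x12 ∧ h 16 = x16 ∧ h 24 = x24 →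
      h' 2 = x2 ∧ h' 4 = x4 ∧ h' 8 = x8 ∧ h' 12 = x12 ∧ h' 16 = x16 ∧ h' 24 = x24 →
      h n = h' n := by
    rintro _ _ _ _ _ _ ⟨rfl, rfl, rfl, rfl, rfl, rfl⟩ ⟨e2, e4, e8, e12, e16, e24⟩
    by_cases hn : n = 2 ∨ n = 4 ∨ n = 8 ∨ n = 12 ∨ n = 16 ∨ n = 24
    · rcases hn with rfl | rfl | rfl | rfl | rfl | rfl
      exacts [e2.symm, e4.symm, e8.symm, e12.symm, e16.symm, e24.symm]
    · push Not at hn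
      obtain ⟨n2, n4, n8, n12, n16, n24⟩ := hn
      rw [t1 n n2 n4 n8 n12 n16 n24, s1 n n2 n4 n8 n12 n16 n24]
  rcases t0 with h0 | h0 | h0 | h0 | h0 | h0 | h0
  · exact six (t2 h0) (s2 h0)
  · exact six (t4 h0) (s4 h0)
  · exact six (t8 h0) (s8 h0)
  · exact six (t12 h0) (s12 h0)
  · exact six (t16 h0) (s16 h0)
  · exact six (t24 h0) (s24 h0)
  · obtain ⟨d₀, hd⟩ := a.exists_unimodularDisc
    obtain ⟨e12, e16⟩ := hcubic h0 d₀ hd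
    obtain ⟨f₁, f₂, f₃, m, hc⟩ := hL'.exists_cubicFrame a' (by rw [hN', ← ho', h0])
    rw [hN'] at hc
    obtain ⟨c12, c16⟩ := hc.hCount_eq a' hN' (ho' ▸ h0) (hχ.isUnimodularDisc hd)
    obtain ⟨e24, -, e8, e4, e2⟩ := t48 h0
    obtain ⟨c24, -, c8, c4, c2⟩ := s48 h0
    have k12 : h' 12 = h 12 := by rw [e12, ← c12, hh']; rfl
    have k16 : h' 16 = h 16 := by rw [e16, ← c16, hh']; rfl
    have k8 : h' 8 = h 8 := by rw [e8, c8, k16]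
    have k4 : h' 4 = h 4 := by rw [e4, c4, k8, k12, k16]
    have k2 : h' 2 = h 2 := by rw [e2, c2, k8, k12, k16]
    exact six ⟨rfl, rfl, rfl, rfl, rfl, e24⟩ ⟨k2, k4, k8, k12, k16, c24⟩
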